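/- **Setting.** Let $\Omega\subset\mathbb R^3$ be a bounded Lipschitz domain, $T>0$, $\Omega_t=(0,t)\times\Omega$, $\alpha>0$, $C_{\rm exch}>0$, $1/2<\theta\le 1$, $Y$ a real Banach space, $\pi:H^1(\Omega;\mathbb R^3)\times Y\to L^2(\Omega;\mathbb R^3)$ a map, $\zeta:\mathbb R\to Y$ (for instance constant), $f\in L^2(\Omega_T;\mathbb R^3)$, and $m^0\in H^1(\Omega;\mathbb R^3)$ with $|m^0|=1$ a.e. All functions below are $\mathbb R^3$-valued unless said otherwise. *Weak solution.* $m$ is a weak solution of the general LLG equation if (i) $m\in H^1(\Omega_T)$, $|m|=1$ a.e. in $\Omega_T$, and $m(0)=m^0$ in the sense of traces; (ii) $\pi(m,\zeta):(t,x)\mapsto\pi(m(t),\zeta(t))(x)$ is in $L^2(\Omega_T)$ and for all $\phi\in C^\infty(\overline{\Omega_T})$ $$\langle\partial_t m,\phi\rangle_{\Omega_T}-\alpha\langle m\times\partial_t m,\phi\rangle_{\Omega_T}=-C_{\rm exch}\langle\nabla m\times m,\nabla\phi\rangle_{\Omega_T}-\langle\pi(m,\zeta)\times m,\phi\rangle_{\Omega_T}+\langle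 f\times m,\phi\rangle_{\Omega_T};$$ (iii) there is $C>0$ with $\|\nabla m(t)\|_{L^2(\Omega)}^2+\|\partial_t m\|_{L^2(\Omega_t)}^2\le C$ for almost all $t\in(0,T)$. *Discretization.* Let $h_\ell>0$, $h_\ell\to0$, and $N_\ell\in\mathbb N$, $N_\ell\ge1$, $N_\ell\to\infty$; put $k_\ell=T/N_\ell$ and omit the index $\ell$. For each $\ell$ let $\mathcal T_h$ be a conforming triangulation of $\overline\Omega$ into tetrahedra, quasi-uniform of mesh-size $h\simeq\operatorname{diam}(S)$ for all $S\in\mathcal T_h$ and shape regular, with constants $\gamma$ and $\kappa$, respectively, that do not depend on $\ell$, and with $$\langle\nabla\eta_z,\nabla\eta_{z'}\rangle_\Omega\le0\quad\text{for the (scalar) nodal hat functions of any two nodes } z\ne z'.$$ Let $\mathcal V_h$ be the continuous functions on $\overline\Omega$ that are affine on each tetrahedron, $\mathcal M_h$ the set of $n\in\mathcal V_h$ with $|n(z)|=1$ at all nodes $z$, and $\mathcal K_m$ the set of $n\in\mathcal V_h$ with $n(z)\cdot m(z)=0$ at all nodes $z$. Given $m_h^0\in\mathcal M_h$, $\pi_h:H^1(\Omega)\times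 Y\to L^2(\Omega)$, $f_h^j\in L^2(\Omega)$ and $\zeta_h^j\in Y$, the linear-implicit tangent-plane integrator computes for $i=0,\dots,N-1$ a $v_h^i\in\mathcal K_{m_h^i}$ such that for all $\psi\in\mathcal K_{m_h^i}$ $$\alpha\langle v_h^i,\psi\rangle_\Omega+C_{\rm exch}k\theta\langle\nabla v_h^i,\nabla\psi\rangle_\Omega+\langle m_h^i\times v_h^i,\psi\rangle_\Omega=-C_{\rm exch}\langle\nabla m_h^i,\nabla\psi\rangle_\Omega-\langle\pi_h(m_h^i,\zeta_h^i),\psi\rangle_\Omega+\langle f_h^i,\psi\rangle_\Omega,$$ and then $m_h^{i+1}\in\mathcal M_h$ with $m_h^{i+1}(z)=\dfrac{m_h^i(z)+k v_h^i(z)}{|m_h^i(z)+k v_h^i(z)|}$ at all nodes $z$. For a sequence $g^0,g^1,\dots$ and $ik\le t<(i+1)k$ let $g_{hk}^-(t)=g^i$ and $g_{hk}(t)=\frac{t-ik}{k}g^{i+1}+\frac{(i+1)k-t}{k}g^i$. *Assumptions.* $f_{hk}^-\rightharpoonup f$ weakly in $L^2(\Omega_T)$; $m_h^0\rightharpoonup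 m^0$ weakly in $H^1(\Omega)$; and there are constants $C_\pi,C_\zeta$ independent of $\ell$ with $$\|\pi_h(n,y)\|_{L^2(\Omega)}\le C_\pi\,(1+\|\nabla n\|_{L^2(\Omega)})\quad\text{for all } n\in H^1(\Omega),\ |n|\le1,\ \text{and all } y\in Y,\ \|y\|_Y\le C_\zeta,$$ and $\|\zeta_h^j\|_Y\le C_\zeta$ for $j=0,\dots,N-1$. **Theorem 3.1.** Under these assumptions the integrator is well-defined for every $\ell$, and for its output the following holds. (a) There are a subsequence and a function $m\in H^1(\Omega_T)$ such that along the subsequence $m_{hk}^-\to m$ strongly in $L^2(\Omega_T)$ and $m_{hk}\rightharpoonup m$ weakly in $H^1(\Omega_T)$; moreover $m\in L^\infty(0,T;H^1(\Omega))$ and $|m|=1$ a.e. in $\Omega_T$. (b) Let $m$ be any limit as in (a), i.e. along some subsequence $m_{hk}^-\to m$ strongly in $L^2(\Omega_T)$ and $m_{hk}\rightharpoonup m$ weakly in $H^1(\Omega_T)$. If $\pi(m,\zeta)\in L^2(\Omega_T)$ and, along a further subsequence, $\pi_h(m_{hk}^-,\zeta_{hk}^-)\rightharpoonup\pi(m,\zeta)$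 weakly in $L^2(\Omega_T)$, then $m$ is a weak solution of the general LLG equation; in particular, weak solutions exist in this case. The constant in (iii) can be chosen as $C=C(B)$ for any $B$ with $\|\nabla m_h^0\|_{L^2(\Omega)}^2\le B$ and $\|f_{hk}^-\|_{L^2(\Omega_T)}^2\le B$ for all $\ell$ (such $B$ exists by the weak convergences), where the function $B\mapsto C(B)>0$ depends only on $\Omega,T,\alpha,C_{\rm exch},\theta,Y,\pi,\zeta,f,m^0,\gamma,\kappa,C_\pi,C_\zeta$, and not on the discretization. -/

import Mathlib

open MeasureTheory Filter Topology
open scoped ContDiff ENNReal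

noncomputable section

namespace LLG

/-- Euclidean three-space; it is both the physical space and the space of values of the
magnetization. -/
abbrev E3 : Type := EuclideanSpace ℝ (Fin 3)

/-- The vector product of `ℝ³`. -/
def cross (a b : E3) : E3 := WithLp.toLp 2 (crossProduct a.ofLp b.ofLp)

/-- The `i`-th standard basis vector of `ℝ³`. -/
def basisVec (i : Fin 3) : E3 := EuclideanSpace.single i 1

/-- The time direction in the space-time `ℝ × ℝ³`. -/
def timeDir : ℝ × E3 := (1, 0)

/-- The `i`-th spatial direction in the space-time `ℝ × ℝ³`. -/
def spaceDir (i : Fin 3) : ℝ × E3 := (0, basisVec i)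

/-- The (open) space-time cylinder `(0,T) × Ω`. -/
def cylinder (T : ℝ) (Ω : Set E3) : Set (ℝ × E3) := Set.Ioo 0 T ×ˢ Ω

/-- Bounded Lipschitz domains: bounded, open, connected, and near each boundary point the set is,
in suitable Cartesian coordinates, the strict epigraph of a Lipschitz function. -/
structure IsLipschitzDomain (Ω : Set E3) : Prop where
  isOpen : IsOpen Ω
  isConnected : IsConnected Ω
  isBounded : Bornology.IsBounded Ω
  locally_epigraph : ∀ x ∈ frontier Ω, ∃ R : E3 ≃ₗᵢ[ℝ] E3, ∃ L : NNReal,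
    ∃ g : EuclideanSpace ℝ (Fin 2) → ℝ, LipschitzWith L g ∧
      ∃ U ∈ 𝓝 x, ∀ y ∈ U, y ∈ Ω ↔ g !₂[R y 0, R y 1] < R y 2

/-! ### Lebesgue and Sobolev spaces -/

section Sobolev

variable {X : Type*} [NormedAddCommGroup X] [NormedSpace ℝ X] [MeasureSpace X]
variable {F : Type*} [NormedAddCommGroup F] [InnerProductSpace ℝ F]

/-- `g` is the weak derivative of `u` on `U` in direction `e`. -/
def HasWeakDeriv (U : Set X) (e : X) (u g : X → F) : Prop :=
  ∀ φ : X → ℝ, ContDiff ℝ ∞ φ → HasCompactSupport φ → tsupport φ ⊆ U →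
    ∫ x in U, fderiv ℝ φ x e • u x = -∫ x in U, φ x • g x

/-- `u ∈ H¹(U)`: `u` is in `L²(U)` and so are its weak derivatives in all directions. -/
def MemH1 (U : Set X) (u : X → F) : Prop :=
  MemLp u 2 (volume.restrict U) ∧
    ∀ e : X, ∃ g : X → F, MemLp g 2 (volume.restrict U) ∧ HasWeakDeriv U e u g

open Classical in
/-- The weak derivative of `u` in direction `e` (unique up to null sets for `U` open), when there
is one in `L²(U)`; it is `0` otherwise. -/
def weakDeriv (U : Set X) (e : X) (u : X → F) : X → F :=
  if h : ∃ g : X → F, MemLp g 2 (volume.restrict U) ∧ HasWeakDeriv U e u g then h.choose else 0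

/-- Weak convergence `u n ⇀ v` in `L²(μ)`. -/
def WeakL2 {X : Type*} [MeasurableSpace X] (μ : Measure X) (u : ℕ → X → F) (v : X → F) : Prop :=
  (∀ n, MemLp (u n) 2 μ) ∧ MemLp v 2 μ ∧
    ∀ g : X → F, MemLp g 2 μ →
      Tendsto (fun n => ∫ x, inner ℝ (u n x) (g x) ∂μ) atTop (𝓝 (∫ x, inner ℝ (v x) (g x) ∂μ))

/-- Strong convergence `u n → v` in `L²(μ)`. -/
def StrongL2 {X : Type*} [MeasurableSpace X] (μ : Measure X) (u : ℕ → X → F) (v : X → F) : Prop :=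
  (∀ n, MemLp (u n) 2 μ) ∧ MemLp v 2 μ ∧
    Tendsto (fun n => eLpNorm (fun x => u n x - v x) 2 μ) atTop (𝓝 0)

/-- Weak convergence `u n ⇀ v` in `H¹(U)`: weak convergence in `L²(U)` of the functions and of all
their first derivatives. -/
def WeakH1 (U : Set X) (u : ℕ → X → F) (v : X → F) : Prop :=
  (∀ n, MemH1 U (u n)) ∧ MemH1 U v ∧ WeakL2 (volume.restrict U) u v ∧
    ∀ e : X, WeakL2 (volume.restrict U) (fun n => weakDeriv U e (u n)) (weakDeriv U e v)

end Sobolev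

section Spaces

variable {F : Type*} [NormedAddCommGroup F] [InnerProductSpace ℝ F]

/-- `⟨∇u, ∇w⟩_Ω`. -/
def gradInner (Ω : Set E3) (u w : E3 → F) : ℝ :=
  ∑ i, ∫ x in Ω, inner ℝ (weakDeriv Ω (basisVec i) u x) (weakDeriv Ω (basisVec i) w x)

/-- `‖∇u‖²` in `L²(Ω)`. -/
def gradNormSq (Ω : Set E3) (u : E3 → F) : ℝ :=
  ∑ i, ∫ x in Ω, ‖weakDeriv Ω (basisVec i) u x‖ ^ 2

/-- The space `L²(Ω)` of vector fields (classes of functions). -/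
abbrev L2 (Ω : Set E3) : Type := Lp E3 2 (volume.restrict Ω : Measure E3)

/-- The space `H¹(Ω)` of vector fields, as a subset of `L²(Ω)`. -/
def H1 (Ω : Set E3) : Type := {u : L2 Ω // MemH1 Ω (u : E3 → E3)}

theorem MemH1.congr {Ω : Set E3} {u w : E3 → E3} (h : MemH1 Ω u)
    (huw : u =ᵐ[volume.restrict Ω] w) : MemH1 Ω w := by
  refine ⟨h.1.ae_eq huw, fun e => ?_⟩
  obtain ⟨g, hg, hd⟩ := h.2 e
  refine ⟨g, hg, fun φ h1 h2 h3 => ?_⟩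
  rw [← hd φ h1 h2 h3]
  refine integral_congr_ae ?_
  filter_upwards [huw] with x hx
  simp [hx]

theorem MemH1.zero (Ω : Set E3) : MemH1 Ω (0 : E3 → E3) :=
  ⟨MemLp.zero, fun _ => ⟨0, MemLp.zero, fun φ _ _ _ => by simp⟩⟩

open Classical in
/-- The class in `H¹(Ω)` of a function `u` with `MemH1 Ω u` (and `0` for other functions). -/
def toH1 (Ω : Set E3) (u : E3 → E3) : H1 Ω :=
  if h : MemH1 Ω u then ⟨h.1.toLp u, h.congr h.1.coeFn_toLp.symm⟩
  else ⟨0, (MemH1.zero Ω).congr (Lp.coeFn_zero E3 2 (volume.restrict Ω)).symm⟩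

end Spaces

/-! ### Meshes and lowest-order Courant elements -/

/-- A conforming triangulation of (the closure of) `Ω` into finitely many tetrahedra. -/
structure TetMesh (Ω : Set E3) where
  complex : Geometry.SimplicialComplex ℝ E3
  finite : complex.faces.Finite
  pure : ∀ s ∈ complex.facets, s.card = 4
  space_eq : complex.space = closure Ω

/-- The tetrahedra of the mesh, given by their sets of vertices. -/
def TetMesh.tets {Ω : Set E3} (M : TetMesh Ω) : Set (Finset E3) :=
  {s | s ∈ M.complex.faces ∧ s.card = 4}

/-- The nodes of the mesh. -/
def TetMesh.nodes {Ω : Set E3} (M : TetMesh Ω) : Set E3 := M.complex.vertices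

/-- The mesh has mesh-size comparable to `h` on every element, with constant `γ`. -/
def TetMesh.IsQuasiUniform {Ω : Set E3} (M : TetMesh Ω) (h γ : ℝ) : Prop :=
  ∀ s ∈ M.tets, Metric.diam (convexHull ℝ (s : Set E3)) ≤ γ * h ∧
    h ≤ γ * Metric.diam (convexHull ℝ (s : Set E3))

/-- The mesh is shape regular with constant `κ`: every tetrahedron contains a ball whose radius is
at least its diameter divided by `κ`. -/
def TetMesh.IsShapeRegular {Ω : Set E3} (M : TetMesh Ω) (κ : ℝ) : Prop :=
  ∀ s ∈ M.tets, ∃ (c : E3) (r : ℝ), 0 < r ∧ Metric.closedBall c r ⊆ convexHull ℝ (s : Set E3) ∧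
    Metric.diam (convexHull ℝ (s : Set E3)) ≤ κ * r

/-- Continuous functions on the closure of `Ω` that are affine on every tetrahedron. -/
def courant {Ω : Set E3} (M : TetMesh Ω) (F : Type*) [NormedAddCommGroup F] [NormedSpace ℝ F] :
    Set (E3 → F) :=
  {u | ContinuousOn u (closure Ω) ∧
    ∀ s ∈ M.tets, ∃ A : E3 →ᵃ[ℝ] F, Set.EqOn u A (convexHull ℝ (s : Set E3))}

/-- `η` is the nodal hat function of the node `z`. -/
def IsHat {Ω : Set E3} (M : TetMesh Ω) (z : E3) (η : E3 → ℝ) : Prop :=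
  η ∈ courant M ℝ ∧ η z = 1 ∧ ∀ z' ∈ M.nodes, z' ≠ z → η z' = 0

/-- The angle condition: `⟨∇η, ∇η'⟩_Ω ≤ 0` for any two different hat functions. -/
def AngleCondition {Ω : Set E3} (M : TetMesh Ω) : Prop :=
  ∀ z ∈ M.nodes, ∀ z' ∈ M.nodes, z ≠ z' → ∀ η η' : E3 → ℝ, IsHat M z η → IsHat M z' η' →
    gradInner Ω η η' ≤ 0

/-- The discrete magnetizations: Courant functions of modulus one at all nodes. -/
def discreteMag {Ω : Set E3} (M : TetMesh Ω) : Set (E3 → E3) :=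
  {u | u ∈ courant M E3 ∧ ∀ z ∈ M.nodes, ‖u z‖ = 1}

/-- The discrete tangent space at `m`. -/
def discreteTangent {Ω : Set E3} (M : TetMesh Ω) (m : E3 → E3) : Set (E3 → E3) :=
  {u | u ∈ courant M E3 ∧ ∀ z ∈ M.nodes, inner ℝ (u z) (m z) = 0}

/-! ### The linear-implicit integrator -/

/-- `m 0, …, m N` and `v 0, …, v (N - 1)` are the discrete magnetizations and discrete time
derivatives that the linear-implicit tangent-plane integrator with time-step size `k` computes from
the initial datum `m0`, the discrete exterior fields `f j`, the data `ζ j`, and the discretized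
field contribution `πh`. -/
structure IsIntegratorOutput {Ω : Set E3} (M : TetMesh Ω) {Y : Type*} (α Cex θ k : ℝ) (N : ℕ)
    (πh : H1 Ω → Y → L2 Ω) (f : ℕ → L2 Ω) (ζ : ℕ → Y) (m0 : E3 → E3) (m v : ℕ → E3 → E3) :
    Prop where
  init : m 0 = m0
  tangent : ∀ i < N, v i ∈ discreteTangent M (m i)
  step : ∀ i < N, ∀ ψ ∈ discreteTangent M (m i),
    α * (∫ x in Ω, inner ℝ (v i x) (ψ x)) + Cex * k * θ * gradInner Ω (v i) ψ
        + ∫ x in Ω, inner ℝ (cross (m i x) (v i x)) (ψ x)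
      = -Cex * gradInner Ω (m i) ψ
        - (∫ x in Ω, inner ℝ (πh (toH1 Ω (m i)) (ζ i) x) (ψ x))
        + ∫ x in Ω, inner ℝ (f i x) (ψ x)
  mag : ∀ i < N, m (i + 1) ∈ discreteMag M
  update : ∀ i < N, ∀ z ∈ M.nodes,
    m (i + 1) z = ‖m i z + k • v i z‖⁻¹ • (m i z + k • v i z)

/-- The interpretation of `γ 0, γ 1, …` that is piecewise constant in time, equal to `γ i` for
`i * k ≤ t < (i + 1) * k`. -/
def timeConst (k : ℝ) (γ : ℕ → E3 → E3) (p : ℝ × E3) : E3 := γ ⌊p.1 / k⌋₊ p.2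

/-- The interpretation of `γ 0, γ 1, …` that is continuous and piecewise affine in time. -/
def timeAffine (k : ℝ) (γ : ℕ → E3 → E3) (p : ℝ × E3) : E3 :=
  ((p.1 - ⌊p.1 / k⌋₊ * k) / k) • γ (⌊p.1 / k⌋₊ + 1) p.2
    + (((⌊p.1 / k⌋₊ + 1) * k - p.1) / k) • γ ⌊p.1 / k⌋₊ p.2

/-! ### Weak solutions -/

/-- The time-dependent field `G : (0,T) → L²(Ω)` is (represented by) the function `P` of
`L²((0,T) × Ω)`. -/
def Represents (T : ℝ) (Ω : Set E3) (P : ℝ × E3 → E3) (G : ℝ → L2 Ω) : Prop :=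
  MemLp P 2 (volume.restrict (cylinder T Ω)) ∧
    ∀ᵐ t ∂(volume.restrict (Set.Ioo 0 T)), ∀ᵐ x ∂(volume.restrict Ω), P (t, x) = G t x

/-- The time-dependent field `t ↦ π(m(t), ζ(t))`. -/
def contribution {Ω : Set E3} {Y : Type*} (π : H1 Ω → Y → L2 Ω) (m : ℝ × E3 → E3) (ζ : ℝ → Y) :
    ℝ → L2 Ω :=
  fun t => π (toH1 Ω fun x => m (t, x)) (ζ t)

/-- `m(0) = m0` in the sense of traces: `m0` is the value at time `0` of the representative of `m`
that is continuous in time with values in `L²(Ω)`. -/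
def HasInitialTrace (T : ℝ) (Ω : Set E3) (m : ℝ × E3 → E3) (m0 : E3 → E3) : Prop :=
  ∃ u : ℝ → L2 Ω, ContinuousOn u (Set.Icc 0 T) ∧
    (∀ᵐ t ∂(volume.restrict (Set.Ioo 0 T)), ∀ᵐ x ∂(volume.restrict Ω), u t x = m (t, x)) ∧
    ∀ᵐ x ∂(volume.restrict Ω), u 0 x = m0 x

/-- `m ∈ L^∞(0,T; H¹(Ω))`, for measurable `m`. -/
def MemLinftyH1 (T : ℝ) (Ω : Set E3) (m : ℝ × E3 → E3) : Prop :=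
  ∃ C : ℝ, ∀ᵐ t ∂(volume.restrict (Set.Ioo 0 T)), MemH1 Ω (fun x => m (t, x)) ∧
    (∫ x in Ω, ‖m (t, x)‖ ^ 2) + gradNormSq Ω (fun x => m (t, x)) ≤ C

/-- `|m| = 1` almost everywhere in `(0,T) × Ω`. -/
def UnitModulus (T : ℝ) (Ω : Set E3) (m : ℝ × E3 → E3) : Prop :=
  ∀ᵐ p ∂(volume.restrict (cylinder T Ω)), ‖m p‖ = 1

/-- The energy estimate with constant `C`: for almost all `t ∈ (0,T)`,
`‖∇m(t)‖²_{L²(Ω)} + ‖∂ₜm‖²_{L²((0,t) × Ω)} ≤ C`. -/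
def EnergyBound (T : ℝ) (Ω : Set E3) (m : ℝ × E3 → E3) (C : ℝ) : Prop :=
  ∀ᵐ t ∂(volume.restrict (Set.Ioo 0 T)), MemH1 Ω (fun x => m (t, x)) ∧
    gradNormSq Ω (fun x => m (t, x))
      + (∫ p in cylinder t Ω, ‖weakDeriv (cylinder T Ω) timeDir m p‖ ^ 2) ≤ C

/-- The variational form of the Gilbert formulation, tested with all functions that are smooth up
to the boundary of the space-time cylinder; `P` stands for the field contribution. -/
def GilbertEquation (T : ℝ) (Ω : Set E3) (α Cex : ℝ) (P f m : ℝ × E3 → E3) : Prop :=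
  ∀ φ : ℝ × E3 → E3, ContDiff ℝ ∞ φ →
    (∫ p in cylinder T Ω, inner ℝ (weakDeriv (cylinder T Ω) timeDir m p) (φ p))
        - α * (∫ p in cylinder T Ω,
            inner ℝ (cross (m p) (weakDeriv (cylinder T Ω) timeDir m p)) (φ p))
      = -Cex * (∑ i, ∫ p in cylinder T Ω,
            inner ℝ (cross (weakDeriv (cylinder T Ω) (spaceDir i) m p) (m p))
              (fderiv ℝ φ p (spaceDir i)))
        - (∫ p in cylinder T Ω, inner ℝ (cross (P p) (m p)) (φ p))
        + ∫ p in cylinder T Ω, inner ℝ (cross (f p) (m p)) (φ p)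

/-- Weak solutions of the general Landau-Lifshitz-Gilbert equation with damping `α`, exchange
constant `Cex`, field contribution `π(·, ζ)`, exterior field `f`, and initial datum `m0`. -/
structure IsWeakSolution {Ω : Set E3} {Y : Type*} (T α Cex : ℝ) (π : H1 Ω → Y → L2 Ω)
    (ζ : ℝ → Y) (f : ℝ × E3 → E3) (m0 : E3 → E3) (m : ℝ × E3 → E3) : Prop where
  memH1 : MemH1 (cylinder T Ω) m
  unitModulus : UnitModulus T Ω m
  initialTrace : HasInitialTrace T Ω m m0
  equation : ∃ P : ℝ × E3 → E3, Represents T Ω P (contribution π m ζ) ∧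
    GilbertEquation T Ω α Cex P f m
  energy : ∃ C : ℝ, 0 < C ∧ EnergyBound T Ω m C

end LLG

end

open MeasureTheory Filter Topology
open scoped ContDiff ENNReal

set_option linter.unusedSectionVars false

namespace LLG

/-! Solvability. On the discrete tangent space the bilinear form of a step is positive definite,
because the vector product term vanishes on the diagonal; in finite dimension it is therefore
invertible. Tangency at the nodes gives `|m + k v|² = 1 + k² |v|² ≥ 1`, so the normalization makes
sense.

Energy. The radial projection is 1-Lipschitz outside the unit ball (`norm_normalize_sub_le`). Under
the angle condition the Dirichlet energy is a sum of squared nodal differences with nonnegative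
weights, so the normalization cannot increase it (`gradNormSq_le_of_contraction`). Testing a step
with `v` and absorbing the fields by Young's inequality gives an energy balance. The linear growth
of `πh` is handled by a discrete Gronwall argument, and `θ > 1/2` leaves control of the sum of `k²
‖∇v‖²` (`IsIntegratorOutput.energy_bound`).

Compactness. At the nodes the difference quotient of `m` is dominated by `v` and differs from it by
at most `k/2 |v|²`. A norm comparison on each tetrahedron, with constants that do not depend on the
mesh, turns this into integral estimates. The interpolants are thus bounded in `H¹` of the cylinder,
and they are bounded by one, so a Rellich theorem proved by mollification gives strong convergence
without regularity of the boundary (`BoundedEvolution.exists_limit`).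

Limits. The modulus is one at the vertices, so on a tetrahedron it deviates from one by at most the
diameter times the gradient; this gives `|m| = 1`. Equicontinuity in time with values in `L²(Ω)`
gives the initial trace. Weak lower semicontinuity gives the energy bound.

Equation. The discrete equation is tested with the nodal interpolant of `m × φ`. In `∇m : ∇(m × φ)`
the only term quadratic in `∇m` is `∂ᵢm · (∂ᵢm × φ) = 0`, so weak convergence of the gradients
suffices. The remaining errors carry a factor from the mesh size, from `√k`, or from the distance of
`v` to the difference quotient (`abs_gilbertDensity_sub_le`), hence no coupling of the two
parameters is required. In the limit, `|m| = 1` and `m · ∂ₜm = 0` turn the equation tested with `m ×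
φ` into the Gilbert form (`TangentEvolution.gilbertEquation`). -/

instance : (volume : Measure (ℝ × E3)).IsAddHaarMeasure :=
  inferInstanceAs ((volume : Measure ℝ).prod (volume : Measure E3)).IsAddHaarMeasure

/-! ### Calculus of weak derivatives -/

section WeakDerivatives

variable {X : Type*} [NormedAddCommGroup X] [NormedSpace ℝ X] [FiniteDimensional ℝ X]
  [MeasureSpace X] [BorelSpace X] [(volume : Measure X).IsAddHaarMeasure]
variable {F : Type*} [NormedAddCommGroup F] [InnerProductSpace ℝ F]

theorem contDiff_fderiv_const {φ : X → ℝ} (hφ : ContDiff ℝ ∞ φ) (e : X) :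
    ContDiff ℝ ∞ fun x => fderiv ℝ φ x e := by
  have : ContDiff ℝ ∞ (fderiv ℝ φ) := hφ.fderiv_right (by simp)
  exact this.clm_apply contDiff_const

theorem hasCompactSupport_fderiv_const {φ : X → ℝ} (h : HasCompactSupport φ) (e : X) :
    HasCompactSupport fun x => fderiv ℝ φ x e := h.fderiv_apply ℝ e

theorem memLp_two_of_test {φ : X → ℝ} (hφ : Continuous φ)
    (h : HasCompactSupport φ) (U : Set X) : MemLp φ 2 (volume.restrict U) :=
  (hφ.memLp_of_hasCompactSupport h).restrict U

theorem integrable_test_smul {φ : X → ℝ} (hφ : Continuous φ)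
    (h : HasCompactSupport φ) {U : Set X} {u : X → F} (hu : MemLp u 2 (volume.restrict U)) :
    Integrable (fun x => φ x • u x) (volume.restrict U) := by
  have := hu.smul (p := 2) (q := 2) (r := 1) (memLp_two_of_test hφ h U)
  exact memLp_one_iff_integrable.1 this

theorem MemLp.locallyIntegrableOn {U : Set X} {u : X → F} (hu : MemLp u 2 (volume.restrict U)) :
    LocallyIntegrableOn u U := by
  refine locallyIntegrableOn_of_locallyIntegrable_restrict ?_
  exact hu.locallyIntegrable (by norm_num)

/-- The fundamental lemma of the calculus of variations. As `weakDeriv` is an arbitrary choice, this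
is what identifies it with concrete derivatives. -/
theorem HasWeakDeriv.ae_unique [CompleteSpace F] {U : Set X} (hU : IsOpen U) {e : X} {u g g' : X → F}
    (hg : MemLp g 2 (volume.restrict U)) (hg' : MemLp g' 2 (volume.restrict U))
    (h : HasWeakDeriv U e u g) (h' : HasWeakDeriv U e u g') : g =ᵐ[volume.restrict U] g' := by
  have key : ∀ᵐ x, x ∈ U → (g - g') x = 0 := by
    refine IsOpen.ae_eq_zero_of_integral_contDiff_smul_eq_zero hU
      (MemLp.locallyIntegrableOn (hg.sub hg')) fun φ h1 h2 h3 => ?_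
    have e1 := h φ h1 h2 h3
    rw [h' φ h1 h2 h3, neg_inj] at e1
    have : ∫ x, φ x • (g - g') x = ∫ x in U, φ x • (g - g') x := by
      refine (setIntegral_eq_integral_of_forall_compl_eq_zero fun x hx => ?_).symm
      rw [image_eq_zero_of_notMem_tsupport fun hx' => hx (h3 hx'), zero_smul]
    rw [this]
    simp only [Pi.sub_apply, smul_sub]
    rw [integral_sub (integrable_test_smul h1.continuous h2 hg)
      (integrable_test_smul h1.continuous h2 hg'), e1, sub_self]
  filter_upwards [(ae_restrict_iff' hU.measurableSet).2 key] with x hx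
  simpa [sub_eq_zero] using hx

theorem MemH1.memLp_weakDeriv {U : Set X} {u : X → F} (h : MemH1 U u) (e : X) :
    MemLp (weakDeriv U e u) 2 (volume.restrict U) := by
  rw [weakDeriv, dif_pos (h.2 e)]
  exact (h.2 e).choose_spec.1

theorem MemH1.hasWeakDeriv {U : Set X} {u : X → F} (h : MemH1 U u) (e : X) :
    HasWeakDeriv U e u (weakDeriv U e u) := by
  rw [weakDeriv, dif_pos (h.2 e)]
  exact (h.2 e).choose_spec.2

theorem HasWeakDeriv.weakDeriv_ae [CompleteSpace F] {U : Set X} (hU : IsOpen U) {e : X} {u g : X → F}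
    (hg : MemLp g 2 (volume.restrict U)) (h : HasWeakDeriv U e u g) :
    weakDeriv U e u =ᵐ[volume.restrict U] g := by
  have ex : ∃ g : X → F, MemLp g 2 (volume.restrict U) ∧ HasWeakDeriv U e u g := ⟨g, hg, h⟩
  rw [weakDeriv, dif_pos ex]
  exact ex.choose_spec.2.ae_unique hU ex.choose_spec.1 hg h

theorem HasWeakDeriv.congr {U : Set X} {e : X} {u u' g g' : X → F} (h : HasWeakDeriv U e u g)
    (hu : u =ᵐ[volume.restrict U] u') (hg : g =ᵐ[volume.restrict U] g') :
    HasWeakDeriv U e u' g' := by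
  intro φ h1 h2 h3
  have := h φ h1 h2 h3
  have e1 : ∫ x in U, fderiv ℝ φ x e • u' x = ∫ x in U, fderiv ℝ φ x e • u x := by
    refine integral_congr_ae ?_
    filter_upwards [hu] with x hx
    rw [hx]
  have e2 : ∫ x in U, φ x • g' x = ∫ x in U, φ x • g x := by
    refine integral_congr_ae ?_
    filter_upwards [hg] with x hx
    rw [hx]
  rw [e1, e2, this]

/-- The equality holds everywhere and not only almost everywhere: both sides choose from the same
predicate. -/
theorem weakDeriv_congr {U : Set X} {e : X} {u u' : X → F} (hu : u =ᵐ[volume.restrict U] u') :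
    weakDeriv U e u = weakDeriv U e u' := by
  have : HasWeakDeriv U e u = HasWeakDeriv U e u' := funext fun g => propext
    ⟨fun h => h.congr hu ae_eq_rfl, fun h => h.congr hu.symm ae_eq_rfl⟩
  unfold weakDeriv
  rw [this]

theorem HasWeakDeriv.add_dir {U : Set X} {e e' : X} {u g g' : X → F}
    (hu : MemLp u 2 (volume.restrict U)) (hg : MemLp g 2 (volume.restrict U))
    (hg' : MemLp g' 2 (volume.restrict U))
    (h : HasWeakDeriv U e u g) (h' : HasWeakDeriv U e' u g') :
    HasWeakDeriv U (e + e') u (fun x => g x + g' x) := by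
  intro φ h1 h2 h3
  simp only [map_add, add_smul, smul_add]
  rw [integral_add, integral_add, h φ h1 h2 h3, h' φ h1 h2 h3, neg_add]
  · exact integrable_test_smul h1.continuous h2 hg
  · exact integrable_test_smul h1.continuous h2 hg'
  · exact integrable_test_smul (contDiff_fderiv_const h1 e).continuous
      (hasCompactSupport_fderiv_const h2 e) hu
  · exact integrable_test_smul (contDiff_fderiv_const h1 e').continuous
      (hasCompactSupport_fderiv_const h2 e') hu

theorem HasWeakDeriv.smul_dir {U : Set X} {e : X} {u g : X → F} (c : ℝ)
    (h : HasWeakDeriv U e u g) : HasWeakDeriv U (c • e) u (fun x => c • g x) := by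
  intro φ h1 h2 h3
  simp only [map_smul, smul_eq_mul, mul_smul, smul_comm (φ _) c]
  rw [integral_smul, integral_smul, h φ h1 h2 h3, smul_neg]

theorem HasWeakDeriv.zero_dir {U : Set X} {u : X → F} : HasWeakDeriv U (0 : X) u 0 := by
  intro φ h1 h2 h3
  simp

/-- `MemH1` and `WeakH1` speak of all directions; linearity in the direction reduces them to
finitely many coordinate directions. -/
theorem HasWeakDeriv.sum_dir {ι : Type*} {U : Set X} {u : X → F} (s : Finset ι) (e : ι → X)
    (c : ι → ℝ) (g : ι → X → F) (hu : MemLp u 2 (volume.restrict U))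
    (hg : ∀ i, MemLp (g i) 2 (volume.restrict U)) (h : ∀ i, HasWeakDeriv U (e i) u (g i)) :
    HasWeakDeriv U (∑ i ∈ s, c i • e i) u (fun x => ∑ i ∈ s, c i • g i x) := by
  classical
  induction s using Finset.induction_on with
  | empty =>
    simp only [Finset.sum_empty]
    exact HasWeakDeriv.zero_dir
  | insert a s ha ih =>
    simp only [Finset.sum_insert ha]
    exact ((h a).smul_dir (c a)).add_dir hu ((hg a).const_smul (c a))
      (memLp_finsetSum s fun i _ => (hg i).const_smul (c i)) ih

theorem HasWeakDeriv.sub {U : Set X} {e : X} {u u' g g' : X → F}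
    (hu : MemLp u 2 (volume.restrict U)) (hu' : MemLp u' 2 (volume.restrict U))
    (hg : MemLp g 2 (volume.restrict U))
    (hg' : MemLp g' 2 (volume.restrict U))
    (h : HasWeakDeriv U e u g) (h' : HasWeakDeriv U e u' g') :
    HasWeakDeriv U e (fun x => u x - u' x) (fun x => g x - g' x) := by
  intro φ h1 h2 h3
  simp only [smul_sub]
  rw [integral_sub, integral_sub, h φ h1 h2 h3, h' φ h1 h2 h3, neg_sub_neg, neg_sub]
  · exact integrable_test_smul h1.continuous h2 hg
  · exact integrable_test_smul h1.continuous h2 hg'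
  · exact integrable_test_smul (contDiff_fderiv_const h1 e).continuous
      (hasCompactSupport_fderiv_const h2 e) hu
  · exact integrable_test_smul (contDiff_fderiv_const h1 e).continuous
      (hasCompactSupport_fderiv_const h2 e) hu'

/-- Weak derivatives pass to weak limits. -/
theorem HasWeakDeriv.of_weakL2 [CompleteSpace F] {U : Set X} {e : X} {u g : ℕ → X → F} {u' g' : X → F}
    (h : ∀ n, HasWeakDeriv U e (u n) (g n)) (hu : WeakL2 (volume.restrict U) u u')
    (hg : WeakL2 (volume.restrict U) g g') : HasWeakDeriv U e u' g' := by
  intro φ h1 h2 h3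
  have i1 : ∀ {w : X → F}, MemLp w 2 (volume.restrict U) →
      Integrable (fun x => fderiv ℝ φ x e • w x) (volume.restrict U) := fun hw =>
    integrable_test_smul (contDiff_fderiv_const h1 e).continuous
      (hasCompactSupport_fderiv_const h2 e) hw
  have i2 : ∀ {w : X → F}, MemLp w 2 (volume.restrict U) →
      Integrable (fun x => φ x • w x) (volume.restrict U) := fun hw =>
    integrable_test_smul h1.continuous h2 hw
  -- Weak convergence pairs with vector-valued functions, so the identity of integrals is tested
  -- against a fixed vector `c`, which makes `φ • c` an admissible partner.
  refine ext_inner_right ℝ fun c => ?_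
  have m1 : MemLp (fun x => fderiv ℝ φ x e • c) 2 (volume.restrict U) := by
    have := memLp_two_of_test (contDiff_fderiv_const h1 e).continuous
      (hasCompactSupport_fderiv_const h2 e) U
    exact (ContinuousLinearMap.toSpanSingleton ℝ c).comp_memLp' this
  have m2 : MemLp (fun x => φ x • c) 2 (volume.restrict U) := by
    have := memLp_two_of_test h1.continuous h2 U
    exact (ContinuousLinearMap.toSpanSingleton ℝ c).comp_memLp' this
  have t1 := hu.2.2 _ m1
  have t2 := (hg.2.2 _ m2).neg
  have conv1 : ∀ {w : X → F}, MemLp w 2 (volume.restrict U) →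
      ∫ x in U, inner ℝ (w x) (fderiv ℝ φ x e • c) = inner ℝ (∫ x in U, fderiv ℝ φ x e • w x) c := by
    intro w hw
    rw [real_inner_comm, ← integral_inner (i1 hw)]
    refine integral_congr_ae (ae_of_all _ fun x => ?_)
    simp [inner_smul_left, inner_smul_right, real_inner_comm]
  have conv2 : ∀ {w : X → F}, MemLp w 2 (volume.restrict U) →
      ∫ x in U, inner ℝ (w x) (φ x • c) = inner ℝ (∫ x in U, φ x • w x) c := by
    intro w hw
    rw [real_inner_comm, ← integral_inner (i2 hw)]
    refine integral_congr_ae (ae_of_all _ fun x => ?_)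
    simp [inner_smul_left, inner_smul_right, real_inner_comm]
  rw [conv1 hu.2.1] at t1
  rw [conv2 hg.2.1] at t2
  rw [inner_neg_left]
  refine tendsto_nhds_unique t1 (t2.congr fun n => ?_)
  rw [conv1 (hu.1 n), conv2 (hg.1 n), h n φ h1 h2 h3, inner_neg_left]

/-- A function that is Lipschitz in the direction `e` locally uniformly, and has the directional
derivative `g` almost everywhere, has the weak derivative `g`. -/
theorem HasWeakDeriv.of_lipschitz_direction {U : Set X} (hU : IsOpen U) {e : X} {u g : X → F}
    (hu : MemLp u 2 (volume.restrict U)) {L : ℝ}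
    (hL : ∀ K ⊆ U, IsCompact K → ∃ δ > 0, ∀ x ∈ K, ∀ s : ℝ, |s| < δ → x + s • e ∈ U →
      ‖u (x + s • e) - u x‖ ≤ L * |s|)
    (hg : ∀ᵐ x ∂(volume.restrict U), HasLineDerivAt ℝ u (g x) x e) :
    HasWeakDeriv U e u g := by
  intro φ h1 h2 h3
  set K := tsupport φ with hK
  have hKc : IsCompact K := h2
  obtain ⟨δ, hδ, hLK⟩ := hL K h3 hKc
  -- Extension by zero makes translation invariance on the whole space available; near the support
  -- of `φ` nothing changes.
  set v : X → F := U.indicator u with hv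
  -- small translates of the support stay in `U`
  obtain ⟨δ', hδ', hth⟩ : ∃ δ' > 0, ∀ x ∈ K, ∀ s : ℝ, |s| < δ' → x + s • e ∈ U := by
    obtain ⟨r, hr, hrU⟩ := hKc.exists_cthickening_subset_open hU h3
    refine ⟨r / (‖e‖ + 1), by positivity, fun x hx s hs => hrU ?_⟩
    refine Metric.mem_cthickening_of_dist_le _ x _ _ hx ?_
    rw [dist_eq_norm, add_sub_cancel_left, norm_smul, Real.norm_eq_abs]
    have := (lt_div_iff₀ (by positivity)).1 hs
    nlinarith [norm_nonneg e, abs_nonneg s]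
  obtain ⟨A, hA⟩ := (contDiff_fderiv_const h1 e).continuous.bounded_above_of_compact_support
    (hasCompactSupport_fderiv_const h2 e)
  obtain ⟨B, hB⟩ := h1.continuous.bounded_above_of_compact_support h2
  have hvL2 : MemLp v 2 := (memLp_indicator_iff_restrict hU.measurableSet).2 hu
  -- sequence of steps
  set a : ℕ → ℝ := fun n => min δ δ' / 2 * (1 / 2) ^ n with ha
  have hm : 0 < min δ δ' := lt_min hδ hδ'
  have hapos : ∀ n, 0 < a n := fun n => by positivity
  have halt : ∀ n, a n < min δ δ' := fun n => by
    have : (1 / 2 : ℝ) ^ n ≤ 1 := pow_le_one₀ (by norm_num) (by norm_num)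
    simp only [ha]; nlinarith
  have ha0 : Tendsto a atTop (𝓝 0) := by
    have := (tendsto_pow_atTop_nhds_zero_of_lt_one (r := (1 / 2 : ℝ)) (by norm_num)
      (by norm_num)).const_mul (min δ δ' / 2)
    rwa [mul_zero] at this
  have ha0' : Tendsto a atTop (𝓝[≠] 0) :=
    tendsto_nhdsWithin_iff.2 ⟨ha0, Eventually.of_forall fun n => (hapos n).ne'⟩
  -- discrete integration by parts
  have hvli : LocallyIntegrable v := hvL2.locallyIntegrable (by norm_num)
  have hφshift : ∀ s : ℝ, Integrable fun x => φ (x + s • e) • v x := fun s => by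
    refine hvli.integrable_smul_left_of_hasCompactSupport (by fun_prop) ?_
    exact h2.comp_homeomorph (Homeomorph.addRight (s • e))
  have hφv : Integrable fun x => φ x • v x :=
    hvli.integrable_smul_left_of_hasCompactSupport h1.continuous h2
  have hvshift : ∀ s : ℝ, Integrable fun x => φ x • v (x - s • e) := fun s => by
    have := (hφshift s).comp_sub_right (s • e)
    simpa using this
  have dibp : ∀ s : ℝ, ∫ x, (s⁻¹ * (φ (x + s • e) - φ x)) • v x
      = - ∫ x, φ x • (s⁻¹ • (v x - v (x - s • e))) := fun s => by
    have e1 : ∫ x, φ (x + s • e) • v x = ∫ x, φ x • v (x - s • e) := by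
      rw [← integral_sub_right_eq_self (fun x => φ (x + s • e) • v x) (s • e)]
      simp
    have l1 : ∀ x, (s⁻¹ * (φ (x + s • e) - φ x)) • v x
        = s⁻¹ • (φ (x + s • e) • v x - φ x • v x) := fun x => by rw [mul_smul, sub_smul]
    have l2 : ∀ x, φ x • (s⁻¹ • (v x - v (x - s • e)))
        = s⁻¹ • (φ x • v x - φ x • v (x - s • e)) := fun x => by rw [smul_comm, smul_sub]
    simp_rw [l1, l2]
    rw [integral_smul, integral_smul, integral_sub (hφshift s) hφv, integral_sub hφv (hvshift s),
      e1, ← smul_neg, neg_sub]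
  -- limits
  have lim1 : Tendsto (fun n => ∫ x, ((a n)⁻¹ * (φ (x + a n • e) - φ x)) • v x) atTop
      (𝓝 (∫ x, fderiv ℝ φ x e • v x)) := by
    -- `K'` contains every `x` for which `x` or `x + a n • e` lies in the support of `φ`, so the
    -- integrands vanish outside of it.
    set K' : Set X := Metric.cthickening (‖e‖ * (min δ δ' + 1)) K
    have hK' : IsCompact K' := hKc.cthickening
    refine tendsto_integral_of_dominated_convergence (fun x => K'.indicator (fun x => A * ‖v x‖) x)
      (fun n => ?_) ?_ (fun n => ae_of_all _ fun x => ?_) (ae_of_all _ fun x => ?_)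
    · have := ((hφshift (a n)).sub hφv).smul ((a n)⁻¹)
      refine this.aestronglyMeasurable.congr (ae_of_all _ fun x => ?_)
      simp [mul_smul, sub_smul]
    · rw [integrable_indicator_iff hK'.measurableSet]
      exact (hvli.integrableOn_isCompact hK').norm.const_mul A
    · by_cases hx : x ∈ K'
      · rw [Set.indicator_of_mem hx, norm_smul]
        refine mul_le_mul_of_nonneg_right ?_ (norm_nonneg _)
        have hd : ∀ y ∈ Set.Icc (0:ℝ) (a n), HasDerivWithinAt (fun s : ℝ => φ (x + s • e))
            (fderiv ℝ φ (x + y • e) e) (Set.Icc 0 (a n)) y := fun y _ => by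
          have hd1 := (h1.differentiable (by simp) (x + y • e)).hasFDerivAt
          have hd2 : HasDerivAt (fun s : ℝ => x + s • e) e y := by
            simpa using ((hasDerivAt_id y).smul_const e).const_add x
          exact (hd1.comp_hasDerivAt y hd2).hasDerivWithinAt
        have := norm_image_sub_le_of_norm_deriv_le_segment' hd
          (fun y _ => hA (x + y • e)) (a n) ⟨(hapos n).le, le_rfl⟩
        simp only [zero_smul, add_zero, sub_zero] at this
        rw [norm_mul, norm_inv, Real.norm_of_nonneg (hapos n).le, inv_mul_le_iff₀ (hapos n)]
        linarith
      · rw [Set.indicator_of_notMem hx]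
        have z1 : φ x = 0 := image_eq_zero_of_notMem_tsupport fun h =>
          hx (Metric.self_subset_cthickening _ h)
        have z2 : φ (x + a n • e) = 0 := image_eq_zero_of_notMem_tsupport fun h => by
          refine hx (Metric.mem_cthickening_of_dist_le _ _ _ _ h ?_)
          rw [dist_eq_norm]
          simp only [sub_add_cancel_left, norm_neg, norm_smul, Real.norm_of_nonneg (hapos n).le]
          nlinarith [norm_nonneg e, halt n]
        simp [z1, z2]
    · have hd := ((h1.differentiable (by simp) x).hasFDerivAt).hasLineDerivAt e
      have := (hd.tendsto_slope_zero).comp ha0'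
      simpa [Function.comp_def] using this.smul_const (v x)
  have lim2 : Tendsto (fun n => ∫ x, φ x • ((a n)⁻¹ • (v x - v (x - a n • e)))) atTop
      (𝓝 (∫ x, φ x • U.indicator g x)) := by
    -- On the support of `φ` the Lipschitz hypothesis bounds the backward difference quotients by
    -- `L`, which makes the constant `B * L` on `K` a dominating function.
    refine tendsto_integral_of_dominated_convergence (fun x => K.indicator (fun _ => B * L) x)
      (fun n => ?_) ?_ (fun n => ae_of_all _ fun x => ?_) ?_
    · have := (hφv.sub (hvshift (a n))).smul ((a n)⁻¹)
      refine this.aestronglyMeasurable.congr (ae_of_all _ fun x => ?_)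
      simp [smul_sub, smul_comm (φ _) (a n)⁻¹]
    · rw [integrable_indicator_iff hKc.measurableSet]
      exact integrableOn_const (by exact hKc.measure_lt_top.ne)
    · by_cases hx : x ∈ K
      · rw [Set.indicator_of_mem hx, norm_smul]
        have hs : |-(a n)| < δ ∧ |-(a n)| < δ' := by
          rw [abs_neg, abs_of_pos (hapos n)]
          exact lt_min_iff.1 (halt n)
        have hin := hth x hx (-(a n)) hs.2
        have := hLK x hx (-(a n)) hs.1 hin
        rw [neg_smul, ← sub_eq_add_neg] at this hin
        rw [hv, Set.indicator_of_mem (h3 hx), Set.indicator_of_mem hin, norm_smul, norm_inv,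
          Real.norm_of_nonneg (hapos n).le]
        rw [norm_sub_rev, abs_neg, abs_of_pos (hapos n)] at this
        refine mul_le_mul (hB x) ?_ (by have := hapos n; positivity) ((norm_nonneg _).trans (hB x))
        rw [inv_mul_le_iff₀ (hapos n)]
        linarith
      · rw [Set.indicator_of_notMem hx, image_eq_zero_of_notMem_tsupport hx]
        simp
    · filter_upwards [(ae_restrict_iff' hU.measurableSet).1 hg] with x hx
      by_cases hxK : x ∈ K
      · have hxU := h3 hxK
        have hn0 : Tendsto (fun n => -(a n)) atTop (𝓝[≠] 0) := by
          refine tendsto_nhdsWithin_iff.2 ⟨by simpa using ha0.neg,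
            Eventually.of_forall fun n => ?_⟩
          simpa using (hapos n).ne'
        have := ((hx hxU).tendsto_slope_zero).comp hn0
        rw [Set.indicator_of_mem hxU]
        refine Tendsto.const_smul (this.congr fun n => ?_) (φ x)
        have hs : |-(a n)| < δ' := by
          rw [abs_neg, abs_of_pos (hapos n)]
          exact (lt_min_iff.1 (halt n)).2
        have hin := hth x hxK (-(a n)) hs
        simp only [Function.comp_def]
        rw [neg_smul, ← sub_eq_add_neg] at hin
        rw [neg_smul, ← sub_eq_add_neg, hv, Set.indicator_of_mem hxU, Set.indicator_of_mem hin,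
          inv_neg, neg_smul, ← smul_neg, neg_sub]
      · rw [image_eq_zero_of_notMem_tsupport hxK]
        simp
  have fin := tendsto_nhds_unique (lim1.congr fun n => dibp (a n)) lim2.neg
  rw [← integral_indicator hU.measurableSet, ← integral_indicator hU.measurableSet]
  have c1 : U.indicator (fun x => fderiv ℝ φ x e • u x) = fun x => fderiv ℝ φ x e • v x := by
    ext1 x
    by_cases hx : x ∈ U <;> simp [hv, hx]
  have c2 : U.indicator (fun x => φ x • g x) = fun x => φ x • U.indicator g x := by
    ext1 x
    by_cases hx : x ∈ U <;> simp [hx]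
  rw [c1, c2, fin]

end WeakDerivatives

end LLG

namespace LLG

/-! ### Strong and weak convergence in `L²` -/

section LTwo

variable {X : Type*} [MeasurableSpace X] {μ : Measure X}
variable {F : Type*} [NormedAddCommGroup F] [InnerProductSpace ℝ F]

theorem MemLp.sub_fun {f g : X → F} (hf : MemLp f 2 μ) (hg : MemLp g 2 μ) :
    MemLp (fun x => f x - g x) 2 μ := hf.sub hg

theorem integral_inner_eq_inner_toLp {f g : X → F} (hf : MemLp f 2 μ) (hg : MemLp g 2 μ) :
    ∫ x, inner ℝ (f x) (g x) ∂μ = inner ℝ (hf.toLp f) (hg.toLp g) := by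
  rw [L2.inner_def]
  refine integral_congr_ae ?_
  filter_upwards [hf.coeFn_toLp, hg.coeFn_toLp] with x h1 h2
  rw [h1, h2]

theorem integral_norm_sq_eq {f : X → F} (hf : MemLp f 2 μ) :
    ∫ x, ‖f x‖ ^ 2 ∂μ = ‖hf.toLp f‖ ^ 2 := by
  rw [← real_inner_self_eq_norm_sq, ← integral_inner_eq_inner_toLp hf hf]
  simp only [real_inner_self_eq_norm_sq]

theorem integrable_inner {f g : X → F} (hf : MemLp f 2 μ) (hg : MemLp g 2 μ) :
    Integrable (fun x => inner ℝ (f x) (g x)) μ := by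
  have := L2.integrable_inner (𝕜 := ℝ) (hf.toLp f) (hg.toLp g)
  refine this.congr ?_
  filter_upwards [hf.coeFn_toLp, hg.coeFn_toLp] with x h1 h2
  rw [h1, h2]

theorem integrable_norm_sq {f : X → F} (hf : MemLp f 2 μ) :
    Integrable (fun x => ‖f x‖ ^ 2) μ := by
  simpa only [real_inner_self_eq_norm_sq] using integrable_inner hf hf

theorem abs_integral_inner_le {f g : X → F} (hf : MemLp f 2 μ) (hg : MemLp g 2 μ) :
    |∫ x, inner ℝ (f x) (g x) ∂μ|
      ≤ √(∫ x, ‖f x‖ ^ 2 ∂μ) * √(∫ x, ‖g x‖ ^ 2 ∂μ) := by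
  rw [integral_inner_eq_inner_toLp hf hg, integral_norm_sq_eq hf, integral_norm_sq_eq hg,
    Real.sqrt_sq (norm_nonneg _), Real.sqrt_sq (norm_nonneg _)]
  exact abs_real_inner_le_norm _ _

theorem eLpNorm_two_eq {f : X → F} (hf : MemLp f 2 μ) :
    eLpNorm f 2 μ = ENNReal.ofReal (√(∫ x, ‖f x‖ ^ 2 ∂μ)) := by
  rw [integral_norm_sq_eq hf, Real.sqrt_sq (norm_nonneg _), Lp.norm_toLp,
    ENNReal.ofReal_toReal hf.2.ne]

/-- Trades `eLpNorm` for real integrals of squares, the form in which the estimates below are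
carried out. -/
theorem strongL2_iff {u : ℕ → X → F} {v : X → F} : StrongL2 μ u v ↔
    (∀ n, MemLp (u n) 2 μ) ∧ MemLp v 2 μ ∧
      Tendsto (fun n => ∫ x, ‖u n x - v x‖ ^ 2 ∂μ) atTop (𝓝 0) := by
  refine and_congr_right fun hu => and_congr_right fun hv => ?_
  have e : ∀ n, eLpNorm (fun x => u n x - v x) 2 μ
      = ENNReal.ofReal (√(∫ x, ‖u n x - v x‖ ^ 2 ∂μ)) := fun n => eLpNorm_two_eq ((hu n).sub hv)
  simp only [e]
  constructor
  · intro h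
    have h1 := (ENNReal.tendsto_toReal ENNReal.zero_ne_top).comp h
    simp only [Function.comp_def, ENNReal.toReal_ofReal (Real.sqrt_nonneg _),
      ENNReal.toReal_zero] at h1
    have h2 := h1.pow 2
    refine (h2.congr fun n => ?_).trans (by simp)
    exact Real.sq_sqrt (integral_nonneg fun x => by positivity)
  · intro h
    have h1 := (Real.continuous_sqrt.tendsto 0).comp h
    have h2 := (ENNReal.continuous_ofReal.tendsto _).comp h1
    simpa [Function.comp_def] using h2

theorem StrongL2.of_bounded_ae [IsFiniteMeasure μ] {u : ℕ → X → F} {v : X → F} {C : ℝ}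
    (hu : ∀ n, AEStronglyMeasurable (u n) μ) (hC : ∀ n, ∀ᵐ x ∂μ, ‖u n x‖ ≤ C)
    (h : ∀ᵐ x ∂μ, Tendsto (fun n => u n x) atTop (𝓝 (v x))) : StrongL2 μ u v := by
  have hv : AEStronglyMeasurable v μ := aestronglyMeasurable_of_tendsto_ae atTop hu h
  have hvC : ∀ᵐ x ∂μ, ‖v x‖ ≤ C := by
    filter_upwards [h, ae_all_iff.2 hC] with x h1 h2
    exact le_of_tendsto h1.norm (Eventually.of_forall h2)
  refine strongL2_iff.2 ⟨fun n => MemLp.of_bound (hu n) C (hC n), MemLp.of_bound hv C hvC, ?_⟩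
  have := tendsto_integral_of_dominated_convergence (μ := μ) (F := fun n x => ‖u n x - v x‖ ^ 2)
    (f := fun _ => (0 : ℝ)) (fun _ => (C + C) ^ 2) (fun n => ((hu n).sub hv).norm.pow 2)
    (integrable_const _) (fun n => ?_) ?_
  · simpa using this
  · filter_upwards [hC n, hvC] with x h1 h2
    rw [Real.norm_of_nonneg (by positivity)]
    exact pow_le_pow_left₀ (norm_nonneg _) ((norm_sub_le _ _).trans (add_le_add h1 h2)) 2
  · filter_upwards [h] with x hx
    have := ((hx.sub_const (v x)).norm).pow 2
    simpa using this

theorem StrongL2.exists_subseq_ae {u : ℕ → X → F} {v : X → F} (h : StrongL2 μ u v) :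
    ∃ σ : ℕ → ℕ, StrictMono σ ∧ ∀ᵐ x ∂μ, Tendsto (fun n => u (σ n) x) atTop (𝓝 (v x)) := by
  have hm : TendstoInMeasure μ u atTop v :=
    tendstoInMeasure_of_tendsto_eLpNorm (p := 2) (by norm_num) (fun n => (h.1 n).1) h.2.1.1 h.2.2
  exact hm.exists_seq_tendsto_ae

theorem StrongL2.comp {u : ℕ → X → F} {v : X → F} (h : StrongL2 μ u v) {σ : ℕ → ℕ}
    (hσ : Tendsto σ atTop atTop) : StrongL2 μ (fun n => u (σ n)) v :=
  ⟨fun n => h.1 _, h.2.1, h.2.2.comp hσ⟩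

theorem WeakL2.comp {u : ℕ → X → F} {v : X → F} (h : WeakL2 μ u v) {σ : ℕ → ℕ}
    (hσ : Tendsto σ atTop atTop) : WeakL2 μ (fun n => u (σ n)) v :=
  ⟨fun n => h.1 _, h.2.1, fun g hg => (h.2.2 g hg).comp hσ⟩

theorem WeakL2.congr {u u' : ℕ → X → F} {v v' : X → F} (h : WeakL2 μ u v)
    (hu : ∀ n, u n =ᵐ[μ] u' n) (hv : v =ᵐ[μ] v') : WeakL2 μ u' v' := by
  refine ⟨fun n => (h.1 n).ae_eq (hu n), h.2.1.ae_eq hv, fun g hg => ?_⟩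
  have e : ∫ x, inner ℝ (v' x) (g x) ∂μ = ∫ x, inner ℝ (v x) (g x) ∂μ := by
    refine integral_congr_ae ?_
    filter_upwards [hv] with x hx
    rw [hx]
  rw [e]
  refine (h.2.2 g hg).congr fun n => integral_congr_ae ?_
  filter_upwards [hu n] with x hx
  rw [hx]

/-- Uniform boundedness principle: the functionals given by `u n` converge, hence are bounded, at
each point of `L²`. -/
theorem WeakL2.exists_bound [CompleteSpace F] {u : ℕ → X → F} {v : X → F} (h : WeakL2 μ u v) :
    ∃ C : ℝ, ∀ n, ∫ x, ‖u n x‖ ^ 2 ∂μ ≤ C := by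
  set w : ℕ → (Lp F 2 μ) := fun n => (h.1 n).toLp (u n) with hw
  have hb : ∀ g : Lp F 2 μ, ∃ C, ∀ n, ‖innerSL ℝ (w n) g‖ ≤ C := fun g => by
    have ht := h.2.2 g (Lp.memLp g)
    obtain ⟨C, hC⟩ := ht.norm.bddAbove_range
    refine ⟨C, fun n => ?_⟩
    have := hC ⟨n, rfl⟩
    simp only [integral_inner_eq_inner_toLp (h.1 n) (Lp.memLp g), Lp.toLp_coeFn] at this
    simpa using this
  obtain ⟨C, hC⟩ := banach_steinhaus hb
  refine ⟨C ^ 2, fun n => ?_⟩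
  rw [integral_norm_sq_eq (h.1 n)]
  have := hC n
  rw [innerSL_apply_norm] at this
  exact pow_le_pow_left₀ (norm_nonneg _) this 2

/-- The limit itself is the test function; Young's inequality with weights one half lets half of its
square be absorbed. -/
theorem WeakL2.integral_norm_sq_le {u : ℕ → X → F} {v : X → F} (h : WeakL2 μ u v) {C : ℝ}
    (hC : ∀ n, ∫ x, ‖u n x‖ ^ 2 ∂μ ≤ C) : ∫ x, ‖v x‖ ^ 2 ∂μ ≤ C := by
  have ht := h.2.2 v h.2.1
  simp only [real_inner_self_eq_norm_sq] at ht
  have key : ∫ x, ‖v x‖ ^ 2 ∂μ ≤ (1 / 2) * C + (1 / 2) * ∫ x, ‖v x‖ ^ 2 ∂μ := by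
    refine le_of_tendsto ht (Eventually.of_forall fun n => ?_)
    have : ∫ x, inner ℝ (u n x) (v x) ∂μ
        ≤ ∫ x, ((1 / 2) * ‖u n x‖ ^ 2 + (1 / 2) * ‖v x‖ ^ 2) ∂μ := by
      refine integral_mono (integrable_inner (h.1 n) h.2.1)
        (((integrable_norm_sq (h.1 n)).const_mul _).add
          ((integrable_norm_sq h.2.1).const_mul _)) fun x => ?_
      have := real_inner_le_norm (u n x) (v x)
      simp only
      nlinarith [sq_nonneg (‖u n x‖ - ‖v x‖)]
    rw [integral_add ((integrable_norm_sq (h.1 n)).const_mul _)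
      ((integrable_norm_sq h.2.1).const_mul _), integral_const_mul, integral_const_mul] at this
    linarith [hC n]
  linarith

/-- Weak times strong: replacing `g n` by its limit costs a bounded factor times one that tends to
zero. -/
theorem WeakL2.tendsto_integral_inner [CompleteSpace F] {u g : ℕ → X → F} {v w : X → F}
    (h : WeakL2 μ u v) (hg : StrongL2 μ g w) :
    Tendsto (fun n => ∫ x, inner ℝ (u n x) (g n x) ∂μ) atTop
      (𝓝 (∫ x, inner ℝ (v x) (w x) ∂μ)) := by
  obtain ⟨C, hC⟩ := h.exists_bound
  have hg2 := (strongL2_iff.1 hg).2.2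
  have h1 := h.2.2 w hg.2.1
  have h2 : Tendsto (fun n => ∫ x, inner ℝ (u n x) (g n x - w x) ∂μ) atTop (𝓝 0) := by
    refine squeeze_zero_norm (a := fun n => √C * √(∫ x, ‖g n x - w x‖ ^ 2 ∂μ)) (fun n => ?_) ?_
    · refine (abs_integral_inner_le (h.1 n) ((hg.1 n).sub hg.2.1)).trans ?_
      exact mul_le_mul_of_nonneg_right (Real.sqrt_le_sqrt (hC n)) (Real.sqrt_nonneg _)
    · have := ((Real.continuous_sqrt.tendsto 0).comp hg2).const_mul √C
      simpa using this
  have := h1.add h2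
  rw [add_zero] at this
  refine this.congr fun n => ?_
  rw [← integral_add (integrable_inner (h.1 n) hg.2.1)
    (integrable_inner (h.1 n) (MemLp.sub_fun (hg.1 n) hg.2.1))]
  refine integral_congr_ae (ae_of_all _ fun x => ?_)
  simp [← inner_add_right]

theorem StrongL2.weakL2 {u : ℕ → X → F} {v : X → F} (h : StrongL2 μ u v) : WeakL2 μ u v := by
  refine ⟨h.1, h.2.1, fun g hg => ?_⟩
  have h2 := (strongL2_iff.1 h).2.2
  have h3 : Tendsto (fun n => ∫ x, inner ℝ (u n x - v x) (g x) ∂μ) atTop (𝓝 0) := by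
    refine squeeze_zero_norm
      (a := fun n => √(∫ x, ‖u n x - v x‖ ^ 2 ∂μ) * √(∫ x, ‖g x‖ ^ 2 ∂μ)) (fun n => ?_) ?_
    · exact abs_integral_inner_le ((h.1 n).sub h.2.1) hg
    · have := ((Real.continuous_sqrt.tendsto 0).comp h2).mul_const √(∫ x, ‖g x‖ ^ 2 ∂μ)
      simpa using this
  have := h3.add_const (∫ x, inner ℝ (v x) (g x) ∂μ)
  rw [zero_add] at this
  refine this.congr fun n => ?_
  rw [← integral_add (integrable_inner (MemLp.sub_fun (h.1 n) h.2.1) hg) (integrable_inner h.2.1 hg)]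
  refine integral_congr_ae (ae_of_all _ fun x => ?_)
  simp [← inner_add_left]

theorem WeakL2.ae_unique {u : ℕ → X → F} {v v' : X → F} (h : WeakL2 μ u v)
    (h' : WeakL2 μ u v') : v =ᵐ[μ] v' := by
  have hd := MemLp.sub_fun h.2.1 h'.2.1
  have e := tendsto_nhds_unique (h.2.2 _ hd) (h'.2.2 _ hd)
  have e2 : ‖hd.toLp‖ ^ 2 = 0 := by
    rw [← integral_norm_sq_eq hd]
    simp_rw [← real_inner_self_eq_norm_sq, inner_sub_left (v _) (v' _)]
    rw [integral_sub (integrable_inner h.2.1 hd) (integrable_inner h'.2.1 hd)]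
    simpa [sub_eq_zero] using e
  have e3 : hd.toLp = 0 := norm_eq_zero.1 (pow_eq_zero_iff (two_ne_zero)|>.1 e2)
  have := hd.coeFn_toLp
  rw [e3] at this
  filter_upwards [this, Lp.coeFn_zero F 2 μ] with x h1 h2
  rw [h2] at h1
  simpa [eq_comm, sub_eq_zero] using h1

/-- Sequential Banach-Alaoglu in the dual of the separable space `L²`; the Riesz representation
brings the limit functional back to a function. -/
theorem exists_weakL2_subseq [CompleteSpace F] [TopologicalSpace.SeparableSpace (Lp F 2 μ)]
    {u : ℕ → X → F} (hu : ∀ n, MemLp (u n) 2 μ) {C : ℝ}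
    (hC : ∀ n, ∫ x, ‖u n x‖ ^ 2 ∂μ ≤ C) :
    ∃ σ : ℕ → ℕ, StrictMono σ ∧ ∃ v, WeakL2 μ (fun n => u (σ n)) v := by
  set w : ℕ → StrongDual ℝ (Lp F 2 μ) := fun n => innerSL ℝ ((hu n).toLp (u n)) with hw
  have hb := WeakDual.isSeqCompact_closedBall ℝ (Lp F 2 μ) 0 √C
  obtain ⟨ψ, -, σ, hσ, hlim⟩ := hb (x := fun n => StrongDual.toWeakDual (w n)) (fun n => by
    simp only [Set.mem_preimage, mem_closedBall_zero_iff]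
    change ‖w n‖ ≤ _
    rw [hw, innerSL_apply_norm]
    refine Real.le_sqrt_of_sq_le ?_
    rw [← integral_norm_sq_eq (hu n)]
    exact hC n)
  obtain ⟨v, hv⟩ := (InnerProductSpace.toDual ℝ (Lp F 2 μ)).surjective (WeakDual.toStrongDual ψ)
  refine ⟨σ, hσ, v, fun n => hu _, Lp.memLp v, fun g hg => ?_⟩
  have h1 := ((WeakDual.eval_continuous (𝕜 := ℝ) (hg.toLp g)).tendsto ψ).comp hlim
  have e : ψ (hg.toLp g) = ∫ x, inner ℝ (v x) (g x) ∂μ := by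
    rw [integral_inner_eq_inner_toLp (Lp.memLp v) hg, Lp.toLp_coeFn]
    have := congrArg (fun f => f (hg.toLp g)) hv
    simpa using this.symm
  rw [← e]
  refine h1.congr fun n => ?_
  rw [integral_inner_eq_inner_toLp (hu _) hg]
  rfl

theorem exists_weakL2_subseq_family [CompleteSpace F]
    [TopologicalSpace.SeparableSpace (Lp F 2 μ)] {ι : Type*} (s : Finset ι)
    {u : ι → ℕ → X → F} (hu : ∀ i n, MemLp (u i n) 2 μ) {C : ℝ}
    (hC : ∀ i n, ∫ x, ‖u i n x‖ ^ 2 ∂μ ≤ C) :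
    ∃ σ : ℕ → ℕ, StrictMono σ ∧ ∀ i ∈ s, ∃ v, WeakL2 μ (fun n => u i (σ n)) v := by
  classical
  induction s using Finset.induction_on with
  | empty => exact ⟨id, strictMono_id, by simp⟩
  | insert a s ha ih =>
    obtain ⟨σ, hσ, h⟩ := ih
    obtain ⟨τ, hτ, v, hv⟩ := exists_weakL2_subseq (u := fun n => u a (σ n)) (fun n => hu _ _)
      (fun n => hC _ _)
    refine ⟨σ ∘ τ, hσ.comp hτ, fun i hi => ?_⟩
    rcases Finset.mem_insert.1 hi with rfl | hi
    · exact ⟨v, hv⟩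
    · obtain ⟨w, hw⟩ := h i hi
      exact ⟨w, hw.comp hτ.tendsto_atTop⟩

/-- Every subsequence has a weakly convergent further one, and all these have the same limit. This
serves for sequences of derivatives, whose limits are identified by integration by parts. -/
theorem weakL2_of_subseq [CompleteSpace F] [TopologicalSpace.SeparableSpace (Lp F 2 μ)]
    {u : ℕ → X → F} {v : X → F} (hu : ∀ n, MemLp (u n) 2 μ) (hv : MemLp v 2 μ) {C : ℝ}
    (hC : ∀ n, ∫ x, ‖u n x‖ ^ 2 ∂μ ≤ C)
    (h : ∀ σ : ℕ → ℕ, Tendsto σ atTop atTop → ∀ w, WeakL2 μ (fun n => u (σ n)) w → w =ᵐ[μ] v) :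
    WeakL2 μ u v := by
  refine ⟨hu, hv, fun g hg => tendsto_of_subseq_tendsto fun ns hns => ?_⟩
  obtain ⟨τ, hτ, w, hw⟩ := exists_weakL2_subseq (u := fun n => u (ns n)) (fun n => hu _)
    (fun n => hC _)
  refine ⟨τ, ?_⟩
  exact ((hw.congr (fun n => ae_eq_rfl)
    (h (fun n => ns (τ n)) (hns.comp hτ.tendsto_atTop) w hw)).2.2 g hg)

end LTwo

/-! ### Slices of the space-time cylinder at fixed times -/

section Slices

variable {F : Type*} [NormedAddCommGroup F] [InnerProductSpace ℝ F]

theorem restrict_cylinder (T : ℝ) (Ω : Set E3) :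
    (volume.restrict (cylinder T Ω) : Measure (ℝ × E3))
      = (volume.restrict (Set.Ioo 0 T)).prod (volume.restrict Ω) := by
  rw [Measure.prod_restrict]
  rfl

instance (T : ℝ) (Ω : Set E3) :
    TopologicalSpace.SeparableSpace (Lp E3 2 (volume.restrict (cylinder T Ω))) :=
  haveI : Fact ((2 : ℝ≥0∞) ≠ ⊤) := ⟨by simp⟩
  inferInstance

instance (Ω : Set E3) : TopologicalSpace.SeparableSpace (Lp E3 2 (volume.restrict Ω)) :=
  haveI : Fact ((2 : ℝ≥0∞) ≠ ⊤) := ⟨by simp⟩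
  inferInstance

theorem MemLp.ae_slice {T : ℝ} {Ω : Set E3} {u : ℝ × E3 → F}
    (hu : MemLp u 2 (volume.restrict (cylinder T Ω))) :
    ∀ᵐ t ∂(volume.restrict (Set.Ioo 0 T)), MemLp (fun x => u (t, x)) 2 (volume.restrict Ω) := by
  rw [restrict_cylinder] at hu
  have h1 := hu.1.prodMk_left
  have h2 := (integrable_norm_sq hu).prod_right_ae
  filter_upwards [h1, h2] with t h3 h4
  exact (memLp_two_iff_integrable_sq_norm h3).2 h4

/-- Strong convergence on the cylinder gives, for a subsequence, strong convergence at almost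
every time. -/
theorem StrongL2.exists_subseq_slices {T : ℝ} {Ω : Set E3} {u : ℕ → ℝ × E3 → F}
    {v : ℝ × E3 → F} (h : StrongL2 (volume.restrict (cylinder T Ω)) u v) :
    ∃ σ : ℕ → ℕ, StrictMono σ ∧ ∀ᵐ t ∂(volume.restrict (Set.Ioo 0 T)),
      StrongL2 (volume.restrict Ω) (fun n x => u (σ n) (t, x)) (fun x => v (t, x)) := by
  have hd : ∀ n, Integrable (fun p => ‖u n p - v p‖ ^ 2)
      ((volume.restrict (Set.Ioo 0 T)).prod (volume.restrict Ω)) := fun n => by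
    rw [← restrict_cylinder]
    exact integrable_norm_sq ((h.1 n).sub h.2.1)
  have h2 := (strongL2_iff.1 h).2.2
  rw [restrict_cylinder] at h2
  -- By Fubini the squared distances of the slices tend to zero in `L¹(0,T)`, hence almost
  -- everywhere for a subsequence.
  set N : ℕ → ℝ → ℝ := fun n t => ∫ x in Ω, ‖u n (t, x) - v (t, x)‖ ^ 2 with hN
  have hNi : ∀ n, Integrable (N n) (volume.restrict (Set.Ioo 0 T)) := fun n =>
    (hd n).integral_prod_left
  have h3 : Tendsto (fun n => ∫ t in Set.Ioo 0 T, N n t) atTop (𝓝 0) :=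
    h2.congr fun n => integral_prod _ (hd n)
  have hm : TendstoInMeasure (volume.restrict (Set.Ioo 0 T)) N atTop (fun _ => (0 : ℝ)) := by
    refine tendstoInMeasure_of_tendsto_eLpNorm (p := 1) one_ne_zero (fun n => (hNi n).1)
      aestronglyMeasurable_const ?_
    have h4 := (ENNReal.continuous_ofReal.tendsto 0).comp h3
    rw [ENNReal.ofReal_zero] at h4
    refine h4.congr fun n => ?_
    have e : (N n - fun _ => (0 : ℝ)) = N n := by ext t; simp
    rw [e, eLpNorm_one_eq_lintegral_enorm, ← ofReal_integral_norm_eq_lintegral_enorm (hNi n)]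
    simp only [Function.comp_apply]
    congr 1
    refine integral_congr_ae (ae_of_all _ fun t => ?_)
    exact (Real.norm_of_nonneg (integral_nonneg fun x => by positivity)).symm
  obtain ⟨σ, hσ, hlim⟩ := hm.exists_seq_tendsto_ae
  refine ⟨σ, hσ, ?_⟩
  filter_upwards [hlim, ae_all_iff.2 fun n => MemLp.ae_slice (h.1 n), MemLp.ae_slice h.2.1]
    with t h5 h6 h7
  exact strongL2_iff.2 ⟨fun n => h6 _, h7, h5⟩

end Slices

end LLG

/-! ### Mollification, translations and Rellich's theorem -/

namespace LLG

/-- Cauchy-Schwarz against the constant one. It is applied to the average over the mollifier and to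
the average along a segment. -/
theorem sq_lintegral_le {α : Type*} [MeasurableSpace α] {ν : Measure α} [IsProbabilityMeasure ν]
    {f : α → ℝ≥0∞} (hf : AEMeasurable f ν) : (∫⁻ a, f a ∂ν) ^ 2 ≤ ∫⁻ a, f a ^ 2 ∂ν := by
  have h := ENNReal.lintegral_mul_le_Lp_mul_Lq ν Real.HolderConjugate.two_two hf
    (aemeasurable_const (b := (1 : ℝ≥0∞)))
  simp only [Pi.mul_apply, mul_one, ENNReal.rpow_ofNat, one_pow, lintegral_const, measure_univ,
    ENNReal.one_rpow] at h
  calc (∫⁻ a, f a ∂ν) ^ 2 ≤ ((∫⁻ a, f a ^ 2 ∂ν) ^ (1 / 2 : ℝ)) ^ 2 := by gcongr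
    _ = _ := by
      rw [← ENNReal.rpow_ofNat, ← ENNReal.rpow_mul]
      norm_num

theorem enorm_sq_eq {F : Type*} [NormedAddCommGroup F] (x : F) :
    ‖x‖ₑ ^ 2 = ENNReal.ofReal (‖x‖ ^ 2) := by
  rw [ENNReal.ofReal_pow (norm_nonneg _), ofReal_norm]

theorem enorm_sub_sq_le {F : Type*} [NormedAddCommGroup F] (x y : F) :
    ‖x‖ₑ ^ 2 ≤ 2 * ‖x - y‖ₑ ^ 2 + 2 * ‖y‖ₑ ^ 2 := by
  have e : (2 : ℝ≥0∞) = ENNReal.ofReal 2 := by simp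
  rw [enorm_sq_eq, enorm_sq_eq, enorm_sq_eq, e, ← ENNReal.ofReal_mul (by norm_num),
    ← ENNReal.ofReal_mul (by norm_num), ← ENNReal.ofReal_add (by positivity) (by positivity)]
  refine ENNReal.ofReal_le_ofReal ?_
  have : ‖x‖ ≤ ‖x - y‖ + ‖y‖ := by simpa using norm_add_le (x - y) y
  nlinarith [sq_nonneg (‖x - y‖ - ‖y‖), norm_nonneg x]

section Rellich

variable {X : Type*} [NormedAddCommGroup X] [NormedSpace ℝ X] [FiniteDimensional ℝ X]
  [MeasureSpace X] [BorelSpace X] [(volume : Measure X).IsAddHaarMeasure]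
variable {F : Type*} [NormedAddCommGroup F] [InnerProductSpace ℝ F] [CompleteSpace F]

/-- The mollification of `u` with the kernel given by a normalized bump function. -/
noncomputable def mollify (φ : ContDiffBump (0 : X)) (u : X → F) : X → F :=
  convolution (φ.normed volume) u (ContinuousLinearMap.lsmul ℝ ℝ) volume

/-- The probability measure whose density is a normalized bump function. -/
noncomputable def bumpMeasure (φ : ContDiffBump (0 : X)) : Measure X :=
  volume.withDensity fun x => ENNReal.ofReal (φ.normed volume x)

theorem measurable_bump_density (φ : ContDiffBump (0 : X)) :
    Measurable fun x => ENNReal.ofReal (φ.normed volume x) :=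
  (φ.continuous_normed).measurable.ennreal_ofReal

instance (φ : ContDiffBump (0 : X)) : IsProbabilityMeasure (bumpMeasure φ) := by
  refine ⟨?_⟩
  rw [bumpMeasure, withDensity_apply _ MeasurableSet.univ, Measure.restrict_univ,
    ← ofReal_integral_eq_lintegral_ofReal φ.integrable_normed
      (ae_of_all _ fun x => φ.nonneg_normed x), φ.integral_normed, ENNReal.ofReal_one]

theorem mollify_eq (φ : ContDiffBump (0 : X)) (u : X → F) (p : X) :
    mollify φ u p = ∫ y, φ.normed volume y • u (p - y) := rfl

theorem enorm_mollify_le (φ : ContDiffBump (0 : X)) (u : X → F) (p : X) :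
    ‖mollify φ u p‖ₑ ≤ ∫⁻ y, ‖u (p - y)‖ₑ ∂(bumpMeasure φ) := by
  rw [mollify_eq]
  refine (enorm_integral_le_lintegral_enorm _).trans ?_
  rw [bumpMeasure, lintegral_withDensity_eq_lintegral_mul_non_measurable _
    (measurable_bump_density φ) (ae_of_all _ fun x => ENNReal.ofReal_lt_top)]
  refine lintegral_mono fun y => ?_
  rw [enorm_smul, Pi.mul_apply, Real.enorm_eq_ofReal (φ.nonneg_normed y)]

theorem enorm_mollify_sq_le (φ : ContDiffBump (0 : X)) {u : X → F} (hu : StronglyMeasurable u)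
    (p : X) : ‖mollify φ u p‖ₑ ^ 2 ≤ ∫⁻ y, ‖u (p - y)‖ₑ ^ 2 ∂(bumpMeasure φ) := by
  refine (pow_le_pow_left' (enorm_mollify_le φ u p) 2).trans (sq_lintegral_le ?_)
  exact ((hu.comp_measurable (measurable_const.sub measurable_id)).enorm).aemeasurable

theorem ae_mem_ball_bumpMeasure (φ : ContDiffBump (0 : X)) :
    ∀ᵐ y ∂(bumpMeasure φ), y ∈ Metric.ball (0 : X) φ.rOut := by
  rw [bumpMeasure, ae_withDensity_iff (measurable_bump_density φ)]
  refine ae_of_all _ fun y hy => ?_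
  by_contra h
  have : y ∉ Function.support (φ.normed volume) := by rwa [φ.support_normed_eq]
  rw [Function.notMem_support] at this
  simp [this] at hy

theorem mollify_eq_setIntegral (φ : ContDiffBump (0 : X)) {U : Set X} (hU : MeasurableSet U)
    (u : X → F) (p : X) :
    mollify φ (U.indicator u) p = ∫ y in U, φ.normed volume (p - y) • u y := by
  rw [mollify_eq, ← integral_sub_left_eq_self _ volume p, ← integral_indicator hU]
  refine integral_congr_ae (ae_of_all _ fun y => ?_)
  by_cases hy : y ∈ U <;> simp [hy]

theorem contDiff_bump_sub (φ : ContDiffBump (0 : X)) (p : X) :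
    ContDiff ℝ ∞ fun y => φ.normed volume (p - y) :=
  φ.contDiff_normed.comp (contDiff_const.sub contDiff_id)

theorem support_bump_sub (φ : ContDiffBump (0 : X)) (p : X) :
    tsupport (fun y => φ.normed volume (p - y)) ⊆ Metric.closedBall p φ.rOut := by
  refine closure_minimal (fun y hy => ?_) Metric.isClosed_closedBall
  have : p - y ∈ Function.support (φ.normed volume) := hy
  rw [φ.support_normed_eq, mem_ball_zero_iff] at this
  rw [Metric.mem_closedBall, dist_comm, dist_eq_norm]
  exact this.le

theorem hasCompactSupport_bump_sub (φ : ContDiffBump (0 : X)) (p : X) :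
    HasCompactSupport (fun y => φ.normed volume (p - y)) :=
  (isCompact_closedBall p φ.rOut).of_isClosed_subset (isClosed_tsupport _) (support_bump_sub φ p)

/-- Mollification commutes with weak derivatives. -/
theorem hasDerivAt_mollify (φ : ContDiffBump (0 : X)) {U : Set X} (hU : IsOpen U) {q : X}
    {u g : X → F} (hu : MemLp u 2 (volume.restrict U)) (hg : HasWeakDeriv U q u g) (p : X) (s : ℝ)
    (hp : Metric.closedBall (p + s • q) φ.rOut ⊆ U) :
    HasDerivAt (fun s : ℝ => mollify φ (U.indicator u) (p + s • q))
      (mollify φ (U.indicator g) (p + s • q)) s := by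
  have hli : LocallyIntegrable (U.indicator u) :=
    ((memLp_indicator_iff_restrict hU.measurableSet).2 hu).locallyIntegrable (by norm_num)
  have h1 := (φ.hasCompactSupport_normed (μ := volume)).hasFDerivAt_convolution_left (μ := volume)
    (ContinuousLinearMap.lsmul ℝ ℝ) (φ.contDiff_normed (n := 1)) hli (p + s • q)
  have h2 : HasDerivAt (fun s : ℝ => p + s • q) q s := by
    simpa using ((hasDerivAt_id s).smul_const q).const_add p
  have h3 := h1.comp_hasDerivAt s h2
  convert! h3 using 1
  set x := p + s • q
  rw [mollify_eq_setIntegral φ hU.measurableSet]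
  -- The reflected kernel is an admissible test function since its support lies in `U`. Its
  -- derivative has the opposite sign to that of the kernel, which cancels the sign in the
  -- integration by parts.
  have h4 := hg _ (contDiff_bump_sub φ x) (hasCompactSupport_bump_sub φ x)
    ((support_bump_sub φ x).trans hp)
  have h5 : ∀ y, fderiv ℝ (fun y => φ.normed volume (x - y)) y q
      = - fderiv ℝ (φ.normed volume) (x - y) q := fun y => by
    have e1 : HasFDerivAt (fun y => x - y) (-(ContinuousLinearMap.id ℝ X)) y := by
      simpa using (hasFDerivAt_id y).const_sub x
    have e2 := ((φ.contDiff_normed (n := 1) (μ := volume)).differentiable (by simp)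
      (x - y)).hasFDerivAt.comp y e1
    rw [HasFDerivAt.fderiv (f := fun y => φ.normed volume (x - y)) e2]
    simp
  simp only [h5, neg_smul] at h4
  rw [integral_neg, neg_inj] at h4
  rw [← h4, convolution]
  rw [ContinuousLinearMap.integral_apply]
  · rw [← integral_sub_left_eq_self _ volume x, ← integral_indicator hU.measurableSet]
    refine integral_congr_ae (ae_of_all _ fun y => ?_)
    by_cases hy : y ∈ U <;> simp [hy, ContinuousLinearMap.precompL_apply]
  · have := (φ.hasCompactSupport_normed (μ := volume)).fderiv ℝ
    exact this.convolutionExists_left _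
      ((φ.contDiff_normed (n := 1)).continuous_fderiv (by simp)) hli x

theorem mollify_congr (φ : ContDiffBump (0 : X)) {u v : X → F} (h : u =ᵐ[volume] v) :
    mollify φ u = mollify φ v := by
  rw [mollify, mollify, convolution_congr _ ae_eq_rfl h]

theorem continuous_mollify (φ : ContDiffBump (0 : X)) {u : X → F} (hu : LocallyIntegrable u) :
    Continuous (mollify φ u) :=
  (φ.hasCompactSupport_normed).continuous_convolution_left _ φ.continuous_normed hu

/-- The mollified function is differentiable along the segment from `p` to `p + q`, with derivative
the mollified `g`. Jensen's inequality is applied twice; then Tonelli and translation invariance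
remove both averages. -/
theorem lintegral_mollify_translate_sub_le (φ : ContDiffBump (0 : X)) {U K : Set X}
    (hU : IsOpen U) (hK : MeasurableSet K) {q : X} {u g : X → F}
    (hu : MemLp u 2 (volume.restrict U)) (hg' : MemLp g 2 (volume.restrict U))
    (hg : HasWeakDeriv U q u g)
    (hKU : ∀ p ∈ K, Metric.closedBall p (‖q‖ + φ.rOut) ⊆ U) :
    ∫⁻ p in K, ‖mollify φ (U.indicator u) (p + q) - mollify φ (U.indicator u) p‖ₑ ^ 2
      ≤ ∫⁻ p in U, ‖g p‖ₑ ^ 2 := by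
  have hgL : MemLp (U.indicator g) 2 := (memLp_indicator_iff_restrict hU.measurableSet).2 hg'
  obtain ⟨G, hG, hGe⟩ := hgL.1
  have hmg : mollify φ (U.indicator g) = mollify φ G := mollify_congr φ hGe
  have hcont : Continuous (mollify φ G) := by
    rw [← hmg]
    exact continuous_mollify φ (hgL.locallyIntegrable (by norm_num))
  set ν : Measure ℝ := volume.restrict (Set.Ioc 0 1) with hν
  have : IsProbabilityMeasure ν := ⟨by simp [hν]⟩
  have hGm : Measurable fun z : (X × ℝ) × X => ‖G (z.1.1 + z.1.2 • q - z.2)‖ₑ ^ 2 := by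
    have : Measurable fun z : (X × ℝ) × X => z.1.1 + z.1.2 • q - z.2 := by fun_prop
    exact ((hG.comp_measurable this).enorm).pow_const 2
  have pt : ∀ p ∈ K, ‖mollify φ (U.indicator u) (p + q) - mollify φ (U.indicator u) p‖ₑ ^ 2
      ≤ ∫⁻ s, ∫⁻ y, ‖G (p + s • q - y)‖ₑ ^ 2 ∂(bumpMeasure φ) ∂ν := fun p hp => by
    have hd : ∀ s ∈ Set.uIcc (0 : ℝ) 1, HasDerivAt
        (fun s : ℝ => mollify φ (U.indicator u) (p + s • q)) (mollify φ G (p + s • q)) s := by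
      intro s hs
      rw [Set.uIcc_of_le zero_le_one] at hs
      rw [← hmg]
      refine hasDerivAt_mollify φ hU hu hg p s (fun y hy => hKU p hp ?_)
      rw [Metric.mem_closedBall] at hy ⊢
      refine (dist_triangle y (p + s • q) p).trans ?_
      have : dist (p + s • q) p ≤ ‖q‖ := by
        rw [dist_eq_norm, add_sub_cancel_left, norm_smul, Real.norm_of_nonneg hs.1]
        exact mul_le_of_le_one_left (norm_nonneg _) hs.2
      linarith
    have hc : Continuous fun s : ℝ => mollify φ G (p + s • q) := by fun_prop
    have ftc := intervalIntegral.integral_eq_sub_of_hasDerivAt hd (hc.intervalIntegrable 0 1)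
    simp only [one_smul, zero_smul, add_zero] at ftc
    rw [← ftc, intervalIntegral.integral_of_le zero_le_one]
    refine (pow_le_pow_left' (enorm_integral_le_lintegral_enorm _) 2).trans ?_
    refine (sq_lintegral_le hc.enorm.measurable.aemeasurable).trans ?_
    exact lintegral_mono fun s => enorm_mollify_sq_le φ hG _
  calc ∫⁻ p in K, ‖mollify φ (U.indicator u) (p + q) - mollify φ (U.indicator u) p‖ₑ ^ 2
      ≤ ∫⁻ p in K, ∫⁻ s, ∫⁻ y, ‖G (p + s • q - y)‖ₑ ^ 2 ∂(bumpMeasure φ) ∂ν :=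
        setLIntegral_mono' hK pt
    _ ≤ ∫⁻ p, ∫⁻ s, ∫⁻ y, ‖G (p + s • q - y)‖ₑ ^ 2 ∂(bumpMeasure φ) ∂ν :=
        setLIntegral_le_lintegral _ _
    _ = ∫⁻ s, ∫⁻ p, ∫⁻ y, ‖G (p + s • q - y)‖ₑ ^ 2 ∂(bumpMeasure φ) ∂volume ∂ν :=
        lintegral_lintegral_swap (hGm.lintegral_prod_right' (ν := bumpMeasure φ)).aemeasurable
    _ = ∫⁻ s, ∫⁻ y, ∫⁻ p, ‖G (p + s • q - y)‖ₑ ^ 2 ∂volume ∂(bumpMeasure φ) ∂ν := by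
        refine lintegral_congr fun s => lintegral_lintegral_swap ?_
        have : Measurable fun z : X × X => ((z.1, s), z.2) := by fun_prop
        exact (hGm.comp this).aemeasurable
    _ = ∫⁻ s, ∫⁻ y, ∫⁻ p, ‖G p‖ₑ ^ 2 ∂volume ∂(bumpMeasure φ) ∂ν := by
        refine lintegral_congr fun s => lintegral_congr fun y => ?_
        simp_rw [add_sub_assoc]
        exact lintegral_add_right_eq_self (fun p => ‖G p‖ₑ ^ 2) _
    _ = ∫⁻ p, ‖G p‖ₑ ^ 2 := by simp
    _ = ∫⁻ p, ‖U.indicator g p‖ₑ ^ 2 := by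
        refine lintegral_congr_ae ?_
        filter_upwards [hGe] with p hp
        rw [hp]
    _ = ∫⁻ p in U, ‖g p‖ₑ ^ 2 := by
        rw [← lintegral_indicator hU.measurableSet]
        refine lintegral_congr fun p => ?_
        by_cases hp : p ∈ U <;> simp [hp]

theorem exists_bump_sequence {r : ℝ} (hr : 0 < r) : ∃ φ : ℕ → ContDiffBump (0 : X),
    (∀ n, (φ n).rOut ≤ r) ∧ Tendsto (fun n => (φ n).rOut) atTop (𝓝 0) ∧
    ∀ n, (φ n).rOut ≤ 2 * (φ n).rIn := by
  refine ⟨fun n => ⟨r / 2 * (1 / (n + 1)), r * (1 / (n + 1)), by positivity, ?_⟩, fun n => ?_, ?_,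
    fun n => ?_⟩
  · have : (0 : ℝ) < 1 / (n + 1) := by positivity
    nlinarith
  · have : (1 : ℝ) / (n + 1) ≤ 1 := by
      rw [div_le_one (by positivity)]
      linarith [(Nat.cast_nonneg n : (0 : ℝ) ≤ n)]
    change r * (1 / (n + 1)) ≤ r
    nlinarith
  · simpa using (tendsto_one_div_add_atTop_nhds_zero_nat (𝕜 := ℝ)).const_mul r
  · change r * (1 / (n + 1)) ≤ 2 * (r / 2 * (1 / (n + 1)))
    linarith

/-- Translations of a function with weak derivative `g` in the direction of translation. -/
theorem lintegral_translate_sub_le {U K : Set X} (hU : IsOpen U) (hK : MeasurableSet K) {q : X}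
    {u g : X → F} (hu : MemLp u 2 (volume.restrict U)) (hg' : MemLp g 2 (volume.restrict U))
    (hg : HasWeakDeriv U q u g) {r : ℝ} (hr : ‖q‖ < r)
    (hKU : ∀ p ∈ K, Metric.closedBall p r ⊆ U) :
    ∫⁻ p in K, ‖U.indicator u (p + q) - U.indicator u p‖ₑ ^ 2 ≤ ∫⁻ p in U, ‖g p‖ₑ ^ 2 := by
  obtain ⟨φ, h1, h2, h3⟩ := exists_bump_sequence (X := X) (sub_pos.2 hr)
  have huL : MemLp (U.indicator u) 2 := (memLp_indicator_iff_restrict hU.measurableSet).2 hu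
  have hli : LocallyIntegrable (U.indicator u) := huL.locallyIntegrable (by norm_num)
  have hlim := ContDiffBump.ae_convolution_tendsto_right_of_locallyIntegrable (μ := volume) h2
    (Eventually.of_forall h3) hli
  have hlim' : ∀ᵐ p, Tendsto (fun n => mollify (φ n) (U.indicator u) (p + q)) atTop
      (𝓝 (U.indicator u (p + q))) :=
    (quasiMeasurePreserving_add_right volume q).ae hlim
  -- Mollifications converge almost everywhere, so Fatou's lemma carries the estimate over from
  -- smooth functions.
  have step : ∀ᵐ p ∂(volume.restrict K), ‖U.indicator u (p + q) - U.indicator u p‖ₑ ^ 2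
      = liminf (fun n => ‖mollify (φ n) (U.indicator u) (p + q)
        - mollify (φ n) (U.indicator u) p‖ₑ ^ 2) atTop := by
    filter_upwards [ae_restrict_of_ae hlim, ae_restrict_of_ae hlim'] with p hp hp'
    have := ((ENNReal.continuous_pow 2).tendsto _).comp ((hp'.sub hp).enorm)
    exact this.liminf_eq.symm
  rw [lintegral_congr_ae step]
  refine (lintegral_liminf_le fun n => ?_).trans ?_
  · have := continuous_mollify (φ n) hli
    have h : Continuous fun p => mollify (φ n) (U.indicator u) (p + q)
        - mollify (φ n) (U.indicator u) p := by fun_prop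
    exact (h.enorm.measurable).pow_const 2
  · refine liminf_le_of_le (by isBoundedDefault) fun b hb => ?_
    obtain ⟨n, hn⟩ := hb.exists
    refine hn.trans (lintegral_mollify_translate_sub_le (φ n) hU hK hu hg' hg fun p hp => ?_)
    refine (Metric.closedBall_subset_closedBall ?_).trans (hKU p hp)
    linarith [h1 n]

/-- The error of mollification is an average of the differences `u p - u (p - y)` over `|y| < rOut`,
each of which is controlled in the mean by `|y|` times the derivative. -/
theorem lintegral_sub_mollify_le (φ : ContDiffBump (0 : X)) {U K : Set X} (hU : IsOpen U)
    (hK : MeasurableSet K) {u : X → F} (hu : MemLp u 2 (volume.restrict U)) {C : ℝ≥0∞}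
    (hC : ∀ q : X, ‖q‖ ≤ 1 → ∃ g, MemLp g 2 (volume.restrict U) ∧ HasWeakDeriv U q u g ∧
      ∫⁻ p in U, ‖g p‖ₑ ^ 2 ≤ C)
    (hKU : ∀ p ∈ K, Metric.closedBall p φ.rOut ⊆ U) :
    ∫⁻ p in K, ‖U.indicator u p - mollify φ (U.indicator u) p‖ₑ ^ 2
      ≤ ENNReal.ofReal (φ.rOut ^ 2) * C := by
  have huL : MemLp (U.indicator u) 2 := (memLp_indicator_iff_restrict hU.measurableSet).2 hu
  obtain ⟨G, hG, hGe⟩ := huL.1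
  have hmg : mollify φ (U.indicator u) = mollify φ G := mollify_congr φ hGe
  have hli : LocallyIntegrable G := (huL.ae_eq hGe).locallyIntegrable (by norm_num)
  have hGm : Measurable fun z : X × X => ‖G z.1 - G (z.1 - z.2)‖ₑ ^ 2 := by
    have h1 : Measurable fun z : X × X => z.1 - z.2 := by fun_prop
    exact (((hG.comp_measurable measurable_fst).sub (hG.comp_measurable h1)).enorm).pow_const 2
  have pt : ∀ p, ‖G p - mollify φ G p‖ₑ ^ 2 ≤ ∫⁻ y, ‖G p - G (p - y)‖ₑ ^ 2 ∂(bumpMeasure φ) := by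
    intro p
    have e : G p - mollify φ G p
        = convolution (φ.normed volume) (fun z => G p - G z) (ContinuousLinearMap.lsmul ℝ ℝ)
          volume p := by
      rw [mollify, convolution, convolution]
      simp only [ContinuousLinearMap.lsmul_apply, smul_sub]
      rw [integral_sub, integral_smul_const, φ.integral_normed, one_smul]
      · exact φ.integrable_normed.smul_const _
      · exact (φ.hasCompactSupport_normed (μ := volume)).convolutionExists_left
          (ContinuousLinearMap.lsmul ℝ ℝ) φ.continuous_normed hli p
    rw [e]
    exact enorm_mollify_sq_le φ (u := fun z => G p - G z) (stronglyMeasurable_const.sub hG) p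
  have tr : ∀ y ∈ Metric.ball (0 : X) φ.rOut,
      ∫⁻ p in K, ‖G p - G (p - y)‖ₑ ^ 2 ≤ ENNReal.ofReal (φ.rOut ^ 2) * C := fun y hy => by
    rw [mem_ball_zero_iff] at hy
    have e1 : ∫⁻ p in K, ‖G p - G (p - y)‖ₑ ^ 2
        = ∫⁻ p in K, ‖U.indicator u (p + -y) - U.indicator u p‖ₑ ^ 2 := by
      refine lintegral_congr_ae ?_
      have h1 : ∀ᵐ p, U.indicator u (p + -y) = G (p + -y) :=
        (quasiMeasurePreserving_add_right volume (-y)).ae hGe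
      filter_upwards [ae_restrict_of_ae hGe, ae_restrict_of_ae h1] with p h2 h3
      rw [h2, h3, ← enorm_neg, neg_sub, sub_eq_add_neg p y]
    rw [e1]
    -- The uniform bound is for directions of norm at most one, so the unit direction is used and
    -- rescaled by `‖y‖`. The convention that the inverse of zero is zero covers `y = 0`.
    obtain ⟨g, hg, hgd, hgC⟩ := hC (-(‖y‖⁻¹ • y)) (by
      rw [norm_neg, norm_smul, norm_inv, norm_norm]
      exact inv_mul_le_one)
    have hgd' : HasWeakDeriv U (-y) u (fun x => ‖y‖ • g x) := by
      have := hgd.smul_dir ‖y‖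
      rwa [smul_neg, ← mul_smul, show (‖y‖ * ‖y‖⁻¹) • y = y from ?_] at this
      by_cases h0 : y = 0
      · simp [h0]
      · rw [mul_inv_cancel₀ (norm_ne_zero_iff.2 h0), one_smul]
    refine (lintegral_translate_sub_le hU hK hu (hg.const_smul ‖y‖) hgd'
      (r := φ.rOut) (by rwa [norm_neg]) hKU).trans ?_
    change ∫⁻ p in U, ‖‖y‖ • g p‖ₑ ^ 2 ≤ _
    simp only [enorm_smul, mul_pow]
    rw [lintegral_const_mul' _ _ (by simp)]
    refine mul_le_mul' ?_ hgC
    rw [enorm_sq_eq, norm_norm]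
    exact ENNReal.ofReal_le_ofReal (pow_le_pow_left₀ (norm_nonneg _) hy.le 2)
  calc ∫⁻ p in K, ‖U.indicator u p - mollify φ (U.indicator u) p‖ₑ ^ 2
      = ∫⁻ p in K, ‖G p - mollify φ G p‖ₑ ^ 2 := by
        refine lintegral_congr_ae ?_
        filter_upwards [ae_restrict_of_ae hGe] with p hp
        rw [hp, hmg]
    _ ≤ ∫⁻ p in K, ∫⁻ y, ‖G p - G (p - y)‖ₑ ^ 2 ∂(bumpMeasure φ) := lintegral_mono pt
    _ = ∫⁻ y, (∫⁻ p in K, ‖G p - G (p - y)‖ₑ ^ 2) ∂(bumpMeasure φ) :=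
        lintegral_lintegral_swap hGm.aemeasurable
    _ ≤ ∫⁻ _, ENNReal.ofReal (φ.rOut ^ 2) * C ∂(bumpMeasure φ) := by
        refine lintegral_mono_ae ?_
        filter_upwards [ae_mem_ball_bumpMeasure φ] with y hy using tr y hy
    _ = _ := by simp

theorem norm_mollify_le (φ : ContDiffBump (0 : X)) {u : X → F} {M : ℝ}
    (hM : ∀ᵐ x, ‖u x‖ ≤ M) (p : X) : ‖mollify φ u p‖ ≤ M := by
  rw [mollify_eq]
  have hM' : ∀ᵐ y, ‖u (p - y)‖ ≤ M := (quasiMeasurePreserving_sub_left volume p).ae hM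
  refine (norm_integral_le_of_norm_le (φ.integrable_normed.mul_const M) ?_).trans ?_
  · filter_upwards [hM'] with y hy
    rw [norm_smul, Real.norm_of_nonneg (φ.nonneg_normed y)]
    exact mul_le_mul_of_nonneg_left hy (φ.nonneg_normed y)
  · rw [integral_mul_const, φ.integral_normed, one_mul]

theorem tendsto_zero_of_inner {F : Type*} [NormedAddCommGroup F] [InnerProductSpace ℝ F]
    [FiniteDimensional ℝ F] {z : ℕ → F} (h : ∀ c, Tendsto (fun n => inner ℝ (z n) c) atTop (𝓝 0)) :
    Tendsto z atTop (𝓝 0) := by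
  set b := stdOrthonormalBasis ℝ F
  have : Tendsto (fun n => ∑ i, inner ℝ (z n) (b i) • b i) atTop
      (𝓝 (∑ i, (0 : ℝ) • b i)) := tendsto_finsetSum _ fun i _ => (h (b i)).smul_const (b i)
  simp only [zero_smul, Finset.sum_const_zero] at this
  refine this.congr fun n => ?_
  conv_rhs => rw [← b.sum_repr' (z n)]
  simp only [real_inner_comm]

/-- Rellich's theorem for bounded sequences: no regularity of the boundary is needed. -/
theorem StrongL2.of_weakL2_of_bounded_deriv [FiniteDimensional ℝ F] {U : Set X} (hU : IsOpen U)
    (hvol : volume U ≠ ⊤) {w : ℕ → X → F} (hw : WeakL2 (volume.restrict U) w 0) {M : ℝ}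
    (hM : ∀ n, ∀ᵐ x ∂(volume.restrict U), ‖w n x‖ ≤ M) {C : ℝ≥0∞} (hCt : C ≠ ⊤)
    (hC : ∀ n, ∀ q : X, ‖q‖ ≤ 1 → ∃ g, MemLp g 2 (volume.restrict U) ∧ HasWeakDeriv U q (w n) g ∧
      ∫⁻ p in U, ‖g p‖ₑ ^ 2 ≤ C) : StrongL2 (volume.restrict U) w 0 := by
  have hfin : IsFiniteMeasure (volume.restrict U : Measure X) := ⟨by simpa using hvol.lt_top⟩
  rcases le_or_gt 0 M with hM0 | hM0
  swap
  · refine ⟨hw.1, hw.2.1, tendsto_const_nhds.congr fun n => ?_⟩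
    have : ∀ᵐ x ∂(volume.restrict U : Measure X), w n x - (0 : X → F) x = 0 := by
      filter_upwards [hM n] with x hx
      linarith [norm_nonneg (w n x)]
    rw [eLpNorm_congr_ae (g := fun _ => (0 : F)) this]
    simp
  have hwL : ∀ n, MemLp (U.indicator (w n)) 2 := fun n =>
    (memLp_indicator_iff_restrict hU.measurableSet).2 (hw.1 n)
  have hMw : ∀ n, ∀ᵐ x, ‖U.indicator (w n) x‖ ≤ M := fun n => by
    filter_upwards [(ae_restrict_iff' hU.measurableSet).1 (hM n)] with x hx
    by_cases hxU : x ∈ U <;> simp [hxU, hx, hM0]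
  suffices H : Tendsto (fun n => ∫⁻ p in U, ‖w n p‖ₑ ^ 2) atTop (𝓝 0) by
    refine strongL2_iff.2 ⟨hw.1, hw.2.1, ?_⟩
    have h1 := (ENNReal.tendsto_toReal ENNReal.zero_ne_top).comp H
    rw [ENNReal.toReal_zero] at h1
    refine h1.congr fun n => ?_
    simp only [Function.comp_apply, enorm_sq_eq, Pi.zero_apply, sub_zero]
    exact (integral_eq_lintegral_of_nonneg_ae (ae_of_all _ fun x => sq_nonneg _)
      ((hw.1 n).1.norm.pow 2)).symm
  rw [ENNReal.tendsto_nhds_zero]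
  intro ε hε
  by_cases hεt : ε = ⊤
  · simp [hεt]
  -- choice of the compact set and of the mollifier
  have hM2 : ENNReal.ofReal (M ^ 2) ≠ ⊤ := ENNReal.ofReal_ne_top
  -- A boundary layer of volume less than `η` contributes at most `η M²` because the functions are
  -- bounded by `M`; this takes the place of regularity of the boundary. The added one in the
  -- witness allows `M = 0`.
  obtain ⟨η, hη, hηM⟩ : ∃ η : ℝ≥0∞, η ≠ 0 ∧ η * ENNReal.ofReal (M ^ 2) ≤ ε / 2 := by
    refine ⟨ε / 2 / (ENNReal.ofReal (M ^ 2) + 1), ?_, ?_⟩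
    · exact (ENNReal.div_pos (ENNReal.half_pos hε.ne').ne' (by simp)).ne'
    · refine (mul_le_mul_right (le_self_add (b := 1)) _).trans ?_
      rw [ENNReal.div_mul_cancel (by simp) (by simp)]
  obtain ⟨K, hKU, hK, hKη⟩ := hU.measurableSet.exists_isCompact_sdiff_lt (μ := volume) hvol hη
  obtain ⟨r, hr, hrU⟩ := hK.exists_cthickening_subset_open hU hKU
  obtain ⟨φ, h1, h2, -⟩ := exists_bump_sequence (X := X) hr
  -- The factor 2 comes from `‖x‖² ≤ 2 ‖x - y‖² + 2 ‖y‖²`. The budget is a quarter of `ε` for the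
  -- mollification error, a quarter for the mollified function and a half for the boundary layer.
  have hsmall : ∃ k, 2 * (ENNReal.ofReal ((φ k).rOut ^ 2) * C) < ε / 4 := by
    have h3 : Tendsto (fun k => 2 * (ENNReal.ofReal ((φ k).rOut ^ 2) * C)) atTop
        (𝓝 (2 * (ENNReal.ofReal (0 ^ 2) * C))) := by
      refine ENNReal.Tendsto.const_mul ?_ (Or.inr (by simp))
      exact ENNReal.Tendsto.mul_const (ENNReal.tendsto_ofReal (h2.pow 2)) (Or.inr hCt)
    have h4 : 2 * (ENNReal.ofReal (0 ^ 2) * C) < ε / 4 := by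
      simp only [ne_eq, OfNat.ofNat_ne_zero, not_false_eq_true, zero_pow, ENNReal.ofReal_zero,
        zero_mul, mul_zero]
      exact ENNReal.div_pos hε.ne' (by simp)
    exact (h3.eventually_lt_const h4).exists
  obtain ⟨k, hk⟩ := hsmall
  have hKb : ∀ p ∈ K, Metric.closedBall p (φ k).rOut ⊆ U := fun p hp =>
    (Metric.closedBall_subset_closedBall (h1 k)).trans
      ((Metric.closedBall_subset_cthickening hp r).trans hrU)
  have hKfin : IsFiniteMeasure (volume.restrict K : Measure X) :=
    ⟨by simpa using hK.measure_lt_top⟩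
  -- the mollified functions converge
  have hpt : ∀ p, Tendsto (fun n => mollify (φ k) (U.indicator (w n)) p) atTop (𝓝 0) := by
    intro p
    refine tendsto_zero_of_inner fun c => ?_
    have m : MemLp (fun y => (φ k).normed volume (p - y) • c) 2 (volume.restrict U) := by
      have := memLp_two_of_test (contDiff_bump_sub (φ k) p).continuous
        (hasCompactSupport_bump_sub (φ k) p) U
      exact (ContinuousLinearMap.toSpanSingleton ℝ c).comp_memLp' this
    have := hw.2.2 _ m
    simp only [Pi.zero_apply, inner_zero_left, integral_zero] at this
    refine this.congr fun n => ?_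
    rw [mollify_eq_setIntegral _ hU.measurableSet, real_inner_comm, ← integral_inner
      (integrable_test_smul (contDiff_bump_sub (φ k) p).continuous
        (hasCompactSupport_bump_sub (φ k) p) (hw.1 n))]
    refine integral_congr_ae (ae_of_all _ fun x => ?_)
    simp [inner_smul_right, real_inner_comm]
  have hmol : StrongL2 (volume.restrict K) (fun n => mollify (φ k) (U.indicator (w n))) 0 :=
    StrongL2.of_bounded_ae (C := M)
      (fun n => (continuous_mollify _ ((hwL n).locallyIntegrable
        (by norm_num))).aestronglyMeasurable)
      (fun n => ae_of_all _ fun p => norm_mollify_le _ (hMw n) p) (ae_of_all _ hpt)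
  have hmol' : Tendsto (fun n => 2 * ∫⁻ p in K, ‖mollify (φ k) (U.indicator (w n)) p‖ₑ ^ 2)
      atTop (𝓝 0) := by
    have h3 := ENNReal.tendsto_ofReal (strongL2_iff.1 hmol).2.2
    have h4 : Tendsto (fun n => ∫⁻ p in K, ‖mollify (φ k) (U.indicator (w n)) p‖ₑ ^ 2)
        atTop (𝓝 0) := by
      rw [ENNReal.ofReal_zero] at h3
      refine h3.congr fun n => ?_
      simp only [enorm_sq_eq, Pi.zero_apply, sub_zero]
      rw [ofReal_integral_eq_lintegral_ofReal (integrable_norm_sq (hmol.1 n))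
        (ae_of_all _ fun x => by positivity)]
    simpa using ENNReal.Tendsto.const_mul h4 (Or.inr (by simp : (2 : ℝ≥0∞) ≠ ⊤))
  have hε4 : 0 < ε / 4 := ENNReal.div_pos hε.ne' (by simp)
  filter_upwards [hmol'.eventually_lt_const hε4] with n hn
  have split : ∫⁻ p in U, ‖w n p‖ₑ ^ 2
      = (∫⁻ p in K, ‖w n p‖ₑ ^ 2) + ∫⁻ p in U \ K, ‖w n p‖ₑ ^ 2 := by
    conv_lhs => rw [← Set.union_sdiff_cancel hKU]
    exact lintegral_union (hU.measurableSet.diff hK.measurableSet) Set.disjoint_sdiff_right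
  have p1 : ∫⁻ p in U \ K, ‖w n p‖ₑ ^ 2 ≤ ε / 2 := by
    calc ∫⁻ p in U \ K, ‖w n p‖ₑ ^ 2 ≤ ∫⁻ p in U \ K, ENNReal.ofReal (M ^ 2) := by
          refine lintegral_mono_ae ?_
          filter_upwards [ae_restrict_of_ae_restrict_of_subset Set.sdiff_subset (hM n)] with p hp
          rw [enorm_sq_eq]
          exact ENNReal.ofReal_le_ofReal (pow_le_pow_left₀ (norm_nonneg _) hp 2)
      _ = ENNReal.ofReal (M ^ 2) * volume (U \ K) := by simp
      _ ≤ η * ENNReal.ofReal (M ^ 2) := by rw [mul_comm]; gcongr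
      _ ≤ ε / 2 := hηM
  have p2 : ∫⁻ p in K, ‖w n p‖ₑ ^ 2 ≤ ε / 4 + ε / 4 := by
    have e : ∫⁻ p in K, ‖w n p‖ₑ ^ 2 = ∫⁻ p in K, ‖U.indicator (w n) p‖ₑ ^ 2 :=
      setLIntegral_congr_fun hK.measurableSet fun p hp => by
        simp only [Set.indicator_of_mem (hKU hp)]
    have hmeas : AEMeasurable (fun p => 2 * ‖U.indicator (w n) p
        - mollify (φ k) (U.indicator (w n)) p‖ₑ ^ 2) (volume.restrict K) := by
      have a1 : AEStronglyMeasurable (U.indicator (w n)) (volume.restrict K) := (hwL n).1.restrict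
      exact ((a1.sub (hmol.1 n).1).enorm.pow_const 2).const_mul 2
    calc ∫⁻ p in K, ‖w n p‖ₑ ^ 2
        ≤ ∫⁻ p in K, (2 * ‖U.indicator (w n) p - mollify (φ k) (U.indicator (w n)) p‖ₑ ^ 2
          + 2 * ‖mollify (φ k) (U.indicator (w n)) p‖ₑ ^ 2) := by
          rw [e]
          exact lintegral_mono fun p => enorm_sub_sq_le _ _
      _ = 2 * (∫⁻ p in K, ‖U.indicator (w n) p - mollify (φ k) (U.indicator (w n)) p‖ₑ ^ 2)
          + 2 * ∫⁻ p in K, ‖mollify (φ k) (U.indicator (w n)) p‖ₑ ^ 2 := by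
          rw [lintegral_add_left' hmeas, lintegral_const_mul' _ _ (by simp),
            lintegral_const_mul' _ _ (by simp)]
      _ ≤ ε / 4 + ε / 4 := by
          refine add_le_add (le_trans ?_ hk.le) hn.le
          exact mul_le_mul_right (lintegral_sub_mollify_le (φ k) hU hK.measurableSet (hw.1 n) (hC n)
            hKb) 2
  rw [split]
  calc _ ≤ (ε / 4 + ε / 4) + ε / 2 := add_le_add p2 p1
    _ = ε := by
      have : ε / 4 + ε / 4 = ε / 2 := by
        rw [← two_mul, div_eq_mul_inv, div_eq_mul_inv, mul_comm 2, mul_assoc]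
        congr 1
        rw [show (4 : ℝ≥0∞) = 2 * 2 by norm_num, ENNReal.mul_inv (by simp) (by simp), mul_assoc,
          ENNReal.inv_mul_cancel (by simp) (by simp), mul_one]
      rw [this, ENNReal.add_halves]

end Rellich

end LLG

/-! ### Triangulations and nodal interpolation -/

namespace LLG

/-- The domain lies on one side of its boundary: a small step down from a boundary point, in the
local coordinates, leaves the closure. Hence there are no slits, and the tetrahedra, which fill the
closure, fill the domain itself up to a null set. -/
theorem IsLipschitzDomain.interior_closure_subset {Ω : Set E3} (hΩ : IsLipschitzDomain Ω) :
    interior (closure Ω) ⊆ Ω := by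
  intro x hx
  by_contra hxΩ
  have hfr : x ∈ frontier Ω := by
    rw [frontier, hΩ.isOpen.interior_eq]
    exact ⟨interior_subset hx, hxΩ⟩
  obtain ⟨R, L, g, hg, U, hU, hUΩ⟩ := hΩ.locally_epigraph x hfr
  have hgc : Continuous g := hg.continuous
  set e : E3 := R.symm (basisVec 2) with he
  have hRe : ∀ t : ℝ, R (x - t • e) = R x - t • basisVec 2 := fun t => by simp [he]
  have htend : Tendsto (fun t : ℝ => x - t • e) (𝓝[>] 0) (𝓝 x) := by
    have : Continuous fun t : ℝ => x - t • e := by fun_prop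
    have h := (this.tendsto 0).mono_left (nhdsWithin_le_nhds (s := Set.Ioi 0))
    simpa using h
  have ev := (htend.eventually (mem_interior_iff_mem_nhds.1 (isOpen_interior.mem_nhds hx |>
    fun h => mem_interior_iff_mem_nhds.2 h))).and
    ((htend.eventually (mem_interior_iff_mem_nhds.1 (mem_interior_iff_mem_nhds.2
      (eventually_mem_nhds_iff.2 hU)))).and self_mem_nhdsWithin)
  obtain ⟨t, ht1, ht2, ht0⟩ := ev.exists
  have ht0' : (0 : ℝ) < t := ht0
  set y := x - t • e with hy
  have hycl : y ∈ closure Ω := interior_subset ht1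
  have hxg : R x 2 ≤ g !₂[R x 0, R x 1] := by
    by_contra h
    exact hxΩ ((hUΩ x (mem_of_mem_nhds hU)).2 (not_le.1 h))
  have hy0 : R y 0 = R x 0 := by simp [hy, hRe, basisVec]
  have hy1 : R y 1 = R x 1 := by simp [hy, hRe, basisVec]
  have hy2 : R y 2 = R x 2 - t := by simp [hy, hRe, basisVec]
  have hlt : R y 2 < g !₂[R y 0, R y 1] := by
    rw [hy0, hy1, hy2]
    linarith
  have hopen : ∀ᶠ z in 𝓝 y, R z 2 < g !₂[R z 0, R z 1] := by
    have c1 : Continuous fun z : E3 => R z 2 := by fun_prop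
    have c2 : Continuous fun z : E3 => g !₂[R z 0, R z 1] := by
      refine hgc.comp ?_
      refine (PiLp.continuous_toLp 2 _).comp (continuous_pi fun i => ?_)
      fin_cases i
      · change Continuous fun z : E3 => R z 0
        fun_prop
      · change Continuous fun z : E3 => R z 1
        fun_prop
    exact c1.continuousAt.eventually_lt c2.continuousAt hlt
  obtain ⟨z, hzΩ, hz, hzU⟩ := (mem_closure_iff_frequently.1 hycl).and_eventually
    (hopen.and ht2) |>.exists
  exact lt_asymm hz ((hUΩ z hzU).1 hzΩ)

/-- The closed simplex spanned by a finite set of points. -/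
abbrev hull (s : Finset E3) : Set E3 := convexHull ℝ (s : Set E3)

namespace TetMesh

variable {Ω : Set E3} (M : TetMesh Ω)

theorem finite_tets : M.tets.Finite := M.finite.subset fun _ h => h.1

theorem finite_nodes : M.nodes.Finite :=
  (M.finite.preimage (Set.injOn_of_injective Finset.singleton_injective) :
    ((fun x : E3 => ({x} : Finset E3)) ⁻¹' M.complex.faces).Finite)

theorem mem_nodes {s : Finset E3} (hs : s ∈ M.tets) {z : E3} (hz : z ∈ s) : z ∈ M.nodes :=
  M.complex.down_closed hs.1 (Finset.singleton_subset_iff.2 hz) (Finset.singleton_nonempty _)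

/-- By finiteness each face lies in a maximal one, which is a tetrahedron by purity. -/
theorem exists_tet {x : E3} (hx : x ∈ closure Ω) : ∃ s ∈ M.tets, x ∈ hull s := by
  rw [← M.space_eq, Geometry.SimplicialComplex.mem_space_iff] at hx
  obtain ⟨s, hs, hxs⟩ := hx
  obtain ⟨t, hst, ht⟩ := M.finite.exists_le_maximal hs
  refine ⟨t, ⟨ht.prop, M.pure t ⟨ht.prop, fun u hu htu => ?_⟩⟩, convexHull_mono (by exact_mod_cast hst) hxs⟩
  exact le_antisymm htu (ht.le_of_ge hu htu)

theorem hull_subset {s : Finset E3} (hs : s ∈ M.tets) : hull s ⊆ closure Ω := by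
  rw [← M.space_eq]
  exact M.complex.convexHull_subset_space hs.1

theorem closure_eq : closure Ω = ⋃ s ∈ M.tets, hull s := by
  ext x
  simp only [Set.mem_iUnion, exists_prop]
  exact ⟨fun hx => M.exists_tet hx, fun ⟨s, hs, hx⟩ => M.hull_subset hs hx⟩

theorem nodes_subset : M.nodes ⊆ closure Ω := by
  rw [← M.space_eq]
  exact M.complex.vertices_subset_space

theorem node_mem_tet {z : E3} (hz : z ∈ M.nodes) : ∃ s ∈ M.tets, z ∈ s := by
  obtain ⟨s, hs, hzs⟩ := M.exists_tet (M.nodes_subset hz)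
  exact ⟨s, hs, (M.complex.vertex_mem_convexHull_iff hz hs.1).1 hzs⟩

theorem nonempty_of_mem_tets {s : Finset E3} (hs : s ∈ M.tets) : s.Nonempty :=
  M.complex.nonempty_of_mem_faces hs.1

theorem affineSpan_tet {s : Finset E3} (hs : s ∈ M.tets) :
    affineSpan ℝ (Set.range ((↑) : s → E3)) = ⊤ := by
  rw [(M.complex.indep hs.1).affineSpan_eq_top_iff_card_eq_finrank_add_one]
  simp [hs.2]

theorem interior_hull_nonempty {s : Finset E3} (hs : s ∈ M.tets) :
    (interior (hull s)).Nonempty := by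
  rw [interior_convexHull_nonempty_iff_affineSpan_eq_top]
  simpa using M.affineSpan_tet hs

section Interp

variable {F : Type*} [NormedAddCommGroup F] [NormedSpace ℝ F]

theorem affine_sum {ι : Type*} (A : E3 →ᵃ[ℝ] F) (s : Finset ι) (c : ι → ℝ) (z : ι → E3)
    (h : ∑ i ∈ s, c i = 1) : A (∑ i ∈ s, c i • z i) = ∑ i ∈ s, c i • A (z i) := by
  have e : ∀ x, A x = A.linear x + A 0 := fun x => by
    simpa using A.map_vadd 0 x
  rw [e, map_sum]
  simp_rw [map_smul]
  conv_rhs => enter [2, i]; rw [e, smul_add]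
  rw [Finset.sum_add_distrib, ← Finset.sum_smul, h, one_smul]

theorem exists_affine {s : Finset E3} (hs : s ∈ M.tets) (w : E3 → F) :
    ∃ A : E3 →ᵃ[ℝ] F, ∀ z ∈ s, A z = w z := by
  classical
  set b : AffineBasis s ℝ E3 := ⟨fun z => z, M.complex.indep hs.1, M.affineSpan_tet hs⟩ with hb
  refine ⟨∑ i : s, (LinearMap.toSpanSingleton ℝ F (w i)).toAffineMap.comp (b.coord i),
    fun z hz => ?_⟩
  have hz' : z = b ⟨z, hz⟩ := rfl
  have e : ∀ (t : Finset s) (x : E3), (∑ i ∈ t,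
      (LinearMap.toSpanSingleton ℝ F (w i)).toAffineMap.comp (b.coord i)) x
      = ∑ i ∈ t, b.coord i x • w i := by
    intro t x
    induction t using Finset.induction_on with
    | empty => simp
    | insert a t ha ih => simp [Finset.sum_insert ha, ih]
  rw [e]
  conv_lhs => enter [2, i]; rw [hz', AffineBasis.coord_apply]
  simp

theorem hull_combination {s : Finset E3} {x : E3} (hx : x ∈ hull s) :
    ∃ c : E3 → ℝ, (∀ z ∈ s, 0 ≤ c z) ∧ ∑ z ∈ s, c z = 1 ∧ ∑ z ∈ s, c z • z = x :=
  Finset.mem_convexHull'.1 hx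

open Classical in
/-- The nodal interpolant. -/
noncomputable def interp (w : E3 → F) (x : E3) : F :=
  if h : ∃ s ∈ M.tets, x ∈ hull s then (M.exists_affine h.choose_spec.1 w).choose x else 0

/-- The tetrahedron chosen in `interp` does not matter: by conformity two tetrahedra meet in the
hull of their common vertices, where the two affine functions are determined by the same nodal
values. -/
theorem interp_eqOn {s : Finset E3} (hs : s ∈ M.tets) {w : E3 → F} {A : E3 →ᵃ[ℝ] F}
    (hA : ∀ z ∈ s, A z = w z) : Set.EqOn (M.interp w) A (hull s) := by
  classical
  intro x hx
  have h : ∃ s ∈ M.tets, x ∈ hull s := ⟨s, hs, hx⟩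
  rw [interp, dif_pos h]
  set t := h.choose
  have ht : t ∈ M.tets := h.choose_spec.1
  have hxt : x ∈ hull t := h.choose_spec.2
  have hB := (M.exists_affine h.choose_spec.1 w).choose_spec
  set B := (M.exists_affine h.choose_spec.1 w).choose
  have hxx := M.complex.inter_subset_convexHull ht.1 hs.1 ⟨hxt, hx⟩
  rw [← Finset.coe_inter] at hxx
  obtain ⟨c, -, h1, h2⟩ := hull_combination hxx
  rw [← h2, affine_sum _ _ _ _ h1, affine_sum _ _ _ _ h1]
  refine Finset.sum_congr rfl fun z hz => ?_
  rw [Finset.mem_inter] at hz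
  rw [hA z hz.2, hB z hz.1]

theorem isCompact_hull (s : Finset E3) : IsCompact (hull s) :=
  s.finite_toSet.isCompact_convexHull (𝕜 := ℝ)

theorem isClosed_hull (s : Finset E3) : IsClosed (hull s) := (isCompact_hull s).isClosed

theorem interp_mem (w : E3 → F) : M.interp w ∈ courant M F := by
  have haff : ∀ s ∈ M.tets, ∃ A : E3 →ᵃ[ℝ] F, Set.EqOn (M.interp w) A (hull s) := fun s hs => by
    obtain ⟨A, hA⟩ := M.exists_affine hs w
    exact ⟨A, M.interp_eqOn hs hA⟩
  refine ⟨?_, haff⟩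
  rw [M.closure_eq, Set.biUnion_eq_iUnion]
  have : Finite M.tets := M.finite_tets
  refine LocallyFinite.continuousOn_iUnion (locallyFinite_of_finite _)
    (fun s => isClosed_hull _) fun s => ?_
  obtain ⟨A, hA⟩ := haff s.1 s.2
  exact (A.continuous_of_finiteDimensional.continuousOn).congr hA

theorem interp_node (w : E3 → F) {z : E3} (hz : z ∈ M.nodes) : M.interp w z = w z := by
  obtain ⟨s, hs, hzs⟩ := M.node_mem_tet hz
  obtain ⟨A, hA⟩ := M.exists_affine hs w
  rw [M.interp_eqOn hs hA (subset_convexHull ℝ _ hzs), hA z hzs]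

end Interp

end TetMesh

/-! ### Courant functions on single tetrahedra and along segments -/

section Courant

variable {Ω : Set E3} {M : TetMesh Ω}
variable {F : Type*} [NormedAddCommGroup F] [NormedSpace ℝ F]

theorem courant_sum_eq {u : E3 → F} (hu : u ∈ courant M F) {s : Finset E3} (hs : s ∈ M.tets)
    {c : E3 → ℝ} (h0 : ∀ z ∈ s, 0 ≤ c z) (h1 : ∑ z ∈ s, c z = 1) :
    u (∑ z ∈ s, c z • z) = ∑ z ∈ s, c z • u z := by
  obtain ⟨A, hA⟩ := hu.2 s hs
  have hx : ∑ z ∈ s, c z • z ∈ hull s := Finset.mem_convexHull'.2 ⟨c, h0, h1, rfl⟩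
  rw [hA hx, TetMesh.affine_sum _ _ _ _ h1]
  refine Finset.sum_congr rfl fun z hz => ?_
  rw [hA (subset_convexHull ℝ _ hz)]

theorem courant_ext {u w : E3 → F} (hu : u ∈ courant M F) (hw : w ∈ courant M F)
    (h : ∀ z ∈ M.nodes, u z = w z) : Set.EqOn u w (closure Ω) := by
  intro x hx
  obtain ⟨s, hs, hxs⟩ := M.exists_tet hx
  obtain ⟨c, h0, h1, rfl⟩ := TetMesh.hull_combination hxs
  rw [courant_sum_eq hu hs h0 h1, courant_sum_eq hw hs h0 h1]
  exact Finset.sum_congr rfl fun z hz => by rw [h z (M.mem_nodes hs hz)]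

theorem courant_add {u w : E3 → F} (hu : u ∈ courant M F) (hw : w ∈ courant M F) :
    (fun x => u x + w x) ∈ courant M F := by
  refine ⟨hu.1.add hw.1, fun s hs => ?_⟩
  obtain ⟨A, hA⟩ := hu.2 s hs
  obtain ⟨B, hB⟩ := hw.2 s hs
  exact ⟨A + B, fun x hx => by simp [hA hx, hB hx]⟩

theorem courant_smul {u : E3 → F} (c : ℝ) (hu : u ∈ courant M F) :
    (fun x => c • u x) ∈ courant M F := by
  refine ⟨hu.1.const_smul c, fun s hs => ?_⟩
  obtain ⟨A, hA⟩ := hu.2 s hs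
  exact ⟨c • A, fun x hx => by simp [hA hx]⟩

theorem courant_sub {u w : E3 → F} (hu : u ∈ courant M F) (hw : w ∈ courant M F) :
    (fun x => u x - w x) ∈ courant M F := by
  have := courant_add hu (courant_smul (-1) hw)
  simpa [sub_eq_add_neg] using this

theorem norm_le_on_hull {u : E3 → F} (hu : u ∈ courant M F) {s : Finset E3} (hs : s ∈ M.tets)
    {C : ℝ} (hC : ∀ z ∈ s, ‖u z‖ ≤ C) {x : E3} (hx : x ∈ hull s) : ‖u x‖ ≤ C := by
  obtain ⟨c, h0, h1, rfl⟩ := TetMesh.hull_combination hx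
  rw [courant_sum_eq hu hs h0 h1]
  calc ‖∑ z ∈ s, c z • u z‖ ≤ ∑ z ∈ s, c z * C := by
        refine norm_sum_le_of_le _ fun z hz => ?_
        rw [norm_smul, Real.norm_of_nonneg (h0 z hz)]
        exact mul_le_mul_of_nonneg_left (hC z hz) (h0 z hz)
    _ = C := by rw [← Finset.sum_mul, h1, one_mul]

theorem norm_le_on_closure {u : E3 → F} (hu : u ∈ courant M F)
    {C : ℝ} (hC : ∀ z ∈ M.nodes, ‖u z‖ ≤ C) {x : E3} (hx : x ∈ closure Ω) : ‖u x‖ ≤ C := by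
  obtain ⟨s, hs, hxs⟩ := M.exists_tet hx
  exact norm_le_on_hull hu hs (fun z hz => hC z (M.mem_nodes hs hz)) hxs

theorem exists_norm_bound {u : E3 → F} (hu : u ∈ courant M F) :
    ∃ C : ℝ, ∀ x ∈ closure Ω, ‖u x‖ ≤ C := by
  obtain ⟨C, hC⟩ := (M.finite_nodes.image fun z => ‖u z‖).bddAbove
  exact ⟨C, fun x hx => norm_le_on_closure hu (fun z hz => hC ⟨z, hz, rfl⟩) hx⟩

theorem exists_gradient {u : E3 → F} (hu : u ∈ courant M F) {s : Finset E3} (hs : s ∈ M.tets) :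
    ∃ G : E3 →L[ℝ] F, (∀ x ∈ interior (hull s), HasFDerivAt u G x) ∧
      ∀ x ∈ hull s, ∀ y ∈ hull s, u y - u x = G (y - x) := by
  obtain ⟨A, hA⟩ := hu.2 s hs
  have e : ∀ x y, A y - A x = A.linear (y - x) := fun x y => by
    rw [← vsub_eq_sub, ← AffineMap.linearMap_vsub, vsub_eq_sub]
  refine ⟨LinearMap.toContinuousLinearMap A.linear, fun x hx => ?_, fun x hx y hy => ?_⟩
  · have h1 : HasFDerivAt A (LinearMap.toContinuousLinearMap A.linear) x := by
      have h2 := ((LinearMap.toContinuousLinearMap A.linear).hasFDerivAt (x := x)).add_const (A 0)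
      refine h2.congr_of_eventuallyEq (Eventually.of_forall fun y => ?_)
      have := e 0 y
      rw [sub_zero] at this
      simp [← this]
    refine h1.congr_of_eventuallyEq ?_
    filter_upwards [isOpen_interior.mem_nhds hx] with y hy using hA (interior_subset hy)
  · rw [hA hx, hA hy, e]
    rfl

theorem differentiableAt_of_interior {u : E3 → F} (hu : u ∈ courant M F) {s : Finset E3}
    (hs : s ∈ M.tets) {x : E3} (hx : x ∈ interior (hull s)) : DifferentiableAt ℝ u x := by
  obtain ⟨G, hG, -⟩ := exists_gradient hu hs
  exact (hG x hx).differentiableAt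

theorem fderiv_apply_sub {u : E3 → F} (hu : u ∈ courant M F) {s : Finset E3}
    (hs : s ∈ M.tets) {x y z : E3} (hx : x ∈ interior (hull s)) (hy : y ∈ hull s)
    (hz : z ∈ hull s) : fderiv ℝ u x (z - y) = u z - u y := by
  obtain ⟨G, hG, h⟩ := exists_gradient hu hs
  rw [(hG x hx).fderiv, h y hy z hz]

theorem exists_fderiv_bound {u : E3 → F} (hu : u ∈ courant M F) :
    ∃ C : ℝ, 0 ≤ C ∧ (∀ s ∈ M.tets, ∀ x ∈ interior (hull s), ‖fderiv ℝ u x‖ ≤ C) ∧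
      ∀ s ∈ M.tets, ∃ G : E3 →L[ℝ] F, ‖G‖ ≤ C ∧
        ∀ x ∈ hull s, ∀ y ∈ hull s, u y - u x = G (y - x) := by
  choose! G hG using fun s (hs : s ∈ M.tets) => exists_gradient hu hs
  obtain ⟨C, hC⟩ := (M.finite_tets.image fun s => ‖G s‖).bddAbove
  refine ⟨max C 0, le_max_right _ _, fun s hs x hx => ?_, fun s hs => ⟨G s, ?_, (hG s hs).2⟩⟩
  · rw [((hG s hs).1 x hx).fderiv]
    exact (hC ⟨s, hs, rfl⟩).trans (le_max_left _ _)
  · exact (hC ⟨s, hs, rfl⟩).trans (le_max_left _ _)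

/-- Courant functions are Lipschitz along segments. -/
theorem exists_lipschitz_on_segments {u : E3 → F} (hu : u ∈ courant M F) :
    ∃ L : ℝ, 0 ≤ L ∧ ∀ x y : E3, segment ℝ x y ⊆ closure Ω → ‖u y - u x‖ ≤ L * ‖y - x‖ := by
  obtain ⟨C, hC0, -, hC⟩ := exists_fderiv_bound hu
  refine ⟨C, hC0, fun x y hxy => ?_⟩
  set p : ℝ → E3 := fun t => x + t • (y - x) with hp
  have hpc : Continuous p := by fun_prop
  have hseg : ∀ t ∈ Set.Icc (0 : ℝ) 1, p t ∈ closure Ω := fun t ht =>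
    hxy (by rw [segment_eq_image']; exact ⟨t, ht, rfl⟩)
  have hcont : ContinuousOn (u ∘ p) (Set.Icc 0 1) := hu.1.comp hpc.continuousOn hseg
  have hder : ∀ t ∈ Set.Ico (0 : ℝ) 1, ∃ d : F, ‖d‖ ≤ C * ‖y - x‖ ∧
      HasDerivWithinAt (u ∘ p) d (Set.Ici t) t := by
    intro t ht
    -- As there are finitely many tetrahedra, one of them is visited at times arbitrarily close to
    -- `t` from the right. It contains `p t` since it is closed, and a whole piece of the segment
    -- after `t` since it is convex; there the function is affine, which gives the right derivative.
    obtain ⟨s, hs, hfr⟩ : ∃ s ∈ M.tets, ∃ᶠ τ in 𝓝[>] t, p τ ∈ hull s := by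
      by_contra! hcon
      have hcon' : ∀ s ∈ M.tets, ∀ᶠ τ in 𝓝[>] t, p τ ∉ hull s := fun s hs => by
        simpa [Filter.Frequently] using hcon s hs
      have h1 := (eventually_all_finite M.finite_tets).2 hcon'
      have h2 : ∀ᶠ τ in 𝓝[>] t, τ ∈ Set.Icc (0 : ℝ) 1 := by
        filter_upwards [Ioo_mem_nhdsGT ht.2] with τ hτ
        exact ⟨ht.1.trans hτ.1.le, hτ.2.le⟩
      obtain ⟨τ, h3, h4⟩ := (h1.and h2).exists
      obtain ⟨s, hs, hτ⟩ := M.exists_tet (hseg τ h4)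
      exact h3 s hs hτ
    obtain ⟨G, hG, hGs⟩ := hC s hs
    have hpt : p t ∈ hull s := by
      have h1 : ∃ᶠ τ in 𝓝 t, p τ ∈ hull s := hfr.filter_mono nhdsWithin_le_nhds
      have h2 : ∃ᶠ q in 𝓝 (p t), q ∈ hull s := hpc.continuousAt.frequently h1
      exact (TetMesh.isClosed_hull s).closure_eq ▸ mem_closure_iff_frequently.2 h2
    obtain ⟨τ₀, hτ₀, hτ₀t⟩ := (hfr.and_eventually self_mem_nhdsWithin).exists
    have hτ₀t' : t < τ₀ := hτ₀t
    have hmem : ∀ τ ∈ Set.Icc t τ₀, p τ ∈ hull s := fun τ hτ => by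
      have hc : Convex ℝ (p ⁻¹' hull s) := by
        have e : p = (AffineMap.lineMap x y : ℝ →ᵃ[ℝ] E3) := by
          ext1 t
          simp [hp, AffineMap.lineMap_apply, add_comm]
        rw [e]
        exact (convex_convexHull ℝ _).affine_preimage _
      exact hc.ordConnected.out hpt hτ₀ hτ
    refine ⟨G (y - x), (G.le_opNorm _).trans (mul_le_mul_of_nonneg_right hG (norm_nonneg _)), ?_⟩
    have hd : HasDerivAt (fun τ => u (p t) + G (p τ - p t)) (G (y - x)) t := by
      have h1 : HasDerivAt p (y - x) t := by
        have h0 := ((hasDerivAt_id t).smul_const (y - x)).const_add x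
        rwa [one_smul] at h0
      exact ((G.hasFDerivAt.comp_hasDerivAt t (h1.sub_const (p t)))).const_add _
    refine hd.hasDerivWithinAt.congr_of_eventuallyEq ?_ (by simp)
    filter_upwards [Icc_mem_nhdsGE hτ₀t'] with τ hτ
    rw [Function.comp_apply, ← hGs _ hpt _ (hmem τ hτ)]
    abel
  choose! d hd1 hd2 using hder
  have := norm_image_sub_le_of_norm_deriv_right_le_segment hcont hd2 hd1 1 ⟨zero_le_one, le_rfl⟩
  simpa [hp] using this

end Courant

end LLG

/-! ### Integration over the mesh and weak derivatives of Courant functions -/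

namespace LLG

theorem frontier_hull_null (s : Finset E3) : volume (frontier (hull s)) = 0 :=
  (convex_convexHull ℝ _).addHaar_frontier volume

theorem IsLipschitzDomain.volume_lt_top {Ω : Set E3} (hΩ : IsLipschitzDomain Ω) : volume Ω < ⊤ :=
  hΩ.isBounded.measure_lt_top

theorem IsLipschitzDomain.isFiniteMeasure {Ω : Set E3} (hΩ : IsLipschitzDomain Ω) :
    IsFiniteMeasure (volume.restrict Ω : Measure E3) := ⟨by simpa using hΩ.volume_lt_top⟩

namespace TetMesh

variable {Ω : Set E3} (M : TetMesh Ω)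

theorem ae_mem_interior (hΩ : IsOpen Ω) :
    ∀ᵐ x ∂(volume.restrict Ω), ∃ s ∈ M.tets, x ∈ interior (hull s) := by
  have h : ∀ᵐ x : E3, ∀ s ∈ M.tets, x ∉ frontier (hull s) :=
    (ae_ball_iff M.finite_tets.countable).2 fun s _ =>
      measure_eq_zero_iff_ae_notMem.1 (frontier_hull_null s)
  rw [ae_restrict_iff' hΩ.measurableSet]
  filter_upwards [h] with x hx hxΩ
  obtain ⟨s, hs, hxs⟩ := M.exists_tet (subset_closure hxΩ)
  refine ⟨s, hs, ?_⟩
  by_contra hi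
  exact hx s hs ⟨subset_closure hxs, hi⟩

/-- The intersection lies in the affine span of the common vertices. This is a null set unless there
are four of them, in which case the tetrahedra coincide. -/
theorem aedisjoint {s t : Finset E3} (hs : s ∈ M.tets) (ht : t ∈ M.tets) (hst : s ≠ t) :
    AEDisjoint volume (hull s) (hull t) := by
  classical
  refine measure_mono_null (M.complex.inter_subset_convexHull hs.1 ht.1) ?_
  rw [← Finset.coe_inter]
  refine measure_mono_null (convexHull_subset_affineSpan (𝕜 := ℝ) _) ?_
  refine Measure.addHaar_affineSubspace volume _ fun htop => ?_
  have hind : AffineIndependent ℝ ((↑) : (s ∩ t : Finset E3) → E3) := by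
    have h0 : AffineIndependent ℝ (fun x : (s : Set E3) => (x : E3)) := M.complex.indep hs.1
    exact h0.mono (s := ((s ∩ t : Finset E3) : Set E3))
      (by exact_mod_cast Finset.inter_subset_left)
  have hc := (hind.affineSpan_eq_top_iff_card_eq_finrank_add_one).1
    (by rw [Subtype.range_coe_subtype]; exact htop)
  rw [Fintype.card_coe, finrank_euclideanSpace_fin] at hc
  have h1 : s ∩ t = s := Finset.eq_of_subset_of_card_le Finset.inter_subset_left
    (by rw [hc, hs.2])
  have h2 : s ∩ t = t := Finset.eq_of_subset_of_card_le Finset.inter_subset_right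
    (by rw [hc, ht.2])
  exact hst (h1.symm.trans h2)

theorem lintegral_eq_sum (hΩ : IsLipschitzDomain Ω) (f : E3 → ℝ≥0∞) :
    ∫⁻ x in Ω, f x = ∑ s ∈ M.finite_tets.toFinset, ∫⁻ x in hull s, f x := by
  rw [← lintegral_biUnion_finset₀]
  · refine setLIntegral_congr ?_
    have hsub : Ω ⊆ ⋃ s ∈ M.finite_tets.toFinset, hull s := by
      refine subset_closure.trans ?_
      rw [M.closure_eq]
      simp
    refine (LE.le.eventuallyLE hsub).antisymm ?_
    have h : ∀ᵐ x : E3, ∀ s ∈ M.tets, x ∉ frontier (hull s) :=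
      (ae_ball_iff M.finite_tets.countable).2 fun s _ =>
        measure_eq_zero_iff_ae_notMem.1 (frontier_hull_null s)
    filter_upwards [h] with x hx hxU
    obtain ⟨s, hs, hxs⟩ := Set.mem_iUnion₂.1 hxU
    rw [Set.Finite.mem_toFinset] at hs
    have hi : x ∈ interior (hull s) := by
      by_contra hi
      exact hx s hs ⟨subset_closure hxs, hi⟩
    exact hΩ.interior_closure_subset (interior_mono (M.hull_subset hs) hi)
  · intro s hs t ht hst
    simp only [Set.Finite.coe_toFinset] at hs ht
    exact M.aedisjoint hs ht hst
  · intro s _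
    exact (isClosed_hull s).measurableSet.nullMeasurableSet

end TetMesh

variable {Ω : Set E3} {M : TetMesh Ω}
variable {F : Type*} [NormedAddCommGroup F] [InnerProductSpace ℝ F] [FiniteDimensional ℝ F]

/-- On each tetrahedron the largest nodal value of an affine function is controlled by its mean
square. -/
theorem volume_mul_nodal_sq_le {v : E3 → F} (hv : v ∈ courant M F) {s : Finset E3}
    (hs : s ∈ M.tets) {z₀ : E3} (hz₀ : z₀ ∈ s) (hmax : ∀ z ∈ s, ‖v z‖ ≤ ‖v z₀‖) :
    ‖v z₀‖ₑ ^ 2 * volume (hull s) ≤ 256 * ∫⁻ x in hull s, ‖v x‖ₑ ^ 2 := by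
  have hz₀h : z₀ ∈ hull s := subset_convexHull ℝ _ hz₀
  -- On the copy shrunk by 1/4 towards the maximizing vertex, `|v|` is at least 3/4 - 1/4 = 1/2 of
  -- the maximum. The copy has 1/64 of the volume, so the constant is 4 · 64 = 256, whatever the
  -- shape of the tetrahedron.
  set H : Set E3 := AffineMap.homothety z₀ (1 / 4 : ℝ) '' hull s with hH
  have hvol : volume H = ENNReal.ofReal (1 / 64) * volume (hull s) := by
    rw [hH, Measure.addHaar_image_homothety, finrank_euclideanSpace_fin]
    congr 2
    rw [abs_of_pos (by positivity)]
    norm_num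
  have hHs : H ⊆ hull s := by
    rintro _ ⟨y, hy, rfl⟩
    rw [AffineMap.homothety_apply]
    have := (convex_convexHull ℝ (s : Set E3)).add_smul_sub_mem hz₀h hy
      (t := 1 / 4) ⟨by norm_num, by norm_num⟩
    simpa [add_comm] using this
  have hHc : IsClosed H := by
    refine IsCompact.isClosed ?_
    exact (TetMesh.isCompact_hull s).image (AffineMap.homothety_continuous z₀ (1 / 4 : ℝ))
  have hpt : ∀ x ∈ H, ‖v z₀‖ₑ ^ 2 ≤ 4 * ‖v x‖ₑ ^ 2 := by
    rintro _ ⟨y, hy, rfl⟩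
    obtain ⟨G, -, hG⟩ := exists_gradient hv hs
    have hmem : AffineMap.homothety z₀ (1 / 4 : ℝ) y ∈ hull s := hHs ⟨y, hy, rfl⟩
    have h1 := hG z₀ hz₀h _ hmem
    have h2 := hG z₀ hz₀h y hy
    have h3 : AffineMap.homothety z₀ (1 / 4 : ℝ) y - z₀ = (1 / 4 : ℝ) • (y - z₀) := by
      simp [AffineMap.homothety_apply]
    rw [h3, map_smul, ← h2] at h1
    have h4 : ‖v y‖ ≤ ‖v z₀‖ := norm_le_on_hull hv hs hmax hy
    have h5 : v (AffineMap.homothety z₀ (1 / 4 : ℝ) y)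
        = (3 / 4 : ℝ) • v z₀ + (1 / 4 : ℝ) • v y := by
      rw [sub_eq_iff_eq_add] at h1
      rw [h1]
      module
    have h6 : ‖v z₀‖ ≤ 2 * ‖v (AffineMap.homothety z₀ (1 / 4 : ℝ) y)‖ := by
      have h7 : (3 / 4 : ℝ) * ‖v z₀‖ ≤ ‖v (AffineMap.homothety z₀ (1 / 4 : ℝ) y)‖
          + (1 / 4) * ‖v y‖ := by
        have := norm_sub_le (v (AffineMap.homothety z₀ (1 / 4 : ℝ) y)) ((1 / 4 : ℝ) • v y)
        rw [h5, add_sub_cancel_right, norm_smul, norm_smul, ← h5] at this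
        norm_num at this
        linarith
      linarith
    have e4 : (4 : ℝ≥0∞) = ENNReal.ofReal 4 := by simp
    rw [enorm_sq_eq, enorm_sq_eq, e4, ← ENNReal.ofReal_mul (by norm_num)]
    refine ENNReal.ofReal_le_ofReal ?_
    nlinarith [norm_nonneg (v z₀)]
  calc ‖v z₀‖ₑ ^ 2 * volume (hull s) = 64 * (‖v z₀‖ₑ ^ 2 * volume H) := by
        rw [hvol, mul_left_comm, ← mul_assoc 64]
        have : (64 : ℝ≥0∞) * ENNReal.ofReal (1 / 64) = 1 := by
          rw [show (64 : ℝ≥0∞) = ENNReal.ofReal 64 by simp, ← ENNReal.ofReal_mul (by norm_num)]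
          norm_num
        rw [this, one_mul]
    _ = 64 * ∫⁻ x in H, ‖v z₀‖ₑ ^ 2 := by simp
    _ ≤ 64 * ∫⁻ x in H, 4 * ‖v x‖ₑ ^ 2 := by
        gcongr 64 * ?_
        exact setLIntegral_mono' hHc.measurableSet hpt
    _ ≤ 64 * ∫⁻ x in hull s, 4 * ‖v x‖ₑ ^ 2 := by
        gcongr 64 * ?_
        exact lintegral_mono_set hHs
    _ = 256 * ∫⁻ x in hull s, ‖v x‖ₑ ^ 2 := by
        rw [lintegral_const_mul' _ _ (by simp), ← mul_assoc]
        norm_num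

/-- Turns estimates at the nodes into integral estimates, one tetrahedron at a time, with a constant
that does not depend on the mesh. -/
theorem lintegral_le_of_nodal_bound (hΩ : IsLipschitzDomain Ω) {v : E3 → F}
    (hv : v ∈ courant M F) {g : E3 → ℝ≥0∞} {c : ℝ≥0∞} (hc : c ≠ ⊤)
    (hg : ∀ s ∈ M.tets, ∀ z₀ ∈ s, (∀ z ∈ s, ‖v z‖ ≤ ‖v z₀‖) → ∀ x ∈ hull s, g x ≤ c * ‖v z₀‖ₑ ^ 2) :
    ∫⁻ x in Ω, g x ≤ c * (256 * ∫⁻ x in Ω, ‖v x‖ₑ ^ 2) := by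
  rw [M.lintegral_eq_sum hΩ, M.lintegral_eq_sum hΩ, Finset.mul_sum, Finset.mul_sum]
  refine Finset.sum_le_sum fun s hs => ?_
  rw [Set.Finite.mem_toFinset] at hs
  obtain ⟨z₀, hz₀, hmax⟩ := s.exists_max_image (fun z => ‖v z‖) (M.nonempty_of_mem_tets hs)
  calc ∫⁻ x in hull s, g x ≤ ∫⁻ _ in hull s, c * ‖v z₀‖ₑ ^ 2 :=
        setLIntegral_mono' (TetMesh.isClosed_hull s).measurableSet (hg s hs z₀ hz₀ hmax)
    _ = c * (‖v z₀‖ₑ ^ 2 * volume (hull s)) := by simp [mul_assoc]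
    _ ≤ _ := by
        gcongr c * ?_
        exact volume_mul_nodal_sq_le hv hs hz₀ hmax

theorem aestronglyMeasurable_of_courant (hΩ : IsOpen Ω) {u : E3 → F} (hu : u ∈ courant M F) :
    AEStronglyMeasurable u (volume.restrict Ω) :=
  (hu.1.mono subset_closure).aestronglyMeasurable hΩ.measurableSet

theorem memLp_of_courant (hΩ : IsLipschitzDomain Ω) {u : E3 → F} (hu : u ∈ courant M F)
    (p : ℝ≥0∞) : MemLp u p (volume.restrict Ω) := by
  have := hΩ.isFiniteMeasure
  obtain ⟨C, hC⟩ := exists_norm_bound hu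
  refine MemLp.of_bound (aestronglyMeasurable_of_courant hΩ.isOpen hu) C ?_
  filter_upwards [ae_restrict_mem hΩ.isOpen.measurableSet] with x hx using hC x (subset_closure hx)

theorem memLp_fderiv_of_courant (hΩ : IsLipschitzDomain Ω) {u : E3 → F} (hu : u ∈ courant M F)
    (e : E3) (p : ℝ≥0∞) : MemLp (fun x => fderiv ℝ u x e) p (volume.restrict Ω) := by
  have := hΩ.isFiniteMeasure
  have := FiniteDimensional.complete ℝ F
  obtain ⟨C, hC0, hC, -⟩ := exists_fderiv_bound hu
  borelize F
  refine MemLp.of_bound (measurable_fderiv_apply_const ℝ u e).aestronglyMeasurable (C * ‖e‖) ?_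
  filter_upwards [M.ae_mem_interior hΩ.isOpen] with x hx
  obtain ⟨s, hs, hxs⟩ := hx
  exact (ContinuousLinearMap.le_opNorm _ _).trans
    (mul_le_mul_of_nonneg_right (hC s hs x hxs) (norm_nonneg _))

theorem exists_segment_subset {X : Type*} [NormedAddCommGroup X] [NormedSpace ℝ X]
    {U K : Set X} (hU : IsOpen U) (hK : IsCompact K) (hKU : K ⊆ U) (e : X) :
    ∃ δ > 0, ∀ x ∈ K, ∀ s : ℝ, |s| < δ → segment ℝ x (x + s • e) ⊆ U := by
  obtain ⟨r, hr, hrU⟩ := hK.exists_cthickening_subset_open hU hKU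
  refine ⟨r / (‖e‖ + 1), by positivity, fun x hx s hs y hy => hrU ?_⟩
  refine Metric.mem_cthickening_of_dist_le _ x _ _ hx ?_
  have h1 := (lt_div_iff₀ (by positivity)).1 hs
  rw [segment_eq_image'] at hy
  obtain ⟨θ, hθ, rfl⟩ := hy
  rw [dist_eq_norm]
  simp only [add_sub_cancel_left, norm_smul, Real.norm_eq_abs]
  rw [abs_of_nonneg hθ.1]
  have h2 : 0 ≤ |s| * ‖e‖ := by positivity
  nlinarith [hθ.1, hθ.2, abs_nonneg s, mul_le_of_le_one_left h2 hθ.2]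

/-- Short segments that start in a compact subset stay in the domain, so the function is Lipschitz
along them; it is differentiable in the interiors of the tetrahedra, that is, almost everywhere. -/
theorem hasWeakDeriv_of_courant (hΩ : IsLipschitzDomain Ω) {u : E3 → F} (hu : u ∈ courant M F)
    (e : E3) : HasWeakDeriv Ω e u (fun x => fderiv ℝ u x e) := by
  obtain ⟨L, hL0, hL⟩ := exists_lipschitz_on_segments hu
  refine HasWeakDeriv.of_lipschitz_direction hΩ.isOpen (memLp_of_courant hΩ hu 2)
    (L := L * ‖e‖) (fun K hKU hK => ?_) ?_
  · obtain ⟨δ, hδ, h⟩ := exists_segment_subset hΩ.isOpen hK hKU e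
    refine ⟨δ, hδ, fun x hx s hs _ => ?_⟩
    refine (hL x (x + s • e) ((h x hx s hs).trans subset_closure)).trans (le_of_eq ?_)
    rw [add_sub_cancel_left, norm_smul, Real.norm_eq_abs]
    ring
  · filter_upwards [M.ae_mem_interior hΩ.isOpen] with x hx
    obtain ⟨s, hs, hxs⟩ := hx
    exact (differentiableAt_of_interior hu hs hxs).hasFDerivAt.hasLineDerivAt e

theorem memH1_of_courant (hΩ : IsLipschitzDomain Ω) {u : E3 → F} (hu : u ∈ courant M F) :
    MemH1 Ω u :=
  ⟨memLp_of_courant hΩ hu 2, fun e => ⟨_, memLp_fderiv_of_courant hΩ hu e 2,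
    hasWeakDeriv_of_courant hΩ hu e⟩⟩

theorem weakDeriv_of_courant (hΩ : IsLipschitzDomain Ω) {u : E3 → F} (hu : u ∈ courant M F)
    (e : E3) : weakDeriv Ω e u =ᵐ[volume.restrict Ω] fun x => fderiv ℝ u x e := by
  have := FiniteDimensional.complete ℝ F
  exact (hasWeakDeriv_of_courant hΩ hu e).weakDeriv_ae hΩ.isOpen
    (memLp_fderiv_of_courant hΩ hu e 2)

theorem gradInner_of_courant (hΩ : IsLipschitzDomain Ω) {u w : E3 → F} (hu : u ∈ courant M F)
    (hw : w ∈ courant M F) : gradInner Ω u w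
      = ∑ i, ∫ x in Ω, inner ℝ (fderiv ℝ u x (basisVec i)) (fderiv ℝ w x (basisVec i)) := by
  refine Finset.sum_congr rfl fun i _ => integral_congr_ae ?_
  filter_upwards [weakDeriv_of_courant hΩ hu (basisVec i),
    weakDeriv_of_courant hΩ hw (basisVec i)] with x h1 h2
  rw [h1, h2]

theorem gradNormSq_of_courant (hΩ : IsLipschitzDomain Ω) {u : E3 → F} (hu : u ∈ courant M F) :
    gradNormSq Ω u = ∑ i, ∫ x in Ω, ‖fderiv ℝ u x (basisVec i)‖ ^ 2 := by
  refine Finset.sum_congr rfl fun i _ => integral_congr_ae ?_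
  filter_upwards [weakDeriv_of_courant hΩ hu (basisVec i)] with x h1
  rw [h1]

theorem gradNormSq_eq_gradInner (Ω : Set E3) (u : E3 → F) : gradNormSq Ω u = gradInner Ω u u := by
  simp [gradNormSq, gradInner]

theorem gradNormSq_nonneg (Ω : Set E3) (u : E3 → F) : 0 ≤ gradNormSq Ω u :=
  Finset.sum_nonneg fun _ _ => integral_nonneg fun _ => sq_nonneg _

end LLG

namespace LLG

/-! ### The vector product -/

section Cross

theorem cross_ofLp (a b : E3) : (cross a b).ofLp = ![a 1 * b 2 - a 2 * b 1,
    a 2 * b 0 - a 0 * b 2, a 0 * b 1 - a 1 * b 0] := by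
  rw [cross, cross_apply]

theorem cross_apply_zero (a b : E3) : cross a b 0 = a 1 * b 2 - a 2 * b 1 := by
  rw [cross_ofLp]; rfl

theorem cross_apply_one (a b : E3) : cross a b 1 = a 2 * b 0 - a 0 * b 2 := by
  rw [cross_ofLp]; rfl

theorem cross_apply_two (a b : E3) : cross a b 2 = a 0 * b 1 - a 1 * b 0 := by
  rw [cross_ofLp]; rfl

theorem E3_ext {a b : E3} (h0 : a 0 = b 0) (h1 : a 1 = b 1) (h2 : a 2 = b 2) : a = b := by
  ext i
  fin_cases i <;> assumption

theorem inner_E3 (a b : E3) : inner ℝ a b = a 0 * b 0 + a 1 * b 1 + a 2 * b 2 := by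
  simp [PiLp.inner_apply, Fin.sum_univ_three, mul_comm]

theorem norm_sq_E3 (a : E3) : ‖a‖ ^ 2 = a 0 * a 0 + a 1 * a 1 + a 2 * a 2 := by
  rw [← real_inner_self_eq_norm_sq, inner_E3]

theorem cross_add_left (a a' b : E3) : cross (a + a') b = cross a b + cross a' b := by
  apply E3_ext <;> simp [cross_apply_zero, cross_apply_one, cross_apply_two] <;> ring

theorem cross_add_right (a b b' : E3) : cross a (b + b') = cross a b + cross a b' := by
  apply E3_ext <;> simp [cross_apply_zero, cross_apply_one, cross_apply_two] <;> ring

theorem cross_smul_left (c : ℝ) (a b : E3) : cross (c • a) b = c • cross a b := by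
  apply E3_ext <;> simp [cross_apply_zero, cross_apply_one, cross_apply_two] <;> ring

theorem cross_smul_right (c : ℝ) (a b : E3) : cross a (c • b) = c • cross a b := by
  apply E3_ext <;> simp [cross_apply_zero, cross_apply_one, cross_apply_two] <;> ring

theorem inner_cross_self (a b : E3) : inner ℝ (cross a b) b = 0 := by
  simp only [inner_E3, cross_apply_zero, cross_apply_one, cross_apply_two]
  ring

theorem inner_cross_left_self (a b : E3) : inner ℝ (cross a b) a = 0 := by
  simp only [inner_E3, cross_apply_zero, cross_apply_one, cross_apply_two]
  ring

theorem norm_cross_le (a b : E3) : ‖cross a b‖ ≤ ‖a‖ * ‖b‖ := by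
  refine abs_le_of_sq_le_sq' ?_ (by positivity) |>.2
  rw [mul_pow, norm_sq_E3, norm_sq_E3, norm_sq_E3]
  simp only [cross_apply_zero, cross_apply_one, cross_apply_two]
  nlinarith [sq_nonneg (a 0 * b 0 + a 1 * b 1 + a 2 * b 2)]

/-- The vector product as a continuous bilinear map. -/
noncomputable def crossL : E3 →L[ℝ] E3 →L[ℝ] E3 :=
  LinearMap.mkContinuous₂ (LinearMap.mk₂ ℝ cross cross_add_left cross_smul_left cross_add_right
    cross_smul_right) 1 fun a b => by simpa using norm_cross_le a b

theorem crossL_apply (a b : E3) : crossL a b = cross a b := rfl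

theorem cross_sub_left (a a' b : E3) : cross (a - a') b = cross a b - cross a' b := by
  simp only [← crossL_apply, map_sub, _root_.sub_apply]

theorem cross_sub_right (a b b' : E3) : cross a (b - b') = cross a b - cross a b' := by
  simp only [← crossL_apply, map_sub]

theorem aestronglyMeasurable_cross {X : Type*} [MeasurableSpace X] {μ : Measure X} {f g : X → E3}
    (hf : AEStronglyMeasurable f μ) (hg : AEStronglyMeasurable g μ) :
    AEStronglyMeasurable (fun x => cross (f x) (g x)) μ :=
  crossL.aestronglyMeasurable_comp₂ hf hg

theorem memLp_cross {X : Type*} [MeasurableSpace X] {μ : Measure X} {f g : X → E3} {C : ℝ}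
    (hf : AEStronglyMeasurable f μ) (hC : ∀ᵐ x ∂μ, ‖f x‖ ≤ C) (hg : MemLp g 2 μ) :
    MemLp (fun x => cross (f x) (g x)) 2 μ := by
  refine hg.of_le_mul (c := C) (aestronglyMeasurable_cross hf hg.1) ?_
  filter_upwards [hC] with x hx
  exact (norm_cross_le _ _).trans (mul_le_mul_of_nonneg_right hx (norm_nonneg _))

theorem memLp_cross' {X : Type*} [MeasurableSpace X] {μ : Measure X} {f g : X → E3} {C : ℝ}
    (hf : MemLp f 2 μ) (hg : AEStronglyMeasurable g μ) (hC : ∀ᵐ x ∂μ, ‖g x‖ ≤ C) :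
    MemLp (fun x => cross (f x) (g x)) 2 μ := by
  refine hf.of_le_mul (c := C) (aestronglyMeasurable_cross hf.1 hg) ?_
  filter_upwards [hC] with x hx
  refine (norm_cross_le _ _).trans ?_
  rw [mul_comm]
  exact mul_le_mul_of_nonneg_right hx (norm_nonneg _)

end Cross

/-! ### Bilinearity of the Dirichlet form on Courant functions -/

section GradInner

variable {Ω : Set E3} {M : TetMesh Ω}
variable {F : Type*} [NormedAddCommGroup F] [InnerProductSpace ℝ F] [FiniteDimensional ℝ F]

theorem gradInner_comm (u w : E3 → F) : gradInner Ω u w = gradInner Ω w u := by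
  simp only [gradInner, real_inner_comm]

theorem gradInner_congr (hΩ : IsOpen Ω) {u u' w w' : E3 → F} (hu : Set.EqOn u u' Ω)
    (hw : Set.EqOn w w' Ω) : gradInner Ω u w = gradInner Ω u' w' := by
  have h1 : u =ᵐ[volume.restrict Ω] u' := by
    filter_upwards [ae_restrict_mem hΩ.measurableSet] with x hx using hu hx
  have h2 : w =ᵐ[volume.restrict Ω] w' := by
    filter_upwards [ae_restrict_mem hΩ.measurableSet] with x hx using hw hx
  simp only [gradInner, weakDeriv_congr h1, weakDeriv_congr h2]

theorem fderiv_add_ae (hΩ : IsLipschitzDomain Ω) {u w : E3 → F} (hu : u ∈ courant M F)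
    (hw : w ∈ courant M F) (e : E3) : ∀ᵐ x ∂(volume.restrict Ω),
      fderiv ℝ (fun x => u x + w x) x e = fderiv ℝ u x e + fderiv ℝ w x e := by
  filter_upwards [M.ae_mem_interior hΩ.isOpen] with x hx
  obtain ⟨s, hs, hxs⟩ := hx
  rw [fderiv_fun_add (differentiableAt_of_interior hu hs hxs)
    (differentiableAt_of_interior hw hs hxs)]
  rfl

theorem fderiv_smul_ae (hΩ : IsLipschitzDomain Ω) {u : E3 → F} (hu : u ∈ courant M F)
    (c : ℝ) (e : E3) : ∀ᵐ x ∂(volume.restrict Ω),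
      fderiv ℝ (fun x => c • u x) x e = c • fderiv ℝ u x e := by
  filter_upwards [M.ae_mem_interior hΩ.isOpen] with x hx
  obtain ⟨s, hs, hxs⟩ := hx
  rw [fderiv_fun_const_smul (differentiableAt_of_interior hu hs hxs)]
  rfl

theorem gradInner_add_left (hΩ : IsLipschitzDomain Ω) {u u' w : E3 → F} (hu : u ∈ courant M F)
    (hu' : u' ∈ courant M F) (hw : w ∈ courant M F) :
    gradInner Ω (fun x => u x + u' x) w = gradInner Ω u w + gradInner Ω u' w := by
  rw [gradInner_of_courant hΩ (courant_add hu hu') hw, gradInner_of_courant hΩ hu hw,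
    gradInner_of_courant hΩ hu' hw, ← Finset.sum_add_distrib]
  refine Finset.sum_congr rfl fun i _ => ?_
  rw [← integral_add (integrable_inner (memLp_fderiv_of_courant hΩ hu _ 2)
    (memLp_fderiv_of_courant hΩ hw _ 2)) (integrable_inner (memLp_fderiv_of_courant hΩ hu' _ 2)
    (memLp_fderiv_of_courant hΩ hw _ 2))]
  refine integral_congr_ae ?_
  filter_upwards [fderiv_add_ae hΩ hu hu' (basisVec i)] with x hx
  rw [hx, inner_add_left]

theorem gradInner_smul_left (hΩ : IsLipschitzDomain Ω) {u w : E3 → F} (c : ℝ)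
    (hu : u ∈ courant M F) (hw : w ∈ courant M F) :
    gradInner Ω (fun x => c • u x) w = c * gradInner Ω u w := by
  rw [gradInner_of_courant hΩ (courant_smul c hu) hw, gradInner_of_courant hΩ hu hw,
    Finset.mul_sum]
  refine Finset.sum_congr rfl fun i _ => ?_
  rw [← integral_const_mul]
  refine integral_congr_ae ?_
  filter_upwards [fderiv_smul_ae hΩ hu c (basisVec i)] with x hx
  rw [hx, real_inner_smul_left]

theorem gradInner_add_right (hΩ : IsLipschitzDomain Ω) {u u' w : E3 → F} (hu : u ∈ courant M F)
    (hu' : u' ∈ courant M F) (hw : w ∈ courant M F) :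
    gradInner Ω w (fun x => u x + u' x) = gradInner Ω w u + gradInner Ω w u' := by
  rw [gradInner_comm, gradInner_add_left hΩ hu hu' hw, gradInner_comm u, gradInner_comm u']

theorem gradInner_smul_right (hΩ : IsLipschitzDomain Ω) {u w : E3 → F} (c : ℝ)
    (hu : u ∈ courant M F) (hw : w ∈ courant M F) :
    gradInner Ω w (fun x => c • u x) = c * gradInner Ω w u := by
  rw [gradInner_comm, gradInner_smul_left hΩ c hu hw, gradInner_comm]

theorem gradNormSq_add_smul (hΩ : IsLipschitzDomain Ω) {u w : E3 → F} (c : ℝ)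
    (hu : u ∈ courant M F) (hw : w ∈ courant M F) :
    gradNormSq Ω (fun x => u x + c • w x)
      = gradNormSq Ω u + 2 * c * gradInner Ω u w + c ^ 2 * gradNormSq Ω w := by
  have hcw := courant_smul c hw
  simp only [gradNormSq_eq_gradInner]
  rw [gradInner_add_left hΩ hu hcw (courant_add hu hcw), gradInner_add_right hΩ hu hcw hu,
    gradInner_add_right hΩ hu hcw hcw, gradInner_smul_right hΩ c hw hu,
    gradInner_smul_left hΩ c hw hu, gradInner_smul_left hΩ c hw hcw,
    gradInner_smul_right hΩ c hw hw, gradInner_comm w u]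
  ring

end GradInner

/-! ### The angle condition and decay of energy under normalization -/

section Angle

variable {Ω : Set E3} {M : TetMesh Ω}

open Classical in
/-- The nodal hat function of a node. -/
noncomputable def hat (M : TetMesh Ω) (z : E3) : E3 → ℝ :=
  M.interp fun z' => if z' = z then 1 else 0

theorem isHat_hat {z : E3} (hz : z ∈ M.nodes) : IsHat M z (hat M z) := by
  refine ⟨M.interp_mem _, ?_, fun z' hz' hne => ?_⟩
  · rw [hat, M.interp_node _ hz, if_pos rfl]
  · rw [hat, M.interp_node _ hz', if_neg hne]

theorem hat_mem (z : E3) : hat M z ∈ courant M ℝ := M.interp_mem _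

variable {F : Type*} [NormedAddCommGroup F] [InnerProductSpace ℝ F] [FiniteDimensional ℝ F]

theorem courant_hat_sum (c : E3 → F) :
    (fun x => ∑ z ∈ M.finite_nodes.toFinset, hat M z x • c z) ∈ courant M F := by
  refine ⟨continuousOn_finsetSum _ fun z _ => ((hat_mem z).1.smul continuousOn_const),
    fun s hs => ?_⟩
  choose A hA using fun z => (hat_mem (M := M) z).2 s hs
  obtain ⟨B, hB⟩ := M.exists_affine hs
    (fun x => ∑ z ∈ M.finite_nodes.toFinset, A z x • c z)
  refine ⟨B, fun x hx => ?_⟩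
  obtain ⟨w, -, h1, h2⟩ := TetMesh.hull_combination hx
  simp only
  rw [← h2, TetMesh.affine_sum _ _ _ _ h1, h2]
  have e1 : ∀ z ∈ s, w z • B z
      = ∑ y ∈ M.finite_nodes.toFinset, (w z * A y z) • c y := fun z hz => by
    rw [hB z hz, Finset.smul_sum]
    exact Finset.sum_congr rfl fun y _ => by rw [mul_smul]
  rw [Finset.sum_congr rfl e1, Finset.sum_comm]
  refine Finset.sum_congr rfl fun y _ => ?_
  rw [← Finset.sum_smul, hA y hx, ← h2, TetMesh.affine_sum _ _ _ _ h1]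
  simp

theorem hat_expansion {u : E3 → F} (hu : u ∈ courant M F) :
    Set.EqOn u (fun x => ∑ z ∈ M.finite_nodes.toFinset, hat M z x • u z) (closure Ω) := by
  refine courant_ext hu (courant_hat_sum u) fun z hz => ?_
  rw [Finset.sum_eq_single z]
  · rw [(isHat_hat hz).2.1, one_smul]
  · intro y hy hyz
    rw [Set.Finite.mem_toFinset] at hy
    rw [(isHat_hat hy).2.2 z hz hyz.symm, zero_smul]
  · intro h
    exact absurd (M.finite_nodes.mem_toFinset.2 hz) h

theorem fderiv_hat_expansion {u : E3 → F} (hu : u ∈ courant M F) {s : Finset E3}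
    (hs : s ∈ M.tets) {x : E3} (hx : x ∈ interior (hull s)) (e : E3) :
    fderiv ℝ u x e = ∑ z ∈ M.finite_nodes.toFinset, fderiv ℝ (hat M z) x e • u z := by
  have h1 : u =ᶠ[𝓝 x] fun x => ∑ z ∈ M.finite_nodes.toFinset, hat M z x • u z := by
    filter_upwards [isOpen_interior.mem_nhds hx] with y hy
    exact hat_expansion hu (M.hull_subset hs (interior_subset hy))
  rw [h1.fderiv_eq]
  have hd : ∀ z ∈ M.finite_nodes.toFinset, HasFDerivAt (fun x => hat M z x • u z)
      ((fderiv ℝ (hat M z) x).smulRight (u z)) x := fun z _ =>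
    ((differentiableAt_of_interior (hat_mem z) hs hx).hasFDerivAt).smul_const (u z)
  rw [(HasFDerivAt.fun_sum hd).fderiv]
  simp

theorem gradInner_eq_sum (hΩ : IsLipschitzDomain Ω) {u w : E3 → F} (hu : u ∈ courant M F)
    (hw : w ∈ courant M F) :
    gradInner Ω u w = ∑ z ∈ M.finite_nodes.toFinset, ∑ y ∈ M.finite_nodes.toFinset,
      gradInner Ω (hat M z) (hat M y) * inner ℝ (u z) (w y) := by
  have hint : ∀ z y i, Integrable (fun x => inner ℝ (fderiv ℝ (hat M z) x (basisVec i))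
      (fderiv ℝ (hat M y) x (basisVec i)) * inner ℝ (u z) (w y)) (volume.restrict Ω) :=
    fun z y i => (integrable_inner (memLp_fderiv_of_courant hΩ (hat_mem z) _ 2)
      (memLp_fderiv_of_courant hΩ (hat_mem y) _ 2)).mul_const _
  rw [gradInner_of_courant hΩ hu hw]
  have e1 : ∀ i, ∫ x in Ω, inner ℝ (fderiv ℝ u x (basisVec i)) (fderiv ℝ w x (basisVec i))
      = ∑ z ∈ M.finite_nodes.toFinset, ∑ y ∈ M.finite_nodes.toFinset,
        ∫ x in Ω, inner ℝ (fderiv ℝ (hat M z) x (basisVec i))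
          (fderiv ℝ (hat M y) x (basisVec i)) * inner ℝ (u z) (w y) := fun i => by
    simp_rw [← integral_finsetSum _ fun y _ => hint _ y i]
    rw [← integral_finsetSum _ fun z _ => integrable_finsetSum _ fun y _ => hint z y i]
    refine integral_congr_ae ?_
    filter_upwards [M.ae_mem_interior hΩ.isOpen] with x hx
    obtain ⟨s, hs, hxs⟩ := hx
    rw [fderiv_hat_expansion hu hs hxs, fderiv_hat_expansion hw hs hxs, sum_inner]
    refine Finset.sum_congr rfl fun z _ => ?_
    rw [inner_sum]
    refine Finset.sum_congr rfl fun y _ => ?_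
    rw [real_inner_smul_left, real_inner_smul_right]
    simp only [RCLike.inner_apply, conj_trivial]
    ring
  simp_rw [e1, gradInner_of_courant hΩ (hat_mem _) (hat_mem _), Finset.sum_mul,
    integral_mul_const]
  rw [Finset.sum_comm]
  exact Finset.sum_congr rfl fun z _ => Finset.sum_comm

/-- The hat functions sum to the constant one, whose gradient vanishes, so the stiffness matrix has
zero row sums. -/
theorem sum_gradInner_hat (hΩ : IsLipschitzDomain Ω) (z : E3) :
    ∑ y ∈ M.finite_nodes.toFinset, gradInner Ω (hat M z) (hat M y) = 0 := by
  have h1 : (fun _ : E3 => (1 : ℝ)) ∈ courant M ℝ :=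
    ⟨continuousOn_const, fun s _ => ⟨AffineMap.const ℝ E3 1, fun x _ => rfl⟩⟩
  simp_rw [gradInner_of_courant hΩ (hat_mem _) (hat_mem _)]
  rw [Finset.sum_comm]
  refine Finset.sum_eq_zero fun i _ => ?_
  rw [← integral_finsetSum _ fun y _ => integrable_inner
    (memLp_fderiv_of_courant hΩ (hat_mem z) _ 2) (memLp_fderiv_of_courant hΩ (hat_mem y) _ 2)]
  refine integral_eq_zero_of_ae ?_
  filter_upwards [M.ae_mem_interior hΩ.isOpen] with x hx
  obtain ⟨s, hs, hxs⟩ := hx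
  have := fderiv_hat_expansion h1 hs hxs (basisVec i)
  simp only [fderiv_fun_const, Pi.zero_apply, _root_.zero_apply, smul_eq_mul,
    mul_one] at this
  rw [← inner_sum, ← this, inner_zero_right]
  rfl

/-- Under the angle condition, a nodewise contraction does not increase the Dirichlet energy. -/
theorem gradNormSq_le_of_contraction (hΩ : IsLipschitzDomain Ω) (hM : AngleCondition M)
    {u w : E3 → F} (hu : u ∈ courant M F) (hw : w ∈ courant M F)
    (h : ∀ z ∈ M.nodes, ∀ y ∈ M.nodes, ‖w z - w y‖ ≤ ‖u z - u y‖) :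
    gradNormSq Ω w ≤ gradNormSq Ω u := by
  -- Zero row sums let the squares of the single nodal values be added for free. The energy becomes
  -- a sum of squared nodal differences whose off-diagonal weights are nonnegative by the angle
  -- condition.
  have key : ∀ u : E3 → F, u ∈ courant M F → gradNormSq Ω u
      = ∑ z ∈ M.finite_nodes.toFinset, ∑ y ∈ M.finite_nodes.toFinset,
        (-(1 / 2) * gradInner Ω (hat M z) (hat M y)) * ‖u z - u y‖ ^ 2 := fun u hu => by
    have e1 : ∀ z y, (-(1 / 2) * gradInner Ω (hat M z) (hat M y)) * ‖u z - u y‖ ^ 2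
        = gradInner Ω (hat M z) (hat M y) * inner ℝ (u z) (u y)
          - (1 / 2) * ‖u z‖ ^ 2 * gradInner Ω (hat M z) (hat M y)
          - (1 / 2) * ‖u y‖ ^ 2 * gradInner Ω (hat M y) (hat M z) := fun z y => by
      rw [norm_sub_sq_real, gradInner_comm (hat M y)]
      ring
    simp_rw [e1, Finset.sum_sub_distrib]
    rw [gradNormSq_eq_gradInner, gradInner_eq_sum hΩ hu hu]
    simp_rw [← Finset.mul_sum]
    rw [Finset.sum_comm (f := fun z y => 1 / 2 * ‖u y‖ ^ 2 * gradInner Ω (hat M y) (hat M z))]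
    simp_rw [← Finset.mul_sum, sum_gradInner_hat hΩ]
    simp
  rw [key u hu, key w hw]
  refine Finset.sum_le_sum fun z hz => Finset.sum_le_sum fun y hy => ?_
  rw [Set.Finite.mem_toFinset] at hz hy
  by_cases hzy : z = y
  · simp [hzy]
  · have h1 := hM z hz y hy hzy _ _ (isHat_hat hz) (isHat_hat hy)
    exact mul_le_mul_of_nonneg_left (pow_le_pow_left₀ (norm_nonneg _) (h z hz y hy) 2)
      (by linarith)

/-- With `c` the cosine of the angle, the difference of the squared distances is `(|a| - |b|)² + 2
(|a| |b| - 1) (1 - c)`, and both summands are nonnegative outside the unit ball. -/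
theorem norm_normalize_sub_le {F : Type*} [NormedAddCommGroup F] [InnerProductSpace ℝ F] {a b : F}
    (ha : 1 ≤ ‖a‖) (hb : 1 ≤ ‖b‖) :
    ‖‖a‖⁻¹ • a - ‖b‖⁻¹ • b‖ ≤ ‖a - b‖ := by
  refine abs_le_of_sq_le_sq' ?_ (norm_nonneg _) |>.2
  rw [norm_sub_sq_real, norm_sub_sq_real, norm_smul, norm_smul, norm_inv, norm_norm, norm_inv,
    norm_norm, inv_mul_cancel₀ (by positivity), inv_mul_cancel₀ (by positivity),
    real_inner_smul_left, real_inner_smul_right]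
  have hab : 1 ≤ ‖a‖ * ‖b‖ := one_le_mul_of_one_le_of_one_le ha hb
  have hpos : 0 < ‖a‖ * ‖b‖ := by linarith
  set c : ℝ := ‖a‖⁻¹ * (‖b‖⁻¹ * inner ℝ a b) with hc
  have hin : inner ℝ a b = ‖a‖ * ‖b‖ * c := by
    rw [hc]; field_simp
  have hc1 : c ≤ 1 := by
    have := real_inner_le_norm a b
    rw [hin] at this
    nlinarith
  rw [hin]
  nlinarith [sq_nonneg (‖a‖ - ‖b‖), mul_nonneg (sub_nonneg.2 hc1) (sub_nonneg.2 hab)]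

end Angle

end LLG

/-! ### Solvability of a step and existence of the discrete evolution -/

namespace LLG

variable {Ω : Set E3} {M : TetMesh Ω}

theorem setIntegral_inner_congr (hΩ : IsOpen Ω) {u u' w w' : E3 → E3} (hu : Set.EqOn u u' Ω)
    (hw : Set.EqOn w w' Ω) : ∫ x in Ω, inner ℝ (u x) (w x) = ∫ x in Ω, inner ℝ (u' x) (w' x) :=
  setIntegral_congr_fun hΩ.measurableSet fun x hx => by simp only [hu hx, hw hx]

theorem integral_inner_add_left {X : Type*} [MeasurableSpace X] {μ : Measure X} {u u' w : X → E3}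
    (hu : MemLp u 2 μ) (hu' : MemLp u' 2 μ) (hw : MemLp w 2 μ) :
    ∫ x, inner ℝ (u x + u' x) (w x) ∂μ = ∫ x, inner ℝ (u x) (w x) ∂μ
      + ∫ x, inner ℝ (u' x) (w x) ∂μ := by
  simp_rw [inner_add_left]
  exact integral_add (integrable_inner hu hw) (integrable_inner hu' hw)

theorem integral_inner_add_right {X : Type*} [MeasurableSpace X] {μ : Measure X} {u u' w : X → E3}
    (hu : MemLp u 2 μ) (hu' : MemLp u' 2 μ) (hw : MemLp w 2 μ) :
    ∫ x, inner ℝ (w x) (u x + u' x) ∂μ = ∫ x, inner ℝ (w x) (u x) ∂μ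
      + ∫ x, inner ℝ (w x) (u' x) ∂μ := by
  simp_rw [inner_add_right]
  exact integral_add (integrable_inner hw hu) (integrable_inner hw hu')

theorem integral_inner_smul_left {X : Type*} [MeasurableSpace X] {μ : Measure X} (c : ℝ)
    (u w : X → E3) : ∫ x, inner ℝ (c • u x) (w x) ∂μ = c * ∫ x, inner ℝ (u x) (w x) ∂μ := by
  simp_rw [real_inner_smul_left]
  exact integral_const_mul _ _

theorem integral_inner_smul_right {X : Type*} [MeasurableSpace X] {μ : Measure X} (c : ℝ)
    (u w : X → E3) : ∫ x, inner ℝ (u x) (c • w x) ∂μ = c * ∫ x, inner ℝ (u x) (w x) ∂μ := by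
  simp_rw [real_inner_smul_right]
  exact integral_const_mul _ _

/-- The bilinear form of the tangent plane scheme. -/
noncomputable def stepForm (Ω : Set E3) (α c : ℝ) (m v ψ : E3 → E3) : ℝ :=
  α * (∫ x in Ω, inner ℝ (v x) (ψ x)) + c * gradInner Ω v ψ
    + ∫ x in Ω, inner ℝ (cross (m x) (v x)) (ψ x)

/-- The right-hand side of the tangent plane scheme. -/
noncomputable def stepLoad (Ω : Set E3) (c : ℝ) (m p f ψ : E3 → E3) : ℝ :=
  -c * gradInner Ω m ψ - (∫ x in Ω, inner ℝ (p x) (ψ x)) + ∫ x in Ω, inner ℝ (f x) (ψ x)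

theorem memLp_cross_courant (hΩ : IsLipschitzDomain Ω) {m v : E3 → E3} (hm : m ∈ courant M E3)
    (hv : v ∈ courant M E3) : MemLp (fun x => cross (m x) (v x)) 2 (volume.restrict Ω) := by
  obtain ⟨C, hC⟩ := exists_norm_bound hm
  refine memLp_cross (C := C) (aestronglyMeasurable_of_courant hΩ.isOpen hm) ?_
    (memLp_of_courant hΩ hv 2)
  filter_upwards [ae_restrict_mem hΩ.isOpen.measurableSet] with x hx using hC x (subset_closure hx)

section StepForm

variable (hΩ : IsLipschitzDomain Ω) (α c : ℝ) {m v v' ψ ψ' p f : E3 → E3}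

include hΩ

theorem stepForm_congr (hv : Set.EqOn v v' Ω) (hψ : Set.EqOn ψ ψ' Ω) :
    stepForm Ω α c m v ψ = stepForm Ω α c m v' ψ' := by
  rw [stepForm, stepForm, setIntegral_inner_congr hΩ.isOpen hv hψ, gradInner_congr hΩ.isOpen hv hψ,
    setIntegral_inner_congr hΩ.isOpen (u' := fun x => cross (m x) (v' x))
      (fun x hx => by simp only [hv hx]) hψ]

theorem stepLoad_congr (hψ : Set.EqOn ψ ψ' Ω) : stepLoad Ω c m p f ψ = stepLoad Ω c m p f ψ' := by
  rw [stepLoad, stepLoad, gradInner_congr hΩ.isOpen (fun _ _ => rfl) hψ,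
    setIntegral_inner_congr hΩ.isOpen (u := p) (fun _ _ => rfl) hψ,
    setIntegral_inner_congr hΩ.isOpen (u := f) (fun _ _ => rfl) hψ]

theorem stepForm_add_left (hm : m ∈ courant M E3) (hv : v ∈ courant M E3)
    (hv' : v' ∈ courant M E3) (hψ : ψ ∈ courant M E3) :
    stepForm Ω α c m (fun x => v x + v' x) ψ = stepForm Ω α c m v ψ + stepForm Ω α c m v' ψ := by
  have h := memLp_of_courant hΩ hψ 2
  simp only [stepForm, cross_add_right]
  rw [integral_inner_add_left (memLp_of_courant hΩ hv 2) (memLp_of_courant hΩ hv' 2) h,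
    gradInner_add_left hΩ hv hv' hψ, integral_inner_add_left (memLp_cross_courant hΩ hm hv)
    (memLp_cross_courant hΩ hm hv') h]
  ring

theorem stepForm_add_right (hm : m ∈ courant M E3) (hv : v ∈ courant M E3)
    (hψ' : ψ' ∈ courant M E3) (hψ : ψ ∈ courant M E3) :
    stepForm Ω α c m v (fun x => ψ x + ψ' x) = stepForm Ω α c m v ψ + stepForm Ω α c m v ψ' := by
  have h := memLp_of_courant hΩ hψ 2
  have h' := memLp_of_courant hΩ hψ' 2
  simp only [stepForm]
  rw [integral_inner_add_right h h' (memLp_of_courant hΩ hv 2), gradInner_add_right hΩ hψ hψ' hv,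
    integral_inner_add_right h h' (memLp_cross_courant hΩ hm hv)]
  ring

theorem stepForm_smul_left (a : ℝ) (hv : v ∈ courant M E3) (hψ : ψ ∈ courant M E3) :
    stepForm Ω α c m (fun x => a • v x) ψ = a * stepForm Ω α c m v ψ := by
  simp only [stepForm, cross_smul_right]
  rw [integral_inner_smul_left, gradInner_smul_left hΩ a hv hψ, integral_inner_smul_left]
  ring

theorem stepForm_smul_right (a : ℝ) (hv : v ∈ courant M E3) (hψ : ψ ∈ courant M E3) :
    stepForm Ω α c m v (fun x => a • ψ x) = a * stepForm Ω α c m v ψ := by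
  simp only [stepForm]
  rw [integral_inner_smul_right, gradInner_smul_right hΩ a hψ hv, integral_inner_smul_right]
  ring

theorem stepLoad_add (hm : m ∈ courant M E3) (hψ : ψ ∈ courant M E3)
    (hψ' : ψ' ∈ courant M E3) (hp : MemLp p 2 (volume.restrict Ω))
    (hf : MemLp f 2 (volume.restrict Ω)) :
    stepLoad Ω c m p f (fun x => ψ x + ψ' x) = stepLoad Ω c m p f ψ + stepLoad Ω c m p f ψ' := by
  have h := memLp_of_courant hΩ hψ 2
  have h' := memLp_of_courant hΩ hψ' 2
  simp only [stepLoad]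
  rw [integral_inner_add_right h h' hp, gradInner_add_right hΩ hψ hψ' hm,
    integral_inner_add_right h h' hf]
  ring

theorem stepLoad_smul (a : ℝ) (hm : m ∈ courant M E3) (hψ : ψ ∈ courant M E3) :
    stepLoad Ω c m p f (fun x => a • ψ x) = a * stepLoad Ω c m p f ψ := by
  simp only [stepLoad]
  rw [integral_inner_smul_right, gradInner_smul_right hΩ a hψ hm, integral_inner_smul_right]
  ring

end StepForm

theorem integral_inner_cross_self (Ω : Set E3) (m v : E3 → E3) :
    ∫ x in Ω, inner ℝ (cross (m x) (v x)) (v x) = 0 := by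
  simp [inner_cross_self]

theorem stepForm_self (α c : ℝ) (m v : E3 → E3) :
    stepForm Ω α c m v v = α * (∫ x in Ω, ‖v x‖ ^ 2) + c * gradNormSq Ω v := by
  rw [stepForm, integral_inner_cross_self, gradNormSq_eq_gradInner]
  simp only [real_inner_self_eq_norm_sq, add_zero]

/-- Definiteness of the `L²` norm on nodal values: every node is a vertex of a tetrahedron, and
tetrahedra have positive volume. -/
theorem eq_zero_of_integral_norm_sq (hΩ : IsLipschitzDomain Ω) {v : E3 → E3}
    (hv : v ∈ courant M E3) (h : ∫ x in Ω, ‖v x‖ ^ 2 = 0) {z : E3} (hz : z ∈ M.nodes) :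
    v z = 0 := by
  have h0 : ∫⁻ x in Ω, ‖v x‖ₑ ^ 2 = 0 := by
    simp_rw [enorm_sq_eq]
    rw [← ofReal_integral_eq_lintegral_ofReal (integrable_norm_sq (memLp_of_courant hΩ hv 2))
      (ae_of_all _ fun x => sq_nonneg _), h, ENNReal.ofReal_zero]
  rw [M.lintegral_eq_sum hΩ, Finset.sum_eq_zero_iff] at h0
  obtain ⟨s, hs, hzs⟩ := M.node_mem_tet hz
  obtain ⟨z₀, hz₀, hmax⟩ := s.exists_max_image (fun z => ‖v z‖) (M.nonempty_of_mem_tets hs)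
  have h1 := volume_mul_nodal_sq_le hv hs hz₀ hmax
  rw [h0 s (M.finite_tets.mem_toFinset.2 hs), mul_zero, nonpos_iff_eq_zero, mul_eq_zero] at h1
  have hpos : volume (hull s) ≠ 0 :=
    ((isOpen_interior.measure_pos volume (M.interior_hull_nonempty hs)).trans_le
      (measure_mono interior_subset)).ne'
  have h2 : v z₀ = 0 := by simpa using h1.resolve_right hpos
  have := hmax z hzs
  rw [h2, norm_zero] at this
  exact norm_le_zero_iff.1 this

/-- One step of the tangent plane scheme is solvable. -/
theorem exists_step (hΩ : IsLipschitzDomain Ω) {α c c' : ℝ} (hα : 0 < α) (hc : 0 ≤ c)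
    {m p f : E3 → E3} (hm : m ∈ courant M E3) (hp : MemLp p 2 (volume.restrict Ω))
    (hf : MemLp f 2 (volume.restrict Ω)) : ∃ v ∈ discreteTangent M m,
      ∀ ψ ∈ discreteTangent M m, stepForm Ω α c m v ψ = stepLoad Ω c' m p f ψ := by
  classical
  have : Finite M.nodes := M.finite_nodes
  have : Fintype M.nodes := Fintype.ofFinite _
  -- Tangential nodal values are finite-dimensional coordinates for the discrete tangent space.
  -- Courant functions are determined by them only on the closure of the domain, so linearity of the
  -- interpolation is recorded on `Ω`.
  let W : Submodule ℝ (M.nodes → E3) :=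
    { carrier := {w | ∀ z, inner ℝ (w z) (m z) = 0}
      add_mem' := fun ha hb z => by
        rw [Pi.add_apply, inner_add_left, ha z, hb z, add_zero]
      zero_mem' := fun z => by simp
      smul_mem' := fun a w hw z => by
        rw [Pi.smul_apply, real_inner_smul_left, hw z, mul_zero] }
  let I : W → E3 → E3 := fun w => M.interp fun x => if h : x ∈ M.nodes then w.1 ⟨x, h⟩ else 0
  have hIm : ∀ w, I w ∈ courant M E3 := fun w => M.interp_mem _
  have hIn : ∀ w (z : M.nodes), I w z = w.1 z := fun w z => by
    simp only [I]
    rw [M.interp_node _ z.2, dif_pos z.2]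
  have hIt : ∀ w, I w ∈ discreteTangent M m := fun w => ⟨hIm w, fun z hz => by
    rw [hIn w ⟨z, hz⟩]
    exact w.2 ⟨z, hz⟩⟩
  have hIadd : ∀ w w', Set.EqOn (I (w + w')) (fun x => I w x + I w' x) Ω := fun w w' =>
    (courant_ext (hIm _) (courant_add (hIm w) (hIm w')) fun z hz => by
      simp only [hIn _ ⟨z, hz⟩]; rfl).mono subset_closure
  have hIsmul : ∀ (a : ℝ) w, Set.EqOn (I (a • w)) (fun x => a • I w x) Ω := fun a w =>
    (courant_ext (hIm _) (courant_smul a (hIm w)) fun z hz => by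
      simp only [hIn _ ⟨z, hz⟩]; rfl).mono subset_closure
  let B : W →ₗ[ℝ] W →ₗ[ℝ] ℝ := LinearMap.mk₂ ℝ (fun w ψ => stepForm Ω α c m (I w) (I ψ))
    (fun w w' ψ => by
      rw [stepForm_congr hΩ α c (hIadd w w') (fun _ _ => rfl),
        stepForm_add_left hΩ α c hm (hIm _) (hIm _) (hIm _)])
    (fun a w ψ => by
      rw [stepForm_congr hΩ α c (hIsmul a w) (fun _ _ => rfl),
        stepForm_smul_left hΩ α c a (hIm _) (hIm _), smul_eq_mul])
    (fun w ψ ψ' => by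
      rw [stepForm_congr hΩ α c (fun _ _ => rfl) (hIadd ψ ψ'),
        stepForm_add_right hΩ α c hm (hIm _) (hIm _) (hIm _)])
    (fun a w ψ => by
      rw [stepForm_congr hΩ α c (fun _ _ => rfl) (hIsmul a ψ),
        stepForm_smul_right hΩ α c a (hIm _) (hIm _), smul_eq_mul])
  -- The form is not symmetric, but on the diagonal the vector product disappears and `α ‖v‖²`
  -- remains. So it is definite, and injectivity implies surjectivity onto the dual of equal
  -- dimension.
  have hinj : Function.Injective B := by
    rw [← LinearMap.ker_eq_bot, LinearMap.ker_eq_bot']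
    intro w hw
    have h0 : stepForm Ω α c m (I w) (I w) = 0 := congrArg (fun g => g w) hw
    rw [stepForm_self] at h0
    have h1 : 0 ≤ ∫ x in Ω, ‖I w x‖ ^ 2 := integral_nonneg fun _ => sq_nonneg _
    have h2 := mul_nonneg hc (gradNormSq_nonneg Ω (I w))
    have h3 : ∫ x in Ω, ‖I w x‖ ^ 2 = 0 := by
      have := mul_nonneg hα.le h1
      have : α * ∫ x in Ω, ‖I w x‖ ^ 2 = 0 := by linarith
      exact (mul_eq_zero.1 this).resolve_left hα.ne'
    ext1
    ext1 z
    rw [← hIn w z]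
    exact eq_zero_of_integral_norm_sq hΩ (hIm w) h3 z.2
  have hsurj : Function.Surjective B := by
    refine (LinearMap.injective_iff_surjective_of_finrank_eq_finrank ?_).1 hinj
    exact (Subspace.dual_finrank_eq (K := ℝ) (V := W)).symm
  let ℓ : W →ₗ[ℝ] ℝ :=
    { toFun := fun ψ => stepLoad Ω c' m p f (I ψ)
      map_add' := fun ψ ψ' => by
        rw [stepLoad_congr hΩ c' (hIadd ψ ψ'), stepLoad_add hΩ c' hm (hIm _) (hIm _) hp hf]
      map_smul' := fun a ψ => by
        rw [stepLoad_congr hΩ c' (hIsmul a ψ), stepLoad_smul hΩ c' a hm (hIm _)]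
        rfl }
  obtain ⟨w, hw⟩ := hsurj ℓ
  refine ⟨I w, hIt w, fun ψ hψ => ?_⟩
  let ψ' : W := ⟨fun z => ψ z, fun z => hψ.2 z z.2⟩
  have hψψ' : Set.EqOn ψ (I ψ') Ω :=
    (courant_ext hψ.1 (hIm _) fun z hz => (hIn ψ' ⟨z, hz⟩).symm).mono subset_closure
  rw [stepForm_congr hΩ α c (fun _ _ => rfl) hψψ', stepLoad_congr hΩ c' hψψ']
  exact congrArg (fun g => g ψ') hw

/-- Pythagoras: the increment is orthogonal to `m`, so a step never moves towards the origin. -/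
theorem norm_add_smul_sq {m v : E3} (k : ℝ) (hm : ‖m‖ = 1) (hv : inner ℝ v m = 0) :
    ‖m + k • v‖ ^ 2 = 1 + k ^ 2 * ‖v‖ ^ 2 := by
  rw [norm_add_sq_real, real_inner_smul_right, real_inner_comm, hv, norm_smul, mul_pow, hm]
  simp

theorem one_le_norm_add_smul {m v : E3} (k : ℝ) (hm : ‖m‖ = 1) (hv : inner ℝ v m = 0) :
    1 ≤ ‖m + k • v‖ := by
  have := norm_add_smul_sq k hm hv
  nlinarith [norm_nonneg (m + k • v), mul_nonneg (sq_nonneg k) (sq_nonneg ‖v‖)]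

/-- The integrator is well-defined. -/
theorem exists_integratorOutput (hΩ : IsLipschitzDomain Ω) {α Cex θ k : ℝ} (hα : 0 < α)
    (hCex : 0 ≤ Cex) (hθ : 0 ≤ θ) (hk : 0 ≤ k) (N : ℕ) {Y : Type*} (πh : H1 Ω → Y → L2 Ω)
    (f : ℕ → L2 Ω) (ζ : ℕ → Y) {m0 : E3 → E3} (hm0 : m0 ∈ discreteMag M) :
    ∃ m v, IsIntegratorOutput M α Cex θ k N πh f ζ m0 m v := by
  have hstep : ∀ (m : discreteMag M) (i : ℕ), ∃ v ∈ discreteTangent M m.1,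
      ∀ ψ ∈ discreteTangent M m.1, stepForm Ω α (Cex * k * θ) m.1 v ψ
        = stepLoad Ω Cex m.1 (πh (toH1 Ω m.1) (ζ i)) (f i) ψ := fun m i =>
    exists_step hΩ hα (by positivity) m.2.1 (Lp.memLp _) (Lp.memLp _)
  choose V hV hVψ using hstep
  have hnext : ∀ (m : discreteMag M) (i : ℕ),
      M.interp (fun z => ‖m.1 z + k • V m i z‖⁻¹ • (m.1 z + k • V m i z)) ∈ discreteMag M := by
    refine fun m i => ⟨M.interp_mem _, fun z hz => ?_⟩
    have h1 := one_le_norm_add_smul k (m.2.2 z hz) ((hV m i).2 z hz)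
    rw [M.interp_node _ hz, norm_smul, norm_inv, norm_norm,
      inv_mul_cancel₀ (by positivity)]
  -- The recursion runs in the set of discrete magnetizations, which carries the nodal unit length
  -- needed to normalize the next step.
  let seq : ℕ → discreteMag M := fun n => Nat.rec ⟨m0, hm0⟩ (fun i m => ⟨_, hnext m i⟩) n
  refine ⟨fun i => (seq i).1, fun i => V (seq i) i, ⟨rfl, fun i _ => hV _ _, fun i _ ψ hψ => ?_,
    fun i _ => (seq (i + 1)).2, fun i _ z hz => ?_⟩⟩
  · exact hVψ (seq i) i ψ hψ
  · exact M.interp_node _ hz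

end LLG

/-! ### Discrete energy estimates -/

namespace LLG

variable {Ω : Set E3} {M : TetMesh Ω}

/-- Each step costs a factor `1 + k q ≤ exp (q k)`. The old value stands on the right-hand side, so
no smallness of `k` is required. -/
theorem discrete_gronwall_bound {x g : ℕ → ℝ} {k q : ℝ} (hk : 0 ≤ k) (hq : 0 ≤ q) {N : ℕ}
    (hx : ∀ j, 0 ≤ x j) (hg : ∀ j, 0 ≤ g j)
    (h : ∀ j < N, x (j + 1) ≤ (1 + k * q) * x j + g j) :
    ∀ j ≤ N, x j ≤ Real.exp (q * (k * j)) * (x 0 + ∑ i ∈ Finset.range j, g i) := by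
  intro j
  induction j with
  | zero => intro _; simp
  | succ j ih =>
    intro hj
    have h1 := ih (by omega)
    have h2 : 1 + k * q ≤ Real.exp (q * k) := by
      have := Real.add_one_le_exp (q * k); linarith
    have h3 : 1 ≤ Real.exp (q * (k * ((j + 1 : ℕ) : ℝ))) :=
      Real.one_le_exp (by positivity)
    have h4 : Real.exp (q * (k * ((j + 1 : ℕ) : ℝ)))
        = Real.exp (q * k) * Real.exp (q * (k * j)) := by
      rw [← Real.exp_add]
      congr 1
      push_cast
      ring
    rw [Finset.sum_range_succ]
    calc x (j + 1) ≤ (1 + k * q) * x j + g j := h j (by omega)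
      _ ≤ Real.exp (q * k) * (Real.exp (q * (k * j)) * (x 0 + ∑ i ∈ Finset.range j, g i))
          + Real.exp (q * (k * ((j + 1 : ℕ) : ℝ))) * g j := by
          refine add_le_add (mul_le_mul h2 h1 (hx j) (Real.exp_nonneg _)) ?_
          exact le_mul_of_one_le_left (hg j) h3
      _ = _ := by rw [h4]; ring

theorem toH1_ae {u : E3 → E3} (h : MemH1 Ω u) :
    ((toH1 Ω u).1 : E3 → E3) =ᵐ[volume.restrict Ω] u := by
  have e : toH1 Ω u = ⟨h.1.toLp u, h.congr h.1.coeFn_toLp.symm⟩ := dif_pos h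
  rw [e]
  exact h.1.coeFn_toLp

theorem gradNormSq_congr {u u' : E3 → E3} (h : u =ᵐ[volume.restrict Ω] u') :
    gradNormSq Ω u = gradNormSq Ω u' := by
  simp only [gradNormSq, weakDeriv_congr h]

theorem integral_norm_sq_L2 (g : L2 Ω) : ∫ x in Ω, ‖g x‖ ^ 2 = ‖g‖ ^ 2 := by
  rw [integral_norm_sq_eq (Lp.memLp g), Lp.toLp_coeFn]

theorem norm_le_one_of_discreteMag {m : E3 → E3} (hm : m ∈ discreteMag M) {x : E3}
    (hx : x ∈ closure Ω) : ‖m x‖ ≤ 1 :=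
  norm_le_on_closure hm.1 (fun z hz => (hm.2 z hz).le) hx

theorem two_mul_integral_inner_le {X : Type*} [MeasurableSpace X] {μ : Measure X} {f g : X → E3}
    (hf : MemLp f 2 μ) (hg : MemLp g 2 μ) {c : ℝ} (hc : 0 < c) :
    2 * |∫ x, inner ℝ (f x) (g x) ∂μ| ≤ c * (∫ x, ‖g x‖ ^ 2 ∂μ) + c⁻¹ * ∫ x, ‖f x‖ ^ 2 ∂μ := by
  have h := abs_integral_inner_le hf hg
  set a := √(∫ x, ‖f x‖ ^ 2 ∂μ)
  set b := √(∫ x, ‖g x‖ ^ 2 ∂μ)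
  have ha : ∫ x, ‖f x‖ ^ 2 ∂μ = a ^ 2 := (Real.sq_sqrt (integral_nonneg fun _ => sq_nonneg _)).symm
  have hb : ∫ x, ‖g x‖ ^ 2 ∂μ = b ^ 2 := (Real.sq_sqrt (integral_nonneg fun _ => sq_nonneg _)).symm
  rw [ha, hb]
  have h2 : 0 ≤ c⁻¹ * (c * b - a) ^ 2 := by positivity
  have h3 : c⁻¹ * (c * b - a) ^ 2 = c * b ^ 2 + c⁻¹ * a ^ 2 - 2 * (a * b) := by
    field_simp
    ring
  linarith

namespace IsIntegratorOutput

variable {Y : Type*} [NormedAddCommGroup Y] {α Cex θ k : ℝ} {N : ℕ} {πh : H1 Ω → Y → L2 Ω}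
  {f : ℕ → L2 Ω} {ζ : ℕ → Y} {m0 : E3 → E3} {m v : ℕ → E3 → E3}

theorem mem_mag (H : IsIntegratorOutput M α Cex θ k N πh f ζ m0 m v) (hm0 : m0 ∈ discreteMag M) :
    ∀ i ≤ N, m i ∈ discreteMag M := by
  intro i hi
  rcases i with _ | i
  · rw [H.init]; exact hm0
  · exact H.mag i hi

/-- The new magnetization is the nodewise projection of `m + k v` onto the sphere, and all nodal
values of `m + k v` lie outside the open unit ball, where the projection is a contraction. -/
theorem gradNormSq_succ_le (H : IsIntegratorOutput M α Cex θ k N πh f ζ m0 m v)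
    (hm0 : m0 ∈ discreteMag M) (hΩ : IsLipschitzDomain Ω) (hM : AngleCondition M) {i : ℕ}
    (hi : i < N) : gradNormSq Ω (m (i + 1))
      ≤ gradNormSq Ω (m i) + 2 * k * gradInner Ω (m i) (v i) + k ^ 2 * gradNormSq Ω (v i) := by
  have hm := H.mem_mag hm0 i hi.le
  have hv := H.tangent i hi
  rw [← gradNormSq_add_smul hΩ k hm.1 hv.1]
  refine gradNormSq_le_of_contraction hΩ hM (courant_add hm.1 (courant_smul k hv.1))
    (H.mag i hi).1 fun z hz y hy => ?_
  rw [H.update i hi z hz, H.update i hi y hy]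
  exact norm_normalize_sub_le (one_le_norm_add_smul k (hm.2 z hz) (hv.2 z hz))
    (one_le_norm_add_smul k (hm.2 y hy) (hv.2 y hy))

theorem norm_pi_sq_le (H : IsIntegratorOutput M α Cex θ k N πh f ζ m0 m v)
    (hm0 : m0 ∈ discreteMag M) (hΩ : IsLipschitzDomain Ω) {Cπ Cζ : ℝ}
    (hπ : ∀ n : H1 Ω, (∀ᵐ x ∂(volume.restrict Ω), ‖n.1 x‖ ≤ 1) → ∀ y : Y, ‖y‖ ≤ Cζ →
      ‖πh n y‖ ≤ Cπ * (1 + √(gradNormSq Ω n.1)))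
    (hζ : ∀ j < N, ‖ζ j‖ ≤ Cζ) {i : ℕ} (hi : i < N) :
    ‖πh (toH1 Ω (m i)) (ζ i)‖ ^ 2 ≤ 2 * Cπ ^ 2 * (1 + gradNormSq Ω (m i)) := by
  have hm := H.mem_mag hm0 i hi.le
  have hae := toH1_ae (memH1_of_courant hΩ hm.1)
  have h1 := hπ (toH1 Ω (m i)) (by
    filter_upwards [hae, ae_restrict_mem hΩ.isOpen.measurableSet] with x hx hxΩ
    rw [hx]
    exact norm_le_one_of_discreteMag hm (subset_closure hxΩ)) (ζ i) (hζ i hi)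
  rw [gradNormSq_congr hae] at h1
  set g := gradNormSq Ω (m i) with hg
  have hg0 : 0 ≤ g := gradNormSq_nonneg Ω _
  have h2 := pow_le_pow_left₀ (norm_nonneg _) h1 2
  refine h2.trans ?_
  have h3 : (1 + √g) ^ 2 ≤ 2 * (1 + g) := by
    nlinarith [Real.sq_sqrt hg0, sq_nonneg (1 - √g)]
  rw [mul_pow]
  nlinarith [sq_nonneg Cπ]

/-- The energy balance of one step. -/
theorem energy_step (H : IsIntegratorOutput M α Cex θ k N πh f ζ m0 m v)
    (hm0 : m0 ∈ discreteMag M) (hΩ : IsLipschitzDomain Ω) (hM : AngleCondition M)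
    (hα : 0 < α) (hCex : 0 < Cex) (hk : 0 ≤ k) {i : ℕ} (hi : i < N) :
    Cex * gradNormSq Ω (m (i + 1)) + k * α * (∫ x in Ω, ‖v i x‖ ^ 2)
        + Cex * k ^ 2 * (2 * θ - 1) * gradNormSq Ω (v i)
      ≤ Cex * gradNormSq Ω (m i)
        + 2 * k / α * (‖f i‖ ^ 2 + ‖πh (toH1 Ω (m i)) (ζ i)‖ ^ 2) := by
  have hv := H.tangent i hi
  have h1 := H.gradNormSq_succ_le hm0 hΩ hM hi
  have h2 := H.step i hi (v i) hv
  rw [integral_inner_cross_self, ← gradNormSq_eq_gradInner] at h2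
  simp only [real_inner_self_eq_norm_sq] at h2
  have hvL := memLp_of_courant hΩ hv.1 2
  -- Weight `α / 2` for each of the two fields: after doubling, together they use `α ‖v‖²` out of
  -- the available `2 α ‖v‖²`.
  have h3 := two_mul_integral_inner_le (Lp.memLp (f i)) hvL (half_pos hα)
  have h4 := two_mul_integral_inner_le (Lp.memLp (πh (toH1 Ω (m i)) (ζ i))) hvL (half_pos hα)
  rw [integral_norm_sq_L2] at h3 h4
  set a := ∫ x in Ω, ‖v i x‖ ^ 2
  set P := ∫ x in Ω, inner ℝ ((πh (toH1 Ω (m i)) (ζ i)) x) (v i x)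
  set Q := ∫ x in Ω, inner ℝ ((f i) x) (v i x)
  set p := ‖πh (toH1 Ω (m i)) (ζ i)‖ ^ 2
  set q := ‖f i‖ ^ 2
  have h5 : 2 * (Q - P) ≤ α * a + 2 / α * (q + p) := by
    have e : (α / 2)⁻¹ = 2 / α := by rw [inv_div]
    rw [e] at h3 h4
    have := le_abs_self Q
    have := neg_abs_le P
    linarith
  have h6 := mul_le_mul_of_nonneg_left h1 hCex.le
  have h7 := mul_le_mul_of_nonneg_left h5 hk
  have e2 : 2 * k / α * (q + p) = k * (2 / α * (q + p)) := by ring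
  rw [e2]
  have h8 : Cex * gradInner Ω (m i) (v i) = Q - P - α * a - Cex * k * θ * gradNormSq Ω (v i) := by
    linarith
  have h9 : Cex * (gradNormSq Ω (m i) + 2 * k * gradInner Ω (m i) (v i)
      + k ^ 2 * gradNormSq Ω (v i)) = Cex * gradNormSq Ω (m i)
      + 2 * k * (Cex * gradInner Ω (m i) (v i)) + Cex * k ^ 2 * gradNormSq Ω (v i) := by ring
  rw [h9, h8] at h6
  nlinarith

end IsIntegratorOutput

/-- The constant of the discrete energy estimate. -/
noncomputable def energyConst (T α Cex Cπ B : ℝ) : ℝ :=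
  Real.exp (4 * Cπ ^ 2 / (α * Cex) * T) * (Cex + (Cex + 2 / α) * |B|)

theorem energyConst_pos {T α Cex : ℝ} (hα : 0 < α) (hCex : 0 < Cex) (Cπ B : ℝ) :
    0 < energyConst T α Cex Cπ B := by
  unfold energyConst
  positivity

namespace IsIntegratorOutput

variable {Y : Type*} [NormedAddCommGroup Y] {α Cex θ k : ℝ} {N : ℕ} {πh : H1 Ω → Y → L2 Ω}
  {f : ℕ → L2 Ω} {ζ : ℕ → Y} {m0 : E3 → E3} {m v : ℕ → E3 → E3}

/-- The discrete energy estimate. -/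
theorem energy_bound (H : IsIntegratorOutput M α Cex θ k N πh f ζ m0 m v)
    (hm0 : m0 ∈ discreteMag M) (hΩ : IsLipschitzDomain Ω) (hM : AngleCondition M)
    (hα : 0 < α) (hCex : 0 < Cex) (hθ : 1 / 2 < θ) (hk : 0 ≤ k) {Cπ Cζ T B : ℝ} (hT : k * N = T)
    (hπ : ∀ n : H1 Ω, (∀ᵐ x ∂(volume.restrict Ω), ‖n.1 x‖ ≤ 1) → ∀ y : Y, ‖y‖ ≤ Cζ →
      ‖πh n y‖ ≤ Cπ * (1 + √(gradNormSq Ω n.1)))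
    (hζ : ∀ j < N, ‖ζ j‖ ≤ Cζ) (hB0 : gradNormSq Ω m0 ≤ B)
    (hBf : ∑ i ∈ Finset.range N, k * ‖f i‖ ^ 2 ≤ B) :
    ∀ j ≤ N, Cex * gradNormSq Ω (m j) + ∑ i ∈ Finset.range j,
      (k * α * (∫ x in Ω, ‖v i x‖ ^ 2) + Cex * k ^ 2 * (2 * θ - 1) * gradNormSq Ω (v i))
        ≤ energyConst T α Cex Cπ B := by
  have hB : 0 ≤ B := (gradNormSq_nonneg Ω m0).trans hB0
  set w : ℕ → ℝ := fun i => k * α * (∫ x in Ω, ‖v i x‖ ^ 2)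
    + Cex * k ^ 2 * (2 * θ - 1) * gradNormSq Ω (v i) with hw
  have hw0 : ∀ i, 0 ≤ w i := fun i => by
    have h1 : 0 ≤ ∫ x in Ω, ‖v i x‖ ^ 2 := integral_nonneg fun _ => sq_nonneg _
    have h2 := gradNormSq_nonneg Ω (v i)
    have h3 : 0 ≤ 2 * θ - 1 := by linarith
    simp only [hw]
    positivity
  -- The added `Cex` makes the affine growth `1 + ‖∇m‖²` of the field contribution a multiple of
  -- `x`. The rate `q` below is then what `(2 / α) · 2 Cπ² (1 + ‖∇m‖²)` amounts to.
  set x : ℕ → ℝ := fun j => Cex + Cex * gradNormSq Ω (m j) + ∑ i ∈ Finset.range j, w i with hx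
  set q : ℝ := 4 * Cπ ^ 2 / (α * Cex) with hq
  have hq0 : 0 ≤ q := by positivity
  have hE : ∀ j, 0 ≤ gradNormSq Ω (m j) := fun j => gradNormSq_nonneg Ω _
  have hsum0 : ∀ j, 0 ≤ ∑ i ∈ Finset.range j, w i := fun j => Finset.sum_nonneg fun i _ => hw0 i
  have hx0 : ∀ j, 0 ≤ x j := fun j => by
    have := hE j; have := hsum0 j
    simp only [hx]; positivity
  have hrec : ∀ j < N, x (j + 1) ≤ (1 + k * q) * x j + 2 / α * (k * ‖f j‖ ^ 2) := fun j hj => by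
    have h1 := H.energy_step hm0 hΩ hM hα hCex hk hj
    have h2 := H.norm_pi_sq_le hm0 hΩ hπ hζ hj
    have h3 : 2 * k / α * ‖πh (toH1 Ω (m j)) (ζ j)‖ ^ 2 ≤ k * q * x j := by
      calc 2 * k / α * ‖πh (toH1 Ω (m j)) (ζ j)‖ ^ 2
          ≤ 2 * k / α * (2 * Cπ ^ 2 * (1 + gradNormSq Ω (m j))) := by gcongr
        _ = k * q * (Cex + Cex * gradNormSq Ω (m j)) := by
            rw [hq]; field_simp; ring
        _ ≤ k * q * x j := by
            gcongr
            simp only [hx]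
            linarith [hsum0 j]
    have h4 : x (j + 1) = Cex + (Cex * gradNormSq Ω (m (j + 1)) + w j)
        + ∑ i ∈ Finset.range j, w i := by
      simp only [hx, Finset.sum_range_succ]; ring
    have h5 : 2 * k / α * (‖f j‖ ^ 2 + ‖πh (toH1 Ω (m j)) (ζ j)‖ ^ 2)
        = 2 / α * (k * ‖f j‖ ^ 2) + 2 * k / α * ‖πh (toH1 Ω (m j)) (ζ j)‖ ^ 2 := by ring
    rw [h4, add_mul, one_mul]
    have h6 : x j = Cex + Cex * gradNormSq Ω (m j) + ∑ i ∈ Finset.range j, w i := rfl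
    have h7 : w j = k * α * (∫ x in Ω, ‖v j x‖ ^ 2)
      + Cex * k ^ 2 * (2 * θ - 1) * gradNormSq Ω (v j) := rfl
    rw [h5] at h1
    linarith
  intro j hj
  have h1 := discrete_gronwall_bound hk hq0 hx0 (fun j => by positivity) hrec j hj
  have h2 : x 0 + ∑ i ∈ Finset.range j, 2 / α * (k * ‖f i‖ ^ 2) ≤ Cex + (Cex + 2 / α) * |B| := by
    rw [abs_of_nonneg hB, ← Finset.mul_sum]
    have h3 : ∑ i ∈ Finset.range j, k * ‖f i‖ ^ 2 ≤ B := by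
      refine (Finset.sum_le_sum_of_subset_of_nonneg ?_ fun i _ _ => by positivity).trans hBf
      exact Finset.range_mono hj
    have h4 : x 0 = Cex + Cex * gradNormSq Ω m0 := by simp [hx, H.init]
    have h5 : 2 / α * ∑ i ∈ Finset.range j, k * ‖f i‖ ^ 2 ≤ 2 / α * B := by gcongr
    have h6 : Cex * gradNormSq Ω m0 ≤ Cex * B := by gcongr
    rw [h4]
    linarith
  have h7 : Real.exp (q * (k * j)) ≤ Real.exp (q * T) := by
    refine Real.exp_le_exp.2 (mul_le_mul_of_nonneg_left ?_ hq0)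
    rw [← hT]
    gcongr
  have h8 : 0 ≤ x 0 + ∑ i ∈ Finset.range j, 2 / α * (k * ‖f i‖ ^ 2) :=
    add_nonneg (hx0 0) (Finset.sum_nonneg fun i _ => by positivity)
  have h9 := h1.trans (mul_le_mul h7 h2 h8 (Real.exp_nonneg _))
  have h10 : x j = Cex + Cex * gradNormSq Ω (m j) + ∑ i ∈ Finset.range j, w i := rfl
  unfold energyConst
  linarith

/-- The old nodal value has length one and is its own projection, so the contraction applies to the
pair `m + k v`, `m`. -/
theorem norm_diff_quot_le (H : IsIntegratorOutput M α Cex θ k N πh f ζ m0 m v)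
    (hm0 : m0 ∈ discreteMag M) (hk : 0 < k) {i : ℕ} (hi : i < N) {z : E3} (hz : z ∈ M.nodes) :
    ‖k⁻¹ • (m (i + 1) z - m i z)‖ ≤ ‖v i z‖ := by
  have hm := H.mem_mag hm0 i hi.le
  have hv := H.tangent i hi
  have h1 := norm_normalize_sub_le (one_le_norm_add_smul k (hm.2 z hz) (hv.2 z hz))
    (hm.2 z hz).ge
  rw [← H.update i hi z hz, hm.2 z hz, inv_one, one_smul, add_sub_cancel_left, norm_smul,
    Real.norm_of_nonneg hk.le] at h1
  rw [norm_smul, norm_inv, Real.norm_of_nonneg hk.le, inv_mul_le_iff₀ hk]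
  exact h1

/-- The error is radial of size `(r - 1) / k`, where `r² = 1 + k² |v|²`, and `r - 1` is at most half
of `r² - 1`. -/
theorem norm_diff_quot_sub_le (H : IsIntegratorOutput M α Cex θ k N πh f ζ m0 m v)
    (hm0 : m0 ∈ discreteMag M) (hk : 0 < k) {i : ℕ} (hi : i < N) {z : E3} (hz : z ∈ M.nodes) :
    ‖k⁻¹ • (m (i + 1) z - m i z) - v i z‖ ≤ k / 2 * ‖v i z‖ ^ 2 := by
  have hm := H.mem_mag hm0 i hi.le
  have hv := H.tangent i hi
  have h1 := one_le_norm_add_smul k (hm.2 z hz) (hv.2 z hz)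
  have h2 := norm_add_smul_sq k (hm.2 z hz) (hv.2 z hz)
  have h3 : k⁻¹ • (m (i + 1) z - m i z) - v i z
      = (k⁻¹ * (‖m i z + k • v i z‖⁻¹ - 1)) • (m i z + k • v i z) := by
    rw [H.update i hi z hz]
    set w := m i z + k • v i z with hw
    have : v i z = k⁻¹ • (w - m i z) := by
      rw [hw, add_sub_cancel_left, smul_smul, inv_mul_cancel₀ hk.ne', one_smul]
    rw [this]
    module
  rw [h3, norm_smul]
  set r := ‖m i z + k • v i z‖ with hr
  have hr0 : 0 < r := by linarith
  have h4 : ‖k⁻¹ * (r⁻¹ - 1)‖ = k⁻¹ * (1 - r⁻¹) := by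
    have : r⁻¹ ≤ 1 := inv_le_one_of_one_le₀ h1
    rw [norm_mul, norm_inv, Real.norm_of_nonneg hk.le, Real.norm_eq_abs, abs_of_nonpos (by linarith)]
    ring
  have h5 : k⁻¹ * (1 - r⁻¹) * r = k⁻¹ * (r - 1) := by
    field_simp
  rw [h4, h5, inv_mul_le_iff₀ hk]
  nlinarith [sq_nonneg (r - 1)]

theorem lintegral_diff_quot_le (H : IsIntegratorOutput M α Cex θ k N πh f ζ m0 m v)
    (hm0 : m0 ∈ discreteMag M) (hΩ : IsLipschitzDomain Ω) (hk : 0 < k) {i : ℕ} (hi : i < N) :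
    ∫ x in Ω, ‖k⁻¹ • (m (i + 1) x - m i x)‖ ^ 2 ≤ 256 * ∫ x in Ω, ‖v i x‖ ^ 2 := by
  have hv := H.tangent i hi
  have hd : (fun x => k⁻¹ • (m (i + 1) x - m i x)) ∈ courant M E3 :=
    courant_smul _ (courant_sub (H.mag i hi).1 (H.mem_mag hm0 i hi.le).1)
  have h := lintegral_le_of_nodal_bound hΩ hv.1 (c := 1) (by simp)
    (g := fun x => ‖k⁻¹ • (m (i + 1) x - m i x)‖ₑ ^ 2) fun s hs z₀ hz₀ hmax x hx => by
      rw [one_mul, enorm_sq_eq, enorm_sq_eq]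
      refine ENNReal.ofReal_le_ofReal (pow_le_pow_left₀ (norm_nonneg _) ?_ 2)
      exact norm_le_on_hull hd hs (fun z hz =>
        (H.norm_diff_quot_le hm0 hk hi (M.mem_nodes hs hz)).trans (hmax z hz)) hx
  simp_rw [one_mul, enorm_sq_eq] at h
  rw [← ofReal_integral_eq_lintegral_ofReal (integrable_norm_sq (memLp_of_courant hΩ hd 2))
      (ae_of_all _ fun x => sq_nonneg _),
    ← ofReal_integral_eq_lintegral_ofReal (integrable_norm_sq (memLp_of_courant hΩ hv.1 2))
      (ae_of_all _ fun x => sq_nonneg _), show (256 : ℝ≥0∞) = ENNReal.ofReal 256 by simp,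
    ← ENNReal.ofReal_mul (by norm_num)] at h
  have h0 : 0 ≤ ∫ x in Ω, ‖v i x‖ ^ 2 := integral_nonneg fun _ => sq_nonneg _
  exact (ENNReal.ofReal_le_ofReal_iff (by positivity)).1 h

/-- The nodal error is quadratic in `v`, so a bound of `v` in `L²` controls it in `L¹` only. The
constant is 256 times the nodal factor one half. It shows that `v` and the difference quotient are
asymptotically the same. -/
theorem lintegral_diff_quot_sub_le (H : IsIntegratorOutput M α Cex θ k N πh f ζ m0 m v)
    (hm0 : m0 ∈ discreteMag M) (hΩ : IsLipschitzDomain Ω) (hk : 0 < k) {i : ℕ} (hi : i < N) :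
    ∫ x in Ω, ‖k⁻¹ • (m (i + 1) x - m i x) - v i x‖ ≤ 128 * k * ∫ x in Ω, ‖v i x‖ ^ 2 := by
  have hv := H.tangent i hi
  have hd : (fun x => k⁻¹ • (m (i + 1) x - m i x) - v i x) ∈ courant M E3 :=
    courant_sub (courant_smul _ (courant_sub (H.mag i hi).1 (H.mem_mag hm0 i hi.le).1)) hv.1
  have h := lintegral_le_of_nodal_bound hΩ hv.1 (c := ENNReal.ofReal (k / 2)) (by simp)
    (g := fun x => ENNReal.ofReal ‖k⁻¹ • (m (i + 1) x - m i x) - v i x‖)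
    fun s hs z₀ hz₀ hmax x hx => by
      rw [enorm_sq_eq, ← ENNReal.ofReal_mul (by positivity)]
      refine ENNReal.ofReal_le_ofReal ?_
      refine norm_le_on_hull hd hs (fun z hz =>
        (H.norm_diff_quot_sub_le hm0 hk hi (M.mem_nodes hs hz)).trans ?_) hx
      have := hmax z hz
      gcongr
  simp_rw [enorm_sq_eq] at h
  have hint : Integrable (fun x => ‖k⁻¹ • (m (i + 1) x - m i x) - v i x‖) (volume.restrict Ω) :=
    (memLp_one_iff_integrable.1 (memLp_of_courant hΩ hd 1)).norm
  rw [← ofReal_integral_eq_lintegral_ofReal hint (ae_of_all _ fun x => norm_nonneg _),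
    ← ofReal_integral_eq_lintegral_ofReal (integrable_norm_sq (memLp_of_courant hΩ hv.1 2))
      (ae_of_all _ fun x => sq_nonneg _), show (256 : ℝ≥0∞) = ENNReal.ofReal 256 by simp,
    ← ENNReal.ofReal_mul (by norm_num), ← ENNReal.ofReal_mul (by positivity)] at h
  have h0 : 0 ≤ ∫ x in Ω, ‖v i x‖ ^ 2 := integral_nonneg fun _ => sq_nonneg _
  have := (ENNReal.ofReal_le_ofReal_iff (by positivity)).1 h
  linarith

end IsIntegratorOutput

end LLG

namespace LLG

/-! ### Interpolation in time with values in a normed space -/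

section Interpolation

variable {k T : ℝ} {N : ℕ}

theorem floor_div_lt (hk : 0 < k) (hT : k * N = T) {t : ℝ} (ht : t < T) (h0 : 0 ≤ t) :
    ⌊t / k⌋₊ < N := by
  rw [Nat.floor_lt (by positivity), div_lt_iff₀ hk]
  linarith

theorem floor_div_mul_le (hk : 0 < k) {t : ℝ} (h0 : 0 ≤ t) : ⌊t / k⌋₊ * k ≤ t :=
  (le_div_iff₀ hk).1 (Nat.floor_le (by positivity))

theorem lt_floor_div_add_one_mul (hk : 0 < k) (t : ℝ) : t < (⌊t / k⌋₊ + 1) * k :=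
  (div_lt_iff₀ hk).1 (Nat.lt_floor_add_one _)

theorem floor_div_eq (hk : 0 < k) {t : ℝ} {j : ℕ} (h1 : j * k ≤ t) (h2 : t < (j + 1) * k) :
    ⌊t / k⌋₊ = j := by
  have h0 : 0 ≤ t := le_trans (by positivity) h1
  rw [Nat.floor_eq_iff (by positivity)]
  exact ⟨(le_div_iff₀ hk).2 h1, (div_lt_iff₀ hk).2 h2⟩

/-- The difference quotients in time. -/
noncomputable def diffQuot {V : Type*} [AddCommGroup V] [Module ℝ V] (k : ℝ) (a : ℕ → V)
    (j : ℕ) : V := k⁻¹ • (a (j + 1) - a j)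

variable {V : Type*} [NormedAddCommGroup V] [NormedSpace ℝ V]

/-- Continuous piecewise affine interpolation in time of the values `a 0, a 1, …`. -/
noncomputable def affineInterp (k : ℝ) (a : ℕ → V) (t : ℝ) : V :=
  ((t - ⌊t / k⌋₊ * k) / k) • a (⌊t / k⌋₊ + 1) + (((⌊t / k⌋₊ + 1) * k - t) / k) • a ⌊t / k⌋₊

theorem timeAffine_eq (k : ℝ) (γ : ℕ → E3 → E3) (p : ℝ × E3) :
    timeAffine k γ p = affineInterp k (fun j => γ j p.2) p.1 := rfl

/-- The formula persists at the right end of the time step, where the floor has already jumped; this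
is what makes the interpolation continuous. -/
theorem affineInterp_eq (hk : 0 < k) (a : ℕ → V) {t : ℝ} {j : ℕ} (h1 : j * k ≤ t)
    (h2 : t ≤ (j + 1) * k) : affineInterp k a t = a j + (t - j * k) • diffQuot k a j := by
  rcases h2.lt_or_eq with h2 | h2
  · rw [affineInterp, floor_div_eq hk h1 h2, diffQuot]
    have e : ((j + 1) * k - t) / k = 1 - (t - j * k) / k := by field_simp; ring
    rw [e, div_eq_mul_inv]
    module
  · have hj : ⌊t / k⌋₊ = j + 1 := floor_div_eq hk (by push_cast; exact h2.ge)
      (by push_cast; nlinarith)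
    rw [affineInterp, hj, diffQuot, h2]
    push_cast
    have e1 : ((j + 1 + 1) * k - (j + 1) * k) / k = 1 := by field_simp; ring
    have e2 : ((j + 1) * k - (j + 1) * k) / k = 0 := by simp
    have e3 : ((j + 1) * k - j * k) = k := by ring
    rw [e1, e2, e3, smul_smul, mul_inv_cancel₀ hk.ne']
    module

theorem affineInterp_eq_floor (hk : 0 < k) (a : ℕ → V) {t : ℝ} (h0 : 0 ≤ t) :
    affineInterp k a t = a ⌊t / k⌋₊ + (t - ⌊t / k⌋₊ * k) • diffQuot k a ⌊t / k⌋₊ :=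
  affineInterp_eq hk a (floor_div_mul_le hk h0) (lt_floor_div_add_one_mul hk t).le

theorem affineInterp_zero (hk : 0 < k) (a : ℕ → V) : affineInterp k a 0 = a 0 := by
  have := affineInterp_eq hk a (t := 0) (j := 0) (by simp) (by simpa using hk.le)
  simpa using this

theorem norm_affineInterp_sub_le (hk : 0 < k) (a : ℕ → V) {t : ℝ} (h0 : 0 ≤ t) :
    ‖affineInterp k a t - a ⌊t / k⌋₊‖ ≤ k * ‖diffQuot k a ⌊t / k⌋₊‖ := by
  rw [affineInterp_eq_floor hk a h0, add_sub_cancel_left, norm_smul]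
  refine mul_le_mul_of_nonneg_right ?_ (norm_nonneg _)
  have h1 := floor_div_mul_le hk h0
  have h2 := lt_floor_div_add_one_mul hk t
  rw [Real.norm_of_nonneg (by linarith)]
  linarith

theorem affineInterp_weights (hk : 0 < k) {t : ℝ} (h0 : 0 ≤ t) :
    0 ≤ (t - ⌊t / k⌋₊ * k) / k ∧ 0 ≤ ((⌊t / k⌋₊ + 1) * k - t) / k ∧
      (t - ⌊t / k⌋₊ * k) / k + ((⌊t / k⌋₊ + 1) * k - t) / k = 1 := by
  have h1 := floor_div_mul_le hk h0
  have h2 := lt_floor_div_add_one_mul hk t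
  refine ⟨div_nonneg (by linarith) hk.le, div_nonneg (by linarith) hk.le, ?_⟩
  field_simp
  ring

theorem norm_affineInterp_le (hk : 0 < k) (a : ℕ → V) {t : ℝ} (h0 : 0 ≤ t) :
    ‖affineInterp k a t‖ ≤ max ‖a (⌊t / k⌋₊ + 1)‖ ‖a ⌊t / k⌋₊‖ := by
  obtain ⟨w1, w2, w3⟩ := affineInterp_weights hk h0
  refine (norm_add_le _ _).trans ?_
  rw [norm_smul, norm_smul, Real.norm_of_nonneg w1, Real.norm_of_nonneg w2]
  calc _ ≤ (t - ⌊t / k⌋₊ * k) / k * max ‖a (⌊t / k⌋₊ + 1)‖ ‖a ⌊t / k⌋₊‖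
        + ((⌊t / k⌋₊ + 1) * k - t) / k * max ‖a (⌊t / k⌋₊ + 1)‖ ‖a ⌊t / k⌋₊‖ := by
        gcongr
        · exact le_max_left _ _
        · exact le_max_right _ _
    _ = _ := by rw [← add_mul, w3, one_mul]

theorem hasDerivWithinAt_affineInterp (hk : 0 < k) (a : ℕ → V) {t : ℝ} (h0 : 0 ≤ t) :
    HasDerivWithinAt (affineInterp k a) (diffQuot k a ⌊t / k⌋₊) (Set.Ici t) t := by
  set j := ⌊t / k⌋₊ with hj
  have h1 := floor_div_mul_le hk h0
  have h2 := lt_floor_div_add_one_mul hk t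
  have hd : HasDerivAt (fun t : ℝ => a j + (t - j * k) • diffQuot k a j) (diffQuot k a j) t := by
    have h := (((hasDerivAt_id t).sub_const (j * k)).smul_const (diffQuot k a j)).const_add (a j)
    rwa [one_smul] at h
  refine hd.hasDerivWithinAt.congr_of_eventuallyEq ?_ (affineInterp_eq hk a h1 h2.le)
  filter_upwards [Icc_mem_nhdsGE h2] with s hs
  exact affineInterp_eq hk a (h1.trans hs.1) hs.2

theorem hasDerivAt_affineInterp (hk : 0 < k) (a : ℕ → V) {t : ℝ} (h0 : 0 ≤ t)
    (ht : t ≠ ⌊t / k⌋₊ * k) :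
    HasDerivAt (affineInterp k a) (diffQuot k a ⌊t / k⌋₊) t := by
  set j := ⌊t / k⌋₊ with hj
  have h1 : j * k < t := lt_of_le_of_ne (floor_div_mul_le hk h0) ht.symm
  have h2 := lt_floor_div_add_one_mul hk t
  have hd : HasDerivAt (fun t : ℝ => a j + (t - j * k) • diffQuot k a j) (diffQuot k a j) t := by
    have h := (((hasDerivAt_id t).sub_const (j * k)).smul_const (diffQuot k a j)).const_add (a j)
    rwa [one_smul] at h
  refine hd.congr_of_eventuallyEq ?_
  filter_upwards [Ioo_mem_nhds h1 h2] with s hs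
  exact affineInterp_eq hk a hs.1.le hs.2.le

theorem continuousOn_affineInterp (hk : 0 < k) (a : ℕ → V) :
    ContinuousOn (affineInterp k a) (Set.Ici 0) := by
  intro t ht
  have ht0 : (0 : ℝ) ≤ t := ht
  by_cases h : t = ⌊t / k⌋₊ * k
  swap
  · exact (hasDerivAt_affineInterp hk a ht0 h).continuousAt.continuousWithinAt
  have hr : ContinuousWithinAt (affineInterp k a) (Set.Ici t) t :=
    (hasDerivWithinAt_affineInterp hk a ht0).continuousWithinAt
  -- At the grid point 0 only the right-hand side matters; at a later grid point the affine piece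
  -- that ends there gives continuity from the left.
  rcases hj : ⌊t / k⌋₊ with _ | j
  · rw [hj] at h
    have : t = 0 := by simpa using h
    rw [this] at hr ⊢
    exact hr
  · rw [hj] at h
    push_cast at h
    have hl : ContinuousWithinAt (affineInterp k a) (Set.Iic t) t := by
      have hc : ContinuousWithinAt (fun t : ℝ => a j + (t - j * k) • diffQuot k a j)
          (Set.Iic t) t := by
        have : Continuous fun t : ℝ => a j + (t - j * k) • diffQuot k a j := by fun_prop
        exact this.continuousWithinAt
      refine hc.congr_of_eventuallyEq ?_ (affineInterp_eq hk a (by nlinarith) h.le)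
      filter_upwards [Icc_mem_nhdsLE (show j * k < t by nlinarith)] with s hs
      exact affineInterp_eq hk a hs.1 (hs.2.trans h.le)
    have := hl.union hr
    rw [Set.Iic_union_Ici] at this
    exact this.mono (Set.subset_univ _)

theorem norm_affineInterp_sub_affineInterp_le (hk : 0 < k) (hT : k * N = T) (a : ℕ → V) {L : ℝ}
    (hL : ∀ j < N, ‖diffQuot k a j‖ ≤ L) {s t : ℝ} (hs : 0 ≤ s) (hst : s ≤ t) (ht : t ≤ T) :
    ‖affineInterp k a t - affineInterp k a s‖ ≤ L * (t - s) := by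
  refine norm_image_sub_le_of_norm_deriv_right_le_segment (f' := fun τ => diffQuot k a ⌊τ / k⌋₊)
    ((continuousOn_affineInterp hk a).mono fun τ hτ => hs.trans hτ.1)
    (fun τ hτ => hasDerivWithinAt_affineInterp hk a (hs.trans hτ.1))
    (fun τ hτ => hL _ (floor_div_lt hk hT (hτ.2.trans_le ht) (hs.trans hτ.1))) t ⟨hst, le_rfl⟩

end Interpolation

/-! ### Integrals of step functions in time over the cylinder -/

section StepFunctions

variable {k T : ℝ} {N : ℕ} {Ω : Set E3}
variable {G : Type*} [NormedAddCommGroup G] [NormedSpace ℝ G]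

/-- A finite sum of products of an indicator in time and a function in space. Measurability,
integrability and Fubini for step functions are reduced to it. -/
theorem step_eq_sum (hk : 0 < k) (hT : k * N = T) (g : ℕ → E3 → G) {p : ℝ × E3} (h0 : 0 ≤ p.1)
    (h1 : p.1 < T) : g ⌊p.1 / k⌋₊ p.2 = ∑ j ∈ Finset.range N,
      (Set.Ico (j * k) ((j + 1) * k)).indicator (fun _ => (1 : ℝ)) p.1 • g j p.2 := by
  rw [Finset.sum_eq_single ⌊p.1 / k⌋₊]
  · rw [Set.indicator_of_mem, one_smul]
    exact ⟨floor_div_mul_le hk h0, lt_floor_div_add_one_mul hk _⟩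
  · intro j _ hj
    rw [Set.indicator_of_notMem, zero_smul]
    exact fun h => hj (floor_div_eq hk h.1 h.2).symm
  · intro h
    exact absurd (Finset.mem_range.2 (floor_div_lt hk hT h1 h0)) h

theorem step_ae_eq (hk : 0 < k) (hT : k * N = T) (g : ℕ → E3 → G) :
    (fun p : ℝ × E3 => g ⌊p.1 / k⌋₊ p.2) =ᵐ[(volume.restrict (Set.Ioo 0 T)).prod
      (volume.restrict Ω)] fun p => ∑ j ∈ Finset.range N,
      (Set.Ico (j * k) ((j + 1) * k)).indicator (fun _ => (1 : ℝ)) p.1 • g j p.2 := by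
  have h : ∀ᵐ t ∂(volume.restrict (Set.Ioo 0 T)), t ∈ Set.Ioo 0 T :=
    ae_restrict_mem measurableSet_Ioo
  filter_upwards [Measure.quasiMeasurePreserving_fst.ae h] with p hp
  exact step_eq_sum hk hT g hp.1.le hp.2

theorem ae_cylinder_fst (T : ℝ) (Ω : Set E3) :
    ∀ᵐ p ∂(volume.restrict (cylinder T Ω)), 0 < p.1 ∧ p.1 < T := by
  rw [restrict_cylinder]
  exact Measure.quasiMeasurePreserving_fst.ae
    (ae_restrict_mem measurableSet_Ioo : ∀ᵐ t ∂(volume.restrict (Set.Ioo 0 T)), t ∈ Set.Ioo 0 T)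

theorem ae_cylinder_snd {P : E3 → Prop} (h : ∀ᵐ x ∂(volume.restrict Ω), P x) (T : ℝ) :
    ∀ᵐ p ∂(volume.restrict (cylinder T Ω)), P p.2 := by
  rw [restrict_cylinder]
  exact Measure.quasiMeasurePreserving_snd.ae h

theorem integrable_indicator_step (T k : ℝ) (j : ℕ) :
    Integrable ((Set.Ico (j * k) ((j + 1) * k)).indicator fun _ => (1 : ℝ))
      (volume.restrict (Set.Ioo 0 T)) :=
  (integrable_const (1 : ℝ)).indicator measurableSet_Ico

theorem integral_indicator_step (hk : 0 < k) (hT : k * N = T) {j : ℕ} (hj : j < N) :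
    ∫ t in Set.Ioo 0 T, (Set.Ico (j * k) ((j + 1) * k)).indicator (fun _ => (1 : ℝ)) t = k := by
  have e : (volume.restrict (Set.Ioo 0 T) : Measure ℝ) = volume.restrict (Set.Ico 0 T) :=
    Measure.restrict_congr_set Ioo_ae_eq_Ico
  have hsub : Set.Ico (j * k) ((j + 1) * k) ⊆ Set.Ico 0 T := by
    refine Set.Ico_subset_Ico (by positivity) ?_
    rw [← hT, mul_comm k]
    have : ((j : ℝ) + 1) ≤ N := by exact_mod_cast hj
    gcongr
  rw [e, integral_indicator measurableSet_Ico, Measure.restrict_restrict measurableSet_Ico,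
    Set.inter_eq_left.2 hsub]
  simp only [integral_const, MeasurableSet.univ, measureReal_restrict_apply, Set.univ_inter,
    smul_eq_mul, mul_one]
  rw [measureReal_def, Real.volume_Ico, ENNReal.toReal_ofReal (by nlinarith)]
  ring

theorem aestronglyMeasurable_step (hk : 0 < k) (hT : k * N = T) {g : ℕ → E3 → G}
    (hg : ∀ j < N, AEStronglyMeasurable (g j) (volume.restrict Ω)) :
    AEStronglyMeasurable (fun p : ℝ × E3 => g ⌊p.1 / k⌋₊ p.2)
      (volume.restrict (cylinder T Ω)) := by
  rw [restrict_cylinder]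
  refine AEStronglyMeasurable.congr ?_ (step_ae_eq hk hT g).symm
  refine Finset.aestronglyMeasurable_fun_sum _ fun j hj => ?_
  exact (integrable_indicator_step T k j).1.comp_fst.smul
    (hg j (Finset.mem_range.1 hj)).comp_snd

theorem integrable_step (hk : 0 < k) (hT : k * N = T) {g : ℕ → E3 → G}
    (hg : ∀ j < N, Integrable (g j) (volume.restrict Ω)) :
    Integrable (fun p : ℝ × E3 => g ⌊p.1 / k⌋₊ p.2) (volume.restrict (cylinder T Ω)) := by
  rw [restrict_cylinder]
  refine Integrable.congr ?_ (step_ae_eq hk hT g).symm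
  exact integrable_finsetSum _ fun j hj =>
    (integrable_indicator_step T k j).smul_prod (hg j (Finset.mem_range.1 hj))

theorem integral_step [CompleteSpace G] (hk : 0 < k) (hT : k * N = T) {g : ℕ → E3 → G}
    (hg : ∀ j < N, Integrable (g j) (volume.restrict Ω)) :
    ∫ p in cylinder T Ω, g ⌊p.1 / k⌋₊ p.2 = ∑ j ∈ Finset.range N, k • ∫ x in Ω, g j x := by
  rw [restrict_cylinder, integral_congr_ae (step_ae_eq hk hT g), integral_finsetSum _ fun j hj =>
    (integrable_indicator_step T k j).smul_prod (hg j (Finset.mem_range.1 hj))]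
  refine Finset.sum_congr rfl fun j hj => ?_
  rw [integral_prod_smul (fun t => (Set.Ico (j * k) ((j + 1) * k)).indicator (fun _ => (1 : ℝ)) t)
    (g j), integral_indicator_step hk hT (Finset.mem_range.1 hj)]

theorem memLp_timeConst (hk : 0 < k) (hT : k * N = T) {γ : ℕ → E3 → E3}
    (hγ : ∀ j < N, MemLp (γ j) 2 (volume.restrict Ω)) :
    MemLp (timeConst k γ) 2 (volume.restrict (cylinder T Ω)) := by
  have h1 : AEStronglyMeasurable (timeConst k γ) (volume.restrict (cylinder T Ω)) :=
    aestronglyMeasurable_step hk hT fun j hj => (hγ j hj).1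
  refine (memLp_two_iff_integrable_sq_norm h1).2 ?_
  exact integrable_step hk hT (g := fun j x => ‖γ j x‖ ^ 2) fun j hj => integrable_norm_sq (hγ j hj)

theorem integral_norm_sq_timeConst (hk : 0 < k) (hT : k * N = T) {γ : ℕ → E3 → E3}
    (hγ : ∀ j < N, MemLp (γ j) 2 (volume.restrict Ω)) :
    ∫ p in cylinder T Ω, ‖timeConst k γ p‖ ^ 2
      = ∑ j ∈ Finset.range N, k * ∫ x in Ω, ‖γ j x‖ ^ 2 :=
  integral_step hk hT (g := fun j x => ‖γ j x‖ ^ 2) fun j hj => integrable_norm_sq (hγ j hj)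

theorem timeAffine_eq_add (k : ℝ) (γ : ℕ → E3 → E3) : timeAffine k γ = fun p =>
    ((p.1 - ⌊p.1 / k⌋₊ * k) / k) • timeConst k (fun j => γ (j + 1)) p
    + (((⌊p.1 / k⌋₊ + 1) * k - p.1) / k) • timeConst k γ p := rfl

theorem measurable_floor_div (k : ℝ) : Measurable fun p : ℝ × E3 => (⌊p.1 / k⌋₊ : ℝ) :=
  measurable_from_nat.comp (Nat.measurable_floor.comp (measurable_fst.div_const k))

theorem aestronglyMeasurable_timeAffine (hk : 0 < k) (hT : k * N = T) {γ : ℕ → E3 → E3}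
    (hγ : ∀ j ≤ N, AEStronglyMeasurable (γ j) (volume.restrict Ω)) :
    AEStronglyMeasurable (timeAffine k γ) (volume.restrict (cylinder T Ω)) := by
  rw [timeAffine_eq_add]
  have h1 := aestronglyMeasurable_step hk hT (g := fun j => γ (j + 1)) fun j hj => hγ (j + 1) hj
  have h2 := aestronglyMeasurable_step hk hT (g := γ) fun j hj => hγ j hj.le
  have m := measurable_floor_div k
  have m1 : Measurable fun p : ℝ × E3 => (p.1 - ⌊p.1 / k⌋₊ * k) / k :=
    (measurable_fst.sub (m.mul_const k)).div_const k
  have m2 : Measurable fun p : ℝ × E3 => ((⌊p.1 / k⌋₊ + 1) * k - p.1) / k :=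
    (((m.add_const 1).mul_const k).sub measurable_fst).div_const k
  exact (m1.aestronglyMeasurable.smul h1).add (m2.aestronglyMeasurable.smul h2)

theorem norm_timeAffine_sq_le (hk : 0 < k) (γ : ℕ → E3 → E3) {p : ℝ × E3} (h0 : 0 ≤ p.1) :
    ‖timeAffine k γ p‖ ^ 2
      ≤ ‖timeConst k (fun j => γ (j + 1)) p‖ ^ 2 + ‖timeConst k γ p‖ ^ 2 := by
  have h := norm_affineInterp_le hk (fun j => γ j p.2) h0
  rw [← timeAffine_eq] at h
  refine (pow_le_pow_left₀ (norm_nonneg _) h 2).trans ?_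
  change max ‖timeConst k (fun j => γ (j + 1)) p‖ ‖timeConst k γ p‖ ^ 2 ≤ _
  rcases max_cases ‖timeConst k (fun j => γ (j + 1)) p‖ ‖timeConst k γ p‖ with h | h <;>
    rw [h.1] <;> linarith [sq_nonneg ‖timeConst k (fun j => γ (j + 1)) p‖,
      sq_nonneg ‖timeConst k γ p‖]

theorem memLp_timeAffine (hk : 0 < k) (hT : k * N = T) {γ : ℕ → E3 → E3}
    (hγ : ∀ j ≤ N, MemLp (γ j) 2 (volume.restrict Ω)) :
    MemLp (timeAffine k γ) 2 (volume.restrict (cylinder T Ω)) := by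
  have h1 := memLp_timeConst hk hT (γ := fun j => γ (j + 1)) fun j hj => hγ (j + 1) hj
  have h2 := memLp_timeConst hk hT (γ := γ) fun j hj => hγ j hj.le
  have h3 := aestronglyMeasurable_timeAffine hk hT fun j hj => (hγ j hj).1
  refine (memLp_two_iff_integrable_sq_norm h3).2 ?_
  refine ((integrable_norm_sq h1).add (integrable_norm_sq h2)).mono' (h3.norm.pow 2) ?_
  filter_upwards [ae_cylinder_fst T Ω] with p hp
  rw [Real.norm_of_nonneg (sq_nonneg _)]
  exact norm_timeAffine_sq_le hk γ hp.1.le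

theorem integral_norm_sq_timeAffine_le (hk : 0 < k) (hT : k * N = T) {γ : ℕ → E3 → E3}
    (hγ : ∀ j ≤ N, MemLp (γ j) 2 (volume.restrict Ω)) {C : ℝ}
    (hC : ∀ j ≤ N, ∫ x in Ω, ‖γ j x‖ ^ 2 ≤ C) :
    ∫ p in cylinder T Ω, ‖timeAffine k γ p‖ ^ 2 ≤ 2 * T * C := by
  have h1 := memLp_timeConst hk hT (γ := fun j => γ (j + 1)) fun j hj => hγ (j + 1) hj
  have h2 := memLp_timeConst hk hT (γ := γ) fun j hj => hγ j hj.le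
  have h3 := memLp_timeAffine hk hT hγ
  have b : ∀ γ' : ℕ → E3 → E3, (∀ j < N, MemLp (γ' j) 2 (volume.restrict Ω)) →
      (∀ j < N, ∫ x in Ω, ‖γ' j x‖ ^ 2 ≤ C) →
      ∫ p in cylinder T Ω, ‖timeConst k γ' p‖ ^ 2 ≤ T * C := fun γ' hm hb => by
    rw [integral_norm_sq_timeConst hk hT hm]
    calc ∑ j ∈ Finset.range N, k * ∫ x in Ω, ‖γ' j x‖ ^ 2 ≤ ∑ j ∈ Finset.range N, k * C :=
          Finset.sum_le_sum fun j hj =>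
            mul_le_mul_of_nonneg_left (hb j (Finset.mem_range.1 hj)) hk.le
      _ = T * C := by
          rw [Finset.sum_const, Finset.card_range, nsmul_eq_mul, ← hT]; ring
  calc ∫ p in cylinder T Ω, ‖timeAffine k γ p‖ ^ 2
      ≤ ∫ p in cylinder T Ω, (‖timeConst k (fun j => γ (j + 1)) p‖ ^ 2
        + ‖timeConst k γ p‖ ^ 2) := by
        refine integral_mono_ae (integrable_norm_sq h3)
          ((integrable_norm_sq h1).add (integrable_norm_sq h2)) ?_
        filter_upwards [ae_cylinder_fst T Ω] with p hp
        exact norm_timeAffine_sq_le hk γ hp.1.le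
    _ ≤ T * C + T * C := by
        rw [integral_add (integrable_norm_sq h1) (integrable_norm_sq h2)]
        exact add_le_add (b _ (fun j hj => hγ (j + 1) hj) fun j hj => hC (j + 1) hj)
          (b _ (fun j hj => hγ j hj.le) fun j hj => hC j hj.le)
    _ = 2 * T * C := by ring

theorem integral_norm_sq_timeAffine_sub_le (hk : 0 < k) (hT : k * N = T) {γ : ℕ → E3 → E3}
    (hγ : ∀ j ≤ N, MemLp (γ j) 2 (volume.restrict Ω)) :
    ∫ p in cylinder T Ω, ‖timeAffine k γ p - timeConst k γ p‖ ^ 2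
      ≤ k ^ 2 * ∑ j ∈ Finset.range N, k * ∫ x in Ω, ‖diffQuot k γ j x‖ ^ 2 := by
  have hd : ∀ j < N, MemLp (diffQuot k γ j) 2 (volume.restrict Ω) := fun j hj =>
    ((hγ (j + 1) hj).sub (hγ j hj.le)).const_smul _
  rw [← integral_norm_sq_timeConst hk hT hd, ← integral_const_mul]
  refine integral_mono_ae (integrable_norm_sq (MemLp.sub_fun (memLp_timeAffine hk hT hγ)
    (memLp_timeConst hk hT fun j hj => hγ j hj.le)))
    ((integrable_norm_sq (memLp_timeConst hk hT hd)).const_mul _) ?_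
  filter_upwards [ae_cylinder_fst T Ω] with p hp
  rw [← mul_pow]
  exact pow_le_pow_left₀ (norm_nonneg _)
    (norm_affineInterp_sub_le hk (fun j => γ j p.2) hp.1.le) 2

end StepFunctions

/-! ### Weak derivatives of the interpolants on the cylinder -/

section WeakDerivativesOnCylinder

variable {k T : ℝ} {N : ℕ} {Ω : Set E3}
variable {F : Type*} [NormedAddCommGroup F] [InnerProductSpace ℝ F]

theorem isOpen_cylinder (hΩ : IsOpen Ω) (T : ℝ) : IsOpen (cylinder T Ω) := isOpen_Ioo.prod hΩ

/-- Spatial weak derivatives may be computed slicewise. -/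
theorem HasWeakDeriv.of_slices (e : E3) {u g : ℝ × E3 → F}
    (hu : MemLp u 2 (volume.restrict (cylinder T Ω)))
    (hg : MemLp g 2 (volume.restrict (cylinder T Ω)))
    (h : ∀ t ∈ Set.Ioo 0 T, HasWeakDeriv Ω e (fun x => u (t, x)) (fun x => g (t, x))) :
    HasWeakDeriv (cylinder T Ω) ((0, e) : ℝ × E3) u g := by
  intro φ h1 h2 h3
  have i1 := integrable_test_smul (contDiff_fderiv_const h1 (0, e)).continuous
    (hasCompactSupport_fderiv_const h2 (0, e)) hu
  have i2 := integrable_test_smul h1.continuous h2 hg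
  rw [restrict_cylinder] at i1 i2 ⊢
  rw [integral_prod _ i1, integral_prod _ i2, ← integral_neg]
  refine setIntegral_congr_fun measurableSet_Ioo fun t ht => ?_
  have hsub : tsupport (fun x => φ (t, x)) ⊆ (fun x => (t, x)) ⁻¹' tsupport φ :=
    closure_minimal (fun x hx => subset_tsupport φ hx)
      ((isClosed_tsupport φ).preimage (Continuous.prodMk_right t))
  have hc : HasCompactSupport fun x => φ (t, x) := by
    refine (h2.isCompact.image continuous_snd).of_isClosed_subset (isClosed_tsupport _) ?_
    intro x hx
    exact ⟨(t, x), hsub hx, rfl⟩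
  have hd := h t ht (fun x => φ (t, x)) (h1.comp (contDiff_const.prodMk contDiff_id)) hc
    fun x hx => (h3 (hsub hx)).2
  have e1 : ∀ x, fderiv ℝ (fun x => φ (t, x)) x e = fderiv ℝ φ (t, x) (0, e) := fun x => by
    have d1 : HasFDerivAt (fun x : E3 => (t, x)) (ContinuousLinearMap.inr ℝ ℝ E3) x :=
      hasFDerivAt_prodMk_right t x
    have d2 := ((h1.differentiable (by simp)) (t, x)).hasFDerivAt.comp x d1
    rw [HasFDerivAt.fderiv (f := fun x => φ (t, x)) d2]
    rfl
  simp only [e1] at hd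
  exact hd

/-- The weak time derivative of a function that is Lipschitz in time. -/
theorem HasWeakDeriv.of_lipschitz_time (hΩ : IsOpen Ω) {u g : ℝ × E3 → F}
    (hu : MemLp u 2 (volume.restrict (cylinder T Ω))) {L : ℝ}
    (hL : ∀ x ∈ Ω, ∀ s t : ℝ, 0 < s → s ≤ t → t < T → ‖u (t, x) - u (s, x)‖ ≤ L * (t - s))
    (hg : ∀ᵐ p ∂(volume.restrict (cylinder T Ω)), HasDerivAt (fun t => u (t, p.2)) (g p) p.1) :
    HasWeakDeriv (cylinder T Ω) timeDir u g := by
  refine HasWeakDeriv.of_lipschitz_direction (isOpen_cylinder hΩ T) hu (L := L)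
    (fun K hK _ => ⟨1, one_pos, fun p hp s _ hps => ?_⟩) ?_
  · have hp' := hK hp
    have e : p + s • timeDir = (p.1 + s, p.2) := by
      ext1 <;> simp [timeDir]
    rw [e] at hps ⊢
    rcases le_total 0 s with hs | hs
    · have := hL p.2 hp'.2 p.1 (p.1 + s) hp'.1.1 (by linarith) hps.1.2
      rw [abs_of_nonneg hs]
      simpa using this
    · have := hL p.2 hp'.2 (p.1 + s) p.1 hps.1.1 (by linarith) hp'.1.2
      rw [abs_of_nonpos hs, norm_sub_rev]
      simpa using this
  · filter_upwards [hg] with p hp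
    have e : (fun s : ℝ => u (p + s • timeDir)) = fun s => u (p.1 + s, p.2) := by
      ext1 s
      congr 1
      ext1 <;> simp [timeDir]
    rw [HasLineDerivAt, e]
    have h1 : HasDerivAt (fun t => u (t, p.2)) (g p) (p.1 + 0) := by simpa using hp
    have h2 := h1.scomp (0 : ℝ) ((hasDerivAt_id (0 : ℝ)).const_add p.1)
    rw [one_smul] at h2
    exact h2

theorem ae_ne_floor (hk : 0 < k) (T : ℝ) (Ω : Set E3) :
    ∀ᵐ p ∂(volume.restrict (cylinder T Ω)), p.1 ≠ ⌊p.1 / k⌋₊ * k := by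
  have h : ∀ᵐ t : ℝ ∂(volume.restrict (Set.Ioo 0 T)), t ≠ ⌊t / k⌋₊ * k := by
    refine ae_restrict_of_ae ?_
    have hc : (Set.range fun j : ℕ => (j : ℝ) * k).Countable := Set.countable_range _
    filter_upwards [hc.ae_notMem volume] with t ht h
    exact ht ⟨⌊t / k⌋₊, h.symm⟩
  rw [restrict_cylinder]
  exact Measure.quasiMeasurePreserving_fst.ae h

theorem hasWeakDeriv_time_timeAffine (hΩ : IsOpen Ω) (hk : 0 < k) (hT : k * N = T)
    {γ : ℕ → E3 → E3} (hγ : ∀ j ≤ N, MemLp (γ j) 2 (volume.restrict Ω)) {C : ℝ}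
    (hC : ∀ j ≤ N, ∀ x ∈ Ω, ‖γ j x‖ ≤ C) :
    HasWeakDeriv (cylinder T Ω) timeDir (timeAffine k γ) (timeConst k (diffQuot k γ)) := by
  -- The Lipschitz constant blows up as `k` tends to zero. This is harmless, for it only justifies
  -- the integration by parts at fixed `k`.
  refine HasWeakDeriv.of_lipschitz_time hΩ (memLp_timeAffine hk hT hγ) (L := k⁻¹ * (C + C))
    (fun x hx s t hs hst ht => ?_) ?_
  · refine norm_affineInterp_sub_affineInterp_le hk hT (fun j => γ j x) (fun j hj => ?_) hs.le hst
      ht.le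
    rw [diffQuot, norm_smul, norm_inv, Real.norm_of_nonneg hk.le]
    gcongr
    exact (norm_sub_le _ _).trans (add_le_add (hC (j + 1) hj x hx) (hC j hj.le x hx))
  · filter_upwards [ae_ne_floor hk T Ω, ae_cylinder_fst T Ω] with p hp hp1
    exact hasDerivAt_affineInterp hk (fun j => γ j p.2) hp1.1.le hp

/-- The time derivative of the square of the modulus. -/
theorem hasWeakDeriv_time_norm_sq (hΩ : IsOpen Ω) (hk : 0 < k) (hT : k * N = T)
    (hfin : volume Ω ≠ ⊤)
    {γ : ℕ → E3 → E3} (hγ : ∀ j ≤ N, MemLp (γ j) 2 (volume.restrict Ω))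
    (hC : ∀ j ≤ N, ∀ x ∈ Ω, ‖γ j x‖ ≤ 1) :
    HasWeakDeriv (cylinder T Ω) timeDir (fun p => ‖timeAffine k γ p‖ ^ 2)
      (fun p => 2 * inner ℝ (timeAffine k γ p) (timeConst k (diffQuot k γ) p)) := by
  have hb : ∀ x ∈ Ω, ∀ t, 0 < t → t < T → ‖timeAffine k γ (t, x)‖ ≤ 1 := fun x hx t h0 h1 => by
    have hlt := floor_div_lt hk hT h1 h0.le
    exact (norm_affineInterp_le hk (fun j => γ j x) h0.le).trans
      (max_le (hC _ hlt x hx) (hC _ hlt.le x hx))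
  have : IsFiniteMeasure (volume.restrict (cylinder T Ω) : Measure (ℝ × E3)) := by
    have : IsFiniteMeasure (volume.restrict Ω : Measure E3) := ⟨by simpa using hfin.lt_top⟩
    rw [restrict_cylinder]
    infer_instance
  refine HasWeakDeriv.of_lipschitz_time hΩ ?_ (L := 2 * (k⁻¹ * (1 + 1)))
    (fun x hx s t hs hst ht => ?_) ?_
  · refine MemLp.of_bound ((memLp_timeAffine hk hT hγ).1.norm.pow 2) 1 ?_
    filter_upwards [ae_cylinder_fst T Ω, ae_restrict_mem (isOpen_cylinder hΩ T).measurableSet]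
      with p hp hpm
    rw [Real.norm_of_nonneg (sq_nonneg _)]
    exact pow_le_one₀ (norm_nonneg _) (hb p.2 hpm.2 p.1 hp.1 hp.2)
  · have h1 : ‖timeAffine k γ (t, x) - timeAffine k γ (s, x)‖ ≤ k⁻¹ * (1 + 1) * (t - s) := by
      refine norm_affineInterp_sub_affineInterp_le hk hT (fun j => γ j x) (fun j hj => ?_) hs.le hst
        ht.le
      rw [diffQuot, norm_smul, norm_inv, Real.norm_of_nonneg hk.le]
      gcongr
      exact (norm_sub_le _ _).trans (add_le_add (hC (j + 1) hj x hx) (hC j hj.le x hx))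
    have ha := hb x hx t (hs.trans_le hst) ht
    have hb' := hb x hx s hs (hst.trans_lt ht)
    set a := timeAffine k γ (t, x)
    set b := timeAffine k γ (s, x)
    have h2 : |‖a‖ - ‖b‖| ≤ ‖a - b‖ := abs_norm_sub_norm_le a b
    rw [Real.norm_eq_abs, sq_sub_sq, abs_mul, abs_of_nonneg (by positivity)]
    have h3 : 0 ≤ |‖a‖ - ‖b‖| := abs_nonneg _
    calc (‖a‖ + ‖b‖) * |‖a‖ - ‖b‖| ≤ 2 * (k⁻¹ * (1 + 1) * (t - s)) :=
          mul_le_mul (by linarith) (h2.trans h1) h3 (by norm_num)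
      _ = _ := by ring
  · filter_upwards [ae_ne_floor hk T Ω, ae_cylinder_fst T Ω] with p hp hp1
    have h1 := hasDerivAt_affineInterp hk (fun j => γ j p.2) hp1.1.le hp
    exact h1.norm_sq

end WeakDerivativesOnCylinder

end LLG

namespace LLG

/-! ### Linear operations, bounds and semicontinuity under weak convergence -/

section WeakCalculus

variable {X : Type*} [MeasurableSpace X] {μ : Measure X}
variable {F : Type*} [NormedAddCommGroup F] [InnerProductSpace ℝ F]

theorem WeakL2.const {v : X → F} (hv : MemLp v 2 μ) : WeakL2 μ (fun _ => v) v :=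
  ⟨fun _ => hv, hv, fun _ _ => tendsto_const_nhds⟩

theorem WeakL2.add {u u' : ℕ → X → F} {v v' : X → F} (h : WeakL2 μ u v) (h' : WeakL2 μ u' v') :
    WeakL2 μ (fun n x => u n x + u' n x) (fun x => v x + v' x) := by
  refine ⟨fun n => (h.1 n).add (h'.1 n), h.2.1.add h'.2.1, fun g hg => ?_⟩
  have e : ∀ {a b : X → F}, MemLp a 2 μ → MemLp b 2 μ → ∫ x, inner ℝ (a x + b x) (g x) ∂μ
      = ∫ x, inner ℝ (a x) (g x) ∂μ + ∫ x, inner ℝ (b x) (g x) ∂μ := fun {a b} ha hb => by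
    simp_rw [inner_add_left]
    exact integral_add (integrable_inner ha hg) (integrable_inner hb hg)
  rw [e h.2.1 h'.2.1]
  exact ((h.2.2 g hg).add (h'.2.2 g hg)).congr fun n => (e (h.1 n) (h'.1 n)).symm

theorem WeakL2.const_smul {u : ℕ → X → F} {v : X → F} (h : WeakL2 μ u v) (c : ℝ) :
    WeakL2 μ (fun n x => c • u n x) (fun x => c • v x) := by
  refine ⟨fun n => (h.1 n).const_smul c, h.2.1.const_smul c, fun g hg => ?_⟩
  simp_rw [real_inner_smul_left, integral_const_mul]
  exact (h.2.2 g hg).const_mul c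

theorem WeakL2.sub {u u' : ℕ → X → F} {v v' : X → F} (h : WeakL2 μ u v) (h' : WeakL2 μ u' v') :
    WeakL2 μ (fun n x => u n x - u' n x) (fun x => v x - v' x) := by
  have := h.add (h'.const_smul (-1))
  simpa only [neg_smul, one_smul, ← sub_eq_add_neg] using this

theorem WeakL2.sum_smul {ι : Type*} (s : Finset ι) (c : ι → ℝ) {u : ι → ℕ → X → F}
    {v : ι → X → F} (h : ∀ i, WeakL2 μ (u i) (v i)) :
    WeakL2 μ (fun n x => ∑ i ∈ s, c i • u i n x) (fun x => ∑ i ∈ s, c i • v i x) := by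
  classical
  induction s using Finset.induction_on with
  | empty => simpa using WeakL2.const (μ := μ) (v := fun _ : X => (0 : F)) MemLp.zero
  | insert a s ha ih =>
    simp_rw [Finset.sum_insert ha]
    exact ((h a).const_smul (c a)).add ih

theorem StrongL2.of_sub {u u' : ℕ → X → F} {v : X → F} (h : StrongL2 μ u v)
    (hu' : ∀ n, MemLp (u' n) 2 μ)
    (hd : Tendsto (fun n => ∫ x, ‖u n x - u' n x‖ ^ 2 ∂μ) atTop (𝓝 0)) : StrongL2 μ u' v := by
  rw [strongL2_iff] at h ⊢
  refine ⟨hu', h.2.1, ?_⟩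
  have hz : Tendsto (fun n => 2 * (∫ x, ‖u n x - u' n x‖ ^ 2 ∂μ) + 2 * ∫ x, ‖u n x - v x‖ ^ 2 ∂μ)
      atTop (𝓝 0) := by simpa using (hd.const_mul 2).add (h.2.2.const_mul 2)
  refine squeeze_zero (fun n => integral_nonneg fun x => by positivity) (fun n => ?_) hz
  have i1 := integrable_norm_sq (MemLp.sub_fun (h.1 n) (hu' n))
  have i2 := integrable_norm_sq (MemLp.sub_fun (h.1 n) h.2.1)
  rw [← integral_const_mul, ← integral_const_mul, ← integral_add (i1.const_mul 2) (i2.const_mul 2)]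
  refine integral_mono (integrable_norm_sq (MemLp.sub_fun (hu' n) h.2.1))
    ((i1.const_mul 2).add (i2.const_mul 2)) fun x => ?_
  have e : u' n x - v x = (u n x - v x) - (u n x - u' n x) := by abel
  have hn := norm_sub_le (u n x - v x) (u n x - u' n x)
  simp only [e]
  nlinarith [norm_nonneg ((u n x - v x) - (u n x - u' n x)),
    sq_nonneg (‖u n x - v x‖ - ‖u n x - u' n x‖), norm_nonneg (u n x - v x),
    norm_nonneg (u n x - u' n x)]

/-- Pointwise bounds are preserved by weak limits. -/
theorem WeakL2.norm_le_ae {u : ℕ → X → F} {v : X → F} (h : WeakL2 μ u v) [IsFiniteMeasure μ] {C : ℝ}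
    (hC : ∀ n, ∀ᵐ x ∂μ, ‖u n x‖ ≤ C) : ∀ᵐ x ∂μ, ‖v x‖ ≤ C := by
  set w := h.2.1.1.mk v with hw
  have hvw : v =ᵐ[μ] w := h.2.1.1.ae_eq_mk
  have hwm : StronglyMeasurable w := h.2.1.1.stronglyMeasurable_mk
  have hw2 : MemLp w 2 μ := h.2.1.ae_eq hvw
  -- The test function is the limit restricted to the set where it exceeds `C`. There the integral
  -- of `|w|²` is at most that of `C |w|`, although the integrand is larger; so the set is null.
  set A : Set X := {x | C < ‖w x‖} with hA
  have hAm : MeasurableSet A := measurableSet_lt measurable_const hwm.norm.measurable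
  have h' := h.congr (fun n => EventuallyEq.rfl) hvw
  have hg : MemLp (A.indicator w) 2 μ := hw2.indicator hAm
  have h2 : MemLp (fun x => ‖w x‖) 2 μ := hw2.norm
  have i1 : Integrable (fun x => A.indicator (fun x => C * ‖w x‖) x) μ :=
    ((h2.integrable one_le_two).const_mul C).indicator hAm
  have i2 : Integrable (fun x => A.indicator (fun x => ‖w x‖ ^ 2) x) μ :=
    (integrable_norm_sq hw2).indicator hAm
  have hle : ∫ x, inner ℝ (w x) (A.indicator w x) ∂μ
      ≤ ∫ x, A.indicator (fun x => C * ‖w x‖) x ∂μ := by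
    refine le_of_tendsto (h'.2.2 _ hg) (Eventually.of_forall fun n => ?_)
    refine integral_mono_ae (integrable_inner (h.1 n) hg) i1 ?_
    filter_upwards [hC n] with x hx
    by_cases hxA : x ∈ A
    · simp only [Set.indicator_of_mem hxA]
      exact (real_inner_le_norm _ _).trans (mul_le_mul_of_nonneg_right hx (norm_nonneg _))
    · simp [Set.indicator_of_notMem hxA]
  have e : ∀ x, inner ℝ (w x) (A.indicator w x) = A.indicator (fun x => ‖w x‖ ^ 2) x := fun x => by
    by_cases hxA : x ∈ A
    · simp [Set.indicator_of_mem hxA, real_inner_self_eq_norm_sq]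
    · simp [Set.indicator_of_notMem hxA]
  simp_rw [e] at hle
  have hnn : 0 ≤ᵐ[μ] fun x => A.indicator (fun x => ‖w x‖ ^ 2) x
      - A.indicator (fun x => C * ‖w x‖) x := ae_of_all _ fun x => by
    by_cases hxA : x ∈ A
    · simp only [Set.indicator_of_mem hxA, Pi.zero_apply]
      have : C < ‖w x‖ := hxA
      nlinarith [norm_nonneg (w x)]
    · simp [Set.indicator_of_notMem hxA]
  have h0 : ∫ x, (A.indicator (fun x => ‖w x‖ ^ 2) x
      - A.indicator (fun x => C * ‖w x‖) x) ∂μ = 0 := by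
    refine le_antisymm ?_ (integral_nonneg_of_ae hnn)
    rw [integral_sub i2 i1]
    linarith
  rw [integral_eq_zero_iff_of_nonneg_ae hnn (i2.sub i1)] at h0
  have hC0 : ∀ᵐ x ∂μ, 0 ≤ C := by
    filter_upwards [hC 0] with x hx using (norm_nonneg _).trans hx
  filter_upwards [h0, hvw, hC0] with x hx hv h0
  rw [hv]
  by_contra hcon
  have hxA : x ∈ A := not_le.1 hcon
  have hlt : C < ‖w x‖ := hxA
  simp only [Set.indicator_of_mem hxA, Pi.zero_apply] at hx
  nlinarith [norm_nonneg (w x)]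

/-- Weak lower semicontinuity for finitely many components. -/
theorem sum_integral_norm_sq_le {ι : Type*} [Fintype ι] {u : ι → ℕ → X → F} {v : ι → X → F}
    (h : ∀ i, WeakL2 μ (u i) (v i)) {C : ℝ} (hC : ∀ n, ∑ i, ∫ x, ‖u i n x‖ ^ 2 ∂μ ≤ C) :
    ∑ i, ∫ x, ‖v i x‖ ^ 2 ∂μ ≤ C := by
  have ht : Tendsto (fun n => ∑ i, ∫ x, inner ℝ (u i n x) (v i x) ∂μ) atTop
      (𝓝 (∑ i, ∫ x, ‖v i x‖ ^ 2 ∂μ)) := by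
    refine tendsto_finsetSum _ fun i _ => ?_
    simpa only [real_inner_self_eq_norm_sq] using (h i).2.2 (v i) (h i).2.1
  have hle : ∑ i, ∫ x, ‖v i x‖ ^ 2 ∂μ ≤ (C + ∑ i, ∫ x, ‖v i x‖ ^ 2 ∂μ) / 2 := by
    refine le_of_tendsto ht (Eventually.of_forall fun n => ?_)
    have : ∀ i, ∫ x, inner ℝ (u i n x) (v i x) ∂μ
        ≤ ((∫ x, ‖u i n x‖ ^ 2 ∂μ) + ∫ x, ‖v i x‖ ^ 2 ∂μ) / 2 := fun i => by
      have i1 := integrable_norm_sq ((h i).1 n)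
      have i2 := integrable_norm_sq (h i).2.1
      rw [← integral_add i1 i2, ← integral_div]
      refine integral_mono (integrable_inner ((h i).1 n) (h i).2.1) ((i1.add i2).div_const 2)
        fun x => ?_
      have := real_inner_le_norm (u i n x) (v i x)
      change _ ≤ (‖u i n x‖ ^ 2 + ‖v i x‖ ^ 2) / 2
      nlinarith [sq_nonneg (‖u i n x‖ - ‖v i x‖)]
    refine (Finset.sum_le_sum fun i _ => this i).trans ?_
    rw [← Finset.sum_div, Finset.sum_add_distrib]
    gcongr
    exact hC n
  linarith

end WeakCalculus

/-! ### From coordinate directions to all directions -/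

section Directions

variable {X : Type*} [NormedAddCommGroup X] [NormedSpace ℝ X] [FiniteDimensional ℝ X]
  [MeasureSpace X] [BorelSpace X] [(volume : Measure X).IsAddHaarMeasure]
variable {F : Type*} [NormedAddCommGroup F] [InnerProductSpace ℝ F] [CompleteSpace F]
variable {ι : Type*} [Fintype ι]

theorem MemH1.of_directions {U : Set X} {d : ι → X} (hd : ∀ e, ∃ c : ι → ℝ, ∑ i, c i • d i = e)
    {u : X → F} {g : ι → X → F} (hu : MemLp u 2 (volume.restrict U))
    (hg : ∀ i, MemLp (g i) 2 (volume.restrict U)) (h : ∀ i, HasWeakDeriv U (d i) u (g i)) :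
    MemH1 U u := by
  refine ⟨hu, fun e => ?_⟩
  obtain ⟨c, rfl⟩ := hd e
  exact ⟨_, memLp_finsetSum _ fun i _ => (hg i).const_smul (c i),
    HasWeakDeriv.sum_dir Finset.univ d c g hu hg h⟩

theorem WeakH1.of_directions {U : Set X} (hU : IsOpen U) {d : ι → X}
    (hd : ∀ e, ∃ c : ι → ℝ, ∑ i, c i • d i = e) {u : ℕ → X → F} {v : X → F}
    {g : ι → ℕ → X → F} {g' : ι → X → F} (hu : WeakL2 (volume.restrict U) u v)
    (hg : ∀ i, WeakL2 (volume.restrict U) (g i) (g' i))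
    (h : ∀ i n, HasWeakDeriv U (d i) (u n) (g i n)) : WeakH1 U u v := by
  have h' : ∀ i, HasWeakDeriv U (d i) v (g' i) := fun i => HasWeakDeriv.of_weakL2 (h i) hu (hg i)
  refine ⟨fun n => MemH1.of_directions hd (hu.1 n) (fun i => (hg i).1 n) fun i => h i n,
    MemH1.of_directions hd hu.2.1 (fun i => (hg i).2.1) h', hu, fun e => ?_⟩
  obtain ⟨c, rfl⟩ := hd e
  have hs := WeakL2.sum_smul Finset.univ c hg
  refine hs.congr (fun n => ?_) ?_
  · exact ((HasWeakDeriv.sum_dir Finset.univ d c (fun i => g i n) (hu.1 n) (fun i => (hg i).1 n)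
      fun i => h i n).weakDeriv_ae hU (hs.1 n)).symm
  · exact ((HasWeakDeriv.sum_dir Finset.univ d c g' hu.2.1 (fun i => (hg i).2.1)
      h').weakDeriv_ae hU hs.2.1).symm

end Directions

theorem sum_smul_basisVec (e : E3) : ∑ i, e i • basisVec i = e := by
  refine E3_ext ?_ ?_ ?_ <;> simp [Fin.sum_univ_three, basisVec]

/-- The coordinate directions of space-time. -/
noncomputable def coordDir : Option (Fin 3) → ℝ × E3
  | none => timeDir
  | some i => spaceDir i

theorem sum_smul_coordDir (q : ℝ × E3) :
    ∑ o, (o.elim q.1 fun i => q.2 i) • coordDir o = q := by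
  rw [Fintype.sum_option]
  refine Prod.ext ?_ ?_
  · simp [coordDir, timeDir, spaceDir, Prod.fst_sum]
  · simp [coordDir, timeDir, spaceDir, Prod.snd_sum, sum_smul_basisVec]

theorem abs_coord_le (q : ℝ × E3) (o : Option (Fin 3)) : |o.elim q.1 fun i => q.2 i| ≤ ‖q‖ := by
  cases o with
  | none => exact norm_fst_le q
  | some i => exact (PiLp.norm_apply_le q.2 i).trans (norm_snd_le q)

theorem norm_apply_sq_le (G : E3 →L[ℝ] E3) (e : E3) :
    ‖G e‖ ^ 2 ≤ ‖e‖ ^ 2 * ∑ i, ‖G (basisVec i)‖ ^ 2 := by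
  have h1 : ‖G e‖ ≤ ∑ i, ‖e i‖ * ‖G (basisVec i)‖ := by
    conv_lhs => rw [← sum_smul_basisVec e, map_sum]
    refine (norm_sum_le _ _).trans (le_of_eq ?_)
    simp_rw [map_smul, norm_smul]
  have h2 : ‖e‖ ^ 2 = ∑ i, ‖e i‖ ^ 2 := EuclideanSpace.norm_sq_eq e
  rw [h2]
  exact (pow_le_pow_left₀ (norm_nonneg _) h1 2).trans
    (Finset.sum_mul_sq_le_sq_mul_sq _ _ _)

/-- Bounded gradients pass to weak limits in `L²(Ω)`. -/
theorem memH1_of_weakL2 {Ω : Set E3} (hΩ : IsOpen Ω) {u : ℕ → E3 → E3} {v : E3 → E3}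
    (h : WeakL2 (volume.restrict Ω) u v) (hu : ∀ n, MemH1 Ω (u n)) {C : ℝ}
    (hC : ∀ n, gradNormSq Ω (u n) ≤ C) : MemH1 Ω v ∧ gradNormSq Ω v ≤ C := by
  obtain ⟨σ, hσ, hw⟩ := exists_weakL2_subseq_family (Finset.univ : Finset (Fin 3))
    (u := fun i n => weakDeriv Ω (basisVec i) (u n)) (fun i n => (hu n).memLp_weakDeriv _)
    (C := C) fun i n => by
      refine le_trans ?_ (hC n)
      exact Finset.single_le_sum (f := fun i => ∫ x in Ω, ‖weakDeriv Ω (basisVec i) (u n) x‖ ^ 2)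
        (fun j _ => integral_nonneg fun x => by positivity) (Finset.mem_univ i)
  choose! g hg using hw
  replace hg := fun i => hg i (Finset.mem_univ i)
  have hd : ∀ i, HasWeakDeriv Ω (basisVec i) v (g i) := fun i =>
    HasWeakDeriv.of_weakL2 (fun n => (hu (σ n)).hasWeakDeriv _) (h.comp hσ.tendsto_atTop) (hg i)
  refine ⟨MemH1.of_directions (fun e => ⟨_, sum_smul_basisVec e⟩) h.2.1 (fun i => (hg i).2.1) hd,
    ?_⟩
  have := sum_integral_norm_sq_le hg fun n => hC (σ n)
  refine le_trans (le_of_eq ?_) this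
  refine Finset.sum_congr rfl fun i _ => integral_congr_ae ?_
  filter_upwards [(hd i).weakDeriv_ae hΩ (hg i).2.1] with x hx
  rw [hx]

end LLG

/-! ### Compactness of bounded discrete evolutions -/

namespace LLG

/-- Discrete magnetizations `m l 0, …, m l (N l)` with time-step size `k l` on meshes of size
at most `d l`, with uniform bounds for the gradients and for the difference quotients in time. -/
structure BoundedEvolution {Ω : Set E3} (mesh : ℕ → TetMesh Ω) (d k : ℕ → ℝ) (N : ℕ → ℕ)
    (T E D : ℝ) (m : ℕ → ℕ → E3 → E3) : Prop where
  step_pos : ∀ l, 0 < k l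
  step_mul : ∀ l, k l * N l = T
  step_tendsto : Tendsto k atTop (𝓝 0)
  diam_le : ∀ l, ∀ s ∈ (mesh l).tets, Metric.diam (hull s) ≤ d l
  diam_tendsto : Tendsto d atTop (𝓝 0)
  mag : ∀ l, ∀ j ≤ N l, m l j ∈ discreteMag (mesh l)
  grad : ∀ l, ∀ j ≤ N l, gradNormSq Ω (m l j) ≤ E
  diff : ∀ l, ∑ j ∈ Finset.range (N l), k l * ∫ x in Ω, ‖diffQuot (k l) (m l) j x‖ ^ 2 ≤ D

namespace BoundedEvolution

variable {Ω : Set E3} {mesh : ℕ → TetMesh Ω} {d k : ℕ → ℝ} {N : ℕ → ℕ} {T E D : ℝ}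
  {m : ℕ → ℕ → E3 → E3}

theorem comp (H : BoundedEvolution mesh d k N T E D m) {σ : ℕ → ℕ} (hσ : Tendsto σ atTop atTop) :
    BoundedEvolution (fun l => mesh (σ l)) (fun l => d (σ l)) (fun l => k (σ l))
      (fun l => N (σ l)) T E D (fun l => m (σ l)) :=
  ⟨fun l => H.step_pos _, fun l => H.step_mul _, H.step_tendsto.comp hσ, fun l => H.diam_le _,
    H.diam_tendsto.comp hσ, fun l => H.mag _, fun l => H.grad _, fun l => H.diff _⟩

theorem memLp (H : BoundedEvolution mesh d k N T E D m) (hΩ : IsLipschitzDomain Ω) (l : ℕ) :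
    ∀ j ≤ N l, MemLp (m l j) 2 (volume.restrict Ω) := fun j hj =>
  memLp_of_courant hΩ (H.mag l j hj).1 2

theorem memLp_diffQuot (H : BoundedEvolution mesh d k N T E D m) (hΩ : IsLipschitzDomain Ω)
    (l : ℕ) : ∀ j < N l, MemLp (diffQuot (k l) (m l) j) 2 (volume.restrict Ω) := fun j hj =>
  ((H.memLp hΩ l (j + 1) hj).sub (H.memLp hΩ l j hj.le)).const_smul _

theorem norm_le (H : BoundedEvolution mesh d k N T E D m) (l : ℕ) :
    ∀ j ≤ N l, ∀ x ∈ Ω, ‖m l j x‖ ≤ 1 := fun j hj _ hx =>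
  norm_le_one_of_discreteMag (H.mag l j hj) (subset_closure hx)

theorem memLp_timeConst (H : BoundedEvolution mesh d k N T E D m) (hΩ : IsLipschitzDomain Ω)
    (l : ℕ) : MemLp (timeConst (k l) (m l)) 2 (volume.restrict (cylinder T Ω)) :=
  LLG.memLp_timeConst (H.step_pos l) (H.step_mul l) fun j hj => H.memLp hΩ l j hj.le

theorem memLp_timeAffine (H : BoundedEvolution mesh d k N T E D m) (hΩ : IsLipschitzDomain Ω)
    (l : ℕ) : MemLp (timeAffine (k l) (m l)) 2 (volume.restrict (cylinder T Ω)) :=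
  LLG.memLp_timeAffine (H.step_pos l) (H.step_mul l) (H.memLp hΩ l)

theorem ae_mem_cylinder (hΩ : IsOpen Ω) (T : ℝ) :
    ∀ᵐ p ∂(volume.restrict (cylinder T Ω)), p ∈ cylinder T Ω :=
  ae_restrict_mem (isOpen_cylinder hΩ T).measurableSet

theorem norm_timeConst_le (H : BoundedEvolution mesh d k N T E D m) (hΩ : IsLipschitzDomain Ω)
    (l : ℕ) : ∀ᵐ p ∂(volume.restrict (cylinder T Ω)), ‖timeConst (k l) (m l) p‖ ≤ 1 := by
  filter_upwards [ae_mem_cylinder hΩ.isOpen T] with p hp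
  exact H.norm_le l _ (floor_div_lt (H.step_pos l) (H.step_mul l) hp.1.2 hp.1.1.le).le _ hp.2

theorem norm_timeAffine_le (H : BoundedEvolution mesh d k N T E D m) (hΩ : IsLipschitzDomain Ω)
    (l : ℕ) : ∀ᵐ p ∂(volume.restrict (cylinder T Ω)), ‖timeAffine (k l) (m l) p‖ ≤ 1 := by
  filter_upwards [ae_mem_cylinder hΩ.isOpen T] with p hp
  have hlt := floor_div_lt (H.step_pos l) (H.step_mul l) hp.1.2 hp.1.1.le
  exact (norm_affineInterp_le (H.step_pos l) (fun j => m l j p.2) hp.1.1.le).trans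
    (max_le (H.norm_le l _ hlt p.2 hp.2) (H.norm_le l _ hlt.le p.2 hp.2))

/-- The derivatives of the interpolation in the coordinate directions of space-time. -/
noncomputable def coordDeriv (k : ℝ) (m : ℕ → E3 → E3) : Option (Fin 3) → ℝ × E3 → E3
  | none => timeConst k (diffQuot k m)
  | some i => timeAffine k fun j x => fderiv ℝ (m j) x (basisVec i)

/-- In time the interpolation is Lipschitz for each point of space; in space it is, at each fixed
time, a combination of two Courant functions with constant coefficients. -/
theorem hasWeakDeriv_coord (H : BoundedEvolution mesh d k N T E D m) (hΩ : IsLipschitzDomain Ω)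
    (l : ℕ) (o : Option (Fin 3)) : HasWeakDeriv (cylinder T Ω) (coordDir o)
      (timeAffine (k l) (m l)) (coordDeriv (k l) (m l) o) := by
  cases o with
  | none =>
    exact hasWeakDeriv_time_timeAffine hΩ.isOpen (H.step_pos l) (H.step_mul l) (H.memLp hΩ l)
      (H.norm_le l)
  | some i =>
    refine HasWeakDeriv.of_slices (basisVec i) (H.memLp_timeAffine hΩ l)
      (LLG.memLp_timeAffine (H.step_pos l) (H.step_mul l) fun j hj =>
        memLp_fderiv_of_courant hΩ (H.mag l j hj).1 _ 2) fun t ht => ?_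
    have hlt := floor_div_lt (H.step_pos l) (H.step_mul l) ht.2 ht.1.le
    have h1 := hasWeakDeriv_of_courant hΩ (H.mag l (⌊t / k l⌋₊ + 1) hlt).1 (basisVec i)
    have h2 := hasWeakDeriv_of_courant hΩ (H.mag l ⌊t / k l⌋₊ hlt.le).1 (basisVec i)
    have m1 := H.memLp hΩ l _ hlt
    have m2 := H.memLp hΩ l _ hlt.le
    have n1 := memLp_fderiv_of_courant hΩ (H.mag l (⌊t / k l⌋₊ + 1) hlt).1 (basisVec i) 2
    have n2 := memLp_fderiv_of_courant hΩ (H.mag l ⌊t / k l⌋₊ hlt.le).1 (basisVec i) 2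
    intro φ c1 c2 c3
    have q := integrable_test_smul (contDiff_fderiv_const c1 (basisVec i)).continuous
      (hasCompactSupport_fderiv_const c2 (basisVec i)) m1
    have q' := integrable_test_smul (contDiff_fderiv_const c1 (basisVec i)).continuous
      (hasCompactSupport_fderiv_const c2 (basisVec i)) m2
    have r := integrable_test_smul c1.continuous c2 n1
    have r' := integrable_test_smul c1.continuous c2 n2
    have e1 := h1 φ c1 c2 c3
    have e2 := h2 φ c1 c2 c3
    have key : ∀ (a b : ℝ) {A B : E3 → E3}, Integrable A (volume.restrict Ω) →
        Integrable B (volume.restrict Ω) →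
        ∫ x in Ω, (a • A x + b • B x) = a • (∫ x in Ω, A x) + b • ∫ x in Ω, B x :=
      fun a b A B hA hB => by
        refine (integral_add (hA.smul a) (hB.smul b)).trans ?_
        exact congrArg₂ _ (integral_smul a A) (integral_smul b B)
    simp only [coordDeriv, timeAffine, smul_add, smul_comm _ (((t - _) / k l) : ℝ),
      smul_comm _ (((_ - t) / k l) : ℝ)]
    refine (key _ _ q q').trans ?_
    rw [key _ _ r r']
    have e1' : ∫ x in Ω, (fderiv ℝ φ x) (basisVec i) • m l ⌊t / k l⌋₊.succ x
      = -∫ x in Ω, φ x • (fderiv ℝ (m l (⌊t / k l⌋₊ + 1)) x) (basisVec i) := e1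
    rw [e1', e2, smul_neg, smul_neg, neg_add]

theorem memLp_coordDeriv (H : BoundedEvolution mesh d k N T E D m) (hΩ : IsLipschitzDomain Ω)
    (l : ℕ) (o : Option (Fin 3)) :
    MemLp (coordDeriv (k l) (m l) o) 2 (volume.restrict (cylinder T Ω)) := by
  cases o with
  | none => exact LLG.memLp_timeConst (H.step_pos l) (H.step_mul l) (H.memLp_diffQuot hΩ l)
  | some i => exact LLG.memLp_timeAffine (H.step_pos l) (H.step_mul l) fun j hj =>
        memLp_fderiv_of_courant hΩ (H.mag l j hj).1 _ 2

theorem integral_diffQuot_le (H : BoundedEvolution mesh d k N T E D m)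
    (hΩ : IsLipschitzDomain Ω) (l : ℕ) :
    ∫ p in cylinder T Ω, ‖timeConst (k l) (diffQuot (k l) (m l)) p‖ ^ 2 ≤ D := by
  rw [integral_norm_sq_timeConst (H.step_pos l) (H.step_mul l) (H.memLp_diffQuot hΩ l)]
  exact H.diff l

theorem integral_fderiv_le (H : BoundedEvolution mesh d k N T E D m)
    (hΩ : IsLipschitzDomain Ω) (l : ℕ) (i : Fin 3) : ∀ j ≤ N l,
    ∫ x in Ω, ‖fderiv ℝ (m l j) x (basisVec i)‖ ^ 2 ≤ E := fun j hj => by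
  have h := H.grad l j hj
  rw [gradNormSq_of_courant hΩ (H.mag l j hj).1] at h
  exact (Finset.single_le_sum (f := fun i => ∫ x in Ω, ‖fderiv ℝ (m l j) x (basisVec i)‖ ^ 2)
    (fun j _ => integral_nonneg fun x => by positivity) (Finset.mem_univ i)).trans h

theorem integral_coordDeriv_le (H : BoundedEvolution mesh d k N T E D m)
    (hΩ : IsLipschitzDomain Ω) (l : ℕ) (o : Option (Fin 3)) :
    ∫ p in cylinder T Ω, ‖coordDeriv (k l) (m l) o p‖ ^ 2 ≤ max D (2 * T * E) := by
  cases o with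
  | none => exact (H.integral_diffQuot_le hΩ l).trans (le_max_left _ _)
  | some i =>
    exact (integral_norm_sq_timeAffine_le (H.step_pos l) (H.step_mul l) (fun j hj =>
        memLp_fderiv_of_courant hΩ (H.mag l j hj).1 _ 2) (H.integral_fderiv_le hΩ l i)).trans
      (le_max_right _ _)

theorem volume_cylinder_ne_top (hΩ : IsLipschitzDomain Ω) (T : ℝ) :
    volume (cylinder T Ω) ≠ ⊤ := by
  rw [cylinder, Measure.volume_eq_prod, Measure.prod_prod]
  exact ENNReal.mul_ne_top (by simp) hΩ.volume_lt_top.ne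

theorem isFiniteMeasure_cylinder (hΩ : IsLipschitzDomain Ω) (T : ℝ) :
    IsFiniteMeasure (volume.restrict (cylinder T Ω) : Measure (ℝ × E3)) :=
  ⟨by rw [Measure.restrict_apply_univ]; exact (volume_cylinder_ne_top hΩ T).lt_top⟩

theorem tendsto_integral_affine_sub_const (H : BoundedEvolution mesh d k N T E D m)
    (hΩ : IsLipschitzDomain Ω) : Tendsto (fun l => ∫ p in cylinder T Ω,
      ‖timeAffine (k l) (m l) p - timeConst (k l) (m l) p‖ ^ 2) atTop (𝓝 0) := by
  have hz : Tendsto (fun l => k l ^ 2 * D) atTop (𝓝 0) := by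
    simpa using (H.step_tendsto.pow 2).mul_const D
  refine squeeze_zero (fun l => integral_nonneg fun p => by positivity) (fun l => ?_) hz
  exact (integral_norm_sq_timeAffine_sub_le (H.step_pos l) (H.step_mul l) (H.memLp hΩ l)).trans
    (mul_le_mul_of_nonneg_left (H.diff l) (sq_nonneg _))

theorem strongL2_timeAffine (H : BoundedEvolution mesh d k N T E D m) (hΩ : IsLipschitzDomain Ω)
    {M : ℝ × E3 → E3} (hs : StrongL2 (volume.restrict (cylinder T Ω))
      (fun l => timeConst (k l) (m l)) M) :
    StrongL2 (volume.restrict (cylinder T Ω)) (fun l => timeAffine (k l) (m l)) M := by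
  refine hs.of_sub (H.memLp_timeAffine hΩ) ?_
  simpa only [norm_sub_rev] using H.tendsto_integral_affine_sub_const hΩ

/-- Bounded discrete evolutions are precompact. -/
theorem exists_limit (H : BoundedEvolution mesh d k N T E D m) (hΩ : IsLipschitzDomain Ω) :
    ∃ σ : ℕ → ℕ, StrictMono σ ∧ ∃ M : ℝ × E3 → E3,
      StrongL2 (volume.restrict (cylinder T Ω)) (fun l => timeConst (k (σ l)) (m (σ l))) M ∧
      WeakH1 (cylinder T Ω) (fun l => timeAffine (k (σ l)) (m (σ l))) M := by
  have hU := isOpen_cylinder hΩ.isOpen T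
  have := isFiniteMeasure_cylinder hΩ T
  obtain ⟨σ, hσ, hw⟩ := exists_weakL2_subseq_family (Finset.univ : Finset (Option (Fin 3)))
    (u := fun o l => coordDeriv (k l) (m l) o) (fun o l => H.memLp_coordDeriv hΩ l o)
    (fun o l => H.integral_coordDeriv_le hΩ l o)
  choose! g hg using hw
  replace hg := fun o => hg o (Finset.mem_univ o)
  have hb : ∀ l, ∫ p in cylinder T Ω, ‖timeAffine (k l) (m l) p‖ ^ 2
      ≤ (volume.restrict (cylinder T Ω)).real Set.univ := fun l => by
    refine (integral_mono_ae (integrable_norm_sq (H.memLp_timeAffine hΩ l))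
      (integrable_const (1 : ℝ)) ?_).trans (by simp)
    filter_upwards [H.norm_timeAffine_le hΩ l] with p hp
    exact pow_le_one₀ (norm_nonneg _) hp
  obtain ⟨τ, hτ, M, hM⟩ := exists_weakL2_subseq (u := fun l => timeAffine (k (σ l)) (m (σ l)))
    (fun l => H.memLp_timeAffine hΩ _) (fun l => hb _)
  replace hg := fun o => (hg o).comp hτ.tendsto_atTop
  have hst := hσ.comp hτ
  set ρ : ℕ → ℕ := fun l => σ (τ l) with hρ
  have Hρ := H.comp hst.tendsto_atTop
  have hd := fun o l => Hρ.hasWeakDeriv_coord hΩ l o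
  have hH1 : WeakH1 (cylinder T Ω) (fun l => timeAffine (k (ρ l)) (m (ρ l))) M :=
    WeakH1.of_directions hU (fun q => ⟨_, sum_smul_coordDir q⟩) hM hg hd
  have hd' : ∀ o, HasWeakDeriv (cylinder T Ω) (coordDir o) M (g o) := fun o =>
    HasWeakDeriv.of_weakL2 (hd o) hM (hg o)
  have hM1 : ∀ᵐ p ∂(volume.restrict (cylinder T Ω)), ‖M p‖ ≤ 1 :=
    hM.norm_le_ae fun l => Hρ.norm_timeAffine_le hΩ l
  have hdiff := hM.sub (WeakL2.const hM.2.1)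
  simp only [sub_self] at hdiff
  have hgd := fun o => (hg o).sub (WeakL2.const (hg o).2.1)
  choose Cb hCb using fun o => (hgd o).exists_bound
  -- Rellich's theorem is applied to the differences from the weak limit: they tend weakly to zero
  -- and are bounded by 2, and their weak derivatives are bounded as weakly convergent sequences.
  -- The factor 4 is Cauchy-Schwarz for the four coordinates of space-time, each of modulus at most
  -- one.
  have hs : StrongL2 (volume.restrict (cylinder T Ω))
      (fun l p => timeAffine (k (ρ l)) (m (ρ l)) p - M p) 0 := by
    refine StrongL2.of_weakL2_of_bounded_deriv hU (volume_cylinder_ne_top hΩ T) hdiff (M := 2)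
      (fun l => ?_) (C := ENNReal.ofReal (4 * ∑ o, Cb o)) ENNReal.ofReal_ne_top fun l q hq => ?_
    · filter_upwards [Hρ.norm_timeAffine_le hΩ l, hM1] with p h1 h2
      exact (norm_sub_le _ _).trans ((add_le_add h1 h2).trans one_add_one_eq_two.le)
    · set G : Option (Fin 3) → ℝ × E3 → E3 := fun o p => coordDeriv (k (ρ l)) (m (ρ l)) o p - g o p
        with hG
      have mG : ∀ o, MemLp (G o) 2 (volume.restrict (cylinder T Ω)) := fun o => (hgd o).1 l
      have hw := fun o => HasWeakDeriv.sub (hM.1 l) hM.2.1 ((hg o).1 l) (hg o).2.1 (hd o l) (hd' o)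
      set c : Option (Fin 3) → ℝ := fun o => o.elim q.1 fun i => q.2 i with hc
      have mS : MemLp (fun p => ∑ o, c o • G o p) 2 (volume.restrict (cylinder T Ω)) :=
        memLp_finsetSum _ fun o _ => (mG o).const_smul (c o)
      refine ⟨fun p => ∑ o, c o • G o p, mS, ?_, ?_⟩
      · have := HasWeakDeriv.sum_dir Finset.univ coordDir c G (hdiff.1 l) mG hw
        rwa [sum_smul_coordDir] at this
      · simp_rw [enorm_sq_eq]
        rw [← ofReal_integral_eq_lintegral_ofReal (integrable_norm_sq mS)
          (ae_of_all _ fun p => by positivity)]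
        refine ENNReal.ofReal_le_ofReal ?_
        calc ∫ p in cylinder T Ω, ‖∑ o, c o • G o p‖ ^ 2
            ≤ ∫ p in cylinder T Ω, 4 * ∑ o, ‖G o p‖ ^ 2 := by
              refine integral_mono (integrable_norm_sq mS)
                ((integrable_finsetSum _ fun o _ => integrable_norm_sq (mG o)).const_mul 4)
                fun p => ?_
              have h1 : ‖∑ o, c o • G o p‖ ≤ ∑ o, ‖G o p‖ := by
                refine (norm_sum_le _ _).trans (Finset.sum_le_sum fun o _ => ?_)
                rw [norm_smul]
                exact mul_le_of_le_one_left (norm_nonneg _) ((abs_coord_le q o).trans hq)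
              refine (pow_le_pow_left₀ (norm_nonneg _) h1 2).trans ?_
              have := sq_sum_le_card_mul_sum_sq (s := Finset.univ) (f := fun o => ‖G o p‖)
              simpa using this
          _ = 4 * ∑ o, ∫ p in cylinder T Ω, ‖G o p‖ ^ 2 := by
              rw [integral_const_mul, integral_finsetSum _ fun o _ => integrable_norm_sq (mG o)]
          _ ≤ 4 * ∑ o, Cb o := by
              gcongr with o
              exact hCb o l
  have hsA : StrongL2 (volume.restrict (cylinder T Ω))
      (fun l => timeAffine (k (ρ l)) (m (ρ l))) M := by
    rw [strongL2_iff] at hs ⊢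
    exact ⟨hM.1, hM.2.1, by simpa using hs.2.2⟩
  exact ⟨ρ, hst, M, hsA.of_sub (Hρ.memLp_timeConst hΩ) (Hρ.tendsto_integral_affine_sub_const hΩ),
    hH1⟩

end BoundedEvolution

end LLG

/-! ### Properties of the limits: energy, unit modulus, initial value -/

namespace LLG

namespace BoundedEvolution

variable {Ω : Set E3} {mesh : ℕ → TetMesh Ω} {d k : ℕ → ℝ} {N : ℕ → ℕ} {T E D : ℝ}
  {m : ℕ → ℕ → E3 → E3}

/-- For almost every time a subsequence of slices converges strongly. Slices of the piecewise
constant interpolation are discrete magnetizations themselves, so their gradient bound passes to the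
limit by semicontinuity. -/
theorem memH1_slice (H : BoundedEvolution mesh d k N T E D m) (hΩ : IsLipschitzDomain Ω)
    {M : ℝ × E3 → E3} (hs : StrongL2 (volume.restrict (cylinder T Ω))
      (fun l => timeConst (k l) (m l)) M) :
    ∀ᵐ t ∂(volume.restrict (Set.Ioo 0 T)), MemH1 Ω (fun x => M (t, x)) ∧
      gradNormSq Ω (fun x => M (t, x)) ≤ E ∧ ∀ᵐ x ∂(volume.restrict Ω), ‖M (t, x)‖ ≤ 1 := by
  have := hΩ.isFiniteMeasure
  obtain ⟨σ, hσ, h⟩ := hs.exists_subseq_slices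
  filter_upwards [h, ae_restrict_mem measurableSet_Ioo] with t ht h0
  have hlt := fun l => (floor_div_lt (H.step_pos (σ l)) (H.step_mul (σ l)) h0.2 h0.1.le).le
  have hw : WeakL2 (volume.restrict Ω) (fun l => m (σ l) ⌊t / k (σ l)⌋₊) (fun x => M (t, x)) :=
    ht.weakL2
  have h1 := memH1_of_weakL2 hΩ.isOpen hw
    (fun l => memH1_of_courant hΩ (H.mag (σ l) _ (hlt l)).1) fun l => H.grad (σ l) _ (hlt l)
  refine ⟨h1.1, h1.2, hw.norm_le_ae fun l => ?_⟩
  filter_upwards [ae_restrict_mem hΩ.isOpen.measurableSet] with x hx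
  exact H.norm_le (σ l) _ (hlt l) x hx

theorem memLinftyH1 (H : BoundedEvolution mesh d k N T E D m) (hΩ : IsLipschitzDomain Ω)
    {M : ℝ × E3 → E3} (hs : StrongL2 (volume.restrict (cylinder T Ω))
      (fun l => timeConst (k l) (m l)) M) : MemLinftyH1 T Ω M := by
  have := hΩ.isFiniteMeasure
  refine ⟨(volume.restrict Ω).real Set.univ + E, ?_⟩
  filter_upwards [H.memH1_slice hΩ hs] with t ht
  refine ⟨ht.1, add_le_add ?_ ht.2.1⟩
  refine (integral_mono_ae (integrable_norm_sq ht.1.1) (integrable_const (1 : ℝ)) ?_).trans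
    (by simp)
  filter_upwards [ht.2.2] with x hx
  exact pow_le_one₀ (norm_nonneg _) hx

theorem energyBound (H : BoundedEvolution mesh d k N T E D m) (hΩ : IsLipschitzDomain Ω)
    {M : ℝ × E3 → E3} (hs : StrongL2 (volume.restrict (cylinder T Ω))
      (fun l => timeConst (k l) (m l)) M)
    (hw : WeakH1 (cylinder T Ω) (fun l => timeAffine (k l) (m l)) M) :
    EnergyBound T Ω M (E + D) := by
  have hU := isOpen_cylinder hΩ.isOpen T
  have hD : ∫ p in cylinder T Ω, ‖weakDeriv (cylinder T Ω) timeDir M p‖ ^ 2 ≤ D := by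
    refine (hw.2.2.2 timeDir).integral_norm_sq_le fun l => ?_
    refine le_trans (le_of_eq (integral_congr_ae ?_)) (H.integral_diffQuot_le hΩ l)
    filter_upwards [(H.hasWeakDeriv_coord hΩ l none).weakDeriv_ae hU
      (H.memLp_coordDeriv hΩ l none)] with p hp
    have hp' : weakDeriv (cylinder T Ω) timeDir (timeAffine (k l) (m l)) p
      = timeConst (k l) (diffQuot (k l) (m l)) p := hp
    rw [hp']
  filter_upwards [H.memH1_slice hΩ hs, ae_restrict_mem measurableSet_Ioo] with t ht h0
  refine ⟨ht.1, add_le_add ht.2.1 (le_trans ?_ hD)⟩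
  refine setIntegral_mono_set (integrable_norm_sq (hw.2.1.memLp_weakDeriv timeDir))
    (ae_of_all _ fun p => by positivity) (Eventually.of_forall ?_)
  exact Set.prod_mono (Set.Ioo_subset_Ioo_right h0.2.le) subset_rfl

/-- Comparison with a vertex, where the modulus is one: along the way the affine function changes by
at most the diameter times the gradient. -/
theorem one_sub_norm_sq_le {M : TetMesh Ω} {u : E3 → E3} (hu : u ∈ discreteMag M) {s : Finset E3}
    (hs : s ∈ M.tets) {δ : ℝ} (hδ : Metric.diam (hull s) ≤ δ) {x : E3}
    (hx : x ∈ interior (hull s)) :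
    (1 - ‖u x‖) ^ 2 ≤ δ ^ 2 * ∑ i, ‖fderiv ℝ u x (basisVec i)‖ ^ 2 := by
  obtain ⟨z, hz⟩ := M.nonempty_of_mem_tets hs
  have hxh := interior_subset hx
  have hzh : z ∈ hull s := subset_convexHull ℝ _ hz
  have h1 := hu.2 z (M.mem_nodes hs hz)
  have hle := norm_le_one_of_discreteMag hu (M.hull_subset hs hxh)
  have h2 : 1 - ‖u x‖ ≤ ‖fderiv ℝ u x (z - x)‖ := by
    rw [fderiv_apply_sub hu.1 hs hx hxh hzh, ← h1]
    exact norm_sub_norm_le _ _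
  have h3 : ‖z - x‖ ≤ δ := by
    rw [← dist_eq_norm]
    exact (Metric.dist_le_diam_of_mem (TetMesh.isCompact_hull s).isBounded hzh hxh).trans hδ
  refine (pow_le_pow_left₀ (by linarith) h2 2).trans ((norm_apply_sq_le _ _).trans ?_)
  exact mul_le_mul_of_nonneg_right (pow_le_pow_left₀ (norm_nonneg _) h3 2)
    (Finset.sum_nonneg fun i _ => sq_nonneg _)

/-- The defect of the modulus tends to zero in `L²` like the mesh size, and the strong convergence
of the magnetizations identifies its limit almost everywhere. -/
theorem unitModulus (H : BoundedEvolution mesh d k N T E D m) (hΩ : IsLipschitzDomain Ω)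
    {M : ℝ × E3 → E3} (hs : StrongL2 (volume.restrict (cylinder T Ω))
      (fun l => timeConst (k l) (m l)) M) : UnitModulus T Ω M := by
  have := isFiniteMeasure_cylinder hΩ T
  have hmeas : ∀ l, MemLp (fun p => 1 - ‖timeConst (k l) (m l) p‖) 2
      (volume.restrict (cylinder T Ω)) := fun l =>
    MemLp.sub_fun (memLp_const 1) (H.memLp_timeConst hΩ l).norm
  have h0 : StrongL2 (volume.restrict (cylinder T Ω))
      (fun l p => 1 - ‖timeConst (k l) (m l) p‖) (fun _ => (0 : ℝ)) := by
    rw [strongL2_iff]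
    refine ⟨hmeas, MemLp.zero, ?_⟩
    have hz : Tendsto (fun l => d l ^ 2 * (T * E)) atTop (𝓝 0) := by
      simpa using (H.diam_tendsto.pow 2).mul_const (T * E)
    refine squeeze_zero (fun l => integral_nonneg fun p => by positivity) (fun l => ?_) hz
    have hi : ∀ j < N l, Integrable (fun x => d l ^ 2 *
        ∑ i, ‖fderiv ℝ (m l j) x (basisVec i)‖ ^ 2) (volume.restrict Ω) := fun j hj =>
      (integrable_finsetSum _ fun i _ => integrable_norm_sq
        (memLp_fderiv_of_courant hΩ (H.mag l j hj.le).1 (basisVec i) 2)).const_mul _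
    have hb := integral_step (H.step_pos l) (H.step_mul l) hi
    calc ∫ p in cylinder T Ω, ‖1 - ‖timeConst (k l) (m l) p‖ - 0‖ ^ 2
        ≤ ∫ p in cylinder T Ω, d l ^ 2 *
            ∑ i, ‖fderiv ℝ (m l ⌊p.1 / k l⌋₊) p.2 (basisVec i)‖ ^ 2 := by
          refine integral_mono_ae (by simpa only [sub_zero] using integrable_norm_sq (hmeas l))
            (integrable_step (H.step_pos l) (H.step_mul l) hi) ?_
          filter_upwards [ae_cylinder_fst T Ω,
            ae_cylinder_snd ((mesh l).ae_mem_interior hΩ.isOpen) T] with p hp ⟨s, hs, hx⟩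
          have hlt := floor_div_lt (H.step_pos l) (H.step_mul l) hp.2 hp.1.le
          rw [sub_zero, Real.norm_eq_abs, sq_abs]
          exact one_sub_norm_sq_le (H.mag l _ hlt.le) hs (H.diam_le l s hs) hx
      _ = ∑ j ∈ Finset.range (N l), k l • (d l ^ 2 * gradNormSq Ω (m l j)) := by
          rw [hb]
          refine Finset.sum_congr rfl fun j hj => ?_
          have hj := Finset.mem_range.1 hj
          rw [integral_const_mul, integral_finsetSum _ fun i _ => integrable_norm_sq
            (memLp_fderiv_of_courant hΩ (H.mag l j hj.le).1 (basisVec i) 2),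
            gradNormSq_of_courant hΩ (H.mag l j hj.le).1]
      _ ≤ ∑ j ∈ Finset.range (N l), k l • (d l ^ 2 * E) := by
          refine Finset.sum_le_sum fun j hj => ?_
          have := H.step_pos l
          rw [smul_eq_mul, smul_eq_mul]
          gcongr
          exact H.grad l j (Finset.mem_range.1 hj).le
      _ = d l ^ 2 * (T * E) := by
          rw [Finset.sum_const, Finset.card_range, nsmul_eq_mul, smul_eq_mul, ← H.step_mul l]
          ring
  obtain ⟨σ, hσ, hσ'⟩ := hs.exists_subseq_ae
  obtain ⟨τ, hτ, hτ'⟩ := (h0.comp hσ.tendsto_atTop).exists_subseq_ae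
  filter_upwards [hσ', hτ'] with p h1 h2
  have h3 := ((tendsto_const_nhds (x := (1 : ℝ))).sub (h1.comp hτ.tendsto_atTop).norm)
  have := tendsto_nhds_unique h3 h2
  linarith

end BoundedEvolution

/-- Equicontinuity in time of interpolations with square summable difference quotients. -/
theorem norm_affineInterp_sub_le_of_sum {V : Type*} [NormedAddCommGroup V] [NormedSpace ℝ V]
    {k T D : ℝ} {N : ℕ} (hk : 0 < k) (hT : k * N = T) {a : ℕ → V}
    (hD : ∑ j ∈ Finset.range N, k * ‖diffQuot k a j‖ ^ 2 ≤ D) {δ : ℝ} (hδ : 0 < δ) {s t : ℝ}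
    (hs : 0 ≤ s) (hst : s ≤ t) (ht : t ≤ T) :
    ‖affineInterp k a t - affineInterp k a s‖ ≤ δ / 2 * (t - s) + D / (2 * δ) := by
  set b : ℕ → ℝ := fun j => if j < N then k * ‖diffQuot k a j‖ ^ 2 else 0 with hb
  -- The interpolation of the partial sums `A` has right derivative `|d|²`, where `d` is the
  -- difference quotient of `a`, and stays between 0 and `D`. Young's inequality `|d| ≤ δ/2 +
  -- |d|²/(2δ)` compares the two growth rates. The terms are cut off at `N`, beyond which nothing is
  -- controlled.
  set A : ℕ → ℝ := fun j => ∑ i ∈ Finset.range j, b i with hA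
  have hb0 : ∀ j, 0 ≤ b j := fun j => by
    simp only [hb]
    split_ifs <;> positivity
  have hA0 : ∀ j, 0 ≤ A j := fun j => Finset.sum_nonneg fun i _ => hb0 i
  have hAD : ∀ j, A j ≤ D := fun j => by
    refine le_trans ?_ hD
    simp only [hA, hb, ← Finset.sum_filter]
    refine Finset.sum_le_sum_of_subset_of_nonneg (fun i hi => ?_) fun i _ _ => by positivity
    exact Finset.mem_range.2 (Finset.mem_filter.1 hi).2
  have hq : ∀ j < N, diffQuot k A j = ‖diffQuot k a j‖ ^ 2 := fun j hj => by
    have : A (j + 1) - A j = b j := by simp only [hA, Finset.sum_range_succ, add_sub_cancel_left]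
    rw [diffQuot, this]
    simp only [hb, if_pos hj, smul_eq_mul]
    field_simp
  have hd : ∀ τ ∈ Set.Ico s t, HasDerivWithinAt
      (fun τ => δ / 2 * (τ - s) + (affineInterp k A τ - affineInterp k A s) / (2 * δ))
      (δ / 2 + ‖diffQuot k a ⌊τ / k⌋₊‖ ^ 2 / (2 * δ)) (Set.Ici τ) τ := fun τ hτ => by
    have h1 := hasDerivWithinAt_affineInterp hk A (hs.trans hτ.1)
    rw [hq _ (floor_div_lt hk hT (hτ.2.trans_le ht) (hs.trans hτ.1))] at h1
    have h2 := (((hasDerivAt_id τ).sub_const s).const_mul (δ / 2)).hasDerivWithinAt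
      (s := Set.Ici τ)
    rw [mul_one] at h2
    exact h2.add ((h1.sub_const (affineInterp k A s)).div_const (2 * δ))
  have hc : ContinuousOn
      (fun τ => δ / 2 * (τ - s) + (affineInterp k A τ - affineInterp k A s) / (2 * δ))
      (Set.Icc s t) := by
    have := (continuousOn_affineInterp hk A).mono (fun τ hτ => hs.trans hτ.1 : Set.Icc s t ⊆ _)
    exact ((continuousOn_id.sub continuousOn_const).const_smul (δ / 2)).add
      ((this.sub continuousOn_const).div_const _)
  have key := image_norm_le_of_norm_deriv_right_le_deriv_boundary' (a := s) (b := t)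
    (f := fun τ => affineInterp k a τ - affineInterp k a s)
    (f' := fun τ => diffQuot k a ⌊τ / k⌋₊)
    (((continuousOn_affineInterp hk a).mono fun τ hτ => hs.trans hτ.1).sub continuousOn_const)
    (fun τ hτ => (hasDerivWithinAt_affineInterp hk a (hs.trans hτ.1)).sub_const _)
    (by simp) hc hd (fun τ hτ => by
      have := sq_nonneg (δ - ‖diffQuot k a ⌊τ / k⌋₊‖)
      rw [← sub_nonneg]
      have e : δ / 2 + ‖diffQuot k a ⌊τ / k⌋₊‖ ^ 2 / (2 * δ) - ‖diffQuot k a ⌊τ / k⌋₊‖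
        = (δ - ‖diffQuot k a ⌊τ / k⌋₊‖) ^ 2 / (2 * δ) := by field_simp; ring
      rw [e]
      positivity) (Set.right_mem_Icc.2 hst)
  refine key.trans ?_
  have h1 : affineInterp k A t ≤ D := by
    refine (le_abs_self _).trans ((norm_affineInterp_le hk A (hs.trans hst)).trans ?_)
    rw [Real.norm_of_nonneg (hA0 _), Real.norm_of_nonneg (hA0 _)]
    exact max_le (hAD _) (hAD _)
  have h2 : 0 ≤ affineInterp k A s := by
    obtain ⟨w1, w2, -⟩ := affineInterp_weights hk hs
    exact add_nonneg (mul_nonneg w1 (hA0 _)) (mul_nonneg w2 (hA0 _))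
  have h3 : affineInterp k A t - affineInterp k A s ≤ D := by linarith
  gcongr

/-- Equicontinuous functions that converge on a dense set converge to a continuous function. -/
theorem exists_continuous_limit {V : Type*} [NormedAddCommGroup V] [CompleteSpace V]
    {T D : ℝ} {U : ℕ → ℝ → V}
    (hU : ∀ n, ∀ δ > 0, ∀ s t : ℝ, 0 ≤ s → s ≤ t → t ≤ T →
      ‖U n t - U n s‖ ≤ δ / 2 * (t - s) + D / (2 * δ))
    {A : Set ℝ} (hA : A ⊆ Set.Icc 0 T) (hd : Set.Icc 0 T ⊆ closure A)
    (hc : ∀ t ∈ A, CauchySeq fun n => U n t) :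
    ∃ u : ℝ → V, ContinuousOn u (Set.Icc 0 T) ∧
      ∀ t ∈ Set.Icc 0 T, Tendsto (fun n => U n t) atTop (𝓝 (u t)) := by
  have hmod : ∀ ε > 0, ∃ η > 0, ∀ n, ∀ s ∈ Set.Icc 0 T, ∀ t ∈ Set.Icc 0 T, |t - s| < η →
      ‖U n t - U n s‖ ≤ ε := fun ε hε => by
    -- This `δ` makes the term `D / (2 δ)` at most `ε / 2`; time differences below `ε / δ` then make
    -- the other term at most `ε / 2` as well.
    set δ := (|D| + 1) / ε with hδ
    have hδ0 : 0 < δ := by positivity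
    refine ⟨ε / δ, by positivity, fun n => ?_⟩
    have key : ∀ s ∈ Set.Icc 0 T, ∀ t ∈ Set.Icc 0 T, s ≤ t → |t - s| < ε / δ →
        ‖U n t - U n s‖ ≤ ε := fun s hs t ht hst hlt => by
      refine (hU n δ hδ0 s t hs.1 hst ht.2).trans ?_
      have h1 : δ / 2 * (t - s) ≤ ε / 2 := by
        have : t - s ≤ ε / δ := (le_abs_self _).trans hlt.le
        calc δ / 2 * (t - s) ≤ δ / 2 * (ε / δ) := by gcongr
          _ = ε / 2 := by field_simp
      have h2 : D / (2 * δ) ≤ ε / 2 := by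
        rw [div_le_iff₀ (by positivity)]
        have : ε / 2 * (2 * δ) = |D| + 1 := by rw [hδ]; field_simp
        rw [this]
        linarith [le_abs_self D]
      linarith
    intro s hs t ht hlt
    rcases le_total s t with h | h
    · exact key s hs t ht h hlt
    · rw [norm_sub_rev]
      exact key t ht s hs h (by rwa [abs_sub_comm])
  have hcs : ∀ t ∈ Set.Icc 0 T, CauchySeq fun n => U n t := fun t ht => by
    rw [Metric.cauchySeq_iff]
    intro ε hε
    obtain ⟨η, hη, h⟩ := hmod (ε / 4) (by positivity)
    obtain ⟨s, hs, hst⟩ := Metric.mem_closure_iff.1 (hd ht) η hη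
    obtain ⟨n₀, hn₀⟩ := Metric.cauchySeq_iff.1 (hc s hs) (ε / 4) (by positivity)
    refine ⟨n₀, fun i hi j hj => ?_⟩
    have h1 := h i s (hA hs) t ht hst
    have h2 := h j s (hA hs) t ht hst
    have h3 := hn₀ i hi j hj
    rw [dist_eq_norm] at h3 ⊢
    have e : U i t - U j t = (U i t - U i s) + (U i s - U j s) - (U j t - U j s) := by abel
    rw [e]
    have := norm_sub_le ((U i t - U i s) + (U i s - U j s)) (U j t - U j s)
    have := norm_add_le (U i t - U i s) (U i s - U j s)
    linarith
  choose! u hu using fun t ht => cauchySeq_tendsto_of_complete (hcs t ht)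
  refine ⟨u, fun t ht => ?_, hu⟩
  rw [Metric.continuousWithinAt_iff]
  intro ε hε
  obtain ⟨η, hη, h⟩ := hmod (ε / 2) (by positivity)
  refine ⟨η, hη, fun {s} hs hst => ?_⟩
  have h1 : ‖u s - u t‖ ≤ ε / 2 :=
    le_of_tendsto ((hu s hs).sub (hu t ht)).norm (Eventually.of_forall fun n => h n t ht s hs hst)
  rw [dist_eq_norm]
  linarith

namespace BoundedEvolution

variable {Ω : Set E3} {mesh : ℕ → TetMesh Ω} {d k : ℕ → ℝ} {N : ℕ → ℕ} {T E D : ℝ}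
  {m : ℕ → ℕ → E3 → E3}

/-- As curves in `L²(Ω)` the interpolants are equicontinuous uniformly in `l`. They converge at
almost every time of a subsequence, hence at every time, with a continuous limit. Its value at 0 is
the strong limit of the initial data, which must agree with their weak limit. -/
theorem hasInitialTrace (H : BoundedEvolution mesh d k N T E D m) (hΩ : IsLipschitzDomain Ω)
    (hT : 0 < T) {M : ℝ × E3 → E3} {m0 : E3 → E3}
    (hs : StrongL2 (volume.restrict (cylinder T Ω)) (fun l => timeConst (k l) (m l)) M)
    (h0 : WeakL2 (volume.restrict Ω) (fun l => m l 0) m0) : HasInitialTrace T Ω M m0 := by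
  obtain ⟨σ, hσ, h⟩ := (H.strongL2_timeAffine hΩ hs).exists_subseq_slices
  set a : ℕ → ℕ → L2 Ω := fun n j => (toH1 Ω (m (σ n) j)).1 with ha
  have hae : ∀ n, ∀ j ≤ N (σ n), (a n j : E3 → E3) =ᵐ[volume.restrict Ω] m (σ n) j :=
    fun n j hj => toH1_ae (memH1_of_courant hΩ (H.mag (σ n) j hj).1)
  set U : ℕ → ℝ → L2 Ω := fun n => affineInterp (k (σ n)) (a n) with hU
  have hDn : ∀ n, ∑ j ∈ Finset.range (N (σ n)), k (σ n) * ‖diffQuot (k (σ n)) (a n) j‖ ^ 2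
      ≤ D := fun n => by
    refine le_trans (le_of_eq (Finset.sum_congr rfl fun j hj => ?_)) (H.diff (σ n))
    have hj := Finset.mem_range.1 hj
    rw [← integral_norm_sq_L2]
    congr 1
    refine integral_congr_ae ?_
    filter_upwards [Lp.coeFn_smul (k (σ n))⁻¹ (a n (j + 1) - a n j),
      Lp.coeFn_sub (a n (j + 1)) (a n j), hae n (j + 1) hj, hae n j hj.le] with x h1 h2 h3 h4
    simp only [diffQuot]
    rw [h1, Pi.smul_apply, h2, Pi.sub_apply, h3, h4]
    rfl
  have hUeq : ∀ n, ∀ t ∈ Set.Ioo 0 T, (U n t : E3 → E3) =ᵐ[volume.restrict Ω]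
      fun x => timeAffine (k (σ n)) (m (σ n)) (t, x) := fun n t ht => by
    have hlt := floor_div_lt (H.step_pos (σ n)) (H.step_mul (σ n)) ht.2 ht.1.le
    simp only [hU, affineInterp]
    filter_upwards [Lp.coeFn_add (((t - ⌊t / k (σ n)⌋₊ * k (σ n)) / k (σ n)) •
        a n (⌊t / k (σ n)⌋₊ + 1)) ((((⌊t / k (σ n)⌋₊ + 1) * k (σ n) - t) / k (σ n)) •
        a n ⌊t / k (σ n)⌋₊),
      Lp.coeFn_smul ((t - ⌊t / k (σ n)⌋₊ * k (σ n)) / k (σ n)) (a n (⌊t / k (σ n)⌋₊ + 1)),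
      Lp.coeFn_smul (((⌊t / k (σ n)⌋₊ + 1) * k (σ n) - t) / k (σ n)) (a n ⌊t / k (σ n)⌋₊),
      hae n _ hlt, hae n _ hlt.le] with x h1 h2 h3 h4 h5
    rw [h1, Pi.add_apply, h2, h3, Pi.smul_apply, Pi.smul_apply, h4, h5]
    rfl
  set P : ℝ → Prop := fun t => StrongL2 (volume.restrict Ω)
    (fun n x => timeAffine (k (σ n)) (m (σ n)) (t, x)) (fun x => M (t, x)) with hP
  have hconv : ∀ t ∈ Set.Ioo 0 T, ∀ ht : P t,
      Tendsto (fun n => U n t) atTop (𝓝 (ht.2.1.toLp _)) := fun t h0t ht => by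
    have h2 := ht.2.2
    rw [tendsto_iff_edist_tendsto_0]
    refine h2.congr fun n => ?_
    rw [Lp.edist_def]
    refine eLpNorm_congr_ae ?_
    filter_upwards [hUeq n t h0t, ht.2.1.coeFn_toLp] with x h1 h2
    rw [Pi.sub_apply, h1, h2]
  set A : Set ℝ := {t | t ∈ Set.Ioo 0 T ∧ P t} with hA
  have hAae : ∀ᵐ t ∂(volume.restrict (Set.Ioo 0 T)), t ∈ A := by
    filter_upwards [h, ae_restrict_mem measurableSet_Ioo] with t h1 h2 using ⟨h2, h1⟩
  -- A set of full measure meets every nonempty open subset of the time interval; `T > 0` makes the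
  -- endpoints limits of interior times.
  have hdense : Set.Icc 0 T ⊆ closure A := by
    rw [← closure_Ioo hT.ne]
    refine closure_minimal (fun t ht => ?_) isClosed_closure
    by_contra hcon
    have hn : (closure A)ᶜ ∩ Set.Ioo 0 T ∈ 𝓝 t :=
      inter_mem (isClosed_closure.isOpen_compl.mem_nhds hcon) (isOpen_Ioo.mem_nhds ht)
    have hpos := Measure.measure_pos_of_mem_nhds (volume : Measure ℝ) hn
    rw [ae_restrict_iff' measurableSet_Ioo] at hAae
    refine hpos.ne' (measure_mono_null (fun τ hτ => ?_) hAae)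
    exact fun hτ' => hτ.1 (subset_closure (hτ' hτ.2))
  obtain ⟨u, hu, hut⟩ := exists_continuous_limit (T := T) (D := D) (U := U)
    (fun n δ hδ s t hs0 hst ht => norm_affineInterp_sub_le_of_sum (H.step_pos (σ n))
      (H.step_mul (σ n)) (hDn n) hδ hs0 hst ht)
    (A := A) (fun t ht => Set.Ioo_subset_Icc_self ht.1) hdense
    (fun t ht => (hconv t ht.1 ht.2).cauchySeq)
  refine ⟨u, hu, ?_, ?_⟩
  · filter_upwards [hAae] with t ht
    have := tendsto_nhds_unique (hut t (Set.Ioo_subset_Icc_self ht.1)) (hconv t ht.1 ht.2)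
    rw [this]
    exact ht.2.2.1.coeFn_toLp
  · have h1 : Tendsto (fun n => a n 0) atTop (𝓝 (u 0)) := by
      have := hut 0 ⟨le_rfl, hT.le⟩
      simpa only [hU, affineInterp_zero (H.step_pos _)] using this
    have h2 : StrongL2 (volume.restrict Ω) (fun n => (a n 0 : E3 → E3)) (u 0) := by
      refine ⟨fun n => Lp.memLp _, Lp.memLp _, ?_⟩
      rw [tendsto_iff_edist_tendsto_0] at h1
      refine h1.congr fun n => ?_
      rw [Lp.edist_def]
      rfl
    refine h2.weakL2.ae_unique ((h0.comp hσ.tendsto_atTop).congr (fun n => ?_) EventuallyEq.rfl)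
    exact (hae n 0 (Nat.zero_le _)).symm

end BoundedEvolution

end LLG

/-! ### Discrete tangential test functions and their interpolation error -/

namespace LLG

/-- `φ` and its derivative field `φ'` are bounded by `L`, and `φ` has a first order Taylor expansion
with constant `L`, on the set `K`. -/
structure TaylorBound (K : Set E3) (L : ℝ) (φ : E3 → E3) (φ' : E3 → E3 →L[ℝ] E3) : Prop where
  nonneg : 0 ≤ L
  norm_le : ∀ x ∈ K, ‖φ x‖ ≤ L
  deriv_le : ∀ x ∈ K, ∀ e, ‖φ' x e‖ ≤ L * ‖e‖
  lipschitz : ∀ x ∈ K, ∀ y ∈ K, ‖φ y - φ x‖ ≤ L * ‖y - x‖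
  taylor : ∀ x ∈ K, ∀ y ∈ K, ‖φ y - φ x - φ' x (y - x)‖ ≤ L * ‖y - x‖ ^ 2

/-- The derivative of a function on space-time in the space variables. -/
noncomputable def spaceFDeriv (φ : ℝ × E3 → E3) (t : ℝ) (x : E3) : E3 →L[ℝ] E3 :=
  (fderiv ℝ φ (t, x)).comp (ContinuousLinearMap.inr ℝ ℝ E3)

theorem spaceFDeriv_apply (φ : ℝ × E3 → E3) (t : ℝ) (x e : E3) :
    spaceFDeriv φ t x e = fderiv ℝ φ (t, x) (0, e) := rfl

theorem exists_bound_fderiv_of_contDiff {X W : Type*} [NormedAddCommGroup X] [NormedSpace ℝ X]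
    [NormedAddCommGroup W] [NormedSpace ℝ W] {g : X → W} (hg : ContDiff ℝ 1 g) {K : Set X}
    (hK : IsCompact K) : ∃ C, ∀ p ∈ K, ‖fderiv ℝ g p‖ ≤ C :=
  hK.exists_bound_of_continuousOn (hg.continuous_fderiv one_ne_zero).continuousOn

/-- One constant for all times, by compactness and bounds of the derivatives up to second order. The
estimates are made on a ball because the mean value inequality needs a convex set, which the domain
need not be. -/
theorem exists_taylorBound {φ : ℝ × E3 → E3} (hφ : ContDiff ℝ ∞ φ) (T R : ℝ) :
    ∃ L, ∀ t ∈ Set.Icc 0 T,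
      TaylorBound (Metric.closedBall 0 R) L (fun x => φ (t, x)) (spaceFDeriv φ t) := by
  set K : Set (ℝ × E3) := Set.Icc 0 T ×ˢ Metric.closedBall 0 R with hK
  have hKc : IsCompact K := isCompact_Icc.prod (isCompact_closedBall 0 R)
  have hKv : Convex ℝ K := (convex_Icc 0 T).prod (convex_closedBall 0 R)
  have hd : ContDiff ℝ ∞ (fderiv ℝ φ) := hφ.fderiv_right (by simp)
  obtain ⟨C0, h0⟩ := hKc.exists_bound_of_continuousOn hφ.continuous.continuousOn
  obtain ⟨C1, h1⟩ := hKc.exists_bound_of_continuousOn hd.continuous.continuousOn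
  obtain ⟨C2, h2⟩ := exists_bound_fderiv_of_contDiff (hd.of_le (by simp)) hKc
  have hL0 : C0 ≤ |C0| + |C1| + |C2| := by
    linarith [le_abs_self C0, abs_nonneg C1, abs_nonneg C2]
  have hL1 : C1 ≤ |C0| + |C1| + |C2| := by
    linarith [le_abs_self C1, abs_nonneg C0, abs_nonneg C2]
  have hL2 : C2 ≤ |C0| + |C1| + |C2| := by
    linarith [le_abs_self C2, abs_nonneg C1, abs_nonneg C0]
  refine ⟨|C0| + |C1| + |C2|, fun t ht => ⟨by positivity, fun x hx => ?_, fun x hx e => ?_,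
    fun x hx y hy => ?_, fun x hx y hy => ?_⟩⟩
  · exact (h0 (t, x) ⟨ht, hx⟩).trans hL0
  · rw [spaceFDeriv_apply]
    refine ((fderiv ℝ φ (t, x)).le_opNorm _).trans ?_
    have e1 : ‖((0 : ℝ), e)‖ = ‖e‖ := by simp [Prod.norm_def]
    rw [e1]
    exact mul_le_mul_of_nonneg_right ((h1 (t, x) ⟨ht, hx⟩).trans hL1) (norm_nonneg _)
  · have := hKv.norm_image_sub_le_of_norm_fderiv_le (𝕜 := ℝ) (f := φ)
      (fun p _ => hφ.differentiable (by simp) p) h1 (x := (t, x)) (y := (t, y)) ⟨ht, hx⟩ ⟨ht, hy⟩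
    refine this.trans ?_
    have e1 : ‖((t, y) : ℝ × E3) - (t, x)‖ = ‖y - x‖ := by simp [Prod.norm_def]
    rw [e1]
    exact mul_le_mul_of_nonneg_right hL1 (norm_nonneg _)
  · have hp : ((t, x) : ℝ × E3) ∈ K := ⟨ht, hx⟩
    have hq : ((t, y) : ℝ × E3) ∈ K := ⟨ht, hy⟩
    have e1 : ‖((t, y) : ℝ × E3) - (t, x)‖ = ‖y - x‖ := by simp [Prod.norm_def]
    have hseg : segment ℝ ((t, x) : ℝ × E3) (t, y) ⊆ K := hKv.segment_subset hp hq
    have hb : ∀ z ∈ segment ℝ ((t, x) : ℝ × E3) (t, y),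
        ‖fderiv ℝ φ z - fderiv ℝ φ (t, x)‖ ≤ C2 * ‖y - x‖ := fun z hz => by
      have := hKv.norm_image_sub_le_of_norm_fderiv_le (𝕜 := ℝ) (f := fderiv ℝ φ)
        (fun p _ => hd.differentiable (by simp) p) h2 hp (hseg hz)
      refine this.trans ?_
      rw [← e1]
      exact mul_le_mul_of_nonneg_left (norm_sub_le_of_mem_segment hz)
        ((norm_nonneg _).trans (h2 _ hp))
    have := (convex_segment ((t, x) : ℝ × E3) (t, y)).norm_image_sub_le_of_norm_fderiv_le'
      (𝕜 := ℝ) (fun p _ => hφ.differentiable (by simp) p) hb (left_mem_segment _ _ _)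
      (right_mem_segment _ _ _)
    rw [e1] at this
    have e2 : ((t, y) : ℝ × E3) - (t, x) = (0, y - x) := by simp
    rw [spaceFDeriv_apply, ← e2]
    refine this.trans ?_
    rw [mul_assoc, ← sq]
    exact mul_le_mul_of_nonneg_right hL2 (sq_nonneg _)

/-- On a set that contains a ball of radius `r`, a linear map is controlled by its increments
between vertices. -/
theorem mul_norm_apply_le_of_vertices {s : Finset E3} {c : E3} {r ε : ℝ} (hr : 0 < r)
    (hs : Metric.closedBall c r ⊆ hull s) (G : E3 →L[ℝ] E3)
    (hG : ∀ z ∈ s, ∀ y ∈ s, ‖G (z - y)‖ ≤ ε) (e : E3) : r * ‖G e‖ ≤ ε * ‖e‖ := by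
  -- Sublevel sets of the increments are convex, so the bound passes from pairs of vertices to pairs
  -- in the hull, one argument at a time. It is then applied to the centre of the ball and the
  -- boundary point in direction `e`.
  have hconv : ∀ a : E3, Convex ℝ {x | ‖G (x - a)‖ ≤ ε} := fun a => by
    have : {x | ‖G (x - a)‖ ≤ ε} = G ⁻¹' Metric.closedBall (G a) ε := by
      ext x
      simp [dist_eq_norm]
    rw [this]
    exact (convex_closedBall (G a) ε).linear_preimage G.toLinearMap
  have h1 : ∀ y ∈ s, ∀ x ∈ hull s, ‖G (x - y)‖ ≤ ε := fun y hy =>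
    convexHull_min (fun z hz => hG z hz y hy) (hconv y)
  have h2 : ∀ x ∈ hull s, ∀ y ∈ hull s, ‖G (y - x)‖ ≤ ε := fun x hx =>
    convexHull_min (fun y hy => by
      change ‖G (y - x)‖ ≤ ε
      rw [← neg_sub, map_neg, norm_neg]
      exact h1 y hy x hx) (hconv x)
  rcases eq_or_ne e 0 with rfl | he
  · simp
  have he' : 0 < ‖e‖ := norm_pos_iff.2 he
  have h3 := h2 c (hs (Metric.mem_closedBall_self hr.le)) (c + (r / ‖e‖) • e) (hs (by
    rw [Metric.mem_closedBall, dist_eq_norm, add_sub_cancel_left, norm_smul,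
      Real.norm_of_nonneg (by positivity)]
    exact (div_mul_cancel₀ r he'.ne').le))
  rw [add_sub_cancel_left, map_smul, norm_smul, Real.norm_of_nonneg (by positivity),
    div_mul_eq_mul_div, div_le_iff₀ he'] at h3
  exact h3

/-- The pointwise Hilbert-Schmidt norm of the gradient. -/
noncomputable def gradNorm (u : E3 → E3) (x : E3) : ℝ :=
  √(∑ i, ‖fderiv ℝ u x (basisVec i)‖ ^ 2)

theorem gradNorm_nonneg (u : E3 → E3) (x : E3) : 0 ≤ gradNorm u x := Real.sqrt_nonneg _

theorem sq_gradNorm (u : E3 → E3) (x : E3) :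
    gradNorm u x ^ 2 = ∑ i, ‖fderiv ℝ u x (basisVec i)‖ ^ 2 :=
  Real.sq_sqrt (Finset.sum_nonneg fun i _ => sq_nonneg _)

theorem norm_fderiv_apply_le (u : E3 → E3) (x e : E3) :
    ‖fderiv ℝ u x e‖ ≤ gradNorm u x * ‖e‖ := by
  refine (sq_le_sq₀ (norm_nonneg _) (mul_nonneg (gradNorm_nonneg u x) (norm_nonneg e))).1 ?_
  rw [mul_pow, sq_gradNorm, mul_comm]
  exact norm_apply_sq_le _ _

theorem norm_basisVec (i : Fin 3) : ‖basisVec i‖ = 1 := by simp [basisVec]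

theorem norm_partial_le (u : E3 → E3) (x : E3) (i : Fin 3) :
    ‖fderiv ℝ u x (basisVec i)‖ ≤ gradNorm u x := by
  simpa [norm_basisVec] using norm_fderiv_apply_le u x (basisVec i)

section Interpolation

variable {Ω : Set E3} {M : TetMesh Ω} {m φ : E3 → E3} {φ' : E3 → E3 →L[ℝ] E3} {K : Set E3}
  {L δ : ℝ}

/-- The tangential test function obtained from `φ`. -/
noncomputable def tangentTest (M : TetMesh Ω) (m φ : E3 → E3) : E3 → E3 :=
  M.interp fun z => cross (m z) (φ z)

theorem tangentTest_mem (M : TetMesh Ω) (m φ : E3 → E3) :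
    tangentTest M m φ ∈ discreteTangent M m := by
  refine ⟨M.interp_mem _, fun z hz => ?_⟩
  rw [tangentTest, M.interp_node _ hz]
  exact inner_cross_left_self _ _

/-- In barycentric coordinates both terms are the same convex combination, of `m z × φ x` and of `m
z × φ z`; only the increment of `φ` remains. Since `m` is affine, its gradient does not enter. -/
theorem norm_cross_sub_tangentTest_le (hm : m ∈ discreteMag M) (hφ : TaylorBound K L φ φ')
    (hK : closure Ω ⊆ K) {s : Finset E3} (hs : s ∈ M.tets) (hδ : Metric.diam (hull s) ≤ δ)
    {x : E3} (hx : x ∈ hull s) : ‖cross (m x) (φ x) - tangentTest M m φ x‖ ≤ L * δ := by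
  obtain ⟨c, h0, h1, h2⟩ := TetMesh.hull_combination hx
  have e1 : m x = ∑ z ∈ s, c z • m z := by
    conv_lhs => rw [← h2]
    exact courant_sum_eq hm.1 hs h0 h1
  have e2 : tangentTest M m φ x = ∑ z ∈ s, c z • cross (m z) (φ z) := by
    conv_lhs => rw [← h2]
    rw [courant_sum_eq (tangentTest_mem M m φ).1 hs h0 h1]
    refine Finset.sum_congr rfl fun z hz => ?_
    rw [tangentTest, M.interp_node _ (M.mem_nodes hs hz)]
  have e3 : cross (m x) (φ x) = ∑ z ∈ s, c z • cross (m z) (φ x) := by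
    rw [e1, ← crossL_apply, map_sum, sum_apply]
    refine Finset.sum_congr rfl fun z _ => ?_
    rw [map_smul]
    rfl
  rw [e3, e2, ← Finset.sum_sub_distrib]
  calc ‖∑ z ∈ s, (c z • cross (m z) (φ x) - c z • cross (m z) (φ z))‖
      ≤ ∑ z ∈ s, c z * (L * δ) := by
        refine (norm_sum_le _ _).trans (Finset.sum_le_sum fun z hz => ?_)
        rw [← smul_sub, ← cross_sub_right, norm_smul, Real.norm_of_nonneg (h0 z hz)]
        refine mul_le_mul_of_nonneg_left ((norm_cross_le _ _).trans ?_) (h0 z hz)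
        rw [hm.2 z (M.mem_nodes hs hz), one_mul]
        have hzh : z ∈ hull s := subset_convexHull ℝ _ hz
        refine (hφ.lipschitz z (hK (M.hull_subset hs hzh)) x (hK (M.hull_subset hs hx))).trans ?_
        refine mul_le_mul_of_nonneg_left ?_ hφ.nonneg
        rw [← dist_eq_norm]
        exact (Metric.dist_le_diam_of_mem (TetMesh.isCompact_hull s).isBounded hx hzh).trans hδ
    _ = L * δ := by rw [← Finset.sum_mul, h1, one_mul]

/-- A discrete product rule. The error is linear on the tetrahedron, its increments between vertices
are of second order in the diameter, and shape regularity allows one order to be divided out by the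
inradius. As `m` is affine, only its first derivatives enter. -/
theorem norm_fderiv_tangentTest_sub_le {κ : ℝ} (hκ : M.IsShapeRegular κ) (hm : m ∈ discreteMag M)
    (hφ : TaylorBound K L φ φ')
    (hK : closure Ω ⊆ K) {s : Finset E3} (hs : s ∈ M.tets) (hδ : Metric.diam (hull s) ≤ δ)
    {x : E3} (hx : x ∈ interior (hull s)) (e : E3) :
    ‖fderiv ℝ (tangentTest M m φ) x e - (cross (fderiv ℝ m x e) (φ x) + cross (m x) (φ' x e))‖
      ≤ 4 * L * |κ| * δ * (1 + gradNorm m x) * ‖e‖ := by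
  obtain ⟨c, r, hr, hball, hdr⟩ := hκ s hs
  set δ₀ := Metric.diam (hull s) with hδ₀
  have hδ00 : 0 ≤ δ₀ := Metric.diam_nonneg
  have hxh := interior_subset hx
  have hxK := hK (M.hull_subset hs hxh)
  have hL := hφ.nonneg
  have hD := gradNorm_nonneg m x
  set G : E3 →L[ℝ] E3 := fderiv ℝ (tangentTest M m φ) x
    - ((crossL.flip (φ x)).comp (fderiv ℝ m x) + (crossL (m x)).comp (φ' x)) with hG
  have hGe : ∀ e, G e = fderiv ℝ (tangentTest M m φ) x e
    - (cross (fderiv ℝ m x e) (φ x) + cross (m x) (φ' x e)) := fun e => rfl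
  have hdist : ∀ y ∈ hull s, ∀ z ∈ hull s, ‖z - y‖ ≤ δ₀ := fun y hy z hz => by
    rw [← dist_eq_norm]
    exact Metric.dist_le_diam_of_mem (TetMesh.isCompact_hull s).isBounded hz hy
  have hv : ∀ z ∈ s, ∀ y ∈ s, ‖G (z - y)‖ ≤ 4 * L * δ₀ ^ 2 * (1 + gradNorm m x) := by
    intro z hz y hy
    have hzh : z ∈ hull s := subset_convexHull ℝ _ hz
    have hyh : y ∈ hull s := subset_convexHull ℝ _ hy
    have hzK := hK (M.hull_subset hs hzh)
    have hyK := hK (M.hull_subset hs hyh)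
    have d1 : fderiv ℝ m x (z - y) = m z - m y := fderiv_apply_sub hm.1 hs hx hyh hzh
    have d2 : fderiv ℝ m x (y - x) = m y - m x := fderiv_apply_sub hm.1 hs hx hxh hyh
    have d3 : fderiv ℝ (tangentTest M m φ) x (z - y) = cross (m z) (φ z) - cross (m y) (φ y) := by
      rw [fderiv_apply_sub (tangentTest_mem M m φ).1 hs hx hyh hzh, tangentTest,
        M.interp_node _ (M.mem_nodes hs hz), M.interp_node _ (M.mem_nodes hs hy)]
    have e0 : φ' x (z - y) = φ' x (z - x) - φ' x (y - x) := by rw [← map_sub]; congr 1; abel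
    -- The first-order terms cancel: what remains are products of two increments and the Taylor
    -- remainders of `φ` at the two vertices.
    have key : G (z - y) = cross (m z - m y) (φ z - φ x)
        + (cross (m y) ((φ z - φ x - φ' x (z - x)) - (φ y - φ x - φ' x (y - x)))
          + cross (m y - m x) (φ' x (z - y))) := by
      rw [hGe, d3, d1, e0]
      simp only [cross_sub_left, cross_sub_right]
      abel
    have b1 : ‖m z - m y‖ ≤ gradNorm m x * δ₀ := by
      rw [← d1]
      exact (norm_fderiv_apply_le m x _).trans (mul_le_mul_of_nonneg_left (hdist y hyh z hzh) hD)
    have b2 : ‖m y - m x‖ ≤ gradNorm m x * δ₀ := by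
      rw [← d2]
      exact (norm_fderiv_apply_le m x _).trans (mul_le_mul_of_nonneg_left (hdist x hxh y hyh) hD)
    have b3 : ‖φ z - φ x‖ ≤ L * δ₀ := (hφ.lipschitz x hxK z hzK).trans
      (mul_le_mul_of_nonneg_left (hdist x hxh z hzh) hL)
    have b4 : ∀ w ∈ hull s, w ∈ K → ‖φ w - φ x - φ' x (w - x)‖ ≤ L * δ₀ ^ 2 := fun w hw hwK =>
      (hφ.taylor x hxK w hwK).trans (mul_le_mul_of_nonneg_left
        (pow_le_pow_left₀ (norm_nonneg _) (hdist x hxh w hw) 2) hL)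
    have b5 : ‖φ' x (z - y)‖ ≤ L * δ₀ := (hφ.deriv_le x hxK _).trans
      (mul_le_mul_of_nonneg_left (hdist y hyh z hzh) hL)
    have c1 : ‖cross (m z - m y) (φ z - φ x)‖ ≤ gradNorm m x * δ₀ * (L * δ₀) :=
      (norm_cross_le _ _).trans (mul_le_mul b1 b3 (norm_nonneg _) (by positivity))
    have c2 : ‖cross (m y) ((φ z - φ x - φ' x (z - x)) - (φ y - φ x - φ' x (y - x)))‖
        ≤ L * δ₀ ^ 2 + L * δ₀ ^ 2 := by
      refine (norm_cross_le _ _).trans ?_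
      rw [hm.2 y (M.mem_nodes hs hy), one_mul]
      exact (norm_sub_le _ _).trans (add_le_add (b4 z hzh hzK) (b4 y hyh hyK))
    have c3 : ‖cross (m y - m x) (φ' x (z - y))‖ ≤ gradNorm m x * δ₀ * (L * δ₀) :=
      (norm_cross_le _ _).trans (mul_le_mul b2 b5 (norm_nonneg _) (by positivity))
    rw [key]
    refine (norm_add_le _ _).trans ((add_le_add c1 ((norm_add_le _ _).trans
      (add_le_add c2 c3))).trans ?_)
    have p1 : 0 ≤ L * δ₀ ^ 2 := by positivity
    have p2 : 0 ≤ gradNorm m x * (L * δ₀ ^ 2) := by positivity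
    linarith
  have h1 := mul_norm_apply_le_of_vertices hr hball G hv e
  have hκr : δ₀ ≤ |κ| * r := hdr.trans (mul_le_mul_of_nonneg_right (le_abs_self κ) hr.le)
  rw [← hGe]
  have h2 : r * ‖G e‖ ≤ r * (4 * L * |κ| * δ₀ * (1 + gradNorm m x) * ‖e‖) := by
    refine h1.trans ?_
    have : δ₀ * δ₀ ≤ |κ| * r * δ₀ := mul_le_mul_of_nonneg_right hκr hδ00
    calc 4 * L * δ₀ ^ 2 * (1 + gradNorm m x) * ‖e‖
        = 4 * L * (1 + gradNorm m x) * ‖e‖ * (δ₀ * δ₀) := by ring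
      _ ≤ 4 * L * (1 + gradNorm m x) * ‖e‖ * (|κ| * r * δ₀) := by gcongr
      _ = _ := by ring
  refine (le_of_mul_le_mul_left h2 hr).trans ?_
  gcongr

end Interpolation

end LLG

/-! ### Pointwise comparison of the Gilbert equation with the discrete one -/

namespace LLG

/-- The density of the Gilbert equation tested with `μ × φ`, as a function of the values of the
magnetization `μ`, its derivatives `q` and `g`, the fields `p` and `f`, and of the test function. -/
noncomputable def gilbertDensity (α Cex : ℝ) (μ q p f : E3) (g : Fin 3 → E3) (φ : E3)
    (φ' : Fin 3 → E3) : ℝ :=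
  inner ℝ q (α • cross μ φ + cross (cross μ φ) μ) + Cex * ∑ i, inner ℝ (g i) (cross μ (φ' i))
    + inner ℝ p (cross μ φ) - inner ℝ f (cross μ φ)

theorem inner_cross_right (a b c : E3) : inner ℝ a (cross b c) = inner ℝ (cross c a) b := by
  simp only [inner_E3, cross_apply_zero, cross_apply_one, cross_apply_two]
  ring

/-- The density of the discrete equation. -/
noncomputable def stepDensity (α Cex c : ℝ) (μ v p f : E3) (g v' : Fin 3 → E3) (ψ : E3)
    (ψ' : Fin 3 → E3) : ℝ :=
  α * inner ℝ v ψ + c * (∑ i, inner ℝ (v' i) (ψ' i)) + inner ℝ (cross μ v) ψ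
    + Cex * (∑ i, inner ℝ (g i) (ψ' i)) + inner ℝ p ψ - inner ℝ f ψ

theorem le_one_add_sq_sum (a b c e : ℝ) :
    a ≤ 1 + a ^ 2 + b ^ 2 + c ^ 2 + e ^ 2 ∧ c + e ≤ 1 + a ^ 2 + b ^ 2 + c ^ 2 + e ^ 2 ∧
      b * (1 + b) ≤ 2 * (1 + a ^ 2 + b ^ 2 + c ^ 2 + e ^ 2) ∧
      1 + b ^ 2 ≤ 1 + a ^ 2 + b ^ 2 + c ^ 2 + e ^ 2 := by
  have ha := sq_nonneg a
  have hb := sq_nonneg b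
  have hc := sq_nonneg c
  have he := sq_nonneg e
  have ha' := two_mul_le_add_sq a 1
  have hb' := two_mul_le_add_sq b 1
  have hc' := two_mul_le_add_sq c 1
  have he' := two_mul_le_add_sq e 1
  have h : b * (1 + b) = b + b ^ 2 := by ring
  refine ⟨?_, ?_, ?_, ?_⟩ <;> linarith

/-- Each error has a small factor: `q - v` from the projection, `δ` from the interpolation of the
test function, and `k` from the implicit part. `D` and `Dv` stand for the gradients of `m` and `v`.
The right-hand side contains only quantities with bounded integrals. -/
theorem abs_gilbertDensity_sub_le {α Cex L A δ k θ D Dv : ℝ} (hα : 0 < α) (hCex : 0 < Cex)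
    (hL : 0 ≤ L) (hA : 0 ≤ A) (hδ : 0 ≤ δ) (hδ1 : δ ≤ 1) (hk : 0 < k) (hθ : 0 ≤ θ) (hθ' : θ ≤ 1)
    {μ q v p f φ ψ : E3} {g v' φ' ψ' : Fin 3 → E3} (hμ : ‖μ‖ ≤ 1) (hφ : ‖φ‖ ≤ L)
    (hφ' : ∀ i, ‖φ' i‖ ≤ L) (hψ : ‖cross μ φ - ψ‖ ≤ L * δ)
    (hψ' : ∀ i, ‖ψ' i - (cross (g i) φ + cross μ (φ' i))‖ ≤ A * δ * (1 + D))
    (hD : 0 ≤ D) (hg : ∀ i, ‖g i‖ ≤ D) (hDv : 0 ≤ Dv) (hv' : ∀ i, ‖v' i‖ ≤ Dv) :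
    |gilbertDensity α Cex μ q p f g φ φ' - stepDensity α Cex (Cex * k * θ) μ v p f g v' ψ ψ'|
      ≤ ((α + 2) * L + Cex * (6 * A + 3 * L)) * (‖q - v‖
        + (δ + √k) * (1 + ‖v‖ ^ 2 + D ^ 2 + ‖p‖ ^ 2 + ‖f‖ ^ 2) + √k * (k * Dv ^ 2)) := by
  set w := cross μ φ with hw
  have hwL : ‖w‖ ≤ L := (norm_cross_le _ _).trans
    ((mul_le_mul hμ hφ (norm_nonneg _) zero_le_one).trans (one_mul L).le)
  have e : gilbertDensity α Cex μ q p f g φ φ'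
        - stepDensity α Cex (Cex * k * θ) μ v p f g v' ψ ψ'
      = inner ℝ (q - v) (α • w + cross w μ) + α * inner ℝ v (w - ψ) + inner ℝ (cross μ v) (w - ψ)
        - Cex * (∑ i, inner ℝ (g i) (ψ' i - (cross (g i) φ + cross μ (φ' i))))
        - Cex * k * θ * (∑ i, inner ℝ (v' i) (ψ' i)) + inner ℝ p (w - ψ) - inner ℝ f (w - ψ) := by
    -- The only term quadratic in the gradient of `m` disappears, because `g × φ` is orthogonal to
    -- `g`.
    have e1 : ∑ i, inner ℝ (g i) (ψ' i - (cross (g i) φ + cross μ (φ' i)))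
        = ∑ i, inner ℝ (g i) (ψ' i) - ∑ i, inner ℝ (g i) (cross μ (φ' i)) := by
      rw [← Finset.sum_sub_distrib]
      refine Finset.sum_congr rfl fun i _ => ?_
      have h0 : inner ℝ (g i) (cross (g i) φ) = 0 := by
        rw [real_inner_comm]
        exact inner_cross_left_self _ _
      rw [inner_sub_right, inner_add_right, h0, zero_add]
    have e2 : inner ℝ v (cross w μ) = inner ℝ (cross μ v) w := inner_cross_right _ _ _
    rw [e1]
    simp only [gilbertDensity, stepDensity, inner_sub_right, inner_sub_left, inner_add_right,
      real_inner_smul_right, ← hw, e2]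
    ring
  have hψL : ∀ i, ‖ψ' i‖ ≤ (L + A) * (1 + D) := fun i => by
    have h1 : ‖cross (g i) φ‖ ≤ D * L :=
      (norm_cross_le _ _).trans (mul_le_mul (hg i) hφ (norm_nonneg _) hD)
    have h2 : ‖cross μ (φ' i)‖ ≤ L := (norm_cross_le _ _).trans
      ((mul_le_mul hμ (hφ' i) (norm_nonneg _) zero_le_one).trans (one_mul L).le)
    have h3 : A * δ * (1 + D) ≤ A * (1 + D) := by
      have : A * δ ≤ A := mul_le_of_le_one_right hA hδ1
      exact mul_le_mul_of_nonneg_right this (by linarith)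
    have h4 : ψ' i = (ψ' i - (cross (g i) φ + cross μ (φ' i)))
      + (cross (g i) φ + cross μ (φ' i)) := by abel
    rw [h4]
    refine (norm_add_le _ _).trans ((add_le_add (hψ' i) (norm_add_le _ _)).trans ?_)
    linarith
  have a1 : |inner ℝ (q - v) (α • w + cross w μ)| ≤ ‖q - v‖ * ((α + 1) * L) := by
    refine (abs_real_inner_le_norm _ _).trans (mul_le_mul_of_nonneg_left ?_ (norm_nonneg _))
    refine (norm_add_le _ _).trans ?_
    rw [norm_smul, Real.norm_of_nonneg hα.le, add_mul, one_mul]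
    refine add_le_add (mul_le_mul_of_nonneg_left hwL hα.le) ((norm_cross_le _ _).trans ?_)
    exact (mul_le_of_le_one_right (norm_nonneg _) hμ).trans hwL
  have a2 : |inner ℝ v (w - ψ)| ≤ ‖v‖ * (L * δ) :=
    (abs_real_inner_le_norm _ _).trans (mul_le_mul_of_nonneg_left hψ (norm_nonneg _))
  have a3 : |inner ℝ (cross μ v) (w - ψ)| ≤ ‖v‖ * (L * δ) :=
    (abs_real_inner_le_norm _ _).trans (mul_le_mul ((norm_cross_le _ _).trans
      (mul_le_of_le_one_left (norm_nonneg _) hμ)) hψ (norm_nonneg _) (norm_nonneg _))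
  have a4 : |∑ i, inner ℝ (g i) (ψ' i - (cross (g i) φ + cross μ (φ' i)))|
      ≤ 3 * (D * (A * δ * (1 + D))) := by
    refine (Finset.abs_sum_le_sum_abs _ _).trans ((Finset.sum_le_card_nsmul _ _
      (D * (A * δ * (1 + D))) fun i _ => ?_).trans (le_of_eq (by simp)))
    exact (abs_real_inner_le_norm _ _).trans (mul_le_mul (hg i) (hψ' i) (norm_nonneg _) hD)
  have a5 : |∑ i, inner ℝ (v' i) (ψ' i)| ≤ 3 * (Dv * ((L + A) * (1 + D))) := by
    refine (Finset.abs_sum_le_sum_abs _ _).trans ((Finset.sum_le_card_nsmul _ _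
      (Dv * ((L + A) * (1 + D))) fun i _ => ?_).trans (le_of_eq (by simp)))
    exact (abs_real_inner_le_norm _ _).trans (mul_le_mul (hv' i) (hψL i) (norm_nonneg _) hDv)
  have a6 : |inner ℝ p (w - ψ)| ≤ ‖p‖ * (L * δ) :=
    (abs_real_inner_le_norm _ _).trans (mul_le_mul_of_nonneg_left hψ (norm_nonneg _))
  have a7 : |inner ℝ f (w - ψ)| ≤ ‖f‖ * (L * δ) :=
    (abs_real_inner_le_norm _ _).trans (mul_le_mul_of_nonneg_left hψ (norm_nonneg _))
  set s := √k with hs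
  have hs0 : 0 ≤ s := Real.sqrt_nonneg _
  have hss : k = s * s := (Real.mul_self_sqrt hk.le).symm
  set X := 1 + ‖v‖ ^ 2 + D ^ 2 + ‖p‖ ^ 2 + ‖f‖ ^ 2 with hX
  have v0 := norm_nonneg v
  have p0 := norm_nonneg p
  have f0 := norm_nonneg f
  have q0 := norm_nonneg (q - v)
  obtain ⟨hX1, hX2, hX3, y5⟩ : ‖v‖ ≤ X ∧ ‖p‖ + ‖f‖ ≤ X ∧ D * (1 + D) ≤ 2 * X ∧ 1 + D ^ 2 ≤ X :=
    le_one_add_sq_sum ‖v‖ D ‖p‖ ‖f‖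
  clear_value X
  -- The energy estimate controls `k |∇v|²` but not `|∇v|²`. Splitting `k = √k · √k` gives one root
  -- to `∇v` and keeps the other as the small factor.
  have hX4 : k * (Dv * (1 + D)) ≤ s * (k * Dv ^ 2) + s * X := by
    have h1 : (s * Dv) * (1 + D) ≤ k * Dv ^ 2 + X := by
      have y1 := two_mul_le_add_sq (s * Dv) (1 + D)
      have y2 := two_mul_le_add_sq 1 D
      have y3 : k * Dv ^ 2 = (s * Dv) ^ 2 := by rw [hss]; ring
      have y4 := sq_nonneg (s * Dv)
      have y6 : (1 + D) ^ 2 = 1 + 2 * 1 * D + D ^ 2 := by ring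
      rw [y3]
      linarith
    calc k * (Dv * (1 + D)) = s * ((s * Dv) * (1 + D)) := by rw [hss]; ring
      _ ≤ s * (k * Dv ^ 2 + X) := mul_le_mul_of_nonneg_left h1 hs0
      _ = _ := by ring
  have hX0 : 0 ≤ X := v0.trans hX1
  rw [e]
  have t2 : |α * inner ℝ v (w - ψ)| ≤ α * L * (δ * X) := by
    rw [abs_mul, abs_of_pos hα]
    calc α * |inner ℝ v (w - ψ)| ≤ α * (‖v‖ * (L * δ)) := by gcongr
      _ ≤ α * (X * (L * δ)) := by gcongr
      _ = _ := by ring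
  have t3 : |inner ℝ (cross μ v) (w - ψ)| ≤ L * (δ * X) := a3.trans (by
    calc ‖v‖ * (L * δ) ≤ X * (L * δ) := by gcongr
      _ = _ := by ring)
  have t4 : |Cex * ∑ i, inner ℝ (g i) (ψ' i - (cross (g i) φ + cross μ (φ' i)))|
      ≤ 6 * (Cex * A) * (δ * X) := by
    rw [abs_mul, abs_of_pos hCex]
    calc _ ≤ Cex * (3 * (D * (A * δ * (1 + D)))) := by gcongr
      _ = 3 * (Cex * A * δ) * (D * (1 + D)) := by ring
      _ ≤ 3 * (Cex * A * δ) * (2 * X) := by gcongr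
      _ = _ := by ring
  have t5 : |Cex * k * θ * ∑ i, inner ℝ (v' i) (ψ' i)|
      ≤ 3 * (Cex * (L + A)) * (s * (k * Dv ^ 2) + s * X) := by
    rw [abs_mul, abs_of_nonneg (by positivity : 0 ≤ Cex * k * θ)]
    calc _ ≤ Cex * k * θ * (3 * (Dv * ((L + A) * (1 + D)))) := by gcongr
      _ ≤ Cex * k * 1 * (3 * (Dv * ((L + A) * (1 + D)))) := by gcongr
      _ = 3 * (Cex * (L + A)) * (k * (Dv * (1 + D))) := by ring
      _ ≤ _ := by gcongr
  have t67 : |inner ℝ p (w - ψ)| + |inner ℝ f (w - ψ)| ≤ L * (δ * X) := by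
    calc _ ≤ (‖p‖ + ‖f‖) * (L * δ) := by linarith
      _ ≤ X * (L * δ) := by gcongr
      _ = _ := by ring
  have tri : ∀ a b c d e f g : ℝ, |a + b + c - d - e + f - g|
      ≤ |a| + |b| + |c| + |d| + |e| + (|f| + |g|) := fun a b c d e f g => by
    rw [abs_le]
    constructor <;> linarith [abs_nonneg a, le_abs_self a, neg_abs_le a, le_abs_self b,
      neg_abs_le b, le_abs_self c, neg_abs_le c, le_abs_self d, neg_abs_le d, le_abs_self e,
      neg_abs_le e, le_abs_self f, neg_abs_le f, le_abs_self g, neg_abs_le g]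
  refine (tri _ _ _ _ _ _ _).trans ((add_le_add (add_le_add (add_le_add (add_le_add
    (add_le_add a1 t2) t3) t4) t5) t67).trans ?_)
  have z1 : 0 ≤ δ * X := by positivity
  have z2 : 0 ≤ s * X := by positivity
  have z3 : 0 ≤ s * (k * Dv ^ 2) := by positivity
  have c1 : 0 ≤ L * ‖q - v‖ := by positivity
  have c2 : 0 ≤ Cex * A * ‖q - v‖ := by positivity
  have c3 : 0 ≤ Cex * L * ‖q - v‖ := by positivity
  have c4 : 0 ≤ Cex * L * (δ * X) := by positivity
  have c5 : 0 ≤ (α + 2) * L * (s * X) := by positivity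
  have c6 : 0 ≤ (α + 2) * L * (s * (k * Dv ^ 2)) := by positivity
  have c7 : 0 ≤ Cex * A * (s * X) := by positivity
  have c8 : 0 ≤ Cex * A * (s * (k * Dv ^ 2)) := by positivity
  linarith

/-- Comparison of integrals over the space-time cylinder by slices. -/
theorem abs_integral_cylinder_le {T : ℝ} {Ω : Set E3} {F G : ℝ × E3 → ℝ}
    (hF : Integrable F (volume.restrict (cylinder T Ω)))
    (hG : Integrable G (volume.restrict (cylinder T Ω)))
    (h : ∀ t ∈ Set.Ioo 0 T, |∫ x in Ω, F (t, x)| ≤ ∫ x in Ω, G (t, x)) :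
    |∫ p in cylinder T Ω, F p| ≤ ∫ p in cylinder T Ω, G p := by
  rw [restrict_cylinder] at hF hG ⊢
  rw [integral_prod _ hF, integral_prod _ hG]
  refine abs_integral_le_integral_abs.trans (integral_mono_ae hF.integral_prod_left.abs
    hG.integral_prod_left ?_)
  filter_upwards [ae_restrict_mem measurableSet_Ioo] with t ht using h t ht

/-- If `S` has integral zero, integrals of `F` are controlled by `F - S`. -/
theorem abs_integral_le_of_sub {X : Type*} [MeasurableSpace X] {ν : Measure X} {F S G : X → ℝ}
    (hS : Integrable S ν) (h0 : ∫ x, S x ∂ν = 0) (hG : Integrable G ν)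
    (h : ∀ᵐ x ∂ν, |F x - S x| ≤ G x) : |∫ x, F x ∂ν| ≤ ∫ x, G x ∂ν := by
  by_cases hF : Integrable F ν
  · have : ∫ x, F x ∂ν = ∫ x, (F x - S x) ∂ν := by rw [integral_sub hF hS, h0, sub_zero]
    rw [this]
    exact abs_integral_le_integral_abs.trans (integral_mono_ae (hF.sub hS).abs hG h)
  · rw [integral_undef hF, abs_zero]
    refine integral_nonneg_of_ae ?_
    filter_upwards [h] with x hx using (abs_nonneg _).trans hx

end LLG

/-! ### Consistency: the residual of the discrete evolutions vanishes -/

namespace LLG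

/-- `f` is integrable with integral `a`. -/
def HasIntegralValue {X : Type*} [MeasurableSpace X] (μ : Measure X) (f : X → ℝ) (a : ℝ) : Prop :=
  Integrable f μ ∧ ∫ x, f x ∂μ = a

namespace HasIntegralValue

variable {X : Type*} [MeasurableSpace X] {μ : Measure X} {f g : X → ℝ} {a b : ℝ}

theorem of_integrable (hf : Integrable f μ) : HasIntegralValue μ f (∫ x, f x ∂μ) := ⟨hf, rfl⟩

theorem add (hf : HasIntegralValue μ f a) (hg : HasIntegralValue μ g b) :
    HasIntegralValue μ (fun x => f x + g x) (a + b) :=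
  ⟨hf.1.add hg.1, by rw [integral_add hf.1 hg.1, hf.2, hg.2]⟩

theorem sub (hf : HasIntegralValue μ f a) (hg : HasIntegralValue μ g b) :
    HasIntegralValue μ (fun x => f x - g x) (a - b) :=
  ⟨hf.1.sub hg.1, by rw [integral_sub hf.1 hg.1, hf.2, hg.2]⟩

theorem const_mul (hf : HasIntegralValue μ f a) (c : ℝ) :
    HasIntegralValue μ (fun x => c * f x) (c * a) :=
  ⟨hf.1.const_mul c, by rw [integral_const_mul, hf.2]⟩

theorem sum {ι : Type*} {s : Finset ι} {f : ι → X → ℝ} {a : ι → ℝ}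
    (hf : ∀ i, HasIntegralValue μ (f i) (a i)) :
    HasIntegralValue μ (fun x => ∑ i ∈ s, f i x) (∑ i ∈ s, a i) :=
  ⟨integrable_finsetSum _ fun i _ => (hf i).1, by
    rw [integral_finsetSum _ fun i _ => (hf i).1]
    exact Finset.sum_congr rfl fun i _ => (hf i).2⟩

theorem inner {f g : X → E3} (hf : MemLp f 2 μ) (hg : MemLp g 2 μ) :
    HasIntegralValue μ (fun x => inner ℝ (f x) (g x)) (∫ x, inner ℝ (f x) (g x) ∂μ) :=
  of_integrable (integrable_inner hf hg)

theorem norm_sq {f : X → E3} (hf : MemLp f 2 μ) :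
    HasIntegralValue μ (fun x => ‖f x‖ ^ 2) (∫ x, ‖f x‖ ^ 2 ∂μ) :=
  of_integrable (integrable_norm_sq hf)

end HasIntegralValue

theorem hasIntegralValue_sq_gradNorm {Ω : Set E3} {M : TetMesh Ω} (hΩ : IsLipschitzDomain Ω)
    {u : E3 → E3} (hu : u ∈ courant M E3) :
    HasIntegralValue (volume.restrict Ω) (fun x => gradNorm u x ^ 2) (gradNormSq Ω u) := by
  simp_rw [sq_gradNorm]
  rw [gradNormSq_of_courant hΩ hu]
  exact HasIntegralValue.sum fun i =>
    HasIntegralValue.norm_sq (memLp_fderiv_of_courant hΩ hu (basisVec i) 2)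

/-- Bounded discrete evolutions that solve the discrete equation of the tangent-plane integrator
with discrete time derivatives `v` and fields `p` and `f`. -/
structure TangentEvolution {Ω : Set E3} (mesh : ℕ → TetMesh Ω) (d k : ℕ → ℝ) (N : ℕ → ℕ)
    (T E D : ℝ) (m : ℕ → ℕ → E3 → E3) (α Cex θ κ Q : ℝ) (v p f : ℕ → ℕ → E3 → E3) : Prop
    extends BoundedEvolution mesh d k N T E D m where
  shape : ∀ l, (mesh l).IsShapeRegular κ
  v_mem : ∀ l, ∀ j < N l, v l j ∈ courant (mesh l) E3
  memLp_p : ∀ l, ∀ j < N l, MemLp (p l j) 2 (volume.restrict Ω)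
  memLp_f : ∀ l, ∀ j < N l, MemLp (f l j) 2 (volume.restrict Ω)
  step_eq : ∀ l, ∀ j < N l, ∀ ψ ∈ discreteTangent (mesh l) (m l j),
    α * (∫ x in Ω, inner ℝ (v l j x) (ψ x)) + Cex * k l * θ * gradInner Ω (v l j) ψ
        + ∫ x in Ω, inner ℝ (cross (m l j x) (v l j x)) (ψ x)
      = -Cex * gradInner Ω (m l j) ψ - (∫ x in Ω, inner ℝ (p l j x) (ψ x))
        + ∫ x in Ω, inner ℝ (f l j x) (ψ x)
  sum_v : ∀ l, ∑ j ∈ Finset.range (N l), k l * ∫ x in Ω, ‖v l j x‖ ^ 2 ≤ Q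
  sum_grad_v : ∀ l, ∑ j ∈ Finset.range (N l), k l * (k l * gradNormSq Ω (v l j)) ≤ Q
  sum_p : ∀ l, ∑ j ∈ Finset.range (N l), k l * ∫ x in Ω, ‖p l j x‖ ^ 2 ≤ Q
  sum_f : ∀ l, ∑ j ∈ Finset.range (N l), k l * ∫ x in Ω, ‖f l j x‖ ^ 2 ≤ Q
  diff_sub : ∀ l, ∀ j < N l,
    ∫ x in Ω, ‖diffQuot (k l) (m l) j x - v l j x‖ ≤ 128 * k l * ∫ x in Ω, ‖v l j x‖ ^ 2

/-- The discrete gradient as a function on space-time. -/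
noncomputable def partialConst (k : ℝ) (m : ℕ → E3 → E3) (i : Fin 3) : ℝ × E3 → E3 :=
  timeConst k fun j x => fderiv ℝ (m j) x (basisVec i)

/-- The density of the Gilbert equation along a discrete evolution. -/
noncomputable def evolutionDensity (α Cex k : ℝ) (m p f : ℕ → E3 → E3) (φ : ℝ × E3 → E3)
    (P : ℝ × E3) : ℝ :=
  gilbertDensity α Cex (timeConst k m P) (timeConst k (diffQuot k m) P) (timeConst k p P)
    (timeConst k f P) (fun i => partialConst k m i P) (φ P) (fun i => fderiv ℝ φ P (spaceDir i))

section Density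

variable {X : Type*} [MeasurableSpace X] {μ : Measure X}

theorem integrable_gilbertDensity {α Cex : ℝ} {u q p f φ : X → E3} {g φ' : Fin 3 → X → E3}
    (hu : AEStronglyMeasurable u μ) (hu1 : ∀ᵐ x ∂μ, ‖u x‖ ≤ 1) (hq : MemLp q 2 μ) (hp : MemLp p 2 μ)
    (hf : MemLp f 2 μ) (hφ : MemLp φ 2 μ) (hg : ∀ i, MemLp (g i) 2 μ)
    (hφ' : ∀ i, MemLp (φ' i) 2 μ) :
    Integrable (fun x => gilbertDensity α Cex (u x) (q x) (p x) (f x) (fun i => g i x) (φ x)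
      (fun i => φ' i x)) μ := by
  have hw := memLp_cross hu hu1 hφ
  have hww := memLp_cross' hw hu hu1
  exact (((integrable_inner hq ((hw.const_smul α).add hww)).add
    ((integrable_finsetSum _ fun i _ => integrable_inner (hg i)
      (memLp_cross hu hu1 (hφ' i))).const_mul Cex)).add (integrable_inner hp hw)).sub
    (integrable_inner hf hw)

end Density

theorem memLp_of_contDiff {Ω : Set E3} (hΩ : IsLipschitzDomain Ω) (T : ℝ) {φ : ℝ × E3 → E3}
    (hφ : Continuous φ) : MemLp φ 2 (volume.restrict (cylinder T Ω)) ∧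
      ∃ C, ∀ p ∈ cylinder T Ω, ‖φ p‖ ≤ C := by
  have := BoundedEvolution.isFiniteMeasure_cylinder hΩ T
  obtain ⟨R, hR⟩ := hΩ.isBounded.subset_closedBall 0
  obtain ⟨C, hC⟩ := (isCompact_Icc.prod (isCompact_closedBall (0 : E3) R) :
    IsCompact (Set.Icc 0 T ×ˢ Metric.closedBall (0 : E3) R)).exists_bound_of_continuousOn hφ.continuousOn
  have hC' : ∀ p ∈ cylinder T Ω, ‖φ p‖ ≤ C := fun p hp =>
    hC p ⟨Set.Ioo_subset_Icc_self hp.1, hR hp.2⟩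
  refine ⟨MemLp.of_bound hφ.aestronglyMeasurable C ?_, C, hC'⟩
  filter_upwards [BoundedEvolution.ae_mem_cylinder hΩ.isOpen T] with p hp using hC' p hp

namespace TangentEvolution

variable {Ω : Set E3} {mesh : ℕ → TetMesh Ω} {d k : ℕ → ℝ} {N : ℕ → ℕ} {T E D : ℝ}
  {m : ℕ → ℕ → E3 → E3} {α Cex θ κ Q : ℝ} {v p f : ℕ → ℕ → E3 → E3}

theorem comp (H : TangentEvolution mesh d k N T E D m α Cex θ κ Q v p f) {σ : ℕ → ℕ}
    (hσ : Tendsto σ atTop atTop) :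
    TangentEvolution (fun l => mesh (σ l)) (fun l => d (σ l)) (fun l => k (σ l))
      (fun l => N (σ l)) T E D (fun l => m (σ l)) α Cex θ κ Q (fun l => v (σ l))
      (fun l => p (σ l)) (fun l => f (σ l)) :=
  ⟨H.toBoundedEvolution.comp hσ, fun l => H.shape _, fun l => H.v_mem _, fun l => H.memLp_p _,
    fun l => H.memLp_f _, fun l => H.step_eq _, fun l => H.sum_v _, fun l => H.sum_grad_v _,
    fun l => H.sum_p _, fun l => H.sum_f _, fun l => H.diff_sub _⟩

theorem memLp_partialConst (H : TangentEvolution mesh d k N T E D m α Cex θ κ Q v p f)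
    (hΩ : IsLipschitzDomain Ω) (l : ℕ) (i : Fin 3) :
    MemLp (partialConst (k l) (m l) i) 2 (volume.restrict (cylinder T Ω)) :=
  memLp_timeConst (H.step_pos l) (H.step_mul l) fun j hj =>
    memLp_fderiv_of_courant hΩ (H.mag l j hj.le).1 _ 2

/-- The discrete equation with all terms on one side, written with classical derivatives, so that it
can be subtracted pointwise from the Gilbert density. -/
theorem stepDensity_integral (H : TangentEvolution mesh d k N T E D m α Cex θ κ Q v p f)
    (hΩ : IsLipschitzDomain Ω) (l : ℕ) {j : ℕ} (hj : j < N l) {ψ : E3 → E3}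
    (hψ : ψ ∈ discreteTangent (mesh l) (m l j)) :
    Integrable (fun x => stepDensity α Cex (Cex * k l * θ) (m l j x) (v l j x) (p l j x) (f l j x)
        (fun i => fderiv ℝ (m l j) x (basisVec i)) (fun i => fderiv ℝ (v l j) x (basisVec i)) (ψ x)
        (fun i => fderiv ℝ ψ x (basisVec i))) (volume.restrict Ω) ∧
    ∫ x in Ω, stepDensity α Cex (Cex * k l * θ) (m l j x) (v l j x) (p l j x) (f l j x)
        (fun i => fderiv ℝ (m l j) x (basisVec i)) (fun i => fderiv ℝ (v l j) x (basisVec i)) (ψ x)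
        (fun i => fderiv ℝ ψ x (basisVec i)) = 0 := by
  have hm := (H.mag l j hj.le).1
  have hv := H.v_mem l j hj
  have Lψ := memLp_of_courant hΩ hψ.1 2
  have Lv := memLp_of_courant hΩ hv 2
  have Lmv := memLp_cross_courant hΩ hm hv
  have D1 := fun i => memLp_fderiv_of_courant hΩ hm (basisVec i) 2
  have D2 := fun i => memLp_fderiv_of_courant hΩ hv (basisVec i) 2
  have D3 := fun i => memLp_fderiv_of_courant hΩ hψ.1 (basisVec i) 2
  have i1 := (HasIntegralValue.inner Lv Lψ).const_mul α
  have i2 := (HasIntegralValue.sum (s := Finset.univ) fun i =>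
    HasIntegralValue.inner (D2 i) (D3 i)).const_mul (Cex * k l * θ)
  have i3 := HasIntegralValue.inner Lmv Lψ
  have i4 := (HasIntegralValue.sum (s := Finset.univ) fun i =>
    HasIntegralValue.inner (D1 i) (D3 i)).const_mul Cex
  have i5 := HasIntegralValue.inner (H.memLp_p l j hj) Lψ
  have i6 := HasIntegralValue.inner (H.memLp_f l j hj) Lψ
  have h := ((((i1.add i2).add i3).add i4).add i5).sub i6
  refine ⟨h.1, h.2.trans ?_⟩
  have e := H.step_eq l j hj ψ hψ
  rw [gradInner_of_courant hΩ hv hψ.1, gradInner_of_courant hΩ hm hψ.1] at e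
  linarith

/-- The residual of the Gilbert equation along the discrete evolutions vanishes in the limit. -/
theorem tendsto_integral_evolutionDensity
    (H : TangentEvolution mesh d k N T E D m α Cex θ κ Q v p f) (hΩ : IsLipschitzDomain Ω)
    (hα : 0 < α) (hCex : 0 < Cex) (hθ : 0 ≤ θ) (hθ' : θ ≤ 1) {φ : ℝ × E3 → E3}
    (hφ : ContDiff ℝ ∞ φ) :
    Tendsto (fun l => ∫ P in cylinder T Ω, evolutionDensity α Cex (k l) (m l) (p l) (f l) φ P) atTop
      (𝓝 0) := by
  have := hΩ.isFiniteMeasure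
  obtain ⟨R, hR⟩ := hΩ.isBounded.subset_closedBall 0
  have hRc : closure Ω ⊆ Metric.closedBall 0 R := closure_minimal hR Metric.isClosed_closedBall
  obtain ⟨L, hL⟩ := exists_taylorBound hφ T R
  set A : ℝ := 4 * |L| * |κ| with hA
  set C : ℝ := (α + 2) * |L| + Cex * (6 * A + 3 * |L|) with hC
  have hA0 : 0 ≤ A := by positivity
  have hC0 : 0 ≤ C := by positivity
  set vol : ℝ := (volume.restrict Ω).real Set.univ with hvol
  -- The time-summed errors: `128 k Q` from the distance of `v` to the difference quotient, the
  -- middle term from the energies of the data and of the solution, and `√k Q` from the implicit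
  -- part. Each tends to zero with the mesh size and the time step, however these are related.
  set B : ℕ → ℝ := fun l => C * (128 * k l * Q + (|d l| + √(k l)) * (T * vol + Q + T * E + Q + Q)
    + √(k l) * Q) with hB
  have hBt : Tendsto B atTop (𝓝 0) := by
    have h1 : Tendsto (fun l => √(k l)) atTop (𝓝 0) := by
      have := (Real.continuous_sqrt.tendsto 0).comp H.step_tendsto
      rwa [Real.sqrt_zero] at this
    have h2 : Tendsto (fun l => |d l|) atTop (𝓝 0) := by simpa using H.diam_tendsto.abs
    have := ((((H.step_tendsto.const_mul 128).mul_const Q).add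
      ((h2.add h1).mul_const (T * vol + Q + T * E + Q + Q))).add (h1.mul_const Q)).const_mul C
    simpa [hB] using this
  have hd1 : ∀ᶠ l in atTop, |d l| ≤ 1 := by
    have h2 : Tendsto (fun l => |d l|) atTop (𝓝 0) := by simpa using H.diam_tendsto.abs
    exact h2.eventually (eventually_le_nhds zero_lt_one)
  refine squeeze_zero_norm' ?_ hBt
  filter_upwards [hd1] with l hl
  have hk := H.step_pos l
  set G : ℕ → E3 → ℝ := fun j x => C * (‖diffQuot (k l) (m l) j x - v l j x‖
    + (|d l| + √(k l)) * (1 + ‖v l j x‖ ^ 2 + gradNorm (m l j) x ^ 2 + ‖p l j x‖ ^ 2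
      + ‖f l j x‖ ^ 2) + √(k l) * (k l * gradNorm (v l j) x ^ 2)) with hG
  have hGv : ∀ j < N l, HasIntegralValue (volume.restrict Ω) (G j)
      (C * ((∫ x in Ω, ‖diffQuot (k l) (m l) j x - v l j x‖)
      + (|d l| + √(k l)) * (vol + (∫ x in Ω, ‖v l j x‖ ^ 2) + gradNormSq Ω (m l j)
        + (∫ x in Ω, ‖p l j x‖ ^ 2) + ∫ x in Ω, ‖f l j x‖ ^ 2)
      + √(k l) * (k l * gradNormSq Ω (v l j)))) := fun j hj => by
    have i0 : HasIntegralValue (volume.restrict Ω) (fun _ => (1 : ℝ)) vol :=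
      ⟨integrable_const _, by simp [hvol]⟩
    have i1 := HasIntegralValue.of_integrable ((MemLp.sub_fun (H.memLp_diffQuot hΩ l j hj)
      (memLp_of_courant hΩ (H.v_mem l j hj) 2)).integrable one_le_two).norm
    have i2 := HasIntegralValue.norm_sq (memLp_of_courant hΩ (H.v_mem l j hj) 2)
    have i3 := hasIntegralValue_sq_gradNorm hΩ (H.mag l j hj.le).1
    have i4 := HasIntegralValue.norm_sq (H.memLp_p l j hj)
    have i5 := HasIntegralValue.norm_sq (H.memLp_f l j hj)
    have i6 := hasIntegralValue_sq_gradNorm hΩ (H.v_mem l j hj)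
    exact ((i1.add (((((i0.add i2).add i3).add i4).add i5).const_mul _)).add
      ((i6.const_mul (k l)).const_mul _)).const_mul C
  have hGi : ∀ j < N l, Integrable (G j) (volume.restrict Ω) := fun j hj => (hGv j hj).1
  have hstep : |∫ P in cylinder T Ω, evolutionDensity α Cex (k l) (m l) (p l) (f l) φ P|
      ≤ ∫ P in cylinder T Ω, G ⌊P.1 / k l⌋₊ P.2 := by
    refine abs_integral_cylinder_le ?_ (integrable_step hk (H.step_mul l) hGi) fun t ht => ?_
    · exact integrable_gilbertDensity (H.memLp_timeConst hΩ l).1 (H.norm_timeConst_le hΩ l)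
        (memLp_timeConst hk (H.step_mul l) (H.memLp_diffQuot hΩ l))
        (memLp_timeConst hk (H.step_mul l) (H.memLp_p l))
        (memLp_timeConst hk (H.step_mul l) (H.memLp_f l))
        (memLp_of_contDiff hΩ T hφ.continuous).1 (H.memLp_partialConst hΩ l)
        fun i => (memLp_of_contDiff hΩ T
          ((hφ.continuous_fderiv (by simp)).clm_apply continuous_const)).1
    · set j := ⌊t / k l⌋₊ with hj
      have hjN : j < N l := floor_div_lt hk (H.step_mul l) ht.2 ht.1.le
      have hTB := hL t (Set.Ioo_subset_Icc_self ht)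
      have hTB0 : |L| = L := abs_of_nonneg hTB.nonneg
      -- The smooth test function is frozen at the time `t`, and the discrete equation of the
      -- current step is used on that slice alone; no interpolation in time is involved.
      set ψ := tangentTest (mesh l) (m l j) fun x => φ (t, x) with hψ
      have hψm : ψ ∈ discreteTangent (mesh l) (m l j) := tangentTest_mem _ _ _
      obtain ⟨hSi, hS0⟩ := H.stepDensity_integral hΩ l hjN hψm
      refine abs_integral_le_of_sub hSi hS0 (hGi j hjN) ?_
      filter_upwards [(mesh l).ae_mem_interior hΩ.isOpen] with x ⟨s, hs, hx⟩
      have hxh := interior_subset hx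
      have hxK := hRc ((mesh l).hull_subset hs hxh)
      have hdl : Metric.diam (hull s) ≤ |d l| := (H.diam_le l s hs).trans (le_abs_self _)
      refine abs_gilbertDensity_sub_le (q := diffQuot (k l) (m l) j x) (v := v l j x)
        (p := p l j x) (f := f l j x) hα hCex (abs_nonneg L) hA0
        (abs_nonneg _) hl hk hθ hθ' (norm_le_one_of_discreteMag (H.mag l j hjN.le)
        ((mesh l).hull_subset hs hxh)) ?_ (fun i => ?_) ?_ (fun i => ?_)
        (gradNorm_nonneg _ _) (norm_partial_le _ _) (gradNorm_nonneg _ _) (norm_partial_le _ _)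
      · rw [hTB0]
        exact hTB.norm_le x hxK
      · rw [hTB0]
        have := hTB.deriv_le x hxK (basisVec i)
        rwa [norm_basisVec, mul_one] at this
      · rw [hTB0]
        exact norm_cross_sub_tangentTest_le (H.mag l j hjN.le) hTB hRc hs hdl hxh
      · have := norm_fderiv_tangentTest_sub_le (H.shape l) (H.mag l j hjN.le) hTB hRc hs hdl hx
          (basisVec i)
        rw [norm_basisVec, mul_one] at this
        rw [hA, hTB0]
        exact this
  rw [Real.norm_eq_abs]
  refine hstep.trans ?_
  rw [integral_step hk (H.step_mul l) hGi]
  have hC128 : ∀ j ∈ Finset.range (N l), k l • ∫ x in Ω, G j x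
      ≤ C * (128 * k l * (k l * ∫ x in Ω, ‖v l j x‖ ^ 2)
      + (|d l| + √(k l)) * (k l * vol + k l * (∫ x in Ω, ‖v l j x‖ ^ 2) + k l * E
        + k l * (∫ x in Ω, ‖p l j x‖ ^ 2) + k l * ∫ x in Ω, ‖f l j x‖ ^ 2)
      + √(k l) * (k l * (k l * gradNormSq Ω (v l j)))) := fun j hj => by
    have hj := Finset.mem_range.1 hj
    rw [(hGv j hj).2, smul_eq_mul]
    have h1 := H.diff_sub l j hj
    have h2 := H.grad l j hj.le
    calc _ ≤ k l * (C * (128 * k l * (∫ x in Ω, ‖v l j x‖ ^ 2)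
      + (|d l| + √(k l)) * (vol + (∫ x in Ω, ‖v l j x‖ ^ 2) + E
        + (∫ x in Ω, ‖p l j x‖ ^ 2) + ∫ x in Ω, ‖f l j x‖ ^ 2)
      + √(k l) * (k l * gradNormSq Ω (v l j)))) := by gcongr
      _ = _ := by ring
  refine (Finset.sum_le_sum hC128).trans ?_
  simp only [← Finset.mul_sum, Finset.sum_add_distrib, Finset.sum_const, Finset.card_range,
    nsmul_eq_mul]
  have e1 : k l * (N l * vol) = T * vol := by rw [← H.step_mul l]; ring
  have e2 : k l * (N l * E) = T * E := by rw [← H.step_mul l]; ring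
  rw [e1, e2]
  simp only [hB]
  have h1 := H.sum_v l
  have h2 := H.sum_grad_v l
  have h3 := H.sum_p l
  have h4 := H.sum_f l
  simp only [← Finset.mul_sum] at h1 h2 h3 h4
  gcongr

end TangentEvolution

end LLG

/-! ### Passage to the limit in the equation -/

namespace LLG

theorem tendsto_cross {a b : ℕ → E3} {a' b' : E3} (ha : Tendsto a atTop (𝓝 a'))
    (hb : Tendsto b atTop (𝓝 b')) :
    Tendsto (fun n => cross (a n) (b n)) atTop (𝓝 (cross a' b')) := by
  have h : Continuous fun x : E3 × E3 => crossL x.1 x.2 :=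
    (crossL.continuous.comp continuous_fst).clm_apply continuous_snd
  have h' := (h.tendsto (a', b')).comp (ha.prodMk_nhds hb)
  simpa only [Function.comp_def, crossL_apply] using h'

/-- For a unit vector `μ` orthogonal to `q` the right-hand side is `q · φ`. This is how a test with
`m × φ` recovers the undamped time derivative. -/
theorem inner_cross_cross (q μ φ : E3) : inner ℝ q (cross (cross μ φ) μ)
    = ‖μ‖ ^ 2 * inner ℝ q φ - inner ℝ μ q * inner ℝ μ φ := by
  simp only [inner_E3, norm_sq_E3, cross_apply_zero, cross_apply_one, cross_apply_two]
  ring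

theorem inner_cross_swap (q μ φ : E3) : inner ℝ q (cross μ φ) = -inner ℝ (cross μ q) φ := by
  simp only [inner_E3, cross_apply_zero, cross_apply_one, cross_apply_two]
  ring

theorem inner_cross_assoc (q μ φ : E3) : inner ℝ q (cross μ φ) = inner ℝ (cross q μ) φ := by
  simp only [inner_E3, cross_apply_zero, cross_apply_one, cross_apply_two]
  ring

theorem hasWeakDeriv_const {T : ℝ} {Ω : Set E3} (hΩ : IsLipschitzDomain Ω) (e : ℝ × E3) (c : ℝ) :
    HasWeakDeriv (cylinder T Ω) e (fun _ => c) (fun _ => (0 : ℝ)) := by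
  have := BoundedEvolution.isFiniteMeasure_cylinder hΩ T
  refine HasWeakDeriv.of_lipschitz_direction (isOpen_cylinder hΩ.isOpen T) (memLp_const c) (L := 0)
    (fun _ _ _ => ⟨1, one_pos, fun x _ s _ _ => by simp⟩) (ae_of_all _ fun x => ?_)
  exact hasDerivAt_const _ _

namespace BoundedEvolution

variable {Ω : Set E3} {mesh : ℕ → TetMesh Ω} {d k : ℕ → ℝ} {N : ℕ → ℕ} {T E D : ℝ}
  {m : ℕ → ℕ → E3 → E3} {M : ℝ × E3 → E3}

theorem weakL2_diffQuot (H : BoundedEvolution mesh d k N T E D m) (hΩ : IsLipschitzDomain Ω)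
    (hw : WeakH1 (cylinder T Ω) (fun l => timeAffine (k l) (m l)) M) :
    WeakL2 (volume.restrict (cylinder T Ω)) (fun l => timeConst (k l) (diffQuot (k l) (m l)))
      (weakDeriv (cylinder T Ω) timeDir M) :=
  (hw.2.2.2 timeDir).congr (fun l => (H.hasWeakDeriv_coord hΩ l none).weakDeriv_ae
    (isOpen_cylinder hΩ.isOpen T) (H.memLp_coordDeriv hΩ l none)) EventuallyEq.rfl

/-- Weak convergence is given for the affine interpolation, but the equation contains the piecewise
constant one. Its gradients are bounded, and any weak limit of them is the gradient of the common
strong limit. -/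
theorem weakL2_partialConst (H : BoundedEvolution mesh d k N T E D m) (hΩ : IsLipschitzDomain Ω)
    (hs : StrongL2 (volume.restrict (cylinder T Ω)) (fun l => timeConst (k l) (m l)) M)
    (hw : WeakH1 (cylinder T Ω) (fun l => timeAffine (k l) (m l)) M) (i : Fin 3) :
    WeakL2 (volume.restrict (cylinder T Ω)) (fun l => partialConst (k l) (m l) i)
      (weakDeriv (cylinder T Ω) (spaceDir i) M) := by
  have hp : ∀ l, MemLp (partialConst (k l) (m l) i) 2 (volume.restrict (cylinder T Ω)) := fun l =>
    LLG.memLp_timeConst (H.step_pos l) (H.step_mul l) fun j hj =>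
      memLp_fderiv_of_courant hΩ (H.mag l j hj.le).1 _ 2
  refine weakL2_of_subseq hp (hw.2.1.memLp_weakDeriv _) (C := T * E) (fun l => ?_)
    fun σ hσ w hww => ?_
  · rw [partialConst, integral_norm_sq_timeConst (H.step_pos l) (H.step_mul l) fun j hj =>
      memLp_fderiv_of_courant hΩ (H.mag l j hj.le).1 _ 2]
    have hk := H.step_pos l
    calc _ ≤ ∑ _j ∈ Finset.range (N l), k l * E := by
          refine Finset.sum_le_sum fun j hj => ?_
          exact mul_le_mul_of_nonneg_left
            (H.integral_fderiv_le hΩ l i j (Finset.mem_range.1 hj).le) hk.le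
      _ = T * E := by
          rw [Finset.sum_const, Finset.card_range, nsmul_eq_mul, ← H.step_mul l]
          ring
  · have hd : ∀ l, HasWeakDeriv (cylinder T Ω) (spaceDir i) (timeConst (k l) (m l))
        (partialConst (k l) (m l) i) := fun l =>
      HasWeakDeriv.of_slices (basisVec i) (H.memLp_timeConst hΩ l) (hp l) fun t ht =>
        hasWeakDeriv_of_courant hΩ (H.mag l _
          (floor_div_lt (H.step_pos l) (H.step_mul l) ht.2 ht.1.le).le).1 (basisVec i)
    exact ((HasWeakDeriv.of_weakL2 (fun l => hd (σ l)) (hs.weakL2.comp hσ) hww).weakDeriv_ae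
      (isOpen_cylinder hΩ.isOpen T) hww.2.1).symm

/-- The time derivative of a limit is orthogonal to it. -/
theorem inner_weakDeriv_time_eq_zero (H : BoundedEvolution mesh d k N T E D m)
    (hΩ : IsLipschitzDomain Ω)
    (hs : StrongL2 (volume.restrict (cylinder T Ω)) (fun l => timeConst (k l) (m l)) M)
    (hw : WeakH1 (cylinder T Ω) (fun l => timeAffine (k l) (m l)) M) :
    ∀ᵐ p ∂(volume.restrict (cylinder T Ω)),
      inner ℝ (M p) (weakDeriv (cylinder T Ω) timeDir M p) = 0 := by
  have := isFiniteMeasure_cylinder hΩ T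
  have hU := isOpen_cylinder hΩ.isOpen T
  have hM1 := H.unitModulus hΩ hs
  set q := weakDeriv (cylinder T Ω) timeDir M with hq
  have hqL : MemLp q 2 (volume.restrict (cylinder T Ω)) := hw.2.1.memLp_weakDeriv _
  obtain ⟨σ, hσ, hae⟩ := (H.strongL2_timeAffine hΩ hs).exists_subseq_ae
  have hq' := (H.weakL2_diffQuot hΩ hw).comp hσ.tendsto_atTop
  have hb := fun n => H.norm_timeAffine_le hΩ (σ n)
  have hgL : MemLp (fun p => 2 * inner ℝ (M p) (q p)) 2 (volume.restrict (cylinder T Ω)) := by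
    have hm : MemLp (fun p => inner ℝ (M p) (q p)) 2 (volume.restrict (cylinder T Ω)) := by
      refine hqL.mono (hs.2.1.1.inner hqL.1) ?_
      filter_upwards [hM1] with p hp
      refine (norm_inner_le_norm _ _).trans ?_
      rw [hp, one_mul]
    exact hm.const_mul 2
  -- The product rule for `|m|²` at the discrete level passes to the limit, since for each test
  -- function it pairs a weakly with a strongly convergent factor. The limit of `|m|²` is one, whose
  -- derivative is zero.
  have hone : HasWeakDeriv (cylinder T Ω) timeDir (fun _ => (1 : ℝ))
      (fun p => 2 * inner ℝ (M p) (q p)) := by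
    intro ψ h1 h2 h3
    have hn : ∀ n, ∫ p in cylinder T Ω, fderiv ℝ ψ p timeDir • ‖timeAffine (k (σ n)) (m (σ n)) p‖ ^ 2
        = -∫ p in cylinder T Ω, ψ p • (2 * inner ℝ (timeAffine (k (σ n)) (m (σ n)) p)
          (timeConst (k (σ n)) (diffQuot (k (σ n)) (m (σ n))) p)) := fun n =>
      hasWeakDeriv_time_norm_sq hΩ.isOpen (H.step_pos _) (H.step_mul _) hΩ.volume_lt_top.ne
        (H.memLp hΩ _) (H.norm_le _) ψ h1 h2 h3
    have hS : StrongL2 (volume.restrict (cylinder T Ω))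
        (fun n p => ‖timeAffine (k (σ n)) (m (σ n)) p‖ ^ 2) (fun _ => (1 : ℝ)) := by
      refine StrongL2.of_bounded_ae (C := 1) (fun n => (H.memLp_timeAffine hΩ (σ n)).1.norm.pow 2)
        (fun n => ?_) ?_
      · filter_upwards [hb n] with p hp
        rw [norm_pow, norm_norm]
        exact pow_le_one₀ (norm_nonneg _) hp
      · filter_upwards [hae, hM1] with p hp h1
        have := hp.norm.pow 2
        rwa [h1, one_pow] at this
    have hl := hS.weakL2.2.2 _ (memLp_two_of_test (contDiff_fderiv_const h1 timeDir).continuous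
      (hasCompactSupport_fderiv_const h2 timeDir) (cylinder T Ω))
    obtain ⟨C, hC⟩ := h2.exists_bound_of_continuous h1.continuous
    have hS' : StrongL2 (volume.restrict (cylinder T Ω))
        (fun n p => (2 * ψ p) • timeAffine (k (σ n)) (m (σ n)) p) (fun p => (2 * ψ p) • M p) := by
      refine StrongL2.of_bounded_ae (C := 2 * C)
        (fun n => (continuous_const.mul h1.continuous).aestronglyMeasurable.smul
          (H.memLp_timeAffine hΩ (σ n)).1) (fun n => ?_) ?_
      · filter_upwards [hb n] with p hp
        rw [norm_smul, norm_mul, Real.norm_ofNat]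
        refine (mul_le_of_le_one_right (by positivity) hp).trans ?_
        exact mul_le_mul_of_nonneg_left (hC p) zero_le_two
      · filter_upwards [hae] with p hp
        exact hp.const_smul _
    have hr := (hq'.tendsto_integral_inner hS').neg
    have e : ∀ n, ∫ p in cylinder T Ω, inner ℝ (‖timeAffine (k (σ n)) (m (σ n)) p‖ ^ 2)
        (fderiv ℝ ψ p timeDir) = -∫ p in cylinder T Ω,
          inner ℝ (timeConst (k (σ n)) (diffQuot (k (σ n)) (m (σ n))) p)
            ((2 * ψ p) • timeAffine (k (σ n)) (m (σ n)) p) := fun n => by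
      refine Eq.trans ?_ ((hn n).trans ?_)
      · rfl
      · congr 1
        refine integral_congr_ae (ae_of_all _ fun p => ?_)
        simp only [real_inner_smul_right, smul_eq_mul]
        rw [real_inner_comm]
        ring
    have huniq := tendsto_nhds_unique hl (hr.congr fun n => (e n).symm)
    refine Eq.trans ?_ (huniq.trans ?_)
    · rfl
    · congr 1
      refine integral_congr_ae (ae_of_all _ fun p => ?_)
      simp only [real_inner_smul_right, smul_eq_mul]
      rw [real_inner_comm]
      ring
  filter_upwards [HasWeakDeriv.ae_unique hU hgL MemLp.zero hone (hasWeakDeriv_const hΩ timeDir 1)]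
    with p hp
  have hp' : 2 * inner ℝ (M p) (q p) = 0 := hp
  linarith

end BoundedEvolution

namespace TangentEvolution

variable {Ω : Set E3} {mesh : ℕ → TetMesh Ω} {d k : ℕ → ℝ} {N : ℕ → ℕ} {T E D : ℝ}
  {m : ℕ → ℕ → E3 → E3} {α Cex θ κ Q : ℝ} {v p f : ℕ → ℕ → E3 → E3} {M P F : ℝ × E3 → E3}

/-- Each term of the density pairs a weakly convergent factor (a derivative of `m` or a field) with
an expression in `m` and `φ` alone, which converges strongly because the magnetizations are bounded
and converge almost everywhere for a subsequence. -/
theorem gilbertEquation (H : TangentEvolution mesh d k N T E D m α Cex θ κ Q v p f)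
    (hΩ : IsLipschitzDomain Ω) (hα : 0 < α) (hCex : 0 < Cex) (hθ : 0 ≤ θ) (hθ' : θ ≤ 1)
    (hs : StrongL2 (volume.restrict (cylinder T Ω)) (fun l => timeConst (k l) (m l)) M)
    (hw : WeakH1 (cylinder T Ω) (fun l => timeAffine (k l) (m l)) M)
    (hp : WeakL2 (volume.restrict (cylinder T Ω)) (fun l => timeConst (k l) (p l)) P)
    (hf : WeakL2 (volume.restrict (cylinder T Ω)) (fun l => timeConst (k l) (f l)) F) :
    GilbertEquation T Ω α Cex P F M := by
  intro φ hφ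
  have := BoundedEvolution.isFiniteMeasure_cylinder hΩ T
  have hM1 := H.unitModulus hΩ hs
  have hM0 := H.inner_weakDeriv_time_eq_zero hΩ hs hw
  set q := weakDeriv (cylinder T Ω) timeDir M with hq
  obtain ⟨σ, hσ, hae⟩ := hs.exists_subseq_ae
  have hσ' := hσ.tendsto_atTop
  have hqw := (H.weakL2_diffQuot hΩ hw).comp hσ'
  have hgw := fun i => (H.weakL2_partialConst hΩ hs hw i).comp hσ'
  replace hp := hp.comp hσ'
  replace hf := hf.comp hσ'
  have hb := fun n => H.norm_timeConst_le hΩ (σ n)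
  have hmm := fun n => (H.memLp_timeConst hΩ (σ n)).1
  obtain ⟨hφL, C, hC⟩ := memLp_of_contDiff hΩ T hφ.continuous
  have hφc : ∀ i, Continuous fun p => fderiv ℝ φ p (spaceDir i) := fun i =>
    (hφ.continuous_fderiv (by simp)).clm_apply continuous_const
  have hφ' := fun i => memLp_of_contDiff hΩ T (hφc i)
  have hstrong : ∀ {χ : ℝ × E3 → E3}, MemLp χ 2 (volume.restrict (cylinder T Ω)) →
      (∃ C, ∀ p ∈ cylinder T Ω, ‖χ p‖ ≤ C) → StrongL2 (volume.restrict (cylinder T Ω))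
        (fun n p => cross (timeConst (k (σ n)) (m (σ n)) p) (χ p)) (fun p => cross (M p) (χ p)) := by
    rintro χ hχ ⟨C, hC⟩
    refine StrongL2.of_bounded_ae (C := C) (fun n => aestronglyMeasurable_cross (hmm n) hχ.1)
      (fun n => ?_) ?_
    · filter_upwards [hb n, BoundedEvolution.ae_mem_cylinder hΩ.isOpen T] with p h1 h2
      exact (norm_cross_le _ _).trans
        ((mul_le_of_le_one_left (norm_nonneg _) h1).trans (hC p h2))
    · filter_upwards [hae] with p h1
      exact tendsto_cross h1 tendsto_const_nhds
  have sw := hstrong hφL ⟨C, hC⟩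
  have sg := fun i => hstrong (hφ' i).1 (hφ' i).2
  have sA : StrongL2 (volume.restrict (cylinder T Ω))
      (fun n p => α • cross (timeConst (k (σ n)) (m (σ n)) p) (φ p)
        + cross (cross (timeConst (k (σ n)) (m (σ n)) p) (φ p)) (timeConst (k (σ n)) (m (σ n)) p))
      (fun p => α • cross (M p) (φ p) + cross (cross (M p) (φ p)) (M p)) := by
    refine StrongL2.of_bounded_ae (C := α * C + C) (fun n =>
      ((aestronglyMeasurable_cross (hmm n) hφL.1).const_smul α).add
        (aestronglyMeasurable_cross (aestronglyMeasurable_cross (hmm n) hφL.1) (hmm n)))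
      (fun n => ?_) ?_
    · filter_upwards [hb n, BoundedEvolution.ae_mem_cylinder hΩ.isOpen T] with p h1 h2
      have h3 : ‖cross (timeConst (k (σ n)) (m (σ n)) p) (φ p)‖ ≤ C := (norm_cross_le _ _).trans
        ((mul_le_of_le_one_left (norm_nonneg _) h1).trans (hC p h2))
      refine (norm_add_le _ _).trans (add_le_add ?_ ?_)
      · rw [norm_smul, Real.norm_of_nonneg hα.le]
        exact mul_le_mul_of_nonneg_left h3 hα.le
      · exact (norm_cross_le _ _).trans ((mul_le_of_le_one_right (norm_nonneg _) h1).trans h3)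
    · filter_upwards [hae] with p h1
      have h2 := tendsto_cross h1 (tendsto_const_nhds (x := φ p))
      exact (h2.const_smul α).add (tendsto_cross h2 h1)
  have hval : ∀ n, ∫ p' in cylinder T Ω,
      evolutionDensity α Cex (k (σ n)) (m (σ n)) (p (σ n)) (f (σ n)) φ p' = _ := fun n =>
    ((((HasIntegralValue.inner (hqw.1 n) (sA.1 n)).add ((HasIntegralValue.sum
      (s := Finset.univ) fun i => HasIntegralValue.inner ((hgw i).1 n) ((sg i).1 n)).const_mul
        Cex)).add (HasIntegralValue.inner (hp.1 n) (sw.1 n))).sub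
      (HasIntegralValue.inner (hf.1 n) (sw.1 n))).2
  have hlim := (((hqw.tendsto_integral_inner sA).add ((tendsto_finsetSum Finset.univ fun i _ =>
    (hgw i).tendsto_integral_inner (sg i)).const_mul Cex)).add
      (hp.tendsto_integral_inner sw)).sub (hf.tendsto_integral_inner sw)
  have h0 := (H.tendsto_integral_evolutionDensity hΩ hα hCex hθ hθ' hφ).comp hσ'
  have heq := tendsto_nhds_unique (hlim.congr fun n => (hval n).symm) h0
  -- Unit modulus and orthogonality of the time derivative enter here, and only in the limit; for
  -- the interpolants both hold merely approximately.
  have e1 : ∫ x in cylinder T Ω, inner ℝ (q x)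
        (α • cross (M x) (φ x) + cross (cross (M x) (φ x)) (M x))
      = (∫ x in cylinder T Ω, inner ℝ (q x) (φ x))
        - α * ∫ x in cylinder T Ω, inner ℝ (cross (M x) (q x)) (φ x) := by
    have hM1' : ∀ᵐ p ∂(volume.restrict (cylinder T Ω)), ‖M p‖ ≤ 1 := by
      filter_upwards [hM1] with p hp using hp.le
    have hv := (HasIntegralValue.inner hqw.2.1 hφL).sub
      ((HasIntegralValue.inner (memLp_cross hs.2.1.1 hM1' hqw.2.1) hφL).const_mul α)
    rw [← hv.2]
    refine integral_congr_ae ?_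
    filter_upwards [hM1, hM0] with x h1 h2
    rw [inner_add_right, real_inner_smul_right, inner_cross_cross, inner_cross_swap, h1, h2]
    ring
  have e2 : ∀ i, ∫ x in cylinder T Ω, inner ℝ (weakDeriv (cylinder T Ω) (spaceDir i) M x)
        (cross (M x) (fderiv ℝ φ x (spaceDir i)))
      = ∫ x in cylinder T Ω, inner ℝ (cross (weakDeriv (cylinder T Ω) (spaceDir i) M x) (M x))
        (fderiv ℝ φ x (spaceDir i)) := fun i => by simp_rw [inner_cross_assoc]
  rw [e1] at heq
  simp_rw [e2, inner_cross_assoc] at heq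
  linarith

end TangentEvolution

end LLG

/-! ### From the integrator to weak solutions -/

namespace LLG

/-- The constant of the energy estimate of weak solutions. -/
noncomputable def limitEnergyConst (T α Cex Cπ B : ℝ) : ℝ :=
  energyConst T α Cex Cπ B / Cex + 256 * (energyConst T α Cex Cπ B / α)

theorem limitEnergyConst_pos {T α Cex : ℝ} (hα : 0 < α) (hCex : 0 < Cex) (Cπ B : ℝ) :
    0 < limitEnergyConst T α Cex Cπ B := by
  have := energyConst_pos (T := T) hα hCex Cπ B
  unfold limitEnergyConst
  positivity

section Output

variable {Ω : Set E3} {T α Cex θ γ κ Cπ Cζ : ℝ} {Y : Type*} [NormedAddCommGroup Y]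
  {mesh : ℕ → TetMesh Ω} {h : ℕ → ℝ} {N : ℕ → ℕ} {πh : ℕ → H1 Ω → Y → L2 Ω} {fh : ℕ → ℕ → L2 Ω}
  {ζh : ℕ → ℕ → Y} {mh0 : ℕ → E3 → E3} {mh vh : ℕ → ℕ → E3 → E3}

/-- The output of the integrator is controlled by the data. -/
theorem exists_tangentEvolution (hΩ : IsLipschitzDomain Ω) (hT : 0 < T) (hα : 0 < α)
    (hCex : 0 < Cex) (hθ : 1 / 2 < θ) (hh : Tendsto h atTop (𝓝 0)) (hN : ∀ l, 0 < N l)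
    (hN' : Tendsto N atTop atTop) (hγ : ∀ l, (mesh l).IsQuasiUniform (h l) γ)
    (hκ : ∀ l, (mesh l).IsShapeRegular κ) (hang : ∀ l, AngleCondition (mesh l))
    (hmag : ∀ l, mh0 l ∈ discreteMag (mesh l))
    (hπ : ∀ l, ∀ n : H1 Ω, (∀ᵐ x ∂(volume.restrict Ω), ‖n.1 x‖ ≤ 1) → ∀ y : Y, ‖y‖ ≤ Cζ →
      ‖πh l n y‖ ≤ Cπ * (1 + √(gradNormSq Ω n.1)))
    (hζ : ∀ l, ∀ j < N l, ‖ζh l j‖ ≤ Cζ)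
    (H : ∀ l, IsIntegratorOutput (mesh l) α Cex θ (T / N l) (N l) (πh l) (fh l) (ζh l) (mh0 l)
      (mh l) (vh l)) {B : ℝ} (hB0 : ∀ l, gradNormSq Ω (mh0 l) ≤ B)
    (hBf : ∀ l, ∫ p in cylinder T Ω, ‖timeConst (T / N l) (fun j => fh l j) p‖ ^ 2 ≤ B) :
    ∃ Q, TangentEvolution mesh (fun l => γ * h l) (fun l => T / N l) N T
      (energyConst T α Cex Cπ B / Cex) (256 * (energyConst T α Cex Cπ B / α)) mh α Cex θ κ Q vh
      (fun l j => πh l (toH1 Ω (mh l j)) (ζh l j)) (fun l j => fh l j) := by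
  set K := energyConst T α Cex Cπ B with hK
  have hKpos : 0 < K := energyConst_pos hα hCex Cπ B
  have hBnn : 0 ≤ B := (gradNormSq_nonneg Ω _).trans (hB0 0)
  have hk : ∀ l, 0 < T / N l := fun l => div_pos hT (by exact_mod_cast hN l)
  have hkN : ∀ l, T / N l * N l = T := fun l =>
    div_mul_cancel₀ T (by exact_mod_cast (hN l).ne')
  have hf : ∀ l, ∑ j ∈ Finset.range (N l), T / N l * ‖fh l j‖ ^ 2 ≤ B := fun l => by
    have := hBf l
    rw [integral_norm_sq_timeConst (hk l) (hkN l) fun j _ => Lp.memLp (fh l j)] at this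
    simpa only [integral_norm_sq_L2] using this
  have hE := fun l => (H l).energy_bound (hmag l) hΩ (hang l) hα hCex hθ (hk l).le (hkN l) (hπ l)
    (hζ l) (hB0 l) (hf l)
  have hθ2 : 0 < 2 * θ - 1 := by linarith
  have hv0 : ∀ l i, 0 ≤ ∫ x in Ω, ‖vh l i x‖ ^ 2 := fun l i =>
    integral_nonneg fun x => by positivity
  have hmagj := fun l => (H l).mem_mag (hmag l)
  have hgrad : ∀ l, ∀ j ≤ N l, gradNormSq Ω (mh l j) ≤ K / Cex := fun l j hj => by
    rw [le_div_iff₀ hCex, mul_comm]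
    refine le_trans (le_add_of_nonneg_right ?_) (hE l j hj)
    refine Finset.sum_nonneg fun i _ => ?_
    have h1 := hk l
    have h2 := hv0 l i
    have h3 := gradNormSq_nonneg Ω (vh l i)
    positivity
  have hsum : ∀ l, α * (∑ j ∈ Finset.range (N l), T / N l * ∫ x in Ω, ‖vh l j x‖ ^ 2)
      + Cex * (2 * θ - 1) * (∑ j ∈ Finset.range (N l), T / N l * (T / N l * gradNormSq Ω (vh l j)))
      ≤ K := fun l => by
    refine le_trans (le_of_eq ?_) ((le_add_of_nonneg_left (mul_nonneg hCex.le
      (gradNormSq_nonneg Ω (mh l (N l))))).trans (hE l (N l) le_rfl))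
    rw [Finset.mul_sum, Finset.mul_sum, ← Finset.sum_add_distrib]
    exact Finset.sum_congr rfl fun j _ => by ring
  have hs1 : ∀ l, 0 ≤ ∑ j ∈ Finset.range (N l), T / N l * ∫ x in Ω, ‖vh l j x‖ ^ 2 := fun l =>
    Finset.sum_nonneg fun j _ => mul_nonneg (hk l).le (hv0 l j)
  have hs2 : ∀ l, 0 ≤ ∑ j ∈ Finset.range (N l), T / N l * (T / N l * gradNormSq Ω (vh l j)) :=
    fun l => Finset.sum_nonneg fun j _ =>
      mul_nonneg (hk l).le (mul_nonneg (hk l).le (gradNormSq_nonneg Ω _))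
  have hV : ∀ l, ∑ j ∈ Finset.range (N l), T / N l * ∫ x in Ω, ‖vh l j x‖ ^ 2 ≤ K / α := fun l => by
    rw [le_div_iff₀ hα, mul_comm]
    exact (le_add_of_nonneg_right (mul_nonneg (by positivity) (hs2 l))).trans (hsum l)
  -- Here `θ > 1/2` is essential: it makes the coefficient of `k² ‖∇v‖²` in the energy balance
  -- positive.
  have hW : ∀ l, ∑ j ∈ Finset.range (N l), T / N l * (T / N l * gradNormSq Ω (vh l j))
      ≤ K / (Cex * (2 * θ - 1)) := fun l => by
    rw [le_div_iff₀ (by positivity), mul_comm]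
    exact (le_add_of_nonneg_left (mul_nonneg hα.le (hs1 l))).trans (hsum l)
  have hP : ∀ l, ∑ j ∈ Finset.range (N l), T / N l * ∫ x in Ω,
      ‖πh l (toH1 Ω (mh l j)) (ζh l j) x‖ ^ 2 ≤ 2 * Cπ ^ 2 * (1 + K / Cex) * T := fun l => by
    calc _ ≤ ∑ _j ∈ Finset.range (N l), T / N l * (2 * Cπ ^ 2 * (1 + K / Cex)) := by
          refine Finset.sum_le_sum fun j hj => ?_
          have hj := Finset.mem_range.1 hj
          rw [integral_norm_sq_L2]
          refine mul_le_mul_of_nonneg_left (((H l).norm_pi_sq_le (hmag l) hΩ (hπ l) (hζ l) hj).trans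
            ?_) (hk l).le
          have := hgrad l j hj.le
          gcongr
      _ = _ := by
          rw [Finset.sum_const, Finset.card_range, nsmul_eq_mul, ← mul_assoc, mul_comm (N l : ℝ),
            hkN l, mul_comm]
  have hq1 : 0 ≤ K / α := by positivity
  have hq2 : 0 ≤ K / (Cex * (2 * θ - 1)) := by positivity
  have hq3 : 0 ≤ 2 * Cπ ^ 2 * (1 + K / Cex) * T := by positivity
  -- `Q` is the sum of the separate bounds and need not be sharp. It serves only to show that the
  -- residual vanishes, while the energy estimate depends on the other two constants.
  refine ⟨K / α + K / (Cex * (2 * θ - 1)) + 2 * Cπ ^ 2 * (1 + K / Cex) * T + B,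
    { step_pos := hk
      step_mul := hkN
      step_tendsto := (tendsto_natCast_atTop_atTop.comp hN').const_div_atTop T
      diam_le := fun l s hs => (hγ l s hs).1
      diam_tendsto := by simpa using hh.const_mul γ
      mag := hmagj
      grad := hgrad
      diff := fun l => ?_
      shape := hκ
      v_mem := fun l j hj => ((H l).tangent j hj).1
      memLp_p := fun l j _ => Lp.memLp _
      memLp_f := fun l j _ => Lp.memLp _
      step_eq := fun l => (H l).step
      sum_v := fun l => (hV l).trans (by linarith)
      sum_grad_v := fun l => (hW l).trans (by linarith)
      sum_p := fun l => (hP l).trans (by linarith)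
      sum_f := fun l => ?_
      diff_sub := fun l j hj => (H l).lintegral_diff_quot_sub_le (hmag l) hΩ (hk l) hj }⟩
  · refine le_trans ?_ (mul_le_mul_of_nonneg_left (hV l) (by norm_num : (0 : ℝ) ≤ 256))
    rw [Finset.mul_sum]
    refine Finset.sum_le_sum fun j hj => ?_
    rw [mul_left_comm]
    exact mul_le_mul_of_nonneg_left
      ((H l).lintegral_diff_quot_le (hmag l) hΩ (hk l) (Finset.mem_range.1 hj)) (hk l).le
  · simp only [integral_norm_sq_L2]
    exact (hf l).trans (by linarith)

/-- Weakly convergent data are bounded. -/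
theorem exists_data_bound {m0 : E3 → E3} {f : ℝ × E3 → E3}
    (hf : WeakL2 (volume.restrict (cylinder T Ω))
      (fun l => timeConst (T / N l) fun j => fh l j) f) (hm : WeakH1 Ω mh0 m0) :
    ∃ B, (∀ l, gradNormSq Ω (mh0 l) ≤ B) ∧
      ∀ l, ∫ p in cylinder T Ω, ‖timeConst (T / N l) (fun j => fh l j) p‖ ^ 2 ≤ B := by
  obtain ⟨B1, h1⟩ := hf.exists_bound
  choose b hb using fun i => (hm.2.2.2 (basisVec i)).exists_bound
  exact ⟨max (∑ i, b i) B1,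
    fun l => (Finset.sum_le_sum fun i _ => hb i l).trans (le_max_left _ _),
    fun l => (h1 l).trans (le_max_right _ _)⟩

end Output

end LLG

theorem theorem3p1 {Ω : Set LLG.E3} (hΩ : LLG.IsLipschitzDomain Ω)
    {T α Cex θ : ℝ} (hT : 0 < T) (hα : 0 < α) (hCex : 0 < Cex) (hθ : 1 / 2 < θ) (hθ' : θ ≤ 1)
    {Y : Type*} [NormedAddCommGroup Y] [NormedSpace ℝ Y] [CompleteSpace Y]
    (π : LLG.H1 Ω → Y → LLG.L2 Ω) (ζ : ℝ → Y)
    (f : ℝ × LLG.E3 → LLG.E3) (hf : MemLp f 2 (volume.restrict (LLG.cylinder T Ω)))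
    (m0 : LLG.E3 → LLG.E3) (hm0 : LLG.MemH1 Ω m0)
    (hm0' : ∀ᵐ x ∂(volume.restrict Ω), ‖m0 x‖ = 1)
    (γ κ Cπ Cζ : ℝ) :
    ∃ Cen : ℝ → ℝ, (∀ B, 0 < Cen B) ∧
    ∀ (mesh : ℕ → LLG.TetMesh Ω) (h : ℕ → ℝ) (N : ℕ → ℕ)
      (πh : ℕ → LLG.H1 Ω → Y → LLG.L2 Ω) (fh : ℕ → ℕ → LLG.L2 Ω) (ζh : ℕ → ℕ → Y)
      (mh0 : ℕ → LLG.E3 → LLG.E3),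
    -- discretization parameters tend to zero, independently of each other
    (∀ l, 0 < h l) → Tendsto h atTop (𝓝 0) →
    (∀ l, 0 < N l) → Tendsto N atTop atTop →
    -- assumptions on the meshes
    (∀ l, (mesh l).IsQuasiUniform (h l) γ) → (∀ l, (mesh l).IsShapeRegular κ) →
    (∀ l, LLG.AngleCondition (mesh l)) →
    -- assumptions on the discrete data
    LLG.WeakL2 (volume.restrict (LLG.cylinder T Ω))
      (fun l => LLG.timeConst (T / N l) fun j => fh l j) f →
    (∀ l, mh0 l ∈ LLG.discreteMag (mesh l)) → LLG.WeakH1 Ω mh0 m0 →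
    (∀ l, ∀ n : LLG.H1 Ω, (∀ᵐ x ∂(volume.restrict Ω), ‖n.1 x‖ ≤ 1) → ∀ y : Y, ‖y‖ ≤ Cζ →
      ‖πh l n y‖ ≤ Cπ * (1 + Real.sqrt (LLG.gradNormSq Ω n.1))) →
    (∀ l, ∀ j < N l, ‖ζh l j‖ ≤ Cζ) →
    -- the integrator is well-defined
    (∀ l, ∃ m v : ℕ → LLG.E3 → LLG.E3,
      LLG.IsIntegratorOutput (mesh l) α Cex θ (T / N l) (N l) (πh l) (fh l) (ζh l) (mh0 l) m v) ∧
    ∀ mh vh : ℕ → ℕ → LLG.E3 → LLG.E3,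
    (∀ l, LLG.IsIntegratorOutput (mesh l) α Cex θ (T / N l) (N l) (πh l) (fh l) (ζh l) (mh0 l)
      (mh l) (vh l)) →
    -- part (a)
    (∃ σ : ℕ → ℕ, StrictMono σ ∧ ∃ m : ℝ × LLG.E3 → LLG.E3,
      LLG.StrongL2 (volume.restrict (LLG.cylinder T Ω))
        (fun l => LLG.timeConst (T / N (σ l)) (mh (σ l))) m ∧
      LLG.WeakH1 (LLG.cylinder T Ω) (fun l => LLG.timeAffine (T / N (σ l)) (mh (σ l))) m ∧
      LLG.MemLinftyH1 T Ω m ∧ LLG.UnitModulus T Ω m) ∧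
    -- part (b)
    (∀ σ : ℕ → ℕ, StrictMono σ → ∀ m : ℝ × LLG.E3 → LLG.E3,
      LLG.StrongL2 (volume.restrict (LLG.cylinder T Ω))
        (fun l => LLG.timeConst (T / N (σ l)) (mh (σ l))) m →
      LLG.WeakH1 (LLG.cylinder T Ω) (fun l => LLG.timeAffine (T / N (σ l)) (mh (σ l))) m →
      ∀ τ : ℕ → ℕ, StrictMono τ → ∀ P : ℝ × LLG.E3 → LLG.E3,
      LLG.Represents T Ω P (LLG.contribution π m ζ) →
      LLG.WeakL2 (volume.restrict (LLG.cylinder T Ω))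
        (fun l => LLG.timeConst (T / N (σ (τ l)))
          fun j => πh (σ (τ l)) (LLG.toH1 Ω (mh (σ (τ l)) j)) (ζh (σ (τ l)) j)) P →
      LLG.IsWeakSolution T α Cex π ζ f m0 m ∧
      ∀ B : ℝ, (∀ l, LLG.gradNormSq Ω (mh0 l) ≤ B) →
        (∀ l, ∫ p in LLG.cylinder T Ω,
          ‖LLG.timeConst (T / N l) (fun j => fh l j) p‖ ^ 2 ≤ B) →
        LLG.EnergyBound T Ω m (Cen B)) := by
  -- The bound of the gradients plus the bound of the difference quotients. It is fixed before the
  -- meshes and discrete data are introduced, so it cannot depend on them.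
  refine ⟨LLG.limitEnergyConst T α Cex Cπ, LLG.limitEnergyConst_pos hα hCex Cπ, ?_⟩
  intro mesh h N πh fh ζh mh0 _ hh hN hN' hγ hκ hang hf' hmag hmh0 hπ hζ
  refine ⟨fun l => LLG.exists_integratorOutput hΩ hα hCex.le (by linarith) (by positivity) _ _ _ _
    (hmag l), fun mh vh H => ?_⟩
  obtain ⟨B, hB0, hBf⟩ := LLG.exists_data_bound hf' hmh0
  -- `B` is left free: some bound suffices for the convergence, whereas the energy estimate is
  -- claimed for every admissible one.
  have hevol := fun {B : ℝ} => LLG.exists_tangentEvolution (B := B) hΩ hT hα hCex hθ hh hN hN' hγ hκ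
    hang hmag hπ hζ H
  obtain ⟨Q, hQ⟩ := hevol hB0 hBf
  have hb := hQ.toBoundedEvolution
  refine ⟨?_, fun σ hσ m hs hw τ hτ P hP hPw => ?_⟩
  · obtain ⟨σ, hσ, m, hs, hw⟩ := hb.exists_limit hΩ
    have hbσ := hb.comp hσ.tendsto_atTop
    exact ⟨σ, hσ, m, hs, hw, hbσ.memLinftyH1 hΩ hs, hbσ.unitModulus hΩ hs⟩
  · have hbσ := hb.comp hσ.tendsto_atTop
    have hστ := (hσ.comp hτ).tendsto_atTop
    have hτ' := hτ.tendsto_atTop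
    have henergy : ∀ B : ℝ, (∀ l, LLG.gradNormSq Ω (mh0 l) ≤ B) →
        (∀ l, ∫ p in LLG.cylinder T Ω, ‖LLG.timeConst (T / N l) (fun j => fh l j) p‖ ^ 2 ≤ B) →
        LLG.EnergyBound T Ω m (LLG.limitEnergyConst T α Cex Cπ B) := fun B hB0 hBf => by
      obtain ⟨Q, hQ⟩ := hevol hB0 hBf
      exact (hQ.toBoundedEvolution.comp hσ.tendsto_atTop).energyBound hΩ hs hw
    -- The initial data converge weakly in `H¹(Ω)` and thus weakly in `L²(Ω)`, which is enough to
    -- identify the trace.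
    have htrace : LLG.WeakL2 (volume.restrict Ω) (fun l => mh (σ l) 0) m0 := by
      simp_rw [fun l => (H l).init]
      exact hmh0.2.2.1.comp hσ.tendsto_atTop
    have hwτ : LLG.WeakH1 (LLG.cylinder T Ω)
        (fun l => LLG.timeAffine (T / N (σ (τ l))) (mh (σ (τ l)))) m :=
      ⟨fun l => hw.1 (τ l), hw.2.1, hw.2.2.1.comp hτ', fun e => (hw.2.2.2 e).comp hτ'⟩
    refine ⟨⟨hw.2.1, hbσ.unitModulus hΩ hs, hbσ.hasInitialTrace hΩ hT hs htrace, ⟨P, hP, ?_⟩,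
      _, LLG.limitEnergyConst_pos hα hCex Cπ B, henergy B hB0 hBf⟩, henergy⟩
    exact (hQ.comp hστ).gilbertEquation hΩ hα hCex (by linarith) hθ' (hs.comp hτ') hwτ hPw
      (hf'.comp hστ)
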